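/- **Setting.** Let $L$ be an even lattice of signature $(b^+,b^-)$ with $b^+>2$, with bilinear form $(\cdot,\cdot)$, $q(\lambda)=(\lambda,\lambda)/2$, dual lattice $L'$, discriminant group $D_L=L'/L$ and $\mathrm{sig}(L)=b^+-b^-$. Let $V=\mathbb{R}^{b^+,b^-}=V^+\oplus V^-$ carry $Q(x)=\frac12(x_1^2+\dots+x_{b^+}^2-x_{b^++1}^2-\dots-x_{b^++b^-}^2)$ and fix an isometry $v_0=v_0^++v_0^-:(L_\mathbb{R},q)\to(V,Q)$. Write $\|w\|=|(w,w)|^{1/2}$ on $V^\pm$ and $\mathbf e(x)=e^{2\pi i x}$. Let $\rho_L$ be the Weil representation of $\mathrm{Mp}_2(\mathbb{Z})$ on $\mathbb{C}[D_L]$, determined by $\rho_L(T)\mathfrak e_\gamma=\mathbf e(q(\gamma))\mathfrak e_\gamma$ and $\rho_L(S)\mathfrak e_\gamma=\frac{\mathbf e(-\mathrm{sig}(L)/8)}{\sqrt{|D_L|}}\sum_\delta\mathbf e(-(\gamma,\delta))\mathfrak e_\delta$. For $k\in\mathbb{Z}_{\ge0}$ with $\nu=k+\frac{\mathrm{sig}(L)}2>\frac32$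 let $S_\nu(D_L)$ be the space of holomorphic cusp forms $f=\sum_\gamma f_{L+\gamma}\mathfrak e_\gamma$ of weight $\nu$ and type $\rho_L$, with Fourier expansion $f_{L+\gamma}(\tau)=\sum_{n\in q(\gamma)+\mathbb{Z}}c(n,\gamma)\mathbf e(n\tau)$. For a polynomial $p$ on $V$ that is homogeneous of degree $k$ and depends on $V^+$ only, and $g\in\mathrm{O}(L_\mathbb{R})$, $\tau=x+iy$, let $\Theta_L(\tau,g;p)=\sum_{\gamma\in D_L}\theta_{L+\gamma}(\tau,g;p)\,\mathfrak e_\gamma$ with $$\theta_{L+\gamma}(\tau,g;p)=y^{b^- /2}\sum_{\lambda\in L+\gamma}\bigl[e^{-\Delta/8\pi y}p\bigr](v_0(g^{-1}\lambda))\,\mathbf e\bigl(\tau Q(v_0^+(g^{-1}\lambda))+\bar\tau Q(v_0^-(g^{-1}\lambda))\bigr),$$ where $\Delta$ is the Laplacian of the definite form $\sum x_j^2$, and let $$\vartheta_L(f;p)(g)=(f,\Theta_L(\cdot,g;p))_\tau=\int_{\mathrm{SL}_2(\mathbb{Z})\backslash\mathbb{H}}\sum_{\gamma}f_{L+\gamma}(\tau)\,\overline{\theta_{L+\gamma}(\tau,g;p)}\;y^\nu\frac{dx\,dy}{y^2}.$$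 For $m\ge2$ and $\kappa=(k_0,\dots,k_{m-3},\pm k_{m-2})$ with $k_0\ge\dots\ge k_{m-2}\ge0$ put $$h_\kappa^m(x)=(x_{m-1}\pm ix_m)^{k_{m-2}}\prod_{j=0}^{m-3}\|x\|_j^{k_j-k_{j+1}}C_{k_j-k_{j+1}}^{k_{j+1}+\frac{m-j-2}2}\Bigl(\frac{x_{j+1}}{\|x\|_j}\Bigr),\qquad \|x\|_j^2=x_{j+1}^2+\dots+x_m^2,$$ with the Gegenbauer polynomials $C_n^\alpha(t)=\sum_j\frac{(-1)^j\Gamma(\alpha+n-j)}{j!(n-2j)!\Gamma(\alpha)}(2t)^{n-2j}$. Let $z\in L$ be a primitive isotropic vector, $z'\in L'$ with $(z,z')=1$, $N>0$ with $(L,z)=N\mathbb{Z}$, and $\zeta\in L$ with $(\zeta,z)=N$. Let $L_1=L\cap\langle z\rangle^\perp\cap\langle z'\rangle^\perp$, a lattice of signature $(b^+-1,b^--1)$, and let $x_{L_1}$ be the orthogonal projection of $x$ to $(L_1)_\mathbb{R}$. Let $M'=\{\lambda\in L'\mid(\lambda,z)\in N\mathbb{Z}\}$ and let $\pi:M'/L\to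 D_{L_1}$ be induced by $\pi(\lambda)=\lambda_{L_1}-\frac{(\lambda,z)}N\zeta_{L_1}$. Put $f_{L_1}=\sum_{\lambda\in D_{L_1}}\bigl(\sum_{\delta\in M'/L,\,\pi(\delta)=\lambda}f_{L+\delta}\bigr)\mathfrak e_\lambda$. Let $z=z^++z^-$ be the decomposition given by $v_0$, $z^*=(z^+-z^-)/(2\|z^+\|^2)$, let $x_W$ be the orthogonal projection of $x\in L_\mathbb{R}$ to $W=\langle z^+\rangle^\perp\cap\langle z^-\rangle^\perp$, and $v_1(x)=v_0(x_W)=v_1^+(x)+v_1^-(x)$, which is an isometry on $(L_1)_\mathbb{R}$ and is used to define $\Theta_{L_1}$. Fix an orthonormal basis of $V^+$ with first vector $v_0^+(z)/\|v_0^+(z)\|$; $h_\kappa^{b^+}$ is formed in the coordinates of this basis and $h_{\kappa^{(1)}}^{b^+-1}$, $\kappa^{(1)}=(k_1,\dots,\pm k_{b^+-2})$, in the coordinates of its other $b^+-1$ vectors. For $u\in(L_1)_\mathbb{R}$, $a\in\mathbb{R}^\times$, $g_1\in\mathrm{O}((L_1)_\mathbb{R})$ let $n_z(u),m_z(a,g_1)\in\mathrm{O}(L_\mathbb{R})$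 be given, for $x\in(L_1)_\mathbb{R}$, by $n_z(u)z=z$, $n_z(u)x=x-(u,x)z$, $n_z(u)z'=z'+u-q(u)z$ and $m_z(a,g_1)z=az$, $m_z(a,g_1)x=g_1x$, $m_z(a,g_1)z'=a^{-1}z'+(a-a^{-1})q(z')z$. **Theorem.** Let $f\in S_\nu(D_L)$, let $\kappa=(k_0,k_1,\dots,\pm k_{b^+-2})$ with $k=k_0\ge k_1\ge\dots\ge k_{b^+-2}\ge0$, and let $g_z=n_z(u)m_z(a,g_1)$. The integral defining $\vartheta_L(f;h_\kappa^{b^+})(g_z)$ converges absolutely, so does the one defining $(f_{L_1},\Theta_{L_1}(\tau,g_1;h_{\kappa^{(1)}}^{b^+-1}))_\tau$ if $k=k_1$, and with $s=k_1+\frac{b^+-3}2$ $$\begin{aligned}&\vartheta_L(f;h_\kappa^{b^+})(g_z)=\frac{\delta_{kk_1}|a|}{\sqrt2\,\|v_0^+(z)\|}\bigl(f_{L_1},\Theta_{L_1}(\tau,g_1;h_{\kappa^{(1)}}^{b^+-1})\bigr)_\tau\\&+\frac{(-i)^{k-k_1}(a/|a|)^{k-k_1}|a|^{k+\frac{b^+-1}2}}{2^{k_1+\frac{b^+}2-3}(k-k_1)!\,\|v_0^+(z)\|^{k+\frac{b^+-1}2}}\cdot\frac{\Gamma(k+\frac{b^+}2-1)}{\Gamma(k_1+\frac{b^+}2-1)}\sum_{\substack{\lambda\in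 L_1'\\q(\lambda)>0}}\biggl(\sum_{n|\lambda}n^{k+b^+-3}\sum_{\substack{\delta\in M'/L\\\pi(\delta)=\lambda/n}}\mathbf e((n\delta,z'))\,c\Bigl(\frac{q(\lambda)}{n^2},\delta\Bigr)\biggr)\\&\qquad\times\mathbf e\bigl((\lambda,u+ag_1(z^*)_{L_1})\bigr)\,\frac{\overline{h_{\kappa^{(1)}}^{b^+-1}(v_1^+(g_1^{-1}\lambda))}}{\|v_1^+(g_1^{-1}\lambda)\|^{s}}\,K_{s}\left(\frac{2\pi|a|\,\|v_1^+(g_1^{-1}\lambda)\|}{\|v_0^+(z)\|}\right),\end{aligned}$$ where the sum over $\lambda$ converges absolutely, $\sum_{n|\lambda}$ runs over the positive integers $n$ with $\lambda/n\in L_1'$, and $K_s$ is the $K$-Bessel function. -/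

import Mathlib

noncomputable section

namespace ThetaLift

open UpperHalfPlane MeasureTheory
open scoped MatrixGroups Manifold ComplexConjugate

/-- `𝐞(x) = exp(2πix)`. -/
def expi (x : ℂ) : ℂ := Complex.exp (2 * Real.pi * Complex.I * x)

/-! ### The metaplectic group `Mp₂(ℤ)` -/

/-- An element of `Mp₂(ℤ)`: a matrix `A = (a b; c d)` in `SL₂(ℤ)` with a holomorphic `φ` on the
upper half plane such that `φ(τ)² = cτ + d`. -/
@[ext]
structure Mp2Z where
  mat : SL(2, ℤ)
  phi : ℍ → ℂ
  holo : MDifferentiable 𝓘(ℂ) 𝓘(ℂ) phi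
  sq : ∀ τ : ℍ, phi τ ^ 2 = (mat 1 0 : ℂ) * τ + (mat 1 1 : ℂ)

namespace Mp2Z

lemma sq_denom (A : Mp2Z) (τ : ℍ) : A.phi τ ^ 2 = denom A.mat τ := by
  rw [A.sq]; simp [denom]

lemma phi_ne_zero (A : Mp2Z) (τ : ℍ) : A.phi τ ≠ 0 := by
  intro h
  have h2 := A.sq_denom τ
  rw [h] at h2
  exact denom_ne_zero (A.mat : GL (Fin 2) ℝ) τ (by rw [← h2]; simp)

lemma holo_smul {φ : ℍ → ℂ} (h : MDifferentiable 𝓘(ℂ) 𝓘(ℂ) φ) (B : SL(2, ℤ)) :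
    MDifferentiable 𝓘(ℂ) 𝓘(ℂ) (fun τ : ℍ => φ (B • τ)) := by
  have hB : 0 < (B : GL (Fin 2) ℝ).det.val := by simp
  exact h.comp (mdifferentiable_smul hB)

/-- `(A, φ₁)(B, φ₂) = (AB, φ₁(Bτ)φ₂(τ))`. -/
instance : Mul Mp2Z where
  mul A B :=
    { mat := A.mat * B.mat
      phi := fun τ => A.phi (B.mat • τ) * B.phi τ
      holo := (holo_smul A.holo B.mat).mul B.holo
      sq := fun τ => by
        have h := denom_cocycle_σ (A.mat : GL (Fin 2) ℝ) (B.mat : GL (Fin 2) ℝ) τ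
        have h2 : denom ((A.mat * B.mat : SL(2, ℤ)) : GL (Fin 2) ℝ) τ
            = denom (A.mat : GL (Fin 2) ℝ) (B.mat • τ : ℍ) * denom (B.mat : GL (Fin 2) ℝ) τ := by
          simpa [σ] using h
        have h3 : (A.phi (B.mat • τ) * B.phi τ) ^ 2
            = denom ((A.mat * B.mat : SL(2, ℤ)) : GL (Fin 2) ℝ) τ := by
          rw [mul_pow, sq_denom, sq_denom, h2]
        rw [h3]; rfl }

instance : One Mp2Z where
  one :=
    { mat := 1
      phi := fun _ => 1
      holo := mdifferentiable_const
      sq := fun τ => by simp }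

instance : Inv Mp2Z where
  inv A :=
    { mat := A.mat⁻¹
      phi := fun τ => (A.phi (A.mat⁻¹ • τ))⁻¹
      holo := by
        have h := UpperHalfPlane.mdifferentiable_iff.mp (holo_smul A.holo A.mat⁻¹)
        rw [UpperHalfPlane.mdifferentiable_iff]
        exact h.inv fun w _ => A.phi_ne_zero _
      sq := fun τ => by
        have h := denom_cocycle_σ (A.mat : GL (Fin 2) ℝ) ((A.mat⁻¹ : SL(2, ℤ)) : GL (Fin 2) ℝ) τ
        have h2 : (1 : ℂ) = denom (A.mat : GL (Fin 2) ℝ) (A.mat⁻¹ • τ : ℍ)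
            * denom ((A.mat⁻¹ : SL(2, ℤ)) : GL (Fin 2) ℝ) τ := by
          simpa [σ] using h
        have h3 : ((A.phi (A.mat⁻¹ • τ))⁻¹) ^ 2
            = denom ((A.mat⁻¹ : SL(2, ℤ)) : GL (Fin 2) ℝ) τ := by
          rw [inv_pow, sq_denom]
          exact inv_eq_of_mul_eq_one_right h2.symm
        rw [h3]; rfl }

@[simp] lemma mul_mat (A B : Mp2Z) : (A * B).mat = A.mat * B.mat := rfl
@[simp] lemma mul_phi (A B : Mp2Z) (τ : ℍ) : (A * B).phi τ = A.phi (B.mat • τ) * B.phi τ := rfl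
@[simp] lemma one_mat : (1 : Mp2Z).mat = 1 := rfl
@[simp] lemma one_phi (τ : ℍ) : (1 : Mp2Z).phi τ = 1 := rfl
@[simp] lemma inv_mat (A : Mp2Z) : (A⁻¹).mat = A.mat⁻¹ := rfl
@[simp] lemma inv_phi (A : Mp2Z) (τ : ℍ) : (A⁻¹).phi τ = (A.phi (A.mat⁻¹ • τ))⁻¹ := rfl

instance : Group Mp2Z where
  mul_assoc A B C := by
    ext1
    · simp [mul_assoc]
    · funext τ; simp [mul_assoc, mul_smul]
  one_mul A := by
    ext1
    · simp
    · funext τ; simp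
  mul_one A := by
    ext1
    · simp
    · funext τ; simp
  inv_mul_cancel A := by
    ext1
    · simp
    · funext τ
      simp [A.phi_ne_zero]

/-- The generator `T = ((1 1; 0 1), 1)`. -/
def T : Mp2Z where
  mat := ModularGroup.T
  phi := fun _ => 1
  holo := mdifferentiable_const
  sq := fun τ => by simp [ModularGroup.T]

/-- The generator `S = ((0 -1; 1 0), √τ)` (principal branch). -/
def S : Mp2Z where
  mat := ModularGroup.S
  phi := fun τ => (τ : ℂ) ^ (1 / 2 : ℂ)
  holo := by
    rw [UpperHalfPlane.mdifferentiable_iff]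
    have h : DifferentiableOn ℂ (fun w : ℂ => w ^ (1 / 2 : ℂ)) {w | 0 < w.im} := fun w hw =>
      (differentiableAt_id.cpow_const
        (Or.inr (ne_of_gt hw))).differentiableWithinAt
    exact h.congr fun w hw => by simp [ofComplex_apply_of_im_pos hw]
  sq := fun τ => by
    rw [← Complex.cpow_nat_mul]
    simp [ModularGroup.S]

end Mp2Z


/-! ### Quadratic spaces, lattices and discriminant groups -/

/-- The quadratic form `Q(x) = (x₁² + ⋯ + x_r² - x_{r+1}² - ⋯ - x_{r+s}²)/2` on `ℝ^{r,s}`; the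
coordinates of `V⁺` are indexed by `Sum.inl`, those of `V⁻` by `Sum.inr`. -/
def stdForm (r s : ℕ) : QuadraticForm ℝ (Fin r ⊕ Fin s → ℝ) :=
  QuadraticMap.weightedSumSquares ℝ
    (Sum.elim (fun _ => (1 / 2 : ℝ)) (fun _ => -(1 / 2 : ℝ)))

/-- `Q(x⁺)`. -/
def qPlus {r s : ℕ} (x : Fin r ⊕ Fin s → ℝ) : ℝ := (∑ j, x (Sum.inl j) ^ 2) / 2

/-- `Q(x⁻)`. -/
def qMinus {r s : ℕ} (x : Fin r ⊕ Fin s → ℝ) : ℝ := -(∑ j, x (Sum.inr j) ^ 2) / 2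

/-- `‖x⁺‖ = |(x⁺, x⁺)|^{1/2}`. -/
def normPlus {r s : ℕ} (x : Fin r ⊕ Fin s → ℝ) : ℝ := Real.sqrt (∑ j, x (Sum.inl j) ^ 2)

variable {E : Type*} [AddCommGroup E] [Module ℝ E]

/-- The bilinear form `(x, y)` with `q(x) = (x, x)/2`. -/
abbrev bil (q : QuadraticForm ℝ E) (x y : E) : ℝ := q.polarBilin x y

/-- `L` is an even lattice of full rank in the quadratic space `(E, q)`. -/
structure IsEvenLattice (q : QuadraticForm ℝ E) (L : Submodule ℤ E) : Prop where
  exists_basis : ∃ (m : ℕ) (b : Module.Basis (Fin m) ℝ E), L = Submodule.span ℤ (Set.range b)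
  even : ∀ x ∈ L, ∃ m : ℤ, q x = m

/-- The dual lattice `L'`. -/
abbrev dual (q : QuadraticForm ℝ E) (L : Submodule ℤ E) : Submodule ℤ E :=
  LinearMap.BilinForm.dualSubmodule q.polarBilin L

/-- The discriminant group `D_L = L'/L`. -/
abbrev Disc (q : QuadraticForm ℝ E) (L : Submodule ℤ E) : Type _ :=
  dual q L ⧸ L.submoduleOf (dual q L)

/-- The class `λ + L` of `λ ∈ L'`. -/
abbrev cls (q : QuadraticForm ℝ E) (L : Submodule ℤ E) (x : dual q L) : Disc q L :=
  (L.submoduleOf (dual q L)).mkQ x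

/-- The orthogonal group of `(E, q)`. -/
abbrev Orth (q : QuadraticForm ℝ E) : Type _ := q.IsometryEquiv q

/-! ### The Weil representation and vector-valued cusp forms

Elements of `ℂ[D_L]` are functions on `D_L`, the basis vector `𝔢_γ` is `Pi.single γ 1`. -/

open Classical in
/-- `ρ` is the Weil representation `ρ_L` of `Mp₂(ℤ)` on `ℂ[D_L]`, for a lattice with
`b⁺ - b⁻ = sig`: it is given by the usual formulas on the generators `T` and `S`. -/
def IsWeilRep (q : QuadraticForm ℝ E) (L : Submodule ℤ E) (sig : ℤ)
    (ρ : Mp2Z →* Module.End ℂ (Disc q L → ℂ)) : Prop :=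
  (∀ γ : dual q L, ρ Mp2Z.T (Pi.single (cls q L γ) 1)
      = expi (q (γ : E) : ℝ) • Pi.single (cls q L γ) (1 : ℂ)) ∧
  (∀ γ δ : dual q L, ρ Mp2Z.S (Pi.single (cls q L γ) 1) (cls q L δ)
      = expi (-(sig : ℂ) / 8) / (Real.sqrt (Nat.card (Disc q L)) : ℂ)
        * expi (-(bil q (γ : E) (δ : E) : ℝ)))

/-- `f_{L+γ}(τ) = ∑_{n ∈ q(γ)+ℤ} c(n, γ) 𝐞(nτ)` for all `γ ∈ D_L`. Only the values `c n γ` with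
`n ∈ q(γ) + ℤ` are relevant. -/
def HasFourierExpansion (q : QuadraticForm ℝ E) (L : Submodule ℤ E)
    (f : ℍ → Disc q L → ℂ) (c : ℝ → Disc q L → ℂ) : Prop :=
  ∀ (γ : dual q L) (τ : ℍ),
    HasSum (fun j : ℤ => c (q (γ : E) + j) (cls q L γ)
        * expi (((q (γ : E) + j : ℝ) : ℂ) * (τ : ℂ)))
      (f τ (cls q L γ))

/-- `f ∈ S_ν(D_L)`, with `w = 2ν ∈ ℤ`: a holomorphic cusp form of weight `ν` and type `ρ_L` for
`Mp₂(ℤ)`. -/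
structure IsCuspForm (q : QuadraticForm ℝ E) (L : Submodule ℤ E) (sig w : ℤ)
    (f : ℍ → Disc q L → ℂ) : Prop where
  holo : ∀ γ, MDifferentiable 𝓘(ℂ) 𝓘(ℂ) (fun τ => f τ γ)
  modular : ∃ ρ : Mp2Z →* Module.End ℂ (Disc q L → ℂ), IsWeilRep q L sig ρ ∧
    ∀ (A : Mp2Z) (τ : ℍ), f (A.mat • τ) = A.phi τ ^ w • ρ A (f τ)
  cusp : ∃ c, HasFourierExpansion q L f c ∧ ∀ n γ, n ≤ 0 → c n γ = 0

/-- The integrand `⟨f(τ), F(τ)⟩_L y^ν` of the Petersson product, with `w = 2ν`. -/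
def peterssonIntegrand {D : Type*} (w : ℤ) (f F : ℍ → D → ℂ) (τ : ℍ) : ℂ :=
  (∑ᶠ γ, f τ γ * conj (F τ γ)) * ((τ.im ^ ((w : ℝ) / 2) : ℝ) : ℂ)

/-- The Petersson product `(f, F)_τ`: the integral of `⟨f, F⟩_L y^ν dxdy/y²` over the standard
fundamental domain of `SL₂(ℤ)`. The measure on `ℍ` is `dxdy/y²`. -/
def petersson {D : Type*} (w : ℤ) (f F : ℍ → D → ℂ) : ℂ :=
  ∫ τ in ModularGroup.fd, peterssonIntegrand w f F τ

/-! ### Theta functions -/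

/-- The Laplacian of the definite form `∑ x_j²`. -/
def lap {σ : Type*} [Fintype σ] (p : MvPolynomial σ ℂ) : MvPolynomial σ ℂ :=
  ∑ i, MvPolynomial.pderiv i (MvPolynomial.pderiv i p)

/-- `exp(-Δ/(8πy)) p`; the terms that are left out of the exponential series vanish. -/
def heat {σ : Type*} [Fintype σ] (y : ℝ) (p : MvPolynomial σ ℂ) : MvPolynomial σ ℂ :=
  ∑ j ∈ Finset.range (p.totalDegree + 1),
    MvPolynomial.C ((((-1 / (8 * Real.pi * y)) ^ j / (j.factorial : ℝ) : ℝ)) : ℂ) * lap^[j] p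

/-- `θ_{L+γ}(τ, g; p)`, the coefficient of `𝔢_γ` in `Θ_L(τ, g; p)`, relative to a linear isometry `v` of `(E, q)` into `ℝ^{r,s}`; here `bneg`
is the negative index of `(E, q)` and `p` is a polynomial function on `ℝ^{r,s}`. -/
def theta (q : QuadraticForm ℝ E) (L : Submodule ℤ E) {r s : ℕ}
    (v : E →ₗ[ℝ] (Fin r ⊕ Fin s → ℝ)) (bneg : ℕ) (p : MvPolynomial (Fin r ⊕ Fin s) ℂ)
    (g : Orth q) (τ : ℍ) (γ : Disc q L) : ℂ :=
  ((τ.im ^ ((bneg : ℝ) / 2) : ℝ) : ℂ) * ∑' x : {x : dual q L // cls q L x = γ},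
    MvPolynomial.eval (fun i => ((v (g.symm (x.1 : E)) i : ℝ) : ℂ)) (heat τ.im p)
      * expi ((τ : ℂ) * (qPlus (v (g.symm (x.1 : E))) : ℝ)
          + conj (τ : ℂ) * (qMinus (v (g.symm (x.1 : E))) : ℝ))

/-! ### The polynomials `h_κ` -/

/-- `‖x‖^m C_m^α(X/‖x‖)` as a polynomial in `X` and `Y = ‖x‖²`, where `C_m^α` is the Gegenbauer
polynomial `∑_j (-1)^j Γ(α+m-j)/(j!(m-2j)!Γ(α)) (2t)^{m-2j}`. -/
def gegenbauerHom {R : Type*} [CommRing R] [Algebra ℂ R] (α : ℝ) (m : ℕ) (X Y : R) : R :=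
  ∑ j ∈ Finset.range (m / 2 + 1),
    algebraMap ℂ R (((-1) ^ j * Real.Gamma (α + m - j)
        / (j.factorial * (m - 2 * j).factorial * Real.Gamma α) : ℝ) : ℂ)
      * (2 * X) ^ (m - 2 * j) * Y ^ j

/-- The harmonic polynomial `h_κ^n` on `ℝ^n`, `n = N + 2`, for
`κ = (k₀, …, k_{N-1}, ε k_N)` with a sign `ε`:
`(x_{n-1} + ε i x_n)^{k_{n-2}} ∏_{j=0}^{n-3} ‖x‖_j^{k_j-k_{j+1}}
C_{k_j-k_{j+1}}^{k_{j+1}+(n-j-2)/2}(x_{j+1}/‖x‖_j)`, where `‖x‖_j² = x_{j+1}² + ⋯ + x_n²`.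
(The variable `x_{i+1}` is `X i`.) -/
def harmonicPoly (N : ℕ) (κ : Fin (N + 1) → ℕ) (ε : ℤˣ) : MvPolynomial (Fin (N + 2)) ℂ :=
  (MvPolynomial.X (Fin.last N).castSucc
      + MvPolynomial.C (((ε : ℤ) : ℂ) * Complex.I) * MvPolynomial.X (Fin.last (N + 1)))
    ^ κ (Fin.last N)
  * ∏ j : Fin N, gegenbauerHom ((κ j.succ : ℝ) + ((N : ℝ) - (j : ℕ)) / 2)
      (κ j.castSucc - κ j.succ)
      (MvPolynomial.X j.castSucc.castSucc)
      (∑ i ∈ Finset.Ici j.castSucc.castSucc, MvPolynomial.X i ^ 2)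

/-- The polynomial function `x ↦ h((x⁺, c₁), …, (x⁺, c_m))` on `ℝ^{r,s}`, for vectors `c_i` in the
Euclidean space `V⁺ = ℝ^r`. -/
def inFrame {m r s : ℕ} (c : Fin m → EuclideanSpace ℝ (Fin r)) (h : MvPolynomial (Fin m) ℂ) :
    MvPolynomial (Fin r ⊕ Fin s) ℂ :=
  MvPolynomial.aeval
    (fun i => ∑ j, MvPolynomial.C ((c i j : ℝ) : ℂ) * MvPolynomial.X (Sum.inl j)) h

/-- The `K`-Bessel function `K_α(x)`, `x > 0`. -/
def besselK (α x : ℝ) : ℝ :=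
  (1 / 2) * ∫ t in Set.Ioi (0 : ℝ), t ^ (α - 1) * Real.exp (-(x / 2) * (t + 1 / t))

/-! ### The maximal parabolic subgroup of a primitive isotropic vector -/

/-- A primitive isotropic vector `z ∈ L`, a vector `z' ∈ L'` (written `zd`) with `(z, z') = 1`, the
positive integer `N` (written `level`) with `(L, z) = Nℤ`, and `ζ ∈ L` with `(ζ, z) = N`. -/
structure IsotropicData (q : QuadraticForm ℝ E) (L : Submodule ℤ E) where
  z : E
  zd : E
  level : ℕ
  zeta : E
  z_mem : z ∈ L
  primitive : ∀ (m : ℤ) (x : E), x ∈ L → z = m • x → IsUnit m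
  isotropic : q z = 0
  zd_mem : zd ∈ dual q L
  pairing : bil q z zd = 1
  level_pos : 0 < level
  level_spec : ∀ r : ℝ, (∃ x ∈ L, bil q x z = r) ↔ ∃ j : ℤ, r = level * j
  zeta_mem : zeta ∈ L
  zeta_spec : bil q zeta z = level

namespace IsotropicData

variable {q : QuadraticForm ℝ E} {L : Submodule ℤ E} (D : IsotropicData q L)

/-- `(L₁)_ℝ`, the orthogonal complement of `z` and `z'`. -/
def E1 : Submodule ℝ E := LinearMap.ker (q.polarBilin D.z) ⊓ LinearMap.ker (q.polarBilin D.zd)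

/-- The quadratic form on `(L₁)_ℝ`. -/
abbrev q1 : QuadraticForm ℝ D.E1 := q.restrict D.E1

/-- `L₁ = L ∩ ⟨z⟩^⊥ ∩ ⟨z'⟩^⊥`, as a lattice in `(L₁)_ℝ`. -/
def L1 : Submodule ℤ D.E1 := L.comap (D.E1.subtype.restrictScalars ℤ)

lemma bil_self (q : QuadraticForm ℝ E) (x : E) : bil q x x = 2 * q x := by
  simp [bil, QuadraticMap.polar_self]

lemma q_add (q : QuadraticForm ℝ E) (x y : E) : q (x + y) = q x + q y + bil q x y := by
  simp only [bil, QuadraticMap.polarBilin_apply_apply, QuadraticMap.polar]; ring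

lemma bil_comm (q : QuadraticForm ℝ E) (x y : E) : bil q x y = bil q y x := by
  simp [bil, QuadraticMap.polar_comm]

lemma q_smul (q : QuadraticForm ℝ E) (a : ℝ) (x : E) : q (a • x) = a * a * q x := by
  simp [QuadraticMap.map_smul]

lemma bil_add_left (q : QuadraticForm ℝ E) (x y w : E) :
    bil q (x + y) w = bil q x w + bil q y w := by simp [bil]

lemma bil_add_right (q : QuadraticForm ℝ E) (x y w : E) :
    bil q x (y + w) = bil q x y + bil q x w := by simp [bil]

lemma bil_smul_left (q : QuadraticForm ℝ E) (a : ℝ) (x y : E) :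
    bil q (a • x) y = a * bil q x y := by simp [bil]

lemma bil_smul_right (q : QuadraticForm ℝ E) (a : ℝ) (x y : E) :
    bil q x (a • y) = a * bil q x y := by simp [bil]

lemma bil_z_z : bil q D.z D.z = 0 := by rw [bil_self, D.isotropic, mul_zero]

lemma bil_zd_z : bil q D.zd D.z = 1 := by rw [bil_comm, D.pairing]

lemma bil_z_E1 (u : D.E1) : bil q D.z (u : E) = 0 := u.2.1

lemma bil_zd_E1 (u : D.E1) : bil q D.zd (u : E) = 0 := u.2.2

lemma bil_E1_z (u : D.E1) : bil q (u : E) D.z = 0 := by rw [bil_comm, D.bil_z_E1]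

lemma bil_E1_zd (u : D.E1) : bil q (u : E) D.zd = 0 := by rw [bil_comm, D.bil_zd_E1]

/-- The coordinate `(x, z') - (x, z)(z', z')` of `x` along `z`. -/
def coordZ : E →ₗ[ℝ] ℝ := q.polarBilin D.zd - bil q D.zd D.zd • q.polarBilin D.z

lemma coordZ_apply (x : E) :
    D.coordZ x = bil q x D.zd - bil q D.zd D.zd * bil q x D.z := by
  rw [bil_comm q x D.zd, bil_comm q x D.z]; rfl

/-- The orthogonal projection `x ↦ x_{L₁} = x - (x, z)z' - ((x, z') - (x, z)(z', z'))z`. -/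
def proj : E →ₗ[ℝ] D.E1 :=
  LinearMap.codRestrict D.E1
    (LinearMap.id - (q.polarBilin D.z).smulRight D.zd - D.coordZ.smulRight D.z) <| by
      intro x
      have h : (LinearMap.id - (q.polarBilin D.z).smulRight D.zd - D.coordZ.smulRight D.z
          : E →ₗ[ℝ] E) x = x + (-bil q x D.z) • D.zd + (-D.coordZ x) • D.z := by
        rw [bil_comm q x D.z]
        simp [sub_eq_add_neg, bil]
      rw [h]
      refine ⟨?_, ?_⟩
      · change bil q D.z _ = 0
        rw [bil_add_right, bil_add_right, bil_smul_right, bil_smul_right, D.pairing, D.bil_z_z,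
          bil_comm q D.z x]
        ring
      · change bil q D.zd _ = 0
        rw [bil_add_right, bil_add_right, bil_smul_right, bil_smul_right, D.bil_zd_z,
          D.coordZ_apply, bil_comm q D.zd x]
        ring

lemma proj_apply (x : E) :
    (D.proj x : E) = x + (-bil q x D.z) • D.zd + (-D.coordZ x) • D.z := by
  rw [bil_comm q x D.z]
  simp [proj, sub_eq_add_neg, bil]

lemma decomp (x : E) : x = (D.proj x : E) + bil q x D.z • D.zd + D.coordZ x • D.z := by
  rw [D.proj_apply]; module

lemma proj_coe (u : D.E1) (s t : ℝ) : D.proj ((u : E) + s • D.zd + t • D.z) = u := by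
  apply Subtype.ext
  rw [D.proj_apply, D.coordZ_apply]
  simp only [bil_add_left, bil_smul_left, D.bil_E1_z, D.bil_E1_zd, D.bil_zd_z, D.bil_z_z,
    D.pairing]
  module

lemma bil_coe_z (u : D.E1) (s t : ℝ) : bil q ((u : E) + s • D.zd + t • D.z) D.z = s := by
  simp only [bil_add_left, bil_smul_left, D.bil_E1_z, D.bil_zd_z, D.bil_z_z]; ring

lemma coordZ_coe (u : D.E1) (s t : ℝ) : D.coordZ ((u : E) + s • D.zd + t • D.z) = t := by
  rw [D.coordZ_apply]
  simp only [bil_add_left, bil_smul_left, D.bil_E1_z, D.bil_E1_zd, D.bil_zd_z, D.bil_z_z,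
    D.pairing]
  ring

lemma q_coe (u : D.E1) (s t : ℝ) :
    q ((u : E) + s • D.zd + t • D.z) = q (u : E) + s * s * q D.zd + s * t := by
  rw [q_add, q_add]
  simp only [bil_add_left, bil_smul_left, bil_smul_right, q_smul, D.bil_E1_z, D.bil_E1_zd,
    D.bil_zd_z, D.isotropic]
  ring

/-- `n_z(u) ∈ O(E)`, the element of the unipotent radical `N_z` with `n_z(u)z = z`,
`n_z(u)x = x - (u, x)z` for `x ∈ (L₁)_ℝ` and `n_z(u)z' = z' + u - q(u)z`. -/
def unip (u : D.E1) : Orth q where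
  toFun x := x + bil q x D.z • (u : E) + (-bil q (u : E) x - q (u : E) * bil q x D.z) • D.z
  map_add' x y := by
    simp only [bil_add_left, bil_add_right]; module
  map_smul' a x := by
    simp only [bil_smul_left, bil_smul_right, RingHom.id_apply]; module
  invFun x := x + bil q x D.z • (-(u : E))
    + (bil q (u : E) x - q (u : E) * bil q x D.z) • D.z
  left_inv x := by
    simp only [bil_add_left, bil_add_right, bil_smul_left, bil_smul_right, D.bil_E1_z, D.bil_z_z,
      bil_self]
    module
  right_inv x := by
    rw [← neg_one_smul ℝ (u : E)]
    simp only [bil_add_left, bil_add_right, bil_smul_left, bil_smul_right, D.bil_E1_z, D.bil_z_z,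
      bil_self]
    module
  map_app' x := by
    change q (x + bil q x D.z • (u : E)
      + (-bil q (u : E) x - q (u : E) * bil q x D.z) • D.z) = q x
    rw [q_add, q_add]
    simp only [bil_add_left, bil_smul_left, bil_smul_right, q_smul, D.bil_E1_z, D.isotropic]
    rw [bil_comm q x (u : E)]
    ring

/-- `m_z(a, g₁) ∈ O(E)`, the element of the Levi subgroup `M_z` with `m_z(a, g₁)z = az`,
`m_z(a, g₁)x = g₁x` for `x ∈ (L₁)_ℝ` and `m_z(a, g₁)z' = a⁻¹z' + (a - a⁻¹)q(z')z`. -/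
def levi (a : ℝˣ) (g₁ : Orth D.q1) : Orth q where
  toFun x := (g₁ (D.proj x) : E) + ((a : ℝ)⁻¹ * bil q x D.z) • D.zd
    + (((a : ℝ) - (a : ℝ)⁻¹) * q D.zd * bil q x D.z + a * D.coordZ x) • D.z
  map_add' x y := by
    simp only [bil_add_left, map_add, Submodule.coe_add]; module
  map_smul' c x := by
    simp only [bil_smul_left, map_smul, Submodule.coe_smul, RingHom.id_apply, smul_eq_mul]
    module
  invFun x := (g₁.symm (D.proj x) : E) + ((a : ℝ) * bil q x D.z) • D.zd
    + (((a : ℝ)⁻¹ - (a : ℝ)) * q D.zd * bil q x D.z + (a : ℝ)⁻¹ * D.coordZ x) • D.z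
  left_inv x := by
    have ha : (a : ℝ) ≠ 0 := a.ne_zero
    simp only [D.proj_coe, D.bil_coe_z, D.coordZ_coe, QuadraticMap.IsometryEquiv.symm_apply_apply]
    conv_rhs => rw [D.decomp x]
    congr 2
    · congr 1; field_simp
    · field_simp; ring
  right_inv x := by
    have ha : (a : ℝ) ≠ 0 := a.ne_zero
    simp only [D.proj_coe, D.bil_coe_z, D.coordZ_coe, QuadraticMap.IsometryEquiv.apply_symm_apply]
    conv_rhs => rw [D.decomp x]
    congr 2
    · congr 1; field_simp
    · field_simp; ring
  map_app' x := by
    have ha : (a : ℝ) ≠ 0 := a.ne_zero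
    have hg : q (g₁ (D.proj x) : E) = q (D.proj x : E) := g₁.map_app (D.proj x)
    change q ((g₁ (D.proj x) : E) + ((a : ℝ)⁻¹ * bil q x D.z) • D.zd
      + (((a : ℝ) - (a : ℝ)⁻¹) * q D.zd * bil q x D.z + a * D.coordZ x) • D.z) = q x
    conv_rhs => rw [D.decomp x]
    rw [q_coe, q_coe, hg]
    field_simp
    ring

/-- `g_z = n_z(u) m_z(a, g₁)`. -/
def parab (u : D.E1) (a : ℝˣ) (g₁ : Orth D.q1) : Orth q := (D.levi a g₁).trans (D.unip u)

lemma unip_z (u : D.E1) : D.unip u D.z = D.z := by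
  change D.z + bil q D.z D.z • (u : E) + _ = _
  rw [D.bil_z_z, D.bil_E1_z]; module

lemma unip_E1 (u x : D.E1) : D.unip u (x : E) = -bil q (u : E) (x : E) • D.z + (x : E) := by
  change (x : E) + bil q (x : E) D.z • (u : E) + _ = _
  rw [D.bil_E1_z]; module

lemma unip_zd (u : D.E1) : D.unip u D.zd = -q (u : E) • D.z + (u : E) + D.zd := by
  change D.zd + bil q D.zd D.z • (u : E) + _ = _
  rw [D.bil_zd_z, D.bil_E1_zd]; module

lemma levi_apply (a : ℝˣ) (g₁ : Orth D.q1) (x : E) :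
    D.levi a g₁ x = (g₁ (D.proj x) : E) + ((a : ℝ)⁻¹ * bil q x D.z) • D.zd
      + (((a : ℝ) - (a : ℝ)⁻¹) * q D.zd * bil q x D.z + a * D.coordZ x) • D.z := rfl

lemma levi_coe (a : ℝˣ) (g₁ : Orth D.q1) (x : D.E1) (s t : ℝ) :
    D.levi a g₁ ((x : E) + s • D.zd + t • D.z) = (g₁ x : E) + ((a : ℝ)⁻¹ * s) • D.zd
      + (((a : ℝ) - (a : ℝ)⁻¹) * q D.zd * s + a * t) • D.z := by
  rw [levi_apply, D.proj_coe, D.coordZ_coe, D.bil_coe_z]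

lemma levi_z (a : ℝˣ) (g₁ : Orth D.q1) : D.levi a g₁ D.z = (a : ℝ) • D.z := by
  simpa using D.levi_coe a g₁ 0 0 1

lemma levi_E1 (a : ℝˣ) (g₁ : Orth D.q1) (x : D.E1) : D.levi a g₁ (x : E) = (g₁ x : E) := by
  simpa using D.levi_coe a g₁ x 0 0

lemma levi_zd (a : ℝˣ) (g₁ : Orth D.q1) :
    D.levi a g₁ D.zd = (a : ℝ)⁻¹ • D.zd + (((a : ℝ) - (a : ℝ)⁻¹) * q D.zd) • D.z := by
  simpa using D.levi_coe a g₁ 0 1 0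

/-- `M' = {λ ∈ L' | (λ, z) ≡ 0 mod N}` and `π(λ) = λ_{L₁} - ((λ, z)/N) ζ_{L₁}`: the relation says
that the class `δ ∈ D_L` lies in `M'/L` and that `π(δ)` is the class of `x ∈ L₁'` modulo `L₁`. -/
def ProjectsTo (δ : Disc q L) (x : D.E1) : Prop :=
  ∃ (l : dual q L) (j : ℤ), cls q L l = δ ∧ bil q (l : E) D.z = D.level * j ∧
    D.proj (l : E) - j • D.proj D.zeta - x ∈ D.L1

/-- `f_{L₁} = ∑_λ f_{L₁+λ} 𝔢_λ` with `f_{L₁+λ} = ∑_{δ ∈ M'/L, π(δ) = λ} f_{L+δ}`. -/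
def reduce (f : ℍ → Disc q L → ℂ) (τ : ℍ) (γ : Disc D.q1 D.L1) : ℂ :=
  ∑ᶠ (δ : Disc q L) (_ : D.ProjectsTo δ (γ.out : D.E1)), f τ δ

/-- The coefficient
`∑_{n ∣ λ} n^t ∑_{δ ∈ M'/L, π(δ) = λ/n} 𝐞((nδ, z')) c(q(λ)/n², δ)` for `λ ∈ L₁'`. The number
`𝐞((nδ, z'))` does not depend on the representative of the class `δ`. -/
def divisorCoeff (c : ℝ → Disc q L → ℂ) (t : ℕ) (x : D.E1) : ℂ :=
  ∑ᶠ (n : ℕ) (_ : 0 < n ∧ (n : ℝ)⁻¹ • x ∈ dual D.q1 D.L1),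
    (n : ℂ) ^ t * ∑ᶠ (δ : Disc q L) (_ : D.ProjectsTo δ ((n : ℝ)⁻¹ • x)),
      expi ((n * bil q ((δ.out : dual q L) : E) D.zd : ℝ)) * c (q (x : E) / n ^ 2) δ

variable {r s : ℕ} (v₀ : q.IsometryEquiv (stdForm r s))

/-- `‖v₀⁺(z)‖`. -/
def rho : ℝ := normPlus (v₀ D.z)

/-- `z^* = (z⁺ - z⁻)/(2‖z⁺‖²)`, where `x⁺`, `x⁻` are the components of `x` with respect to the
pullback of `V = V⁺ ⊕ V⁻` under `v₀`. -/
def zStar : E :=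
  (1 / (2 * D.rho v₀ ^ 2)) • v₀.symm
    (Sum.elim (fun j => v₀ D.z (Sum.inl j)) (fun j => -v₀ D.z (Sum.inr j)))

/-- `v₁(x) = v₀(x_W)`, where `x_W = x - (x, z^*)z - (x, z)z^*` is the orthogonal projection to
the orthogonal complement `W` of the hyperbolic plane `⟨z, z^*⟩ = ⟨z⁺, z⁻⟩`. -/
def v1 : E →ₗ[ℝ] (Fin r ⊕ Fin s → ℝ) :=
  v₀.toLinearEquiv.toLinearMap ∘ₗ
    (LinearMap.id - (q.polarBilin (D.zStar v₀)).smulRight D.z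
      - (q.polarBilin D.z).smulRight (D.zStar v₀))

end IsotropicData

end ThetaLift

/-!
The lift of `f` at `g_z = n_z(u) m_z(a, g₁)` is the integral of `y^ν ⟨f, Θ⟩` over a fundamental
domain. It is evaluated by unfolding against the stabilizer of the isotropic vector `z`.

**Reduction of the polynomial.** Up to a multiple of `∑ x_j²`, the polynomial `h_κ` is a constant
times `x_1^{k-k₁} h_{κ⁽¹⁾}(x_2, …)` (`harmonicPoly_succ_eq`); the constant comes from the leading
term of a Gegenbauer polynomial. If `p` is homogeneous of degree `k - 2`, then
`(f, Θ(·; ∑ x_j² p)) = 0` (`integral_fd_thetaPair_sum_sq`): the integrand is a multiple of the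
`∂/∂τ̄`-derivative of the pairing of `f` with `Θ(·; p)`, so that Green's formula leaves a line
integral over the arc `|τ| = 1`, and the modular transformation under `S` makes it odd.

**Unfolding.** Instead of writing the theta function as a Poincaré-type series, the pairing of `f`
with the theta function is given two characteristics `(σ, t)`: the argument is shifted by `σz` and
twisted by `𝐞(t(x, z))`. As `z` is isotropic, the result `thetaPair` is `ℤ²`-periodic in the
characteristics, and `SL₂(ℤ)` acts on them linearly (`thetaPair_S`, which is Poisson summation over
`L'` together with the formula for `ρ_L(S)`). Hence its Fourier coefficients `charCoeff` in the
characteristics satisfy `F_w(γτ) = F_{wγ}(τ)` for `w ∈ ℤ²`, the nonzero `w` unfold to the strip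
`0 ≤ Re τ < 1`, and
`∫_fd F = ∫_fd F_0 + 2 ∑_{d ≥ 1} ∫_strip F_{(0,d)}` (`integral_fd_thetaPair`).

**The coefficients.** The integral over the twist `t` keeps the `x ∈ L'` with `(x, z) = 0`, and the
one over the shift `σ` turns the sum over `x + ℤz` into an integral over a line. The vectors that
remain modulo `z` are the pairs `(x, δ)` of `x ∈ L₁'` and `δ ∈ M'/L` with `π(δ) = x + L₁`. On a line
the transform of the kernel is elementary, because the heat operator `exp(-Δ/8πy)` is exactly the
one that makes the transform of a Gaussian times a Hermite polynomial a Gaussian times a pure power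
(`integral_conj_kern_line`). The coefficient `F_{(0,d)}` is therefore a sum over the pairs of terms
proportional to `d^{k-k₁}` (`hasSum_charCoeff`). For `d = 0` only `k = k₁` survives, and gives the
theta function of `L₁` (`charCoeff_zero`). For `d ≥ 1` the integral over `x` in the strip picks a
Fourier coefficient of `f`, the one over `y` is the integral of a `K`-Bessel function
(`integral_strip_pairTerm`), and collecting the pairs `(d, x)` with the same `d x` yields the divisor
sums (`hasSum_divisorCoeff`).

**Convergence.** It follows from Hecke's bound `f ≪ y^{-ν/2}` with exponential decay at the cusp
(`IsCuspForm.exists_bound`), the decay of the kernel (`norm_kern_le`), and the Gaussian in `d/√y`,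
which dominates all powers of `1/y` near the real axis (`norm_lineFactor_le`).
-/

namespace ThetaLift

open UpperHalfPlane MeasureTheory
open scoped MatrixGroups Manifold ComplexConjugate

/-! ### Hermite polynomials -/

/-- The polynomial `exp(-t d²/dx²) x^e` (a rescaled Hermite polynomial), as a function of the
complex numbers `t` and `x`. -/
def heatMonomial (t x : ℂ) : ℕ → ℂ
  | 0 => 1
  | 1 => x
  | e + 2 => x * heatMonomial t x (e + 1) - 2 * t * (e + 1) * heatMonomial t x e

lemma heatMonomial_zero (t x : ℂ) : heatMonomial t x 0 = 1 := by rw [heatMonomial]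

lemma heatMonomial_succ (t x : ℂ) (e : ℕ) :
    heatMonomial t x (e + 1) = x * heatMonomial t x e - 2 * t * e * heatMonomial t x (e - 1) := by
  cases e with
  | zero => simp [heatMonomial]
  | succ e => rw [heatMonomial]; simp

lemma heatMonomial_zero_left (x : ℂ) (e : ℕ) : heatMonomial 0 x e = x ^ e := by
  induction e with
  | zero => simp [heatMonomial]
  | succ e ih => rw [heatMonomial_succ, ih]; ring

lemma hasDerivAt_heatMonomial (t x : ℂ) (e : ℕ) :
    HasDerivAt (fun x => heatMonomial t x e) (e * heatMonomial t x (e - 1)) x := by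
  induction e using Nat.strong_induction_on with
  | _ e ih =>
    match e with
    | 0 => simpa [heatMonomial] using hasDerivAt_const x (1 : ℂ)
    | 1 => simpa [heatMonomial] using hasDerivAt_id' x
    | e + 2 =>
      have h1 := ih (e + 1) (by omega)
      have h0 := ih e (by omega)
      have := ((hasDerivAt_id x).mul h1).sub (h0.const_mul (2 * t * (e + 1)))
      refine (this.congr_of_eventuallyEq ?_).congr_deriv ?_
      · exact Filter.Eventually.of_forall fun y => by simp [heatMonomial]
      · have h2 := heatMonomial_succ t x e
        simp only [Nat.add_sub_cancel, show e + 2 - 1 = e + 1 by omega, id_eq]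
        rw [h2]; push_cast; ring

lemma hasDerivAt_heatMonomial_left (t x : ℂ) (e : ℕ) :
    HasDerivAt (fun t => heatMonomial t x e)
      (-(e * (e - 1) * heatMonomial t x (e - 2))) t := by
  induction e using Nat.strong_induction_on with
  | _ e ih =>
    match e with
    | 0 => simpa [heatMonomial] using hasDerivAt_const t (1 : ℂ)
    | 1 => simpa [heatMonomial] using hasDerivAt_const t x
    | e + 2 =>
      have h1 := ih (e + 1) (by omega)
      have h0 := ih e (by omega)
      have := (h1.const_mul x).sub (((hasDerivAt_id t).const_mul (2 * (e + 1 : ℂ))).mul h0)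
      refine (this.congr_of_eventuallyEq ?_).congr_deriv ?_
      · exact Filter.Eventually.of_forall fun y => by simp only [heatMonomial, Pi.sub_apply, Pi.mul_apply, id_eq]; ring
      · have h2 := heatMonomial_succ t x (e - 1)
        rcases e with _ | e
        · simp [heatMonomial]; norm_num
        · simp only [Nat.add_sub_cancel] at h2
          simp only [show e + 1 + 2 - 2 = e + 1 by omega, id_eq,
            show e + 1 - 2 = e - 1 by omega, show e + 1 + 1 - 2 = e by omega]
          rw [h2]; push_cast; ring

@[fun_prop]
lemma continuous_heatMonomial (e : ℕ) : Continuous fun p : ℂ × ℂ => heatMonomial p.1 p.2 e := by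
  induction e using Nat.strong_induction_on with
  | _ e ih =>
    match e with
    | 0 => simpa [heatMonomial] using continuous_const
    | 1 => simpa [heatMonomial] using continuous_snd
    | e + 2 =>
      have h1 := ih (e + 1) (by omega)
      have h0 := ih e (by omega)
      simp only [heatMonomial]
      fun_prop

lemma heatMonomial_smul (c t x : ℂ) (e : ℕ) :
    heatMonomial (c ^ 2 * t) (c * x) e = c ^ e * heatMonomial t x e := by
  induction e using Nat.strong_induction_on with
  | _ e ih =>
    match e with
    | 0 => simp [heatMonomial]
    | 1 => simp [heatMonomial]
    | e + 2 =>
      rw [heatMonomial, ih (e + 1) (by omega), ih e (by omega), heatMonomial]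
      ring

lemma heatMonomial_add_two (t x : ℂ) (e : ℕ) :
    heatMonomial t x (e + 2) = x ^ 2 * heatMonomial t x e - 2 * t * (2 * e + 1) * heatMonomial t x e
      - 4 * t ^ 2 * (e * (e - 1)) * heatMonomial t x (e - 2) := by
  rw [heatMonomial, heatMonomial_succ]
  rcases e with _ | e
  · simp [heatMonomial]; ring
  · have h2 := heatMonomial_succ t x e
    simp only [Nat.add_sub_cancel, show e + 1 - 2 = e - 1 by omega]
    have h3 : x * heatMonomial t x e = heatMonomial t x (e + 1)
      + 2 * t * e * heatMonomial t x (e - 1) := by rw [h2]; ring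
    push_cast
    linear_combination (-2 * t * (e + 1)) * h3

lemma norm_heatMonomial_le (e : ℕ) : ∃ C : ℝ, 0 ≤ C ∧ ∀ t x : ℂ,
    ‖heatMonomial t x e‖ ≤ C * ((1 + ‖t‖) ^ e * (1 + ‖x‖) ^ e) := by
  induction e using Nat.strong_induction_on with
  | _ e ih =>
    match e with
    | 0 => exact ⟨1, zero_le_one, fun t x => by simp [heatMonomial]⟩
    | 1 => exact ⟨1, zero_le_one, fun t x => by
        simp only [heatMonomial, pow_one]
        nlinarith [norm_nonneg t, norm_nonneg x, mul_nonneg (norm_nonneg t) (norm_nonneg x)]⟩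
    | e + 2 =>
      obtain ⟨C1, hC1, h1⟩ := ih (e + 1) (by omega)
      obtain ⟨C0, hC0, h0⟩ := ih e (by omega)
      refine ⟨C1 + 2 * (e + 1) * C0, by positivity, fun t x => ?_⟩
      rw [heatMonomial]
      have hT : 1 ≤ 1 + ‖t‖ := by linarith [norm_nonneg t]
      have hX : 1 ≤ 1 + ‖x‖ := by linarith [norm_nonneg x]
      set T := 1 + ‖t‖
      set X := 1 + ‖x‖
      have hx : ‖x‖ ≤ X := by simp [X]
      have ht : ‖t‖ ≤ T := by simp [T]
      calc ‖x * heatMonomial t x (e + 1) - 2 * t * (e + 1) * heatMonomial t x e‖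
          ≤ ‖x‖ * ‖heatMonomial t x (e + 1)‖ + 2 * ‖t‖ * (e + 1) * ‖heatMonomial t x e‖ := by
            refine (norm_sub_le _ _).trans (le_of_eq ?_)
            simp only [norm_mul]
            congr 3
            · simp
            · exact_mod_cast Complex.norm_natCast (e + 1)
        _ ≤ X * (C1 * (T ^ (e + 1) * X ^ (e + 1))) + 2 * T * (e + 1) * (C0 * (T ^ e * X ^ e)) := by
            gcongr
            · exact h1 t x
            · exact h0 t x
        _ = C1 * (T ^ (e + 1) * X ^ (e + 2)) + 2 * (e + 1) * C0 * (T ^ (e + 1) * X ^ e) := by ring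
        _ ≤ C1 * (T ^ (e + 2) * X ^ (e + 2)) + 2 * (e + 1) * C0 * (T ^ (e + 2) * X ^ (e + 2)) := by
            gcongr <;> first | assumption | omega
        _ = _ := by ring

/-! ### Fourier transforms of Hermite functions -/

lemma integrable_heatMonomial_gaussian (t : ℂ) {b : ℂ} (hb : 0 < b.re) (ξ : ℝ) (e : ℕ) :
    Integrable fun x : ℝ => heatMonomial t x e
      * Complex.exp (-b * (x : ℂ) ^ 2 - 2 * Real.pi * Complex.I * ξ * x) := by
  obtain ⟨C, hC, h⟩ := norm_heatMonomial_le e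
  have h1 : Integrable fun x : ℝ => C * (1 + ‖t‖) ^ e * 2 ^ e *
      (Real.exp (-b.re * x ^ 2) + |x| ^ e * Real.exp (-b.re * x ^ 2)) := by
    refine Integrable.const_mul (Integrable.add (integrable_exp_neg_mul_sq hb) ?_) _
    have := (integrable_rpow_mul_exp_neg_mul_sq hb (s := e) (by
      have : (0 : ℝ) ≤ e := Nat.cast_nonneg e
      linarith)).norm
    refine this.congr (Filter.Eventually.of_forall fun x => ?_)
    simp
  refine h1.mono' ?_ (Filter.Eventually.of_forall fun x => ?_)
  · refine Continuous.aestronglyMeasurable ?_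
    have := (continuous_heatMonomial e).comp (f := fun x : ℝ => (t, (x : ℂ))) (by fun_prop)
    refine Continuous.mul this (by fun_prop)
  · rw [norm_mul, Complex.norm_exp]
    have hre : (-b * (x : ℂ) ^ 2 - 2 * Real.pi * Complex.I * ξ * x).re = -b.re * x ^ 2 := by
      simp [← Complex.ofReal_pow]
    rw [hre]
    have h2 := h t x
    have h3 : (1 + ‖(x : ℂ)‖) ^ e ≤ 2 ^ e * (1 + |x| ^ e) := by
      rw [Complex.norm_real, Real.norm_eq_abs]
      have hx := abs_nonneg x
      rcases le_total |x| 1 with h4 | h4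
      · calc (1 + |x|) ^ e ≤ 2 ^ e := by gcongr; linarith
          _ ≤ 2 ^ e * (1 + |x| ^ e) := by
            have : 0 ≤ |x| ^ e := by positivity
            have : (0:ℝ) < 2 ^ e := by positivity
            nlinarith
      · calc (1 + |x|) ^ e ≤ (2 * |x|) ^ e := by gcongr; linarith
          _ ≤ 2 ^ e * (1 + |x| ^ e) := by
            rw [mul_pow]; gcongr; linarith
    calc ‖heatMonomial t x e‖ * Real.exp (-b.re * x ^ 2)
        ≤ C * ((1 + ‖t‖) ^ e * (2 ^ e * (1 + |x| ^ e))) * Real.exp (-b.re * x ^ 2) := by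
          gcongr
          exact h2.trans (by gcongr)
      _ = _ := by ring

/-- The Fourier transform of `exp(-t d²/dx²) x^e` times a Gaussian. The recursion in `e` comes from
integrating the derivative of `exp(-t d²/dx²) x^e` times the Gaussian. -/
theorem integral_heatMonomial_gaussian (t : ℂ) {b : ℂ} (hb : 0 < b.re) (ξ : ℝ) (e : ℕ) :
    ∫ x : ℝ, heatMonomial t x e
      * Complex.exp (-b * (x : ℂ) ^ 2 - 2 * Real.pi * Complex.I * ξ * x)
    = heatMonomial (t - 1 / (4 * b)) (-(Complex.I * Real.pi * ξ) / b) e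
      * ((Real.pi / b) ^ (1 / 2 : ℂ) * Complex.exp (-(Real.pi ^ 2 * ξ ^ 2) / b)) := by
  have hb0 : b ≠ 0 := by rintro rfl; simp at hb
  set G : ℝ → ℂ := fun x => Complex.exp (-b * (x : ℂ) ^ 2 - 2 * Real.pi * Complex.I * ξ * x)
  set J : ℕ → ℂ := fun e => ∫ x : ℝ, heatMonomial t x e * G x with hJ
  have hI := integrable_heatMonomial_gaussian t hb ξ
  have h0 : J 0 = (Real.pi / b) ^ (1 / 2 : ℂ) * Complex.exp (-(Real.pi ^ 2 * ξ ^ 2) / b) := by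
    have := integral_cexp_quadratic (b := -b) (by simpa using hb) (-2 * Real.pi * Complex.I * ξ) 0
    simp only [hJ, heatMonomial_zero, one_mul, G]
    rw [neg_neg] at this
    convert this using 2
    · funext x; ring_nf
    · congr 1
      rw [zero_sub, neg_div, neg_inj]
      rw [div_eq_div_iff hb0 (by simpa using hb0)]
      ring_nf
      rw [Complex.I_sq]; ring
  -- the integral of the derivative of `heatMonomial t x e * G x` vanishes
  have hrec : ∀ e : ℕ, J (e + 1) = -(Complex.I * Real.pi * ξ) / b * J e
      - 2 * (t - 1 / (4 * b)) * e * J (e - 1) := by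
    intro e
    have hx : ∀ x : ℝ, (x : ℂ) * heatMonomial t x e
        = heatMonomial t x (e + 1) + 2 * t * e * heatMonomial t x (e - 1) := fun x => by
      rw [heatMonomial_succ]; ring
    have hder : ∀ x : ℝ, HasDerivAt (fun x : ℝ => heatMonomial t x e * G x)
        ((1 - 4 * b * t) * e * (heatMonomial t x (e - 1) * G x)
          - 2 * b * (heatMonomial t x (e + 1) * G x)
          - 2 * Real.pi * Complex.I * ξ * (heatMonomial t x e * G x)) x := by
      intro x
      have h1 := (hasDerivAt_heatMonomial t x e).comp_ofReal
      have h2 : HasDerivAt G (G x * (-b * (2 * x) - 2 * Real.pi * Complex.I * ξ)) x := by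
        have h3 : HasDerivAt (fun x : ℂ => Complex.exp (-b * x ^ 2 - 2 * Real.pi * Complex.I * ξ * x))
            (G x * (-b * (2 * x) - 2 * Real.pi * Complex.I * ξ)) (x : ℂ) := by
          refine HasDerivAt.cexp ?_
          have := (((hasDerivAt_id' (x : ℂ)).fun_pow 2).const_mul (-b)).fun_sub
            ((hasDerivAt_id' (x : ℂ)).const_mul (2 * Real.pi * Complex.I * ξ))
          simpa using this
        exact h3.comp_ofReal
      refine (h1.mul h2).congr_deriv ?_
      linear_combination (-2 * b * G x) * hx x
    have i1 : Integrable fun x : ℝ => (1 - 4 * b * t) * e * (heatMonomial t x (e - 1) * G x) :=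
      (hI (e - 1)).const_mul ((1 - 4 * b * t) * e)
    have i2 : Integrable fun x : ℝ => 2 * b * (heatMonomial t x (e + 1) * G x) :=
      (hI (e + 1)).const_mul (2 * b)
    have i3 : Integrable fun x : ℝ => 2 * Real.pi * Complex.I * ξ * (heatMonomial t x e * G x) :=
      (hI e).const_mul (2 * Real.pi * Complex.I * ξ)
    have i4 : Integrable fun x : ℝ => (1 - 4 * b * t) * e * (heatMonomial t x (e - 1) * G x)
        - 2 * b * (heatMonomial t x (e + 1) * G x) := i1.sub i2
    have hz := integral_eq_zero_of_hasDerivAt_of_integrable hder (i4.sub i3) (hI e)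
    have e1 : (∫ x : ℝ, ((1 - 4 * b * t) * e * (heatMonomial t x (e - 1) * G x)
          - 2 * b * (heatMonomial t x (e + 1) * G x)
          - 2 * Real.pi * Complex.I * ξ * (heatMonomial t x e * G x)))
        = (1 - 4 * b * t) * e * J (e - 1) - 2 * b * J (e + 1)
          - 2 * Real.pi * Complex.I * ξ * J e := by
      rw [integral_sub i4 i3, integral_sub i1 i2, integral_const_mul, integral_const_mul,
        integral_const_mul]
    rw [e1] at hz
    field_simp
    linear_combination (-2) * hz
  change J e = _
  rw [← h0]
  induction e using Nat.strong_induction_on with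
  | _ e ih =>
    match e with
    | 0 => rw [heatMonomial_zero, one_mul]
    | 1 => rw [hrec 0]; simp [heatMonomial]
    | e + 2 =>
      rw [hrec (e + 1), ih (e + 1) (by omega), Nat.add_sub_cancel, ih e (by omega), heatMonomial]
      push_cast; ring

/-! ### The heat operator on polynomials in several variables -/

section HeatOperator

variable {σ : Type*} [Fintype σ]

/-- The Laplacian as a linear map. -/
def lapLinear (σ : Type*) [Fintype σ] : MvPolynomial σ ℂ →ₗ[ℂ] MvPolynomial σ ℂ :=
  ∑ i, (MvPolynomial.pderiv i).toLinearMap ∘ₗ (MvPolynomial.pderiv i).toLinearMap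

lemma lapLinear_apply (p : MvPolynomial σ ℂ) : lapLinear σ p = lap p := by
  simp [lapLinear, lap]

lemma iterate_lap (j : ℕ) (p : MvPolynomial σ ℂ) : lap^[j] p = (lapLinear σ ^ j) p := by
  rw [Module.End.pow_apply]
  congr 1
  exact funext fun p => (lapLinear_apply p).symm

lemma lap_eq_zero_of_isHomogeneous {p : MvPolynomial σ ℂ} {n : ℕ} (hp : p.IsHomogeneous n)
    (hn : n ≤ 1) : lap p = 0 := by
  refine Finset.sum_eq_zero fun i _ => ?_
  have h1 : (MvPolynomial.pderiv i p).IsHomogeneous 0 := by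
    have := hp.pderiv (i := i)
    rwa [show n - 1 = 0 by omega] at this
  rw [MvPolynomial.totalDegree_eq_zero_iff_eq_C.mp
    (Nat.le_zero.mp h1.totalDegree_le), MvPolynomial.pderiv_C]

lemma isHomogeneous_lap {p : MvPolynomial σ ℂ} {n : ℕ} (hp : p.IsHomogeneous n) :
    (lap p).IsHomogeneous (n - 2) :=
  MvPolynomial.IsHomogeneous.sum _ _ _ fun i _ => by
    have := (hp.pderiv (i := i)).pderiv (i := i)
    rwa [Nat.sub_sub] at this

lemma iterate_lap_eq_zero_of_isHomogeneous (j : ℕ) {p : MvPolynomial σ ℂ} {n : ℕ}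
    (hp : p.IsHomogeneous n) (hn : n < j) : lap^[j] p = 0 := by
  induction j generalizing p n with
  | zero => omega
  | succ j ih =>
    rw [Function.iterate_succ_apply]
    rcases Nat.lt_or_ge n 2 with h | h
    · rw [lap_eq_zero_of_isHomogeneous hp (by omega), iterate_lap, map_zero]
    · exact ih (isHomogeneous_lap hp) (by omega)

lemma iterate_lap_eq_zero {p : MvPolynomial σ ℂ} {M : ℕ} (hM : p.totalDegree < M) :
    lap^[M] p = 0 := by
  rw [iterate_lap, ← MvPolynomial.sum_homogeneousComponent p, map_sum]
  refine Finset.sum_eq_zero fun i hi => ?_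
  rw [← iterate_lap]
  exact iterate_lap_eq_zero_of_isHomogeneous M
    (MvPolynomial.homogeneousComponent_isHomogeneous i p) (by
      have := Finset.mem_range.mp hi; omega)

/-- The value at `x` of `exp(-tΔ) p`, defined by its values on monomials. It is linear in `p`,
defined for all complex `t`, and agrees with `heat y p` for `t = 1/(8πy)`. -/
def heatEval (t : ℂ) (x : σ → ℂ) : MvPolynomial σ ℂ →ₗ[ℂ] ℂ :=
  (MvPolynomial.basisMonomials σ ℂ).constr ℂ fun e => ∏ i, heatMonomial t (x i) (e i)

lemma heatEval_monomial (t : ℂ) (x : σ → ℂ) (e : σ →₀ ℕ) (c : ℂ) :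
    heatEval t x (MvPolynomial.monomial e c) = c * ∏ i, heatMonomial t (x i) (e i) := by
  have h : MvPolynomial.monomial e c = c • MvPolynomial.basisMonomials σ ℂ e := by
    simp [MvPolynomial.smul_monomial]
  rw [h, map_smul, heatEval, Module.Basis.constr_basis, smul_eq_mul]

lemma heatEval_eq_sum (t : ℂ) (x : σ → ℂ) (p : MvPolynomial σ ℂ) :
    heatEval t x p = ∑ e ∈ p.support, p.coeff e * ∏ i, heatMonomial t (x i) (e i) := by
  conv_lhs => rw [p.as_sum, map_sum]
  simp only [heatEval_monomial]

lemma heatEval_zero (x : σ → ℂ) (p : MvPolynomial σ ℂ) :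
    heatEval 0 x p = MvPolynomial.eval x p := by
  rw [heatEval_eq_sum, MvPolynomial.eval_eq']
  simp only [heatMonomial_zero_left]

lemma lap_monomial (e : σ →₀ ℕ) (c : ℂ) :
    lap (MvPolynomial.monomial e c) = ∑ i, MvPolynomial.monomial
      (e - Finsupp.single i 1 - Finsupp.single i 1) (c * (e i * (e i - 1))) := by
  refine Finset.sum_congr rfl fun i _ => ?_
  rw [MvPolynomial.pderiv_monomial, MvPolynomial.pderiv_monomial]
  congr 1
  rcases h : e i with _ | n
  · simp
  · simp [h]; ring

lemma heatEval_lap_monomial [DecidableEq σ] (t : ℂ) (x : σ → ℂ) (e : σ →₀ ℕ) (c : ℂ) :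
    heatEval t x (lap (MvPolynomial.monomial e c)) = c * ∑ i,
      (e i * (e i - 1) * heatMonomial t (x i) (e i - 2))
        * ∏ j ∈ Finset.univ.erase i, heatMonomial t (x j) (e j) := by
  rw [lap_monomial, map_sum, Finset.mul_sum]
  refine Finset.sum_congr rfl fun i _ => ?_
  rw [heatEval_monomial, ← Finset.mul_prod_erase _ _ (Finset.mem_univ i)]
  have h : ∏ j ∈ Finset.univ.erase i,
      heatMonomial t (x j) ((e - Finsupp.single i 1 - Finsupp.single i 1 : σ →₀ ℕ) j)
      = ∏ j ∈ Finset.univ.erase i, heatMonomial t (x j) (e j) :=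
    Finset.prod_congr rfl fun j hj => by
      have : i ≠ j := (Finset.ne_of_mem_erase hj).symm
      simp [this]
  rw [h]
  simp only [Finsupp.coe_tsub, Pi.sub_apply, Finsupp.single_eq_same, Nat.sub_sub]
  ring

lemma hasDerivAt_heatEval (t : ℂ) (x : σ → ℂ) (p : MvPolynomial σ ℂ) :
    HasDerivAt (fun t => heatEval t x p) (-heatEval t x (lap p)) t := by
  classical
  induction p using MvPolynomial.induction_on' with
  | monomial e c =>
    simp only [heatEval_monomial, heatEval_lap_monomial]
    have := HasDerivAt.fun_finsetProd (u := Finset.univ)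
      (fun i _ => hasDerivAt_heatMonomial_left t (x i) (e i))
    refine (this.const_mul c).congr_deriv ?_
    rw [← mul_neg, ← Finset.sum_neg_distrib]
    congr 1
    refine Finset.sum_congr rfl fun i _ => ?_
    rw [smul_eq_mul]; ring
  | add p q hp hq =>
    rw [← lapLinear_apply, map_add]
    simp only [map_add, lapLinear_apply]
    exact (hp.fun_add hq).congr_deriv (by ring)

/-- Both sides have the same value at `t = 0` and, by induction, the same derivative. -/
lemma heatEval_eq_sum_iterate (M : ℕ) (t : ℂ) (x : σ → ℂ) {p : MvPolynomial σ ℂ}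
    (hp : lap^[M] p = 0) :
    heatEval t x p = ∑ j ∈ Finset.range M,
      ((-t) ^ j / (j.factorial : ℂ)) * MvPolynomial.eval x (lap^[j] p) := by
  induction M generalizing p t with
  | zero =>
    rw [Function.iterate_zero, id] at hp
    simp [hp]
  | succ M ih =>
    set F : ℂ → ℂ := fun t => heatEval t x p - ∑ j ∈ Finset.range (M + 1),
      ((-t) ^ j / (j.factorial : ℂ)) * MvPolynomial.eval x (lap^[j] p) with hF
    have hd : ∀ t, HasDerivAt F 0 t := by
      intro t
      have h1 := hasDerivAt_heatEval t x p
      have h2 : HasDerivAt (fun t : ℂ => ∑ j ∈ Finset.range (M + 1),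
          ((-t) ^ j / (j.factorial : ℂ)) * MvPolynomial.eval x (lap^[j] p))
          (∑ j ∈ Finset.range (M + 1),
            ((j * (-t) ^ (j - 1) * (-1)) / (j.factorial : ℂ))
              * MvPolynomial.eval x (lap^[j] p)) t :=
        HasDerivAt.fun_sum fun j _ => (((hasDerivAt_neg t).fun_pow j).div_const _).mul_const _
      refine (h1.fun_sub h2).congr_deriv ?_
      rw [ih t (p := lap p) (by rwa [← Function.iterate_succ_apply]), Finset.sum_range_succ']
      simp only [Function.iterate_succ_apply, Nat.cast_zero, zero_mul, zero_div, add_zero,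
        Nat.add_sub_cancel]
      rw [← Finset.sum_neg_distrib, ← Finset.sum_sub_distrib]
      refine Finset.sum_eq_zero fun j _ => ?_
      have : (j.factorial : ℂ) ≠ 0 := by exact_mod_cast j.factorial_ne_zero
      have : ((j : ℂ) + 1) ≠ 0 := by exact_mod_cast j.succ_ne_zero
      rw [Nat.factorial_succ]
      push_cast
      field_simp
      ring
    have hc := is_const_of_deriv_eq_zero (f := F) (fun t => (hd t).differentiableAt)
      (fun t => (hd t).deriv) t 0
    have h0 : F 0 = 0 := by
      simp only [hF]
      rw [heatEval_zero, Finset.sum_range_succ']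
      simp
    rw [h0] at hc
    exact sub_eq_zero.mp hc

lemma heatEval_of_lap_eq_zero (t : ℂ) (x : σ → ℂ) {p : MvPolynomial σ ℂ} (hp : lap p = 0) :
    heatEval t x p = MvPolynomial.eval x p := by
  rw [heatEval_eq_sum_iterate 1 t x (by simpa using hp)]
  simp

/-- Two linear maps that agree on the monomials of degree `k` agree on the homogeneous polynomials
of degree `k`. -/
lemma linearMap_eq_of_isHomogeneous {W : Type*} [AddCommGroup W] [Module ℂ W] {k : ℕ}
    {A B : MvPolynomial σ ℂ →ₗ[ℂ] W}
    (h : ∀ e : σ →₀ ℕ, ∑ i, e i = k →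
      A (MvPolynomial.monomial e 1) = B (MvPolynomial.monomial e 1))
    {p : MvPolynomial σ ℂ} (hp : p.IsHomogeneous k) : A p = B p := by
  rw [p.as_sum, map_sum, map_sum]
  refine Finset.sum_congr rfl fun e he => ?_
  have h1 : MvPolynomial.monomial e (p.coeff e)
      = p.coeff e • MvPolynomial.monomial e (1 : ℂ) := by simp [MvPolynomial.smul_monomial]
  have h2 : ∑ i, e i = k := by
    rw [← Finsupp.degree_eq_sum]
    by_contra h3
    exact MvPolynomial.mem_support_iff.mp he (hp.coeff_eq_zero h3)
  rw [h1, map_smul, map_smul, h e h2]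

lemma heatEval_smul {k : ℕ} (c t : ℂ) (x : σ → ℂ) {p : MvPolynomial σ ℂ}
    (hp : p.IsHomogeneous k) :
    heatEval (c ^ 2 * t) (fun i => c * x i) p = c ^ k * heatEval t x p := by
  refine linearMap_eq_of_isHomogeneous (A := heatEval (c ^ 2 * t) (fun i => c * x i))
    (B := c ^ k • heatEval t x) (fun e he => ?_) hp
  rw [LinearMap.smul_apply, heatEval_monomial, heatEval_monomial, one_mul, one_mul, smul_eq_mul]
  simp only [heatMonomial_smul]
  rw [Finset.prod_mul_distrib, Finset.prod_pow_eq_pow_sum, he]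

/-- The commutator of `exp(-tΔ)` with multiplication by `∑ x_i²`. -/
lemma heatEval_sum_sq_mul {k : ℕ} (t : ℂ) (x : σ → ℂ) {p : MvPolynomial σ ℂ}
    (hp : p.IsHomogeneous k) :
    heatEval t x ((∑ i, MvPolynomial.X i ^ 2) * p)
      = ((∑ i, x i ^ 2) - t * (4 * k + 2 * Fintype.card σ)) * heatEval t x p
        - 4 * t ^ 2 * heatEval t x (lap p) := by
  classical
  have key := linearMap_eq_of_isHomogeneous
    (A := heatEval t x ∘ₗ LinearMap.mulLeft ℂ (∑ i, MvPolynomial.X i ^ 2))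
    (B := ((∑ i, x i ^ 2) - t * (4 * k + 2 * Fintype.card σ)) • heatEval t x
      - (4 * t ^ 2) • (heatEval t x ∘ₗ lapLinear σ)) (fun e he => ?_) hp
  · simpa [lapLinear_apply] using key
  · simp only [LinearMap.comp_apply, LinearMap.mulLeft_apply, LinearMap.sub_apply,
      LinearMap.smul_apply, lapLinear_apply, smul_eq_mul]
    rw [heatEval_lap_monomial, heatEval_monomial, one_mul, one_mul, Finset.sum_mul, map_sum]
    have h1 : ∀ i : σ, heatEval t x (MvPolynomial.X i ^ 2 * MvPolynomial.monomial e 1)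
        = (x i ^ 2 - 2 * t * (2 * e i + 1)) * ∏ j, heatMonomial t (x j) (e j)
          - 4 * t ^ 2 * ((e i * (e i - 1) * heatMonomial t (x i) (e i - 2))
            * ∏ j ∈ Finset.univ.erase i, heatMonomial t (x j) (e j)) := by
      intro i
      rw [MvPolynomial.X_pow_eq_monomial, MvPolynomial.monomial_mul, heatEval_monomial,
        ← Finset.mul_prod_erase _ _ (Finset.mem_univ i),
        ← Finset.mul_prod_erase Finset.univ (fun j => heatMonomial t (x j) (e j))
          (Finset.mem_univ i)]
      have h : ∏ j ∈ Finset.univ.erase i,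
          heatMonomial t (x j) ((Finsupp.single i 2 + e : σ →₀ ℕ) j)
          = ∏ j ∈ Finset.univ.erase i, heatMonomial t (x j) (e j) :=
        Finset.prod_congr rfl fun j hj => by
          have : i ≠ j := (Finset.ne_of_mem_erase hj).symm
          simp [this]
      rw [h, Finsupp.add_apply, Finsupp.single_eq_same, add_comm 2, heatMonomial_add_two]
      ring
    simp only [h1]
    rw [Finset.sum_sub_distrib, ← Finset.sum_mul, ← Finset.mul_sum]
    congr 2
    have h2 : (k : ℂ) = ∑ i, (e i : ℂ) := by rw [← he]; push_cast; rfl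
    rw [Finset.sum_sub_distrib, h2, ← Finset.mul_sum, Finset.sum_add_distrib, ← Finset.mul_sum]
    simp only [Finset.sum_const, Finset.card_univ, nsmul_eq_mul, mul_one]
    ring

lemma continuous_heatEval (p : MvPolynomial σ ℂ) :
    Continuous fun u : ℂ × (σ → ℂ) => heatEval u.1 u.2 p := by
  simp only [heatEval_eq_sum]
  refine continuous_finsetSum _ fun e _ => continuous_const.mul
    (continuous_finsetProd _ fun i _ => ?_)
  exact (continuous_heatMonomial (e i)).comp
    (f := fun u : ℂ × (σ → ℂ) => (u.1, u.2 i)) (by fun_prop)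

lemma norm_heatEval_le (p : MvPolynomial σ ℂ) : ∃ (C : ℝ) (A : ℕ), 0 ≤ C ∧
    ∀ (t : ℂ) (x : σ → ℂ) (R : ℝ), (∀ i, ‖x i‖ ≤ R) → 0 ≤ R →
      ‖heatEval t x p‖ ≤ C * ((1 + ‖t‖) ^ A * (1 + R) ^ A) := by
  choose Ce hCe hb using fun e : ℕ => norm_heatMonomial_le e
  refine ⟨∑ e ∈ p.support, ‖p.coeff e‖ * ∏ i, Ce (e i), p.totalDegree,
    Finset.sum_nonneg fun e _ => mul_nonneg (norm_nonneg _)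
      (Finset.prod_nonneg fun i _ => hCe _), fun t x R hx hR => ?_⟩
  rw [heatEval_eq_sum, Finset.sum_mul]
  refine (norm_sum_le _ _).trans (Finset.sum_le_sum fun e he => ?_)
  rw [norm_mul, mul_assoc, norm_prod]
  refine mul_le_mul_of_nonneg_left ?_ (norm_nonneg _)
  have hT : 1 ≤ 1 + ‖t‖ := by linarith [norm_nonneg t]
  have hX : 1 ≤ 1 + R := by linarith
  have hdeg : ∑ i, e i ≤ p.totalDegree := by
    have := MvPolynomial.le_totalDegree he
    rwa [Finsupp.sum_fintype _ _ (fun _ => rfl)] at this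
  calc ∏ i, ‖heatMonomial t (x i) (e i)‖
      ≤ ∏ i, (Ce (e i) * ((1 + ‖t‖) ^ e i * (1 + R) ^ e i)) := by
        refine Finset.prod_le_prod (fun _ _ => norm_nonneg _) fun i _ => ?_
        refine (hb (e i) t (x i)).trans ?_
        have := hCe (e i)
        have := hx i
        gcongr
    _ = (∏ i, Ce (e i)) * ((1 + ‖t‖) ^ (∑ i, e i) * (1 + R) ^ (∑ i, e i)) := by
        rw [Finset.prod_mul_distrib, Finset.prod_mul_distrib, Finset.prod_pow_eq_pow_sum,
          Finset.prod_pow_eq_pow_sum]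
    _ ≤ _ := by
        have := Finset.prod_nonneg fun (i : σ) (_ : i ∈ Finset.univ) => hCe (e i)
        gcongr

/-- `exp(-tΔ)` acts on separate variables separately. -/
lemma heatEval_X_pow_mul_rename {n : ℕ} (t : ℂ) (x : Fin (n + 1) → ℂ) (m : ℕ)
    (h : MvPolynomial (Fin n) ℂ) :
    heatEval t x (MvPolynomial.X 0 ^ m * MvPolynomial.rename Fin.succ h)
      = heatMonomial t (x 0) m * heatEval t (fun i => x i.succ) h := by
  induction h using MvPolynomial.induction_on' with
  | monomial e c =>
    rw [MvPolynomial.rename_monomial, MvPolynomial.X_pow_eq_monomial, MvPolynomial.monomial_mul,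
      heatEval_monomial, heatEval_monomial, Fin.prod_univ_succ, one_mul]
    have h0 : (Finsupp.mapDomain Fin.succ e) (0 : Fin (n + 1)) = 0 :=
      Finsupp.mapDomain_of_notMem_range _ _ (by simp)
    have h1 : ∀ i : Fin n, (Finsupp.mapDomain Fin.succ e) i.succ = e i := fun i =>
      Finsupp.mapDomain_apply (Fin.succ_injective n) _ _
    simp only [Finsupp.add_apply, Finsupp.single_eq_same, h0, h1, add_zero]
    have h2 : ∀ i : Fin n, (Finsupp.single (0 : Fin (n + 1)) m) i.succ = 0 := fun i => by
      simp
    simp only [h2, zero_add]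
    ring
  | add p q hp hq => rw [map_add, mul_add, map_add, map_add, hp, hq]; ring

lemma eval_heat_of_le {y : ℝ} (x : σ → ℂ) (p : MvPolynomial σ ℂ) {M : ℕ}
    (hM : p.totalDegree < M) :
    MvPolynomial.eval x (heat y p) = ∑ j ∈ Finset.range M,
      ((-(1 / (8 * Real.pi * y) : ℝ) : ℂ) ^ j / (j.factorial : ℂ))
        * MvPolynomial.eval x (lap^[j] p) := by
  rw [heat, map_sum]
  have h1 : ∑ j ∈ Finset.range M, ((-(1 / (8 * Real.pi * y) : ℝ) : ℂ) ^ j / (j.factorial : ℂ))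
        * MvPolynomial.eval x (lap^[j] p)
      = ∑ j ∈ Finset.range (p.totalDegree + 1),
        ((-(1 / (8 * Real.pi * y) : ℝ) : ℂ) ^ j / (j.factorial : ℂ))
        * MvPolynomial.eval x (lap^[j] p) := by
    refine (Finset.sum_subset (Finset.range_mono hM) fun j _ hj => ?_).symm
    rw [iterate_lap_eq_zero (by simpa using hj), map_zero, mul_zero]
  rw [h1]
  refine Finset.sum_congr rfl fun j _ => ?_
  rw [map_mul, MvPolynomial.eval_C]
  push_cast
  rw [neg_div]

end HeatOperator

/-! ### Polynomials in orthonormal coordinates -/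

section Frame

variable {m r s : ℕ} (c : Fin m → EuclideanSpace ℝ (Fin r))

lemma pderiv_inl_inFrame (h : MvPolynomial (Fin m) ℂ) (j : Fin r) :
    MvPolynomial.pderiv (Sum.inl j) (inFrame (s := s) c h)
      = ∑ i, MvPolynomial.C ((c i j : ℝ) : ℂ) * inFrame c (MvPolynomial.pderiv i h) := by
  induction h using MvPolynomial.induction_on with
  | C a => simp [inFrame]
  | add p q hp hq =>
    simp only [inFrame, map_add, mul_add, Finset.sum_add_distrib] at hp hq ⊢
    rw [hp, hq]
  | mul_X p i hp =>
    simp only [inFrame, map_mul, MvPolynomial.pderiv_mul, MvPolynomial.aeval_X, map_add, mul_add,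
      Finset.sum_add_distrib] at hp ⊢
    rw [hp]
    congr 1
    · rw [Finset.sum_mul]
      exact Finset.sum_congr rfl fun i _ => by ring
    · classical
      rw [map_sum]
      simp only [MvPolynomial.pderiv_C_mul, MvPolynomial.pderiv_X, Pi.single_apply,
        Sum.inl.injEq]
      simp [Finset.sum_ite_eq, mul_comm, eq_comm]

lemma pderiv_inr_inFrame (h : MvPolynomial (Fin m) ℂ) (j : Fin s) :
    MvPolynomial.pderiv (Sum.inr j) (inFrame (r := r) c h) = 0 := by
  induction h using MvPolynomial.induction_on with
  | C a => simp [inFrame]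
  | add p q hp hq =>
    simp only [inFrame, map_add] at hp hq ⊢
    rw [hp, hq, add_zero]
  | mul_X p i hp =>
    classical
    simp only [inFrame, map_mul, MvPolynomial.pderiv_mul, MvPolynomial.aeval_X] at hp ⊢
    rw [hp, zero_mul, zero_add, map_sum]
    simp [MvPolynomial.pderiv_X]

/-- The Laplacian commutes with orthonormal changes of coordinates. -/
lemma lap_inFrame {c : Fin m → EuclideanSpace ℝ (Fin r)} (hc : Orthonormal ℝ c)
    (h : MvPolynomial (Fin m) ℂ) :
    lap (inFrame (s := s) c h) = inFrame c (lap h) := by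
  have hsum : ∀ i i' : Fin m, ∑ j, (c i j) * (c i' j) = if i = i' then 1 else 0 := by
    intro i i'
    have := (orthonormal_iff_ite.mp hc) i i'
    rw [← this, PiLp.inner_apply]
    simp [mul_comm]
  rw [lap, Fintype.sum_sum_type]
  simp only [pderiv_inr_inFrame, map_zero, Finset.sum_const_zero, add_zero, pderiv_inl_inFrame,
    map_sum, MvPolynomial.pderiv_C_mul]
  simp only [Finset.mul_sum, ← mul_assoc, ← MvPolynomial.C_mul]
  rw [Finset.sum_comm]
  have h1 : ∀ i : Fin m, ∑ j : Fin r, ∑ i' : Fin m,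
      MvPolynomial.C (((c i j : ℝ) : ℂ) * ((c i' j : ℝ) : ℂ))
        * inFrame (s := s) c (MvPolynomial.pderiv i' (MvPolynomial.pderiv i h))
      = inFrame c (MvPolynomial.pderiv i (MvPolynomial.pderiv i h)) := by
    intro i
    rw [Finset.sum_comm]
    have h2 : ∀ i' : Fin m, ∑ j : Fin r, MvPolynomial.C (((c i j : ℝ) : ℂ) * ((c i' j : ℝ) : ℂ))
        * inFrame (s := s) c (MvPolynomial.pderiv i' (MvPolynomial.pderiv i h))
        = if i = i' then inFrame (s := s) c (MvPolynomial.pderiv i' (MvPolynomial.pderiv i h))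
          else 0 := by
      intro i'
      rw [← Finset.sum_mul, ← map_sum]
      have h3 : ∑ j, ((c i j : ℝ) : ℂ) * ((c i' j : ℝ) : ℂ) = if i = i' then 1 else 0 := by
        have := congrArg (fun u : ℝ => (u : ℂ)) (hsum i i')
        push_cast at this
        rw [this]
        split_ifs <;> simp
      rw [h3]
      split_ifs <;> simp
    simp only [h2, Finset.sum_ite_eq, Finset.mem_univ, if_true]
  rw [Finset.sum_congr rfl fun i _ => h1 i]
  simp only [lap, inFrame, map_sum]

lemma eval_inFrame (h : MvPolynomial (Fin m) ℂ) (x : Fin r ⊕ Fin s → ℝ) :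
    MvPolynomial.eval (fun i => ((x i : ℝ) : ℂ)) (inFrame c h)
      = MvPolynomial.eval (fun i => ((∑ j, c i j * x (Sum.inl j) : ℝ) : ℂ)) h := by
  induction h using MvPolynomial.induction_on with
  | C a => simp [inFrame]
  | add p q hp hq =>
    simp only [inFrame, map_add] at hp hq ⊢
    rw [hp, hq]
  | mul_X p i hp =>
    simp only [inFrame, map_mul, MvPolynomial.aeval_X, MvPolynomial.eval_X] at hp ⊢
    rw [hp]
    simp

lemma iterate_lap_inFrame {c : Fin m → EuclideanSpace ℝ (Fin r)} (hc : Orthonormal ℝ c)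
    (h : MvPolynomial (Fin m) ℂ) (j : ℕ) :
    lap^[j] (inFrame (s := s) c h) = inFrame c (lap^[j] h) := by
  induction j with
  | zero => rfl
  | succ j ih => rw [Function.iterate_succ_apply', ih, lap_inFrame hc, Function.iterate_succ_apply']

/-- The heat operator commutes with orthonormal changes of coordinates. -/
lemma eval_heat_inFrame {c : Fin m → EuclideanSpace ℝ (Fin r)} (hc : Orthonormal ℝ c)
    (h : MvPolynomial (Fin m) ℂ) (y : ℝ) (x : Fin r ⊕ Fin s → ℝ) :
    MvPolynomial.eval (fun i => ((x i : ℝ) : ℂ)) (heat y (inFrame c h))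
      = heatEval (1 / (8 * Real.pi * y) : ℝ)
        (fun i => ((∑ j, c i j * x (Sum.inl j) : ℝ) : ℂ)) h := by
  set M := max (inFrame (s := s) c h).totalDegree h.totalDegree + 1
  rw [eval_heat_of_le _ _ (Nat.lt_succ_of_le (le_max_left _ h.totalDegree)),
    heatEval_eq_sum_iterate M _ _ (iterate_lap_eq_zero (Nat.lt_succ_of_le (le_max_right _ _)))]
  refine Finset.sum_congr rfl fun j _ => ?_
  rw [iterate_lap_inFrame hc, eval_inFrame]

end Frame

/-! ### The polynomials `h_κ` are harmonic -/

section Harmonic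

lemma lap_mul {σ : Type*} [Fintype σ] (p q : MvPolynomial σ ℂ) :
    lap (p * q) = lap p * q
      + 2 * ∑ i, MvPolynomial.pderiv i p * MvPolynomial.pderiv i q + p * lap q := by
  simp only [lap, MvPolynomial.pderiv_mul, map_add]
  rw [Finset.mul_sum, Finset.sum_mul, Finset.mul_sum, ← Finset.sum_add_distrib,
    ← Finset.sum_add_distrib]
  exact Finset.sum_congr rfl fun i _ => by ring

lemma lap_sum_sq_mul {σ : Type*} [Fintype σ] {p : MvPolynomial σ ℂ} {d : ℕ}
    (hp : p.IsHomogeneous d) :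
    lap ((∑ i, MvPolynomial.X i ^ 2) * p)
      = (∑ i, MvPolynomial.X i ^ 2) * lap p
        + ((4 * d + 2 * Fintype.card σ : ℕ) : MvPolynomial σ ℂ) * p := by
  classical
  have h1 : ∀ i : σ, MvPolynomial.pderiv i (∑ j : σ, (MvPolynomial.X j : MvPolynomial σ ℂ) ^ 2)
      = 2 * MvPolynomial.X i := by
    intro i
    rw [map_sum, Finset.sum_eq_single i]
    · rw [MvPolynomial.pderiv_pow, MvPolynomial.pderiv_X_self]; norm_num
    · intro j _ hj
      rw [MvPolynomial.pderiv_pow, MvPolynomial.pderiv_X_of_ne hj, mul_zero]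
    · simp
  have h2 : lap (∑ j : σ, (MvPolynomial.X j : MvPolynomial σ ℂ) ^ 2) = 2 * Fintype.card σ := by
    have h3 : ∀ i : σ, MvPolynomial.pderiv i (2 * (MvPolynomial.X i : MvPolynomial σ ℂ)) = 2 := by
      intro i
      rw [show (2 : MvPolynomial σ ℂ) = MvPolynomial.C 2 from (map_ofNat _ 2).symm,
        MvPolynomial.pderiv_C_mul, MvPolynomial.pderiv_X_self, mul_one]
    simp only [lap, h1, h3, Finset.sum_const, Finset.card_univ, nsmul_eq_mul]
    ring
  rw [lap_mul, h2]
  simp only [h1]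
  have h3 := hp.sum_X_mul_pderiv
  rw [nsmul_eq_mul] at h3
  have h4 : ∑ i : σ, 2 * MvPolynomial.X i * MvPolynomial.pderiv i p = 2 * (d * p) := by
    rw [← h3, Finset.mul_sum]
    exact Finset.sum_congr rfl fun i _ => by ring
  rw [h4]
  push_cast
  ring

lemma isHomogeneous_sum_sq (σ : Type*) [Fintype σ] :
    (∑ i : σ, (MvPolynomial.X i : MvPolynomial σ ℂ) ^ 2).IsHomogeneous 2 :=
  MvPolynomial.IsHomogeneous.sum _ _ _ fun i _ => MvPolynomial.isHomogeneous_X_pow i 2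

lemma lap_sum_sq_pow_mul {σ : Type*} [Fintype σ] {p : MvPolynomial σ ℂ} {d : ℕ}
    (hp : p.IsHomogeneous d) (j : ℕ) :
    lap ((∑ i, MvPolynomial.X i ^ 2) ^ j * p)
      = (∑ i, MvPolynomial.X i ^ 2) ^ j * lap p
        + MvPolynomial.C (j * (4 * d + 4 * (j - 1) + 2 * Fintype.card σ) : ℂ)
          * ((∑ i, MvPolynomial.X i ^ 2) ^ (j - 1) * p) := by
  induction j with
  | zero => simp
  | succ j ih =>
    have h1 : ((∑ i : σ, (MvPolynomial.X i : MvPolynomial σ ℂ) ^ 2) ^ j * p).IsHomogeneous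
        (2 * j + d) := ((isHomogeneous_sum_sq σ).pow j).mul hp
    rw [pow_succ', mul_assoc, lap_sum_sq_mul h1, ih]
    rcases j with _ | j
    · simp only [MvPolynomial.C_add, MvPolynomial.C_mul, MvPolynomial.C_sub, map_natCast,
        map_ofNat, MvPolynomial.C_1]
      push_cast
      simp
    · simp only [Nat.add_sub_cancel, MvPolynomial.C_add, MvPolynomial.C_mul, MvPolynomial.C_sub,
        map_natCast, map_ofNat, MvPolynomial.C_1]
      push_cast
      ring

/-- The coefficient of `(2X)^{m-2j} Y^j` in the homogenized Gegenbauer polynomial. -/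
def gegenbauerCoeff (α : ℝ) (m j : ℕ) : ℂ :=
  (((-1) ^ j * Real.Gamma (α + m - j)
    / (j.factorial * (m - 2 * j).factorial * Real.Gamma α) : ℝ) : ℂ)

/-- The recursion of the coefficients, which expresses Gegenbauer's differential equation. -/
lemma gegenbauerCoeff_succ {α : ℝ} (hα : 0 < α) {m j : ℕ} (hj : 2 * (j + 1) ≤ m) :
    gegenbauerCoeff α m (j + 1) * ((j + 1) * (α + m - j - 1))
      = -gegenbauerCoeff α m j * ((m - 2 * j : ℕ) * ((m - 2 * j : ℕ) - 1)) := by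
  obtain ⟨i, rfl⟩ := Nat.exists_eq_add_of_le hj
  have e1 : 2 * (j + 1) + i - 2 * (j + 1) = i := by omega
  have e2 : 2 * (j + 1) + i - 2 * j = i + 2 := by omega
  rw [gegenbauerCoeff, gegenbauerCoeff, e1, e2]
  have hpos : (0 : ℝ) < α + (2 * (j + 1) + i : ℕ) - j - 1 := by
    push_cast
    have : (0 : ℝ) ≤ j := Nat.cast_nonneg j
    have : (0 : ℝ) ≤ i := Nat.cast_nonneg i
    linarith
  have hG : Real.Gamma (α + (2 * (j + 1) + i : ℕ) - j)
      = (α + (2 * (j + 1) + i : ℕ) - j - 1) * Real.Gamma (α + (2 * (j + 1) + i : ℕ) - j - 1) := by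
    rw [← Real.Gamma_add_one hpos.ne']; ring_nf
  have hα' := (Real.Gamma_pos_of_pos hα).ne'
  have e3 : α + ((2 * (j + 1) + i : ℕ) : ℝ) - ((j + 1 : ℕ) : ℝ)
      = α + (2 * (j + 1) + i : ℕ) - j - 1 := by push_cast; ring
  rw [hG, e3]
  have key : ((-1) ^ (j + 1) * Real.Gamma (α + (2 * (j + 1) + i : ℕ) - j - 1)
      / ((j + 1).factorial * i.factorial * Real.Gamma α)) *
        ((j + 1) * (α + (2 * (j + 1) + i : ℕ) - j - 1))
      = -((-1) ^ j * ((α + (2 * (j + 1) + i : ℕ) - j - 1)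
          * Real.Gamma (α + (2 * (j + 1) + i : ℕ) - j - 1))
      / (j.factorial * (i + 2).factorial * Real.Gamma α)) * ((i + 2 : ℕ) * ((i + 2 : ℕ) - 1)) := by
    rw [Nat.factorial_succ j, Nat.factorial_succ (i + 1), Nat.factorial_succ i]
    have h1 : (j.factorial : ℝ) ≠ 0 := by exact_mod_cast j.factorial_ne_zero
    have h2 : (i.factorial : ℝ) ≠ 0 := by exact_mod_cast i.factorial_ne_zero
    have h3 : (j : ℝ) + 1 ≠ 0 := by positivity
    have h4 : (i : ℝ) + 1 ≠ 0 := by positivity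
    have h5 : (i : ℝ) + 1 + 1 ≠ 0 := by positivity
    push_cast
    field_simp
    ring
  have := congrArg (fun u : ℝ => (u : ℂ)) key
  push_cast at this ⊢
  exact this

lemma gegenbauerHom_eq {R : Type*} [CommRing R] [Algebra ℂ R] (α : ℝ) (m : ℕ) (X Y : R) :
    gegenbauerHom α m X Y = ∑ j ∈ Finset.range (m / 2 + 1),
      algebraMap ℂ R (gegenbauerCoeff α m j * 2 ^ (m - 2 * j)) * (X ^ (m - 2 * j) * Y ^ j) := by
  refine Finset.sum_congr rfl fun j _ => ?_
  rw [gegenbauerCoeff, map_mul, mul_pow, map_pow, map_ofNat]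
  ring

lemma map_gegenbauerHom {R R' : Type*} [CommRing R] [Algebra ℂ R] [CommRing R'] [Algebra ℂ R']
    (φ : R →ₐ[ℂ] R') (α : ℝ) (m : ℕ) (X Y : R) :
    φ (gegenbauerHom α m X Y) = gegenbauerHom α m (φ X) (φ Y) := by
  simp [gegenbauerHom_eq]

lemma isHomogeneous_gegenbauerHom {σ : Type*} (α : ℝ) (m : ℕ) {X Y : MvPolynomial σ ℂ}
    (hX : X.IsHomogeneous 1) (hY : Y.IsHomogeneous 2) :
    (gegenbauerHom α m X Y).IsHomogeneous m := by
  rw [gegenbauerHom_eq]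
  refine MvPolynomial.IsHomogeneous.sum _ _ _ fun j hj => ?_
  have h := ((hX.pow (m - 2 * j)).mul (hY.pow j)).C_mul
    (gegenbauerCoeff α m j * 2 ^ (m - 2 * j))
  have : 1 * (m - 2 * j) + 2 * j = m := by
    have := Finset.mem_range.mp hj; omega
  rwa [this] at h

lemma harmonicPoly_succ (N : ℕ) (κ : Fin (N + 2) → ℕ) (ε : ℤˣ) :
    harmonicPoly (N + 1) κ ε
      = gegenbauerHom ((κ 1 : ℝ) + ((N : ℝ) + 1) / 2) (κ 0 - κ 1) (MvPolynomial.X 0)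
          (∑ i, MvPolynomial.X i ^ 2)
        * MvPolynomial.rename Fin.succ (harmonicPoly N (Fin.tail κ) ε) := by
  rw [harmonicPoly, harmonicPoly, Fin.prod_univ_succ]
  simp only [map_prod, map_gegenbauerHom, map_pow, map_add, map_mul, map_sum, MvPolynomial.rename_X,
    MvPolynomial.rename_C]
  have h0 : Finset.Ici (0 : Fin (N + 3)) = Finset.univ := by
    ext i; simp
  have h1 : ∀ (j : Fin (N + 2)), ∑ i ∈ Finset.Ici j.succ,
      (MvPolynomial.X i : MvPolynomial (Fin (N + 3)) ℂ) ^ 2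
      = ∑ i ∈ Finset.Ici j, (MvPolynomial.X i.succ) ^ 2 := by
    intro j
    rw [← Fin.map_succEmb_Ici, Finset.sum_map]
    simp
  simp only [Fin.castSucc_zero, h0, Fin.succ_zero_eq_one, ← Fin.succ_castSucc, h1, Fin.tail,
    Fin.succ_last]
  have h2 : ∀ j : Fin N, ((N + 1 : ℕ) : ℝ) - ((j.succ : Fin (N + 1)) : ℕ) = (N : ℝ) - (j : ℕ) := by
    intro j; push_cast [Fin.val_succ]; ring
  simp only [h2, Fin.val_zero,
    show (Fin.last N).castSucc.succ = (Fin.last (N + 1)).castSucc from rfl]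
  push_cast
  ring_nf

lemma isHomogeneous_harmonicPoly (N : ℕ) (κ : Fin (N + 1) → ℕ) (hκ : Antitone κ) (ε : ℤˣ) :
    (harmonicPoly N κ ε).IsHomogeneous (κ 0) := by
  induction N with
  | zero =>
    have h : ((MvPolynomial.X (Fin.last 0).castSucc
        + MvPolynomial.C (((ε : ℤ) : ℂ) * Complex.I) * MvPolynomial.X (Fin.last (0 + 1)) :
          MvPolynomial (Fin 2) ℂ)).IsHomogeneous 1 :=
      (MvPolynomial.isHomogeneous_X _ _).add ((MvPolynomial.isHomogeneous_X _ _).C_mul _)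
    simpa [harmonicPoly] using h.pow (κ 0)
  | succ N ih =>
    rw [harmonicPoly_succ]
    have h1 : (κ 0 - κ 1) + κ 1 = κ 0 := Nat.sub_add_cancel (hκ (Fin.zero_le 1))
    rw [← h1, h1]
    have := (isHomogeneous_gegenbauerHom ((κ 1 : ℝ) + ((N : ℝ) + 1) / 2) (κ 0 - κ 1)
      (MvPolynomial.isHomogeneous_X ℂ (0 : Fin (N + 3)))
      (isHomogeneous_sum_sq _)).mul
        ((ih (Fin.tail κ) (fun i j hij => hκ (Fin.succ_le_succ_iff.mpr hij))).rename_isHomogeneous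
          (f := Fin.succ))
    rwa [show Fin.tail κ 0 = κ 1 from rfl, h1] at this

lemma lap_rename_succ {n : ℕ} (h : MvPolynomial (Fin n) ℂ) :
    lap (MvPolynomial.rename Fin.succ h) = MvPolynomial.rename Fin.succ (lap h) := by
  have h0 : MvPolynomial.pderiv (0 : Fin (n + 1)) (MvPolynomial.rename Fin.succ h) = 0 := by
    refine MvPolynomial.pderiv_eq_zero_of_notMem_vars fun hv => ?_
    obtain ⟨i, _, hi⟩ := Finset.mem_image.mp (MvPolynomial.vars_rename _ _ hv)
    exact Fin.succ_ne_zero i hi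
  rw [lap, Fin.sum_univ_succ, h0, map_zero, zero_add, lap, map_sum]
  refine Finset.sum_congr rfl fun i _ => ?_
  rw [MvPolynomial.pderiv_rename (Fin.succ_injective n),
    MvPolynomial.pderiv_rename (Fin.succ_injective n)]

lemma lap_X_zero_pow_mul_rename {n : ℕ} (a : ℕ) {h : MvPolynomial (Fin n) ℂ} (hh : lap h = 0) :
    lap (MvPolynomial.X 0 ^ a * MvPolynomial.rename Fin.succ h)
      = MvPolynomial.C (a * (a - 1) : ℂ)
        * (MvPolynomial.X 0 ^ (a - 2) * MvPolynomial.rename Fin.succ h) := by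
  have h0 : MvPolynomial.pderiv (0 : Fin (n + 1)) (MvPolynomial.rename Fin.succ h) = 0 := by
    refine MvPolynomial.pderiv_eq_zero_of_notMem_vars fun hv => ?_
    obtain ⟨i, _, hi⟩ := Finset.mem_image.mp (MvPolynomial.vars_rename _ _ hv)
    exact Fin.succ_ne_zero i hi
  have h1 : ∀ i : Fin n, MvPolynomial.pderiv i.succ
      ((MvPolynomial.X 0 : MvPolynomial (Fin (n + 1)) ℂ) ^ a) = 0 := fun i => by
    rw [MvPolynomial.pderiv_pow, MvPolynomial.pderiv_X_of_ne (Fin.succ_ne_zero i).symm, mul_zero]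
  rw [lap_mul, lap_rename_succ, hh, map_zero, mul_zero, add_zero, Fin.sum_univ_succ, h0, mul_zero,
    zero_add]
  simp only [h1, zero_mul, Finset.sum_const_zero, mul_zero, add_zero]
  rw [← mul_assoc]
  congr 1
  rw [lap, Fin.sum_univ_succ]
  simp only [h1, map_zero, Finset.sum_const_zero, add_zero]
  rw [MvPolynomial.pderiv_pow, MvPolynomial.pderiv_X_self, mul_one, MvPolynomial.pderiv_mul,
    MvPolynomial.pderiv_pow, MvPolynomial.pderiv_X_self, Nat.sub_sub]
  rcases a with _ | a
  · simp
  · rw [← map_natCast (MvPolynomial.C (σ := Fin (n + 1))) (a + 1), MvPolynomial.pderiv_C]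
    simp [MvPolynomial.C_mul]
    ring

lemma lap_C_mul {σ : Type*} [Fintype σ] (c : ℂ) (p : MvPolynomial σ ℂ) :
    lap (MvPolynomial.C c * p) = MvPolynomial.C c * lap p := by
  simp only [← lapLinear_apply, ← MvPolynomial.smul_eq_C_mul, map_smul]

/-- A harmonic polynomial in `n` variables times a Gegenbauer polynomial is harmonic in `n + 1`
variables: the contributions of neighbouring powers of `∑ x_i²` to the Laplacian cancel. -/
lemma lap_gegenbauerHom_mul {n k₁ : ℕ} (m : ℕ) {α : ℝ} (hα : 0 < α)
    (hn : 2 * α = 2 * k₁ + n - 1)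
    {h : MvPolynomial (Fin n) ℂ} (hh : lap h = 0) (hk : h.IsHomogeneous k₁) :
    lap (gegenbauerHom α m (MvPolynomial.X 0) (∑ i, MvPolynomial.X i ^ 2)
      * MvPolynomial.rename Fin.succ h) = 0 := by
  set Y : MvPolynomial (Fin (n + 1)) ℂ := ∑ i, MvPolynomial.X i ^ 2 with hY
  set u : MvPolynomial (Fin (n + 1)) ℂ := MvPolynomial.rename Fin.succ h
  have hn' : (2 * α : ℂ) = 2 * k₁ + n - 1 := by exact_mod_cast congrArg (fun u : ℝ => (u : ℂ)) hn
  rw [gegenbauerHom_eq, Finset.sum_mul, ← lapLinear_apply, map_sum]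
  set c : ℕ → ℂ := fun j => gegenbauerCoeff α m j * 2 ^ (m - 2 * j) with hc
  set A : ℕ → MvPolynomial (Fin (n + 1)) ℂ := fun j =>
    MvPolynomial.C (c j * ((m - 2 * j : ℕ) * ((m - 2 * j : ℕ) - 1)))
      * (MvPolynomial.X 0 ^ (m - 2 * (j + 1)) * Y ^ j * u) with hA
  set B : ℕ → MvPolynomial (Fin (n + 1)) ℂ := fun j =>
    MvPolynomial.C (c j * (j * (4 * (m - 2 * j + k₁ : ℕ) + 4 * (j - 1) + 2 * (n + 1))))
      * (MvPolynomial.X 0 ^ (m - 2 * j) * Y ^ (j - 1) * u) with hB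
  have hterm : ∀ j ∈ Finset.range (m / 2 + 1), lapLinear _
      (algebraMap ℂ (MvPolynomial (Fin (n + 1)) ℂ) (gegenbauerCoeff α m j * 2 ^ (m - 2 * j))
        * (MvPolynomial.X 0 ^ (m - 2 * j) * Y ^ j) * u) = A j + B j := by
    intro j hj
    have h1 : (MvPolynomial.X 0 ^ (m - 2 * j) * u).IsHomogeneous (m - 2 * j + k₁) :=
      (MvPolynomial.isHomogeneous_X_pow _ _).mul (hk.rename_isHomogeneous)
    have h2 := lap_sum_sq_pow_mul h1 j
    rw [lap_X_zero_pow_mul_rename _ hh, Fintype.card_fin] at h2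
    rw [lapLinear_apply, MvPolynomial.algebraMap_eq, mul_assoc, lap_C_mul,
      show (MvPolynomial.X 0 ^ (m - 2 * j) * Y ^ j) * u = Y ^ j * (MvPolynomial.X 0 ^ (m - 2 * j) * u)
        by ring, h2]
    simp only [hA, hB, hc, show m - 2 * (j + 1) = m - 2 * j - 2 by omega, MvPolynomial.C_mul]
    push_cast
    ring
  rw [Finset.sum_congr rfl hterm, Finset.sum_add_distrib, Finset.sum_range_succ,
    Finset.sum_range_succ' B]
  have hlast : A (m / 2) = 0 := by
    have : m - 2 * (m / 2) = 0 ∨ m - 2 * (m / 2) = 1 := by omega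
    rcases this with h1 | h1 <;> simp [hA, h1]
  have hfirst : B 0 = 0 := by simp [hB]
  rw [hlast, hfirst, add_zero, add_zero, ← Finset.sum_add_distrib]
  refine Finset.sum_eq_zero fun j hj => ?_
  have hj' : 2 * (j + 1) ≤ m := by have := Finset.mem_range.mp hj; omega
  have h3 := gegenbauerCoeff_succ hα hj'
  have h4 : c (j + 1) * (((j + 1 : ℕ) : ℂ) * (4 * (m - 2 * (j + 1) + k₁ : ℕ)
      + 4 * (((j + 1 : ℕ) : ℂ) - 1) + 2 * (n + 1)))
      = -(c j * ((m - 2 * j : ℕ) * ((m - 2 * j : ℕ) - 1))) := by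
    have h5 : (2 : ℂ) ^ (m - 2 * j) = 2 ^ (m - 2 * (j + 1)) * 4 := by
      rw [show m - 2 * j = m - 2 * (j + 1) + 2 by omega, pow_add]; norm_num
    simp only [hc, h5]
    have h6 : (4 * (m - 2 * (j + 1) + k₁ : ℕ) + 4 * (((j + 1 : ℕ) : ℂ) - 1) + 2 * (n + 1))
        = 4 * (α + m - j - 1) := by
      push_cast [Nat.cast_sub hj']
      linear_combination (-2) * hn'
    rw [h6]
    push_cast
    linear_combination (4 * 2 ^ (m - 2 * (j + 1))) * h3
  simp only [hA, hB, Nat.add_sub_cancel]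
  rw [h4, MvPolynomial.C_neg]
  ring

lemma lap_harmonicPoly (N : ℕ) (κ : Fin (N + 1) → ℕ) (hκ : Antitone κ) (ε : ℤˣ) :
    lap (harmonicPoly N κ ε) = 0 := by
  induction N with
  | zero =>
    have hI : (((ε : ℤ) : ℂ) * Complex.I) * (((ε : ℤ) : ℂ) * Complex.I) = -1 := by
      rcases Int.units_eq_one_or ε with h | h <;> simp [h]
    have hC : MvPolynomial.C (σ := Fin 2) (((ε : ℤ) : ℂ) * Complex.I)
        * MvPolynomial.C (((ε : ℤ) : ℂ) * Complex.I) = -1 := by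
      rw [← MvPolynomial.C_mul, hI]; simp
    have e : harmonicPoly 0 κ ε = (MvPolynomial.X 0
      + MvPolynomial.C (((ε : ℤ) : ℂ) * Complex.I) * MvPolynomial.X 1) ^ κ 0 := by
      simp [harmonicPoly]
    rw [e, lap, Fin.sum_univ_two]
    have h01 : MvPolynomial.pderiv (0 : Fin 2) (MvPolynomial.X (R := ℂ) 1) = 0 :=
      MvPolynomial.pderiv_X_of_ne (by decide)
    have h10 : MvPolynomial.pderiv (1 : Fin 2) (MvPolynomial.X (R := ℂ) 0) = 0 :=
      MvPolynomial.pderiv_X_of_ne (by decide)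
    set w := MvPolynomial.C (σ := Fin 2) (((ε : ℤ) : ℂ) * Complex.I) with hw
    have hn : ∀ (i : Fin 2) (n : ℕ), MvPolynomial.pderiv i ((n : MvPolynomial (Fin 2) ℂ)) = 0 :=
      fun i n => by rw [← map_natCast (MvPolynomial.C (σ := Fin 2)), MvPolynomial.pderiv_C]
    have hw0 : ∀ i : Fin 2, MvPolynomial.pderiv i w = 0 := fun i => MvPolynomial.pderiv_C
    simp only [MvPolynomial.pderiv_pow, MvPolynomial.pderiv_mul, map_add, h01, h10, hn, hw0,
      MvPolynomial.pderiv_X_self, MvPolynomial.pderiv_one, map_zero]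
    linear_combination ((κ 0 : MvPolynomial (Fin 2) ℂ) * ((κ 0 - 1 : ℕ) : MvPolynomial (Fin 2) ℂ)
      * (MvPolynomial.X 0 + w * MvPolynomial.X 1) ^ (κ 0 - 1 - 1)) * hC
  | succ N ih =>
    have ht : Antitone (Fin.tail κ) := fun i j hij => hκ (Fin.succ_le_succ_iff.mpr hij)
    rw [harmonicPoly_succ]
    refine lap_gegenbauerHom_mul (k₁ := κ 1) _ (by positivity) ?_ (ih _ ht)
      (isHomogeneous_harmonicPoly N _ ht ε)
    push_cast; ring

/-- Up to a multiple of `∑ x_i²`, the polynomial `h_κ` is a multiple of `x_1^{k-k_1} h_{κ^{(1)}}`.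
-/
lemma harmonicPoly_succ_eq (N : ℕ) (κ : Fin (N + 2) → ℕ) (hκ : Antitone κ) (ε : ℤˣ) :
    ∃ p : MvPolynomial (Fin (N + 3)) ℂ, p.IsHomogeneous (κ 0 - 2) ∧ (κ 0 < 2 → p = 0) ∧
      harmonicPoly (N + 1) κ ε
        = MvPolynomial.C (gegenbauerCoeff ((κ 1 : ℝ) + ((N : ℝ) + 1) / 2) (κ 0 - κ 1) 0
            * 2 ^ (κ 0 - κ 1))
          * (MvPolynomial.X 0 ^ (κ 0 - κ 1)
            * MvPolynomial.rename Fin.succ (harmonicPoly N (Fin.tail κ) ε))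
          + (∑ i, MvPolynomial.X i ^ 2) * p := by
  have ht : Antitone (Fin.tail κ) := fun i j hij => hκ (Fin.succ_le_succ_iff.mpr hij)
  set α := (κ 1 : ℝ) + ((N : ℝ) + 1) / 2
  set m := κ 0 - κ 1 with hm
  set Y : MvPolynomial (Fin (N + 3)) ℂ := ∑ i, MvPolynomial.X i ^ 2
  set u := MvPolynomial.rename Fin.succ (harmonicPoly N (Fin.tail κ) ε)
  have hu : u.IsHomogeneous (κ 1) :=
    (isHomogeneous_harmonicPoly N _ ht ε).rename_isHomogeneous
  have h10 : κ 1 ≤ κ 0 := hκ (Fin.zero_le 1)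
  refine ⟨∑ j ∈ Finset.range (m / 2), MvPolynomial.C
    (gegenbauerCoeff α m (j + 1) * 2 ^ (m - 2 * (j + 1)))
    * (MvPolynomial.X 0 ^ (m - 2 * (j + 1)) * Y ^ j) * u, ?_, fun h => ?_, ?_⟩
  · refine MvPolynomial.IsHomogeneous.sum _ _ _ fun j hj => ?_
    have h1 := ((((MvPolynomial.isHomogeneous_X_pow (R := ℂ) (0 : Fin (N + 3))
      (m - 2 * (j + 1))).mul ((isHomogeneous_sum_sq (Fin (N + 3))).pow j)).C_mul
        (gegenbauerCoeff α m (j + 1) * 2 ^ (m - 2 * (j + 1)))).mul hu)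
    have : m - 2 * (j + 1) + 2 * j + κ 1 = κ 0 - 2 := by
      have := Finset.mem_range.mp hj; omega
    rwa [this] at h1
  · rw [show m / 2 = 0 by omega]; simp
  · rw [harmonicPoly_succ, gegenbauerHom_eq, Finset.sum_range_succ', add_mul,
      Finset.sum_mul, Finset.mul_sum]
    refine (add_comm _ _).trans (congrArg₂ (· + ·) ?_ ?_)
    · simp only [MvPolynomial.algebraMap_eq, mul_zero, Nat.sub_zero, pow_zero, mul_one]
      ring
    · refine Finset.sum_congr rfl fun j _ => ?_
      rw [MvPolynomial.algebraMap_eq]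
      ring

end Harmonic

/-! ### Unfolding over the standard fundamental domain -/

section Unfolding

open scoped ENNReal

/-- The strip `0 ≤ Re τ < 1`, a fundamental domain of `⟨T⟩`. -/
def strip : Set ℍ := {τ | 0 ≤ τ.re ∧ τ.re < 1}

lemma measurableSet_strip : MeasurableSet strip := by
  have h : Measurable (fun τ : ℍ => τ.re) := UpperHalfPlane.continuous_re.measurable
  exact (measurableSet_le measurable_const h).inter (measurableSet_lt h measurable_const)

instance countable_SL : Countable SL(2, ℤ) :=
  Function.Injective.countable (f := fun γ : SL(2, ℤ) => fun i j => γ.1 i j) fun _ _ h =>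
    Subtype.ext h

lemma volume_fd_diff_fdo : volume (ModularGroup.fd \ ModularGroup.fdo : Set ℍ) = 0 := by
  rw [volume_eq_lintegral]
  refine setLIntegral_measure_zero _ _ ?_
  have hline : ∀ c : ℝ, volume {z : ℂ | z.re = c} = 0 := by
    intro c
    have : {z : ℂ | z.re = c} = Complex.measurableEquivRealProd ⁻¹' ({c} ×ˢ Set.univ) := by
      ext z; simp [Complex.measurableEquivRealProd]
    rw [this, Complex.volume_preserving_equiv_real_prod.measure_preimage
      ((measurableSet_singleton c).prod MeasurableSet.univ).nullMeasurableSet,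
      Measure.volume_eq_prod, Measure.prod_prod]
    simp
  refine measure_mono_null (t := Metric.sphere (0 : ℂ) 1 ∪ ({z : ℂ | z.re = 1 / 2}
    ∪ {z : ℂ | z.re = -(1 / 2)})) ?_ ?_
  · rintro _ ⟨τ, ⟨h1, h2⟩, rfl⟩
    by_contra hcon
    simp only [Set.mem_union, mem_sphere_zero_iff_norm, Set.mem_ofPred_eq, not_or] at hcon
    refine h2 ⟨lt_of_le_of_ne h1.1 fun h => hcon.1 ?_, lt_of_le_of_ne h1.2 fun h => ?_⟩
    · rw [Complex.normSq_eq_norm_sq] at h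
      nlinarith [norm_nonneg (τ : ℂ)]
    · rcases (abs_eq (by norm_num)).mp h with h | h
      · exact hcon.2.1 h
      · exact hcon.2.2 h
  · rw [measure_union_null_iff, measure_union_null_iff]
    exact ⟨Measure.addHaar_sphere _ _ _, hline _, hline _⟩

lemma measurePreserving_smul_SL (γ : SL(2, ℤ)) :
    MeasurePreserving (fun τ : ℍ => γ • τ) volume volume :=
  measurePreserving_smul (γ : GL (Fin 2) ℝ) (volume : Measure ℍ)

lemma measurable_smul_SL (γ : SL(2, ℤ)) : Measurable fun τ : ℍ => γ • τ :=
  (measurePreserving_smul_SL γ).measurable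

lemma ae_exists_smul_mem_fdo : ∀ᵐ τ : ℍ, ∃ γ : SL(2, ℤ), γ • τ ∈ ModularGroup.fdo := by
  have h : ∀ᵐ τ : ℍ, ∀ γ : SL(2, ℤ), γ • τ ∉ (ModularGroup.fd \ ModularGroup.fdo : Set ℍ) := by
    rw [ae_all_iff]
    intro γ
    have h0 := (measurePreserving_smul_SL γ).quasiMeasurePreserving.preimage_null
      volume_fd_diff_fdo
    exact measure_eq_zero_iff_ae_notMem.mp h0
  filter_upwards [h] with τ hτ
  obtain ⟨γ, hγ⟩ := ModularGroup.exists_smul_mem_fd τ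
  exact ⟨γ, by_contra fun h' => hτ γ ⟨hγ, h'⟩⟩

/-- Almost every point has exactly two translates `±γ • τ` in the fundamental domain. -/
lemma ae_tsum_indicator_fd : ∀ᵐ τ : ℍ,
    ∑' γ : SL(2, ℤ), ModularGroup.fd.indicator (fun _ => (1 : ℝ≥0∞)) (γ • τ) = 2 := by
  filter_upwards [ae_exists_smul_mem_fdo] with τ ⟨γ₀, h₀⟩
  have hne : γ₀ ≠ -γ₀ := by
    intro h
    have h1 : (2 : ℤ) * γ₀ 0 0 = 0 ∧ (2 : ℤ) * γ₀ 0 1 = 0 := by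
      constructor
      · have := congrArg (fun g : SL(2, ℤ) => g 0 0) h
        simp at this; omega
      · have := congrArg (fun g : SL(2, ℤ) => g 0 1) h
        simp at this; omega
    have hdet := Matrix.det_fin_two (γ₀ : Matrix (Fin 2) (Fin 2) ℤ)
    rw [γ₀.det_coe] at hdet
    have h00 : γ₀ 0 0 = 0 := by omega
    have h01 : γ₀ 0 1 = 0 := by omega
    rw [h00, h01] at hdet
    simp at hdet
  have hmem : ∀ γ : SL(2, ℤ), γ • τ ∈ (ModularGroup.fd : Set ℍ) ↔ γ = γ₀ ∨ γ = -γ₀ := by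
    intro γ
    constructor
    · intro h
      have h1 : (γ * γ₀⁻¹) • (γ₀ • τ) ∈ (ModularGroup.fd : Set ℍ) := by
        rwa [← mul_smul, inv_mul_cancel_right]
      rcases ModularGroup.eq_one_or_neg_one_of_mem_fdo_mem_fd h₀ h1 with h2 | h2
      · left; exact mul_inv_eq_one.mp h2
      · right
        rw [mul_inv_eq_iff_eq_mul] at h2
        rw [h2, neg_one_mul]
    · rintro (rfl | rfl)
      · exact ModularGroup.fdo_subset_fd h₀
      · rw [ModularGroup.SL_neg_smul]; exact ModularGroup.fdo_subset_fd h₀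
  rw [tsum_eq_sum (s := {γ₀, -γ₀}) (fun γ hγ => by
    simp only [Finset.mem_insert, Finset.mem_singleton] at hγ
    exact Set.indicator_of_notMem (fun h => hγ ((hmem γ).mp h)) _), Finset.sum_pair hne,
    Set.indicator_of_mem ((hmem _).mpr (Or.inl rfl)),
    Set.indicator_of_mem ((hmem _).mpr (Or.inr rfl))]
  norm_num

lemma measurableSet_fd : MeasurableSet (ModularGroup.fd : Set ℍ) :=
  ModularGroup.isClosed_fd.measurableSet

lemma tsum_lintegral_fd {G : ℍ → ℝ≥0∞} (hG : Measurable G) :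
    ∑' γ : SL(2, ℤ), ∫⁻ τ in ModularGroup.fd, G (γ • τ) = 2 * ∫⁻ τ, G τ := by
  have hm : ∀ γ : SL(2, ℤ), Measurable fun τ : ℍ =>
      ModularGroup.fd.indicator (fun _ => (1 : ℝ≥0∞)) (γ⁻¹ • τ) * G τ := fun γ =>
    ((measurable_const.indicator measurableSet_fd).comp (measurable_smul_SL γ⁻¹)).mul hG
  have h1 : ∀ γ : SL(2, ℤ), ∫⁻ τ in ModularGroup.fd, G (γ • τ)
      = ∫⁻ τ, ModularGroup.fd.indicator (fun _ => (1 : ℝ≥0∞)) (γ⁻¹ • τ) * G τ := by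
    intro γ
    rw [← lintegral_indicator measurableSet_fd,
      ← (measurePreserving_smul_SL γ).lintegral_comp (hm γ)]
    refine lintegral_congr fun τ => ?_
    simp only [inv_smul_smul]
    by_cases h : τ ∈ (ModularGroup.fd : Set ℍ) <;> simp [h]
  simp only [h1]
  rw [← lintegral_tsum fun γ => (hm γ).aemeasurable, ← lintegral_const_mul _ hG]
  refine lintegral_congr_ae ?_
  filter_upwards [ae_tsum_indicator_fd] with τ hτ
  rw [ENNReal.tsum_mul_right, ← hτ]
  congr 1
  exact (Equiv.inv SL(2, ℤ)).tsum_eq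
    (fun γ => ModularGroup.fd.indicator (fun _ => (1 : ℝ≥0∞)) (γ • τ))

/-- The transformation law `F_w(γτ) = F_{wγ}(τ)` for families of functions on the upper half plane
indexed by row vectors `w = (c, d)`. -/
def IsRowFamily {α : Type*} (F : (Fin 2 → ℤ) → ℍ → α) : Prop :=
  ∀ (γ : SL(2, ℤ)) (w : Fin 2 → ℤ) (τ : ℍ), F w (γ • τ) = F (Matrix.vecMul w γ.1) τ

/-- It suffices to check the transformation law on the generators `S` and `T`. -/
lemma isRowFamily_of_generators {α : Type*} {F : (Fin 2 → ℤ) → ℍ → α}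
    (hS : ∀ c d τ, F ![c, d] (ModularGroup.S • τ) = F ![d, -c] τ)
    (hT : ∀ c d τ, F ![c, d] (ModularGroup.T • τ) = F ![c, c + d] τ) : IsRowFamily F := by
  intro γ
  have hγ : γ ∈ Subgroup.closure {ModularGroup.S, ModularGroup.T} := by
    rw [SpecialLinearGroup.SL2Z_generators]; trivial
  have hw : ∀ w : Fin 2 → ℤ, w = ![w 0, w 1] := fun w => by
    ext i; fin_cases i <;> rfl
  induction hγ using Subgroup.closure_induction with
  | mem x hx =>
    intro w τ
    rcases hx with rfl | rfl
    · rw [hw w, hS]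
      congr 1
      ext i; fin_cases i <;> simp [ModularGroup.S, Matrix.vecMul, dotProduct, Fin.sum_univ_two]
    · rw [hw w, hT]
      congr 1
      ext i; fin_cases i <;> simp [ModularGroup.T, Matrix.vecMul, dotProduct, Fin.sum_univ_two]
  | one => intro w τ; simp
  | mul x y _ _ hx hy =>
    intro w τ
    rw [mul_smul, hx, hy, Matrix.vecMul_vecMul]
    rfl
  | inv x _ hx =>
    intro w τ
    have := hx (Matrix.vecMul w (x⁻¹ : SL(2, ℤ)).1) (x⁻¹ • τ)
    rw [smul_inv_smul, Matrix.vecMul_vecMul] at this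
    rw [this]
    have h1 : ((x⁻¹ : SL(2, ℤ)).1 * x.1 : Matrix (Fin 2) (Fin 2) ℤ) = 1 := by
      have := congrArg (fun g : SL(2, ℤ) => g.1) (inv_mul_cancel x)
      exact this
    rw [h1, Matrix.vecMul_one]

/-- Every nonzero `w ∈ ℤ²` is `(n + 1)` times the bottom row of exactly one `γ ∈ SL₂(ℤ)` with
`γτ` in the strip. -/
lemma bijective_smul_bottomRow (τ : ℍ) : Function.Bijective
    (fun x : {x : ℕ × SL(2, ℤ) // x.2 • τ ∈ strip} =>
      (⟨Matrix.vecMul ![0, (x.1.1 + 1 : ℤ)] x.1.2.1, by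
        intro h
        have h0 := congrFun h 0
        have h1 := congrFun h 1
        simp only [Matrix.vecMul, dotProduct, Fin.sum_univ_two, Matrix.cons_val_zero,
          Matrix.cons_val_one, Pi.zero_apply, zero_mul, zero_add] at h0 h1
        have hn : (x.1.1 + 1 : ℤ) ≠ 0 := by positivity
        have hc := ModularGroup.bottom_row_coprime x.1.2
        have h2 : x.1.2.1 1 0 = 0 := by simpa [hn] using h0
        have h3 : x.1.2.1 1 1 = 0 := by simpa [hn] using h1
        rw [h2, h3] at hc
        exact not_isCoprime_zero_zero hc⟩ : {w : Fin 2 → ℤ // w ≠ 0})) := by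
  constructor
  · rintro ⟨⟨n, γ⟩, h⟩ ⟨⟨n', γ'⟩, h'⟩ heq
    have heq' := congrArg Subtype.val heq
    have h0 := congrFun heq' 0
    have h1 := congrFun heq' 1
    simp only [Matrix.vecMul, dotProduct, Fin.sum_univ_two, Matrix.cons_val_zero,
      Matrix.cons_val_one, zero_mul, zero_add] at h0 h1 h h'
    have hg : ∀ γ : SL(2, ℤ), Int.gcd (γ.1 1 0) (γ.1 1 1) = 1 := fun γ =>
      Int.isCoprime_iff_gcd_eq_one.mp (ModularGroup.bottom_row_coprime γ)
    have hn : n = n' := by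
      have e1 : Int.gcd ((n + 1 : ℤ) * γ.1 1 0) ((n + 1 : ℤ) * γ.1 1 1) = n + 1 := by
        rw [Int.gcd_mul_left, hg]; simp; omega
      have e2 : Int.gcd ((n' + 1 : ℤ) * γ'.1 1 0) ((n' + 1 : ℤ) * γ'.1 1 1) = n' + 1 := by
        rw [Int.gcd_mul_left, hg]; simp; omega
      rw [h0, h1, e2] at e1
      omega
    subst hn
    have hn0 : (n + 1 : ℤ) ≠ 0 := by positivity
    have hc := mul_left_cancel₀ hn0 h0
    have hd := mul_left_cancel₀ hn0 h1
    have hdet := Matrix.det_fin_two γ.1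
    have hdet' := Matrix.det_fin_two γ'.1
    rw [γ.det_coe] at hdet
    rw [γ'.det_coe] at hdet'
    set j : ℤ := γ'.1 0 1 * γ.1 0 0 - γ'.1 0 0 * γ.1 0 1 with hj
    have hT : γ' = ModularGroup.T ^ j * γ := by
      rw [← mul_inv_eq_iff_eq_mul]
      ext i k
      rw [ModularGroup.coe_T_zpow]
      fin_cases i <;> fin_cases k <;>
        simp [Matrix.SpecialLinearGroup.coe_mul, Matrix.mul_apply, Fin.sum_univ_two,
          Matrix.SpecialLinearGroup.coe_inv, Matrix.adjugate_fin_two] <;>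
        first
        | (rw [hc, hd]; linear_combination -hdet')
        | linear_combination -hj
        | (rw [hc, hd]; ring)
        | (rw [← hc, ← hd]; linear_combination -hdet)
    have hre : (γ' • τ).re = (γ • τ).re + j := by
      rw [hT, mul_smul, ModularGroup.re_T_zpow_smul]
    have hj0 : j = 0 := by
      have h3 : (-1 : ℝ) < j := by linarith [h.1, h.2, h'.1, h'.2]
      have h4 : (j : ℝ) < 1 := by linarith [h.1, h.2, h'.1, h'.2]
      have h5 : (-1 : ℤ) < j := by exact_mod_cast h3
      have h6 : j < (1 : ℤ) := by exact_mod_cast h4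
      omega
    rw [hj0, zpow_zero, one_mul] at hT
    subst hT
    rfl
  · rintro ⟨w, hw⟩
    have hg : 0 < Int.gcd (w 0) (w 1) := by
      rw [Int.gcd_pos_iff]
      by_contra hcon
      push Not at hcon
      exact hw (by ext i; fin_cases i; exacts [hcon.1, hcon.2])
    obtain ⟨c, d, hcd, h0, h1⟩ := Int.exists_gcd_one hg
    obtain ⟨γ₀, -, hγ₀⟩ := ModularGroup.bottom_row_surj (R := ℤ)
      (show (![c, d] : Fin 2 → ℤ) ∈ {cd : Fin 2 → ℤ | IsCoprime (cd 0) (cd 1)} from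
        Int.isCoprime_iff_gcd_eq_one.mpr hcd)
    set γ := ModularGroup.T ^ (-⌊(γ₀ • τ).re⌋) * γ₀ with hγ
    have hrow : ∀ k, γ.1 1 k = γ₀.1 1 k := by
      intro k
      rw [hγ, Matrix.SpecialLinearGroup.coe_mul, Matrix.mul_apply, ModularGroup.coe_T_zpow,
        Fin.sum_univ_two]
      simp
    have hc : γ₀.1 1 0 = c := congrFun hγ₀ 0
    have hd : γ₀.1 1 1 = d := congrFun hγ₀ 1
    refine ⟨⟨(Int.gcd (w 0) (w 1) - 1, γ), ?_⟩, ?_⟩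
    · rw [hγ, mul_smul]
      refine ⟨?_, ?_⟩ <;> rw [ModularGroup.re_T_zpow_smul] <;> push_cast
      · linarith [Int.floor_le (γ₀ • τ).re]
      · linarith [Int.lt_floor_add_one (γ₀ • τ).re]
    · refine Subtype.ext ?_
      have hn : ((Int.gcd (w 0) (w 1) - 1 : ℕ) : ℤ) + 1 = Int.gcd (w 0) (w 1) := by
        rw [Nat.cast_sub hg]; simp
      ext k
      fin_cases k
      · simp only [Matrix.vecMul, dotProduct, Fin.sum_univ_two, hn, hrow]
        simp [hc, mul_comm, ← h0]
      · simp only [Matrix.vecMul, dotProduct, Fin.sum_univ_two, hn, hrow]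
        simp [hd, mul_comm, ← h1]

/-- Unfolding for nonnegative families: the nonzero `w ∈ ℤ²` are the `(0, n + 1)γ`, and the `γ` with
the same value are told apart by requiring `γτ` to lie in the strip. -/
theorem tsum_lintegral_fd_eq {φ : (Fin 2 → ℤ) → ℍ → ℝ≥0∞} (hφ : ∀ w, Measurable (φ w))
    (h : IsRowFamily φ) :
    ∑' w : {w : Fin 2 → ℤ // w ≠ 0}, ∫⁻ τ in ModularGroup.fd, φ w τ
      = 2 * ∑' n : ℕ, ∫⁻ τ in strip, φ ![0, (n + 1 : ℤ)] τ := by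
  have h1 : ∀ n : ℕ, 2 * ∫⁻ τ in strip, φ ![0, (n + 1 : ℤ)] τ
      = ∑' γ : SL(2, ℤ), ∫⁻ τ in ModularGroup.fd,
        strip.indicator (φ ![0, (n + 1 : ℤ)]) (γ • τ) := by
    intro n
    rw [← lintegral_indicator measurableSet_strip,
      tsum_lintegral_fd ((hφ _).indicator measurableSet_strip)]
  rw [← ENNReal.tsum_mul_left]
  simp only [h1]
  have hm : ∀ x : ℕ × SL(2, ℤ), AEMeasurable
      (fun τ : ℍ => strip.indicator (φ ![0, (x.1 + 1 : ℤ)]) (x.2 • τ))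
      (volume.restrict ModularGroup.fd) := fun x =>
    (((hφ _).indicator measurableSet_strip).comp (measurable_smul_SL _)).aemeasurable
  rw [← ENNReal.tsum_prod (f := fun (n : ℕ) (γ : SL(2, ℤ)) => ∫⁻ τ in ModularGroup.fd,
        strip.indicator (φ ![0, (n + 1 : ℤ)]) (γ • τ)), ← lintegral_tsum hm,
    ← lintegral_tsum (μ := volume.restrict ModularGroup.fd)
      (f := fun (w : {w : Fin 2 → ℤ // w ≠ 0}) τ => φ w τ) fun w => (hφ _).aemeasurable]
  refine lintegral_congr fun τ => ?_
  have h2 : ∀ x : ℕ × SL(2, ℤ), strip.indicator (φ ![0, (x.1 + 1 : ℤ)]) (x.2 • τ)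
      = {x : ℕ × SL(2, ℤ) | x.2 • τ ∈ strip}.indicator
        (fun x => φ (Matrix.vecMul ![0, (x.1 + 1 : ℤ)] x.2.1) τ) x := by
    intro x
    by_cases hx : x.2 • τ ∈ strip
    · rw [Set.indicator_of_mem hx, Set.indicator_of_mem (by exact hx), h]
    · rw [Set.indicator_of_notMem hx, Set.indicator_of_notMem (by exact hx)]
  simp only [h2]
  rw [← tsum_subtype]
  exact ((Equiv.ofBijective _ (bijective_smul_bottomRow τ)).tsum_eq
    (fun w : {w : Fin 2 → ℤ // w ≠ 0} => φ w τ)).symm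

/-- Unfolding for complex-valued families. -/
theorem hasSum_integral_fd {F : (Fin 2 → ℤ) → ℍ → ℂ} (hF : ∀ w, Measurable (F w))
    (h : IsRowFamily F)
    (hfin : ∑' n : ℕ, ∫⁻ τ in strip, ‖F ![0, (n + 1 : ℤ)] τ‖ₑ ≠ ∞) :
    (∀ w ≠ 0, IntegrableOn (F w) ModularGroup.fd) ∧
    (Summable fun w : {w : Fin 2 → ℤ // w ≠ 0} => ∫ τ in ModularGroup.fd, ‖F w τ‖) ∧
    HasSum (fun w : {w : Fin 2 → ℤ // w ≠ 0} => ∫ τ in ModularGroup.fd, F w τ)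
      (2 * ∑' n : ℕ, ∫ τ in strip, F ![0, (n + 1 : ℤ)] τ) := by
  have hrow : ∀ {α : Type} (g : ℂ → α), IsRowFamily fun w τ => g (F w τ) :=
    fun g γ w τ => congrArg g (h γ w τ)
  have hnorm := tsum_lintegral_fd_eq (φ := fun w τ => ‖F w τ‖ₑ) (fun w => (hF w).enorm)
    (hrow fun z => ‖z‖ₑ)
  have hfin2 : ∑' w : {w : Fin 2 → ℤ // w ≠ 0}, ∫⁻ τ in ModularGroup.fd, ‖F w τ‖ₑ ≠ ∞ := by
    rw [hnorm]; exact ENNReal.mul_ne_top (by norm_num) hfin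
  have hint : ∀ w ≠ 0, IntegrableOn (F w) ModularGroup.fd := fun w hw =>
    ⟨(hF w).aestronglyMeasurable, (ENNReal.ne_top_of_tsum_ne_top hfin2 ⟨w, hw⟩).lt_top⟩
  have hintS : ∀ n : ℕ, IntegrableOn (F ![0, (n + 1 : ℤ)]) strip := fun n =>
    ⟨(hF _).aestronglyMeasurable, (ENNReal.ne_top_of_tsum_ne_top hfin n).lt_top⟩
  -- the sum formula for a nonnegative function of `F` dominated by the norm
  have key : ∀ g : ℂ → ℝ, Measurable g → (∀ z, 0 ≤ g z) → (∀ z, g z ≤ ‖z‖) →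
      (Summable fun n : ℕ => ∫ τ in strip, g (F ![0, (n + 1 : ℤ)] τ)) ∧
      HasSum (fun w : {w : Fin 2 → ℤ // w ≠ 0} => ∫ τ in ModularGroup.fd, g (F w τ))
        (2 * ∑' n : ℕ, ∫ τ in strip, g (F ![0, (n + 1 : ℤ)] τ)) := by
    intro g hg hg0 hg1
    have hle : ∀ z, ENNReal.ofReal (g z) ≤ ‖z‖ₑ := fun z => by
      rw [← ofReal_norm]; exact ENNReal.ofReal_le_ofReal (hg1 z)
    have e1 : ∀ (s : Set ℍ) (w : Fin 2 → ℤ), ∫ τ in s, g (F w τ)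
        = (∫⁻ τ in s, ENNReal.ofReal (g (F w τ))).toReal := fun s w =>
      integral_eq_lintegral_of_nonneg_ae (Filter.Eventually.of_forall fun τ => hg0 _)
        (hg.comp (hF w)).aestronglyMeasurable
    have hsum := tsum_lintegral_fd_eq (φ := fun w τ => ENNReal.ofReal (g (F w τ)))
      (fun w => (hg.comp (hF w)).ennreal_ofReal) (hrow fun z => ENNReal.ofReal (g z))
    have f1 : ∑' n : ℕ, ∫⁻ τ in strip, ENNReal.ofReal (g (F ![0, (n + 1 : ℤ)] τ)) ≠ ∞ :=
      ne_top_of_le_ne_top hfin (ENNReal.tsum_le_tsum fun n => lintegral_mono fun τ => hle _)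
    have f2 : ∑' w : {w : Fin 2 → ℤ // w ≠ 0},
        ∫⁻ τ in ModularGroup.fd, ENNReal.ofReal (g (F w τ)) ≠ ∞ :=
      ne_top_of_le_ne_top hfin2 (ENNReal.tsum_le_tsum fun n => lintegral_mono fun τ => hle _)
    simp only [e1]
    refine ⟨ENNReal.summable_toReal f1, ?_⟩
    have h3 := (ENNReal.summable_toReal f2).hasSum
    rwa [← ENNReal.tsum_toReal_eq (ENNReal.ne_top_of_tsum_ne_top f2), hsum, ENNReal.toReal_mul,
      ENNReal.tsum_toReal_eq (ENNReal.ne_top_of_tsum_ne_top f1)] at h3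
  refine ⟨hint, (key (fun z => ‖z‖) measurable_norm (fun _ => norm_nonneg _)
    fun _ => le_rfl).2.summable, ?_⟩
  have part : ∀ g : ℂ →L[ℝ] ℝ, (∀ z, |g z| ≤ ‖z‖) →
      (Summable fun n : ℕ => g (∫ τ in strip, F ![0, (n + 1 : ℤ)] τ)) ∧
      HasSum (fun w : {w : Fin 2 → ℤ // w ≠ 0} => g (∫ τ in ModularGroup.fd, F w τ))
        (2 * ∑' n : ℕ, g (∫ τ in strip, F ![0, (n + 1 : ℤ)] τ)) := by
    intro g hg
    have hp := key (fun z => max (g z) 0) (g.measurable.max measurable_const)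
      (fun z => le_max_right _ _) fun z => max_le ((le_abs_self _).trans (hg z)) (norm_nonneg _)
    have hm := key (fun z => max (-g z) 0) (g.measurable.neg.max measurable_const)
      (fun z => le_max_right _ _) fun z => max_le ((neg_le_abs _).trans (hg z)) (norm_nonneg _)
    have e : ∀ (s : Set ℍ) (w : Fin 2 → ℤ), IntegrableOn (F w) s →
        g (∫ τ in s, F w τ) = (∫ τ in s, max (g (F w τ)) 0) - ∫ τ in s, max (-g (F w τ)) 0 := by
      intro s w hi
      rw [← g.integral_comp_comm hi]
      have := integral_eq_integral_pos_part_sub_integral_neg_part (g.integrable_comp hi)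
      simpa only [Real.coe_toNNReal'] using this
    have e1 := fun n : ℕ => e _ _ (hintS n)
    have e2 := fun w : {w : Fin 2 → ℤ // w ≠ 0} => e _ _ (hint w w.2)
    simp only [e1, e2]
    refine ⟨hp.1.sub hm.1, ?_⟩
    rw [hp.1.tsum_sub hm.1, mul_sub]
    exact hp.2.sub hm.2
  have hre := part Complex.reCLM Complex.abs_re_le_norm
  have him := part Complex.imCLM Complex.abs_im_le_norm
  have hs : HasSum (fun n : ℕ => ∫ τ in strip, F ![0, (n + 1 : ℤ)] τ)
      ⟨∑' n : ℕ, (∫ τ in strip, F ![0, (n + 1 : ℤ)] τ).re,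
        ∑' n : ℕ, (∫ τ in strip, F ![0, (n + 1 : ℤ)] τ).im⟩ :=
    (Complex.hasSum_iff _ _).mpr ⟨hre.1.hasSum, him.1.hasSum⟩
  rw [hs.tsum_eq]
  refine (Complex.hasSum_iff _ _).mpr ⟨?_, ?_⟩
  · simpa using hre.2
  · simpa using him.2

end Unfolding

/-! ### Fourier series and Poisson summation on `ℤⁿ` -/

section Poisson

lemma expi_add (x y : ℂ) : expi (x + y) = expi x * expi y := by
  rw [expi, mul_add, Complex.exp_add]; rfl

@[simp] lemma expi_zero : expi 0 = 1 := by simp [expi]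

lemma expi_ne_zero (x : ℂ) : expi x ≠ 0 := Complex.exp_ne_zero _

@[simp] lemma expi_int (n : ℤ) : expi n = 1 := by
  rw [expi, mul_comm, Complex.exp_int_mul_two_pi_mul_I]

lemma expi_add_int (x : ℂ) (n : ℤ) : expi (x + n) = expi x := by
  rw [expi_add, expi_int, mul_one]

lemma conj_expi (x : ℂ) : conj (expi x) = expi (-conj x) := by
  rw [expi, expi, ← Complex.exp_conj]
  simp [Complex.conj_ofNat]

lemma norm_expi (x : ℂ) : ‖expi x‖ = Real.exp (-2 * Real.pi * x.im) := by
  rw [expi, Complex.norm_exp]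
  simp

lemma norm_expi_real (x : ℝ) : ‖expi x‖ = 1 := by simp [norm_expi]

@[fun_prop] lemma continuous_expi : Continuous expi := by unfold expi; fun_prop

lemma expi_sum {ι : Type*} (s : Finset ι) (x : ι → ℂ) :
    expi (∑ i ∈ s, x i) = ∏ i ∈ s, expi (x i) := by
  rw [expi, Finset.mul_sum, Complex.exp_sum]; rfl

variable {ι : Type*}

/-- The half-open unit box `(0, 1]^ι`. -/
def unitBox (ι : Type*) : Set (ι → ℝ) := {x | ∀ i, x i ∈ Set.Ioc (0 : ℝ) 1}

lemma unitBox_eq : unitBox ι = Set.univ.pi fun _ => Set.Ioc (0 : ℝ) 1 := by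
  ext; simp [unitBox]

variable [Fintype ι]

lemma measurableSet_unitBox : MeasurableSet (unitBox ι) := by
  rw [unitBox_eq]
  exact MeasurableSet.univ_pi fun _ => measurableSet_Ioc

/-- The Fourier series of a continuous `ℤⁿ`-periodic function converges pointwise if its
coefficients are summable. -/
lemma hasSum_fourier_of_periodic {g : (ι → ℝ) → ℂ} (hg : Continuous g)
    (hper : ∀ (a : ι → ℝ) (m : ι → ℤ), g (fun i => a i + m i) = g a)
    (hs : Summable fun m : ι → ℤ => ∫ a in unitBox ι, g a * expi (-(∑ i, m i * a i : ℝ)))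
    (a : ι → ℝ) :
    HasSum (fun m : ι → ℤ => (∫ a in unitBox ι, g a * expi (-(∑ i, m i * a i : ℝ)))
      * expi (∑ i, m i * a i : ℝ)) (g a) := by
  -- the function on the torus that `g` induces
  set G : UnitAddTorus ι → ℂ := fun x => g fun i => (AddCircle.equivIoc 1 0 (x i)).1 with hG
  have hGval : ∀ a : ι → ℝ, G (fun i => (a i : UnitAddCircle)) = g a := by
    intro a
    have h1 : ∀ i, ∃ n : ℤ, ((AddCircle.equivIoc (1 : ℝ) 0 (a i : UnitAddCircle)).1 : ℝ)
        = a i + n := by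
      intro i
      have h2 : (((AddCircle.equivIoc (1 : ℝ) 0 (a i : UnitAddCircle)).1 : ℝ) : UnitAddCircle)
          = (a i : UnitAddCircle) :=
        (AddCircle.equivIoc (1 : ℝ) 0).symm_apply_apply _
      rw [QuotientAddGroup.eq, AddSubgroup.mem_zmultiples_iff] at h2
      obtain ⟨n, hn⟩ := h2
      refine ⟨-n, ?_⟩
      rw [zsmul_one] at hn
      push_cast
      linarith
    choose n hn using h1
    rw [hG]
    simp only [hn]
    exact hper a n
  have hquot : IsOpenQuotientMap (fun (a : ι → ℝ) i => (a i : UnitAddCircle)) :=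
    IsOpenQuotientMap.piMap fun _ => QuotientAddGroup.isOpenQuotientMap_mk
  have hGc : Continuous G := by
    rw [hquot.isQuotientMap.continuous_iff]
    exact hg.congr fun a => (hGval a).symm
  have hmF : ∀ (m : ι → ℤ) (a : ι → ℝ),
      UnitAddTorus.mFourier m (fun i => (a i : UnitAddCircle)) = expi (∑ i, m i * a i : ℝ) := by
    intro m a
    push_cast
    rw [expi_sum]
    simp only [UnitAddTorus.mFourier, ContinuousMap.coe_mk, fourier_coe_apply, expi]
    refine Finset.prod_congr rfl fun i _ => ?_
    congr 1
    push_cast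
    ring
  have hcoef : ∀ m : ι → ℤ, UnitAddTorus.mFourierCoeff G m
      = ∫ a in unitBox ι, g a * expi (-(∑ i, m i * a i : ℝ)) := by
    intro m
    rw [UnitAddTorus.mFourierCoeff_eq_integral _ _ 0]
    simp only [Pi.zero_apply, zero_add, unitBox]
    refine integral_congr_ae (Filter.Eventually.of_forall fun a => ?_)
    simp only [hGval, hmF, smul_eq_mul]
    rw [mul_comm]
    congr 2
    push_cast
    simp
  have := UnitAddTorus.hasSum_mFourier_series_apply_of_summable
    (f := (⟨G, hGc⟩ : C(UnitAddTorus ι, ℂ))) (by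
      change Summable (UnitAddTorus.mFourierCoeff G)
      exact hs.congr fun m => (hcoef m).symm)
    (fun i => (a i : UnitAddCircle))
  simp only [ContinuousMap.coe_mk, hGval, hmF, smul_eq_mul] at this
  exact this.congr_fun fun m => by rw [← hcoef m]

lemma summable_lattice {F : Type*} [NormedAddCommGroup F] [NormedSpace ℝ F]
    (b : Module.Basis ι ℝ F) {K : ℕ} (hK : Fintype.card ι < K) :
    Summable fun m : ι → ℤ => ((1 + ‖∑ i, (m i : ℝ) • b i‖) ^ K)⁻¹ := by
  classical
  have : FiniteDimensional ℝ F := b.finiteDimensional_of_finite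
  set Λ := Submodule.span ℤ (Set.range b)
  have hrank : Module.finrank ℤ Λ = Fintype.card ι := by
    rw [ZLattice.rank ℝ Λ, Module.finrank_eq_card_basis b]
  have h1 := ZLattice.summable_norm_pow_inv Λ K (by omega)
  set φ : (ι → ℤ) → Λ := fun m => ⟨∑ i, (m i : ℝ) • b i, Submodule.sum_mem _ fun i _ => by
    rw [Int.cast_smul_eq_zsmul]
    exact Submodule.smul_mem _ _ (Submodule.subset_span ⟨i, rfl⟩)⟩
  have hφ : Function.Injective φ := by
    intro m m' h
    have h2 := congrArg Subtype.val h
    simp only [φ] at h2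
    have h3 := congrArg b.repr h2
    ext i
    have h4 := DFunLike.congr_fun h3 i
    rw [b.repr_sum_self, b.repr_sum_self] at h4
    exact_mod_cast h4
  have h2 := h1.comp_injective hφ
  refine Summable.of_norm_bounded_eventually (g := fun m => (‖φ m‖⁻¹) ^ K) h2 ?_
  have h0 : {m : ι → ℤ | φ m = 0}.Finite := by
    refine Set.Subsingleton.finite fun m hm m' hm' => hφ (by rw [hm, hm'])
  filter_upwards [h0.compl_mem_cofinite] with m hm
  have hpos : 0 < ‖φ m‖ := norm_pos_iff.mpr hm
  rw [Real.norm_of_nonneg (by positivity), inv_pow]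
  change ((1 + ‖φ m‖) ^ K)⁻¹ ≤ _
  gcongr
  linarith

lemma summable_int_pow {K : ℕ} (hK : Fintype.card ι < K) :
    Summable fun m : ι → ℤ => ((1 + ‖fun i => (m i : ℝ)‖) ^ K)⁻¹ := by
  have := summable_lattice (Pi.basisFun ℝ ι) hK
  refine this.congr fun m => ?_
  have h : ∑ i, (m i : ℝ) • Pi.basisFun ℝ ι i = fun i => (m i : ℝ) := by
    classical
    ext i
    simp [Finset.sum_apply, Pi.single_apply]
  rw [h]

/-- `(1 + ‖x + y‖)⁻¹ ≤ (1 + ‖y‖)(1 + ‖x‖)⁻¹`, to the power `K`. -/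
lemma inv_one_add_norm_add_pow_le {F : Type*} [SeminormedAddCommGroup F] (x y : F) (K : ℕ) :
    ((1 + ‖x + y‖) ^ K)⁻¹ ≤ (1 + ‖y‖) ^ K * ((1 + ‖x‖) ^ K)⁻¹ := by
  have h : 1 + ‖x‖ ≤ (1 + ‖y‖) * (1 + ‖x + y‖) := by
    have h1 : ‖x‖ ≤ ‖x + y‖ + ‖y‖ := by simpa using norm_sub_le (x + y) y
    nlinarith [norm_nonneg y, norm_nonneg (x + y)]
  rw [← div_eq_mul_inv, inv_eq_one_div, div_le_div_iff₀ (by positivity) (by positivity), one_mul,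
    ← mul_pow]
  gcongr

lemma integrable_of_decay {Ψ : (ι → ℝ) → ℂ} (hc : Continuous Ψ) {C : ℝ} {K : ℕ}
    (hK : Fintype.card ι < K) (hb : ∀ a, ‖Ψ a‖ ≤ C * ((1 + ‖a‖) ^ K)⁻¹) : Integrable Ψ := by
  have h := (integrable_one_add_norm (E := ι → ℝ) (μ := volume) (r := K)
    (by simpa using (by exact_mod_cast hK))).const_mul C
  refine h.mono' hc.aestronglyMeasurable (Filter.Eventually.of_forall fun a => ?_)
  rw [Real.rpow_neg (by positivity), Real.rpow_natCast]
  exact hb a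

/-- The translates of the unit box tile `ℝⁿ`. -/
lemma hasSum_integral_unitBox {F : Type*} [NormedAddCommGroup F] [NormedSpace ℝ F]
    {Ψ : (ι → ℝ) → F} (hi : Integrable Ψ) :
    HasSum (fun m : ι → ℤ => ∫ a in unitBox ι, Ψ (fun i => a i + m i)) (∫ a, Ψ a) := by
  set B : (ι → ℤ) → Set (ι → ℝ) := fun m => {x | (fun i => x i - m i) ∈ unitBox ι} with hB
  have hmeas : ∀ m, MeasurableSet (B m) := fun m =>
    measurableSet_unitBox.preimage (by fun_prop : Measurable fun x : ι → ℝ => fun i => x i - m i)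
  have hdisj : Pairwise (Function.onFun Disjoint B) := by
    intro m m' hne
    rw [Function.onFun, Set.disjoint_left]
    intro x hx hx'
    refine hne (funext fun i => ?_)
    have h1 := hx i
    have h2 := hx' i
    have h3 : (m i : ℝ) < m' i + 1 := by linarith [h1.1, h2.2]
    have h4 : (m' i : ℝ) < m i + 1 := by linarith [h1.2, h2.1]
    have h5 : m i < m' i + 1 := by exact_mod_cast h3
    have h6 : m' i < m i + 1 := by exact_mod_cast h4
    omega
  have hunion : ⋃ m, B m = Set.univ := by
    refine Set.eq_univ_of_forall fun x => Set.mem_iUnion.mpr ⟨fun i => ⌈x i⌉ - 1, fun i => ?_⟩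
    push_cast
    exact ⟨by linarith [Int.ceil_lt_add_one (x i)], by linarith [Int.le_ceil (x i)]⟩
  have h := hasSum_integral_iUnion hmeas hdisj (hi.integrableOn (s := ⋃ m, B m))
  rw [hunion, setIntegral_univ] at h
  refine h.congr_fun fun m => ?_
  have hpre : (fun x : ι → ℝ => x + fun i => (m i : ℝ)) ⁻¹' B m = unitBox ι := by
    ext x
    simp [hB]
  rw [← (measurePreserving_add_right volume fun i => (m i : ℝ)).setIntegral_preimage_emb
    (measurableEmbedding_addRight _) Ψ (B m), hpre]
  rfl

/-- **Poisson summation** on `ℤⁿ`. -/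
theorem poisson_int {Ψ : (ι → ℝ) → ℂ} (hc : Continuous Ψ) {C : ℝ} {K : ℕ}
    (hK : Fintype.card ι < K) (hb : ∀ a, ‖Ψ a‖ ≤ C * ((1 + ‖a‖) ^ K)⁻¹)
    (hs : Summable fun m : ι → ℤ => ∫ a, Ψ a * expi (-(∑ i, m i * a i : ℝ))) :
    ∑' m : ι → ℤ, Ψ (fun i => m i) = ∑' m : ι → ℤ, ∫ a, Ψ a * expi (-(∑ i, m i * a i : ℝ)) := by
  have hC : 0 ≤ C := by
    have := (norm_nonneg _).trans (hb 0)
    simpa using this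
  have hbd : ∀ (R : ℝ), ∀ a : ι → ℝ, ‖a‖ ≤ R → ∀ m : ι → ℤ, ‖Ψ (fun i => a i + m i)‖
      ≤ C * ((1 + R) ^ K * ((1 + ‖fun i => (m i : ℝ)‖) ^ K)⁻¹) := by
    intro R a ha m
    refine (hb _).trans (mul_le_mul_of_nonneg_left ?_ hC)
    have : (fun i => a i + m i) = (fun i => (m i : ℝ)) + a := by ext i; simp [add_comm]
    rw [this]
    refine (inv_one_add_norm_add_pow_le _ _ K).trans ?_
    gcongr
  have hsum : ∀ a : ι → ℝ, Summable fun m : ι → ℤ => Ψ (fun i => a i + m i) := fun a =>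
    Summable.of_norm_bounded ((summable_int_pow hK).mul_left _ |>.mul_left C) (hbd _ a le_rfl)
  -- the periodization of `Ψ`, whose Fourier coefficients are values of the transform of `Ψ`
  set g : (ι → ℝ) → ℂ := fun a => ∑' m : ι → ℤ, Ψ (fun i => a i + m i) with hg
  have hgc : Continuous g := by
    rw [continuous_iff_continuousAt]
    intro a₀
    have : ContinuousOn g (Metric.ball 0 (‖a₀‖ + 1)) := by
      refine continuousOn_tsum (fun m => (hc.comp (by fun_prop)).continuousOn)
        (((summable_int_pow hK).mul_left ((1 + (‖a₀‖ + 1)) ^ K)).mul_left C) fun m a ha => ?_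
      exact hbd _ a (by simpa using (mem_ball_zero_iff.mp ha).le) m
    exact this.continuousAt (Metric.isOpen_ball.mem_nhds (by simp))
  have hper : ∀ (a : ι → ℝ) (m : ι → ℤ), g (fun i => a i + m i) = g a := by
    intro a m
    simp only [hg]
    rw [← (Equiv.addLeft m).tsum_eq fun n : ι → ℤ => Ψ (fun i => a i + n i)]
    refine tsum_congr fun n => ?_
    congr 1
    ext i
    simp [add_assoc]
  have hcoef : ∀ k : ι → ℤ, ∫ a in unitBox ι, g a * expi (-(∑ i, k i * a i : ℝ))
      = ∫ a, Ψ a * expi (-(∑ i, k i * a i : ℝ)) := by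
    intro k
    have hcΨ : Continuous fun a => Ψ a * expi (-(∑ i, k i * a i : ℝ)) := by fun_prop
    have hnorm : ∀ a : ι → ℝ, ‖Ψ a * expi (-(∑ i, k i * a i : ℝ))‖ = ‖Ψ a‖ := by
      intro a
      rw [norm_mul, ← Complex.ofReal_neg, norm_expi_real, mul_one]
    have hi : Integrable fun a => Ψ a * expi (-(∑ i, k i * a i : ℝ)) :=
      integrable_of_decay hcΨ hK fun a => by rw [hnorm]; exact hb a
    have h1 := hasSum_integral_unitBox hi
    have h1n := hasSum_integral_unitBox hi.norm
    have h2 : ∀ m : ι → ℤ, ∀ a : ι → ℝ,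
        Ψ (fun i => a i + m i) * expi (-(∑ i, k i * (a i + m i) : ℝ))
        = Ψ (fun i => a i + m i) * expi (-(∑ i, k i * a i : ℝ)) := by
      intro m a
      congr 1
      have : ((-(∑ i, k i * (a i + m i) : ℝ) : ℝ) : ℂ)
          = ((-(∑ i, k i * a i : ℝ) : ℝ) : ℂ) + ((-∑ i, k i * m i : ℤ) : ℂ) := by
        push_cast
        simp only [mul_add, Finset.sum_add_distrib]
        ring
      rw [← Complex.ofReal_neg, this, expi_add_int, Complex.ofReal_neg]
    simp only [h2] at h1 h1n
    have h3 := hasSum_integral_of_summable_integral_norm (μ := volume.restrict (unitBox ι))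
      (fun m => by
        simp only [← h2 m]
        exact (hi.comp_add_right fun i => (m i : ℝ)).integrableOn) h1n.summable
    rw [← h1.tsum_eq, h3.tsum_eq]
    refine integral_congr_ae (Filter.Eventually.of_forall fun a => ?_)
    simp only [hg]
    rw [tsum_mul_right]
  have := hasSum_fourier_of_periodic hgc hper (by simpa only [hcoef] using hs) 0
  simp only [hcoef] at this
  simpa [hg] using this.tsum_eq.symm

end Poisson

/-! ### Lattices in quadratic spaces: dual bases, discriminant, Poisson summation -/

section Lattice

variable {r s : ℕ}

/-- The bilinear form of `ℝ^{r,s}`. -/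
def stdBil (X Y : Fin r ⊕ Fin s → ℝ) : ℝ :=
  ∑ j, X (Sum.inl j) * Y (Sum.inl j) - ∑ j, X (Sum.inr j) * Y (Sum.inr j)

lemma stdForm_apply (X : Fin r ⊕ Fin s → ℝ) :
    stdForm r s X = (∑ j, X (Sum.inl j) ^ 2 - ∑ j, X (Sum.inr j) ^ 2) / 2 := by
  simp only [stdForm, QuadraticMap.weightedSumSquares_apply, Fintype.sum_sum_type, Sum.elim_inl,
    Sum.elim_inr, smul_eq_mul]
  rw [← Finset.mul_sum, ← Finset.mul_sum]
  simp only [pow_two]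
  ring

lemma stdForm_eq_qPlus_add_qMinus (X : Fin r ⊕ Fin s → ℝ) :
    stdForm r s X = qPlus X + qMinus X := by
  rw [stdForm_apply, qPlus, qMinus]; ring

lemma bil_stdForm (X Y : Fin r ⊕ Fin s → ℝ) : bil (stdForm r s) X Y = stdBil X Y := by
  simp only [bil, QuadraticMap.polarBilin_apply_apply, QuadraticMap.polar, stdForm_apply, stdBil,
    Pi.add_apply, add_sq, Finset.sum_add_distrib]
  have : ∀ (n : ℕ) (a b : Fin n → ℝ), ∑ j, 2 * a j * b j = 2 * ∑ j, a j * b j := by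
    intro n a b; rw [Finset.mul_sum]; exact Finset.sum_congr rfl fun _ _ => by ring
  rw [this _ (fun j => X (Sum.inl j)) (fun j => Y (Sum.inl j)),
    this _ (fun j => X (Sum.inr j)) (fun j => Y (Sum.inr j))]
  ring

lemma stdBil_eq_sum (X Y : Fin r ⊕ Fin s → ℝ) :
    stdBil X Y = ∑ i, X i * (Sum.elim (fun _ => (1 : ℝ)) (fun _ => -1) i * Y i) := by
  simp [stdBil, Fintype.sum_sum_type, sub_eq_add_neg]

variable {E : Type*} [AddCommGroup E] [Module ℝ E] {q : QuadraticForm ℝ E} {L : Submodule ℤ E}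

lemma bil_eq_stdBil (V : q.IsometryEquiv (stdForm r s)) (x y : E) :
    bil q x y = stdBil (V x) (V y) := by
  rw [← bil_stdForm]
  simp only [bil, QuadraticMap.polarBilin_apply_apply, QuadraticMap.polar]
  rw [← map_add, V.map_app, V.map_app, V.map_app]

lemma polarBilin_isSymm (q : QuadraticForm ℝ E) : (q.polarBilin).IsSymm :=
  ⟨fun x y => by simp [QuadraticMap.polar_comm]⟩

lemma polarBilin_nondegenerate (V : q.IsometryEquiv (stdForm r s)) :
    LinearMap.BilinForm.Nondegenerate q.polarBilin := by
  unfold LinearMap.BilinForm.Nondegenerate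
  rw [(polarBilin_isSymm q).isRefl.nondegenerate_iff_separatingLeft]
  intro x hx
  apply V.toLinearEquiv.injective
  rw [map_zero]
  ext i
  have h : stdBil (V x) (Pi.single i 1) = 0 := by
    have := hx (V.symm (Pi.single i 1))
    rw [← bil, bil_eq_stdBil V, V.apply_symm_apply] at this
    exact this
  rw [stdBil_eq_sum, Finset.sum_eq_single i (by intro j _ hj; simp [hj]) (by simp)] at h
  rcases i with i | i <;> simpa using h

lemma le_dual (hL : IsEvenLattice q L) : L ≤ dual q L := by
  intro x hx y hy
  obtain ⟨a, ha⟩ := hL.even x hx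
  obtain ⟨b, hb⟩ := hL.even y hy
  obtain ⟨c, hc⟩ := hL.even (x + y) (L.add_mem hx hy)
  rw [Submodule.mem_one]
  refine ⟨c - a - b, ?_⟩
  have := IsotropicData.q_add q x y
  rw [ha, hb, hc] at this
  simp only [algebraMap_int_eq, Int.coe_castRingHom, Int.cast_sub]
  rw [bil] at this
  linarith

lemma exists_int_bil {x y : E} (hx : x ∈ dual q L) (hy : y ∈ L) : ∃ n : ℤ, bil q x y = n := by
  obtain ⟨n, hn⟩ := Submodule.mem_one.mp (hx y hy)
  exact ⟨n, by rw [bil, ← hn]; simp⟩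

/-- A basis of `L` together with the dual basis of `L'`, in coordinates of `ℝ^{r,s}`. -/
lemma exists_dual_bases (hL : IsEvenLattice q L) (V : q.IsometryEquiv (stdForm r s)) :
    ∃ b b' : Module.Basis (Fin r ⊕ Fin s) ℝ E,
      L = Submodule.span ℤ (Set.range b) ∧ dual q L = Submodule.span ℤ (Set.range b') ∧
      (∀ i j, bil q (b i) (b' j) = if i = j then 1 else 0) ∧
      (∀ x i, b'.repr x i = bil q x (b i)) := by
  classical
  obtain ⟨m, b₀, hb₀⟩ := hL.exists_basis
  have hcard : Nonempty (Fin m ≃ Fin r ⊕ Fin s) :=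
    ⟨b₀.indexEquiv ((Pi.basisFun ℝ (Fin r ⊕ Fin s)).map V.toLinearEquiv.symm)⟩
  obtain ⟨e⟩ := hcard
  have hfin : FiniteDimensional ℝ E := b₀.finiteDimensional_of_finite
  have hnd := polarBilin_nondegenerate V
  have hspan : L = Submodule.span ℤ (Set.range (b₀.reindex e)) := by
    rw [Module.Basis.range_reindex, hb₀]
  refine ⟨b₀.reindex e, LinearMap.BilinForm.dualBasis q.polarBilin hnd (b₀.reindex e), hspan, ?_,
    ?_, ?_⟩
  · rw [← LinearMap.BilinForm.dualSubmodule_span_of_basis, ← hspan]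
  · intro i j
    exact LinearMap.BilinForm.apply_dualBasis_right hnd ⟨(polarBilin_isSymm q).eq⟩ _ i j
  · intro x i
    exact LinearMap.BilinForm.dualBasis_repr_apply _ _ _ _

/-- The coordinate matrix of a basis of `E`. -/
def coordMatrix (V : q.IsometryEquiv (stdForm r s)) (b : Module.Basis (Fin r ⊕ Fin s) ℝ E) :
    Matrix (Fin r ⊕ Fin s) (Fin r ⊕ Fin s) ℝ := Matrix.of fun i j => V (b j) i

/-- The Gram matrix of `ℝ^{r,s}`. -/
def signMatrix (r s : ℕ) : Matrix (Fin r ⊕ Fin s) (Fin r ⊕ Fin s) ℝ :=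
  Matrix.diagonal (Sum.elim (fun _ => (1 : ℝ)) (fun _ => -1))

lemma abs_det_signMatrix : |(signMatrix r s).det| = 1 := by
  rw [signMatrix, Matrix.det_diagonal, Finset.abs_prod]
  exact Finset.prod_eq_one fun i _ => by rcases i with i | i <;> simp

lemma coordMatrix_gram (V : q.IsometryEquiv (stdForm r s))
    (b b' : Module.Basis (Fin r ⊕ Fin s) ℝ E) (i j : Fin r ⊕ Fin s) :
    ((coordMatrix V b).transpose * signMatrix r s * coordMatrix V b') i j
      = bil q (b i) (b' j) := by
  rw [bil_eq_stdBil V, stdBil_eq_sum, Matrix.mul_apply]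
  refine Finset.sum_congr rfl fun l _ => ?_
  rw [signMatrix, Matrix.mul_diagonal]
  simp only [Matrix.transpose_apply, coordMatrix, Matrix.of_apply]
  ring

/-- The covolume of `L'` is `|D_L|^{-1/2}`. -/
lemma card_disc_eq (hL : IsEvenLattice q L) (V : q.IsometryEquiv (stdForm r s))
    {b b' : Module.Basis (Fin r ⊕ Fin s) ℝ E}
    (hb : L = Submodule.span ℤ (Set.range b)) (hb' : dual q L = Submodule.span ℤ (Set.range b'))
    (hdual : ∀ i j, bil q (b i) (b' j) = if i = j then 1 else 0)
    (hrepr : ∀ x i, b'.repr x i = bil q x (b i)) :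
    |(coordMatrix V b').det| * Real.sqrt (Nat.card (Disc q L)) = 1 := by
  classical
  -- the bases are dual, and the index of `L` in `L'` is the determinant of the Gram matrix of `b`
  have h1 : |(coordMatrix V b).det| * |(coordMatrix V b').det| = 1 := by
    have : (coordMatrix V b).transpose * signMatrix r s * coordMatrix V b' = 1 := by
      ext i j
      rw [coordMatrix_gram, hdual, Matrix.one_apply]
    have h2 := congrArg Matrix.det this
    rw [Matrix.det_mul, Matrix.det_mul, Matrix.det_transpose, Matrix.det_one] at h2
    have h3 := congrArg abs h2
    rwa [abs_mul, abs_mul, abs_det_signMatrix, mul_one, abs_one] at h3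
  set β' : Module.Basis (Fin r ⊕ Fin s) ℤ (dual q L) :=
    (b'.restrictScalars ℤ).map (LinearEquiv.ofEq _ _ hb'.symm) with hβ'
  set β : Module.Basis (Fin r ⊕ Fin s) ℤ (L.submoduleOf (dual q L)) :=
    ((b.restrictScalars ℤ).map (LinearEquiv.ofEq _ _ hb.symm)).map
      (Submodule.submoduleOfEquivOfLe (le_dual hL)).symm with hβ
  have : Module.Free ℤ (dual q L) := Module.Free.of_basis β'
  have : Module.Finite ℤ (dual q L) := Module.Finite.of_basis β'
  have h2 := Submodule.natAbs_det_basis_change β' (L.submoduleOf (dual q L)) β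
  have h3 : ((β'.det ((↑) ∘ β) : ℤ) : ℝ)
      = ((coordMatrix V b).transpose * signMatrix r s * coordMatrix V b).det := by
    rw [Module.Basis.det_apply, Int.cast_det, ← Matrix.det_transpose]
    congr 1
    ext i j
    rw [coordMatrix_gram, ← hrepr]
    simp only [Matrix.transpose_apply, Matrix.map_apply, Module.Basis.toMatrix_apply]
    have : β'.repr ((β i : dual q L)) j
        = (b'.restrictScalars ℤ).repr (LinearEquiv.ofEq _ _ hb' (β i : dual q L)) j := by
      simp [hβ']
    simp only [Function.comp_apply]
    rw [this]
    have h4 := b'.restrictScalars_repr_apply ℤ (LinearEquiv.ofEq _ _ hb' (β i : dual q L)) j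
    refine h4.trans ?_
    congr 2
    simp [hβ, Submodule.submoduleOfEquivOfLe]
  have h4 : (Nat.card (Disc q L) : ℝ) = |(coordMatrix V b).det| ^ 2 := by
    have h5 : ((Nat.card (Disc q L) : ℕ) : ℝ) = |((β'.det ((↑) ∘ β) : ℤ) : ℝ)| := by
      rw [← h2, Nat.cast_natAbs, Int.cast_abs]
    rw [h5, h3, Matrix.det_mul, Matrix.det_mul, Matrix.det_transpose, abs_mul, abs_mul,
      abs_det_signMatrix]
    ring
  rw [h4, Real.sqrt_sq (abs_nonneg _), mul_comm, h1]

lemma finite_disc (hL : IsEvenLattice q L) (V : q.IsometryEquiv (stdForm r s)) :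
    Finite (Disc q L) := by
  obtain ⟨b, b', hb, hb', hd, hr⟩ := exists_dual_bases hL V
  have := card_disc_eq hL V hb hb' hd hr
  refine Nat.finite_of_card_ne_zero fun h => ?_
  rw [h] at this
  simp at this

/-- The coordinates of the points of the lattice `L'`. -/
def intSpanEquiv {ι F : Type*} [Fintype ι] [AddCommGroup F] [Module ℝ F]
    (b : Module.Basis ι ℝ F) (Λ : Submodule ℤ F) (h : Λ = Submodule.span ℤ (Set.range b)) :
    (ι → ℤ) ≃ Λ :=
  ((b.restrictScalars ℤ).map (LinearEquiv.ofEq _ _ h.symm)).equivFun.symm.toEquiv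

lemma coe_intSpanEquiv {ι F : Type*} [Fintype ι] [AddCommGroup F] [Module ℝ F]
    (b : Module.Basis ι ℝ F) (Λ : Submodule ℤ F) (h : Λ = Submodule.span ℤ (Set.range b))
    (m : ι → ℤ) : (intSpanEquiv b Λ h m : F) = ∑ i, (m i : ℝ) • b i := by
  simp only [intSpanEquiv, LinearEquiv.coe_toEquiv, Module.Basis.equivFun_symm_apply]
  rw [Submodule.coe_sum]
  refine Finset.sum_congr rfl fun i _ => ?_
  rw [Submodule.coe_smul, Int.cast_smul_eq_zsmul]
  simp

lemma summable_dual (hL : IsEvenLattice q L) (V : q.IsometryEquiv (stdForm r s)) {K : ℕ}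
    (hK : r + s < K) : Summable fun x : dual q L => ((1 + ‖V (x : E)‖) ^ K)⁻¹ := by
  obtain ⟨b, b', hb, hb', hd, hr⟩ := exists_dual_bases hL V
  rw [← (intSpanEquiv b' _ hb').summable_iff]
  refine (summable_lattice (b'.map V.toLinearEquiv) (K := K) (by simpa using hK)).congr fun m => ?_
  rw [Function.comp_apply, coe_intSpanEquiv]
  congr 4
  have : V (∑ i, (m i : ℝ) • b' i) = V.toLinearEquiv (∑ i, (m i : ℝ) • b' i) := rfl
  rw [this, map_sum]
  simp

/-- **Poisson summation** for the lattices `L'` and `L`. -/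
theorem poisson_dual (hL : IsEvenLattice q L) (V : q.IsometryEquiv (stdForm r s))
    {Φ : (Fin r ⊕ Fin s → ℝ) → ℂ} (hc : Continuous Φ) {C : ℝ} {K : ℕ} (hK : r + s < K)
    (hb : ∀ X, ‖Φ X‖ ≤ C * ((1 + ‖X‖) ^ K)⁻¹)
    (hs : Summable fun x : L => ∫ X, Φ X * expi (-(stdBil (V (x : E)) X : ℝ))) :
    ∑' x : dual q L, Φ (V (x : E))
      = Real.sqrt (Nat.card (Disc q L)) * ∑' x : L, ∫ X, Φ X * expi (-(stdBil (V (x : E)) X : ℝ)) := by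
  obtain ⟨b, b', hLb, hLb', hd, hr⟩ := exists_dual_bases hL V
  have hcard := card_disc_eq hL V hLb hLb' hd hr
  have hC : 0 ≤ C := by
    have := (norm_nonneg _).trans (hb 0)
    simpa using this
  set M := coordMatrix V b' with hM
  have hdet : M.det ≠ 0 := by
    intro h
    rw [h] at hcard
    simp at hcard
  have hlin : ∀ a : Fin r ⊕ Fin s → ℝ, V (∑ i, a i • b' i) = M.toLin' a := by
    intro a
    have : V (∑ i, a i • b' i) = V.toLinearEquiv (∑ i, a i • b' i) := rfl
    rw [this, map_sum]
    ext j
    simp only [map_smul, Finset.sum_apply, Pi.smul_apply, smul_eq_mul, Matrix.toLin'_apply,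
      Matrix.mulVec, dotProduct, hM, coordMatrix, Matrix.of_apply]
    exact Finset.sum_congr rfl fun i _ => mul_comm _ _
  have hcont : Continuous M.toLin' := LinearMap.continuous_of_finiteDimensional _
  obtain ⟨c, hc0, hcle⟩ : ∃ c : ℝ, 1 ≤ c ∧ ∀ a, ‖a‖ ≤ c * ‖M.toLin' a‖ := by
    set A := LinearMap.toContinuousLinearMap (M⁻¹).toLin' with hA
    refine ⟨max 1 ‖A‖, le_max_left _ _, fun a => ?_⟩
    have h1 : A (M.toLin' a) = a := by
      rw [hA]
      simp only [LinearMap.coe_toContinuousLinearMap', Matrix.toLin'_apply, Matrix.mulVec_mulVec]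
      rw [Matrix.nonsing_inv_mul _ (isUnit_iff_ne_zero.mpr hdet), Matrix.one_mulVec]
    calc ‖a‖ = ‖A (M.toLin' a)‖ := by rw [h1]
      _ ≤ ‖A‖ * ‖M.toLin' a‖ := A.le_opNorm _
      _ ≤ _ := by gcongr; exact le_max_right _ _
  have hbd : ∀ a, ‖Φ (M.toLin' a)‖ ≤ (C * c ^ K) * ((1 + ‖a‖) ^ K)⁻¹ := by
    intro a
    refine (hb _).trans ?_
    rw [mul_assoc]
    refine mul_le_mul_of_nonneg_left ?_ hC
    rw [← div_eq_mul_inv, inv_eq_one_div, div_le_div_iff₀ (by positivity) (by positivity), one_mul,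
      ← mul_pow]
    gcongr
    nlinarith [hcle a, norm_nonneg (M.toLin' a)]
  have hFT : ∀ m : Fin r ⊕ Fin s → ℤ,
      ∫ a, Φ (M.toLin' a) * expi (-(∑ i, m i * a i : ℝ))
        = Real.sqrt (Nat.card (Disc q L))
          * ∫ X, Φ X * expi (-(stdBil (V (intSpanEquiv b L hLb m : E)) X : ℝ)) := by
    intro m
    have h1 : ∀ a : Fin r ⊕ Fin s → ℝ, ∑ i, m i * a i
        = stdBil (V (intSpanEquiv b L hLb m : E)) (M.toLin' a) := by
      intro a
      rw [← hlin, ← bil_eq_stdBil, coe_intSpanEquiv]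
      simp only [bil, map_sum, map_smul, LinearMap.sum_apply, LinearMap.smul_apply, smul_eq_mul]
      refine Finset.sum_congr rfl fun i _ => ?_
      rw [Finset.sum_eq_single i]
      · have := hd i i
        rw [bil, if_pos rfl] at this
        rw [this]; ring
      · intro j _ hj
        have := hd j i
        rw [bil, if_neg hj] at this
        rw [this]; ring
      · simp
    simp only [h1]
    set h : (Fin r ⊕ Fin s → ℝ) → ℂ := fun X =>
      Φ X * expi (-(stdBil (V (intSpanEquiv b L hLb m : E)) X : ℝ)) with hh
    have hhc : Continuous h := by
      rw [hh]; unfold stdBil; fun_prop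
    change ∫ a, h (M.toLin' a) = _ * ∫ X, h X
    rw [← integral_map (μ := volume) (φ := M.toLin') hcont.measurable.aemeasurable
      hhc.aestronglyMeasurable, Real.map_matrix_volume_pi_eq_smul_volume_pi hdet,
      integral_smul_measure, ENNReal.toReal_ofReal (abs_nonneg _), Complex.real_smul, abs_inv]
    congr 2
    rw [inv_eq_one_div, div_eq_iff (by simpa using hdet), ← hcard, mul_comm]
  have key := poisson_int (Ψ := fun a => Φ (M.toLin' a)) (hc.comp hcont)
    (by simpa using hK) hbd (by
      simp only [hFT]
      exact ((intSpanEquiv b L hLb).summable_iff.mpr hs).mul_left _)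
  rw [← (intSpanEquiv b' _ hLb').tsum_eq, ← (intSpanEquiv b _ hLb).tsum_eq, ← tsum_mul_left]
  simp only [hFT] at key
  rw [← key]
  refine tsum_congr fun m => ?_
  rw [coe_intSpanEquiv, hlin]

end Lattice

/-! ### The theta kernel -/

section Kernel

variable {r s : ℕ}

/-- The summand
`y^{s/2} [e^{-Δ/8πy} p](x⁺) 𝐞(τ Q(x⁺) + τ̄ Q(x⁻))` of the theta function, as a function on
`ℝ^{r,s}`, for a polynomial `p` in the coordinates of `V⁺`. -/
def kern (p : MvPolynomial (Fin r) ℂ) (τ : ℍ) (X : Fin r ⊕ Fin s → ℝ) : ℂ :=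
  ((τ.im ^ ((s : ℝ) / 2) : ℝ) : ℂ)
    * heatEval (1 / (8 * Real.pi * τ.im) : ℝ) (fun i => (X (Sum.inl i) : ℂ)) p
    * expi ((τ : ℂ) * (qPlus X : ℝ) + conj (τ : ℂ) * (qMinus X : ℝ))

/-- The weight `y + 1/y`, whose powers measure growth at both ends of `(0, ∞)`. -/
def growth (y : ℝ) : ℝ := y + y⁻¹

lemma one_le_growth {y : ℝ} (hy : 0 < y) : 1 ≤ growth y := by
  have h : y * y⁻¹ = 1 := mul_inv_cancel₀ hy.ne'
  have h2 : 0 < y⁻¹ := inv_pos.mpr hy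
  unfold growth
  nlinarith [sq_nonneg (y - y⁻¹)]

lemma le_growth {y : ℝ} (hy : 0 < y) : y ≤ growth y := by
  have : 0 < y⁻¹ := inv_pos.mpr hy
  unfold growth; linarith

lemma inv_le_growth {y : ℝ} (hy : 0 < y) : y⁻¹ ≤ growth y := by unfold growth; linarith

lemma rpow_le_growth {y : ℝ} (hy : 0 < y) {a : ℝ} {A : ℕ} (h : |a| ≤ A) :
    y ^ a ≤ growth y ^ A := by
  rw [← Real.rpow_natCast]
  have h1 := one_le_growth hy
  rcases le_total 0 a with ha | ha
  · exact (Real.rpow_le_rpow hy.le (le_growth hy) ha).trans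
      (Real.rpow_le_rpow_of_exponent_le h1 ((le_abs_self a).trans h))
  · rw [show a = -(-a) by ring, Real.rpow_neg hy.le, ← Real.inv_rpow hy.le]
    exact (Real.rpow_le_rpow (inv_pos.mpr hy).le (inv_le_growth hy) (by linarith)).trans
      (Real.rpow_le_rpow_of_exponent_le h1 ((neg_le_abs a).trans h))

lemma norm_sq_le_sum (X : Fin r ⊕ Fin s → ℝ) :
    ‖X‖ ^ 2 ≤ ∑ j, X (Sum.inl j) ^ 2 + ∑ j, X (Sum.inr j) ^ 2 := by
  rw [← Fintype.sum_sum_type fun i => X i ^ 2]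
  have h0 : 0 ≤ ∑ i, X i ^ 2 := Finset.sum_nonneg fun i _ => sq_nonneg _
  have h : ‖X‖ ≤ Real.sqrt (∑ i, X i ^ 2) := by
    rw [pi_norm_le_iff_of_nonneg (Real.sqrt_nonneg _)]
    intro i
    rw [Real.norm_eq_abs, ← Real.sqrt_sq_eq_abs]
    exact Real.sqrt_le_sqrt (Finset.single_le_sum (f := fun i => X i ^ 2)
      (fun i _ => sq_nonneg _) (Finset.mem_univ i))
  calc ‖X‖ ^ 2 ≤ Real.sqrt (∑ i, X i ^ 2) ^ 2 := by gcongr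
    _ = _ := Real.sq_sqrt h0

lemma norm_expi_kern (τ : ℍ) (X : Fin r ⊕ Fin s → ℝ) :
    ‖expi ((τ : ℂ) * (qPlus X : ℝ) + conj (τ : ℂ) * (qMinus X : ℝ))‖
      = Real.exp (-(Real.pi * τ.im * (∑ j, X (Sum.inl j) ^ 2 + ∑ j, X (Sum.inr j) ^ 2))) := by
  rw [norm_expi]
  congr 1
  simp only [Complex.add_im, Complex.mul_im, Complex.ofReal_im, Complex.ofReal_re, mul_zero,
    Complex.conj_im, Complex.conj_re, coe_im, qPlus, qMinus, zero_add]
  ring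

/-- Gaussian decay dominates polynomial growth, uniformly in the width. -/
lemma one_add_pow_mul_exp_le (M : ℕ) {y R : ℝ} (hy : 0 < y) (hR : 0 ≤ R) :
    (1 + R) ^ M * Real.exp (-(Real.pi * y * R ^ 2))
      ≤ (2 ^ M * M.factorial * Real.exp 1) * growth y ^ M := by
  have hg := one_le_growth hy
  have h1 : 1 + R ≤ (1 + R) ^ 2 := by nlinarith
  have h2 : (1 + R) ^ 2 ≤ 2 * growth y * (1 + y * R ^ 2) := by
    have h3 : R ^ 2 ≤ growth y * (y * R ^ 2) := by
      have : 1 ≤ growth y * y := by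
        unfold growth
        have := inv_mul_cancel₀ hy.ne'
        nlinarith
      nlinarith [sq_nonneg R]
    nlinarith [sq_nonneg (R - 1)]
  have h3 : (1 + y * R ^ 2) ^ M ≤ M.factorial * Real.exp (1 + y * R ^ 2) := by
    have := Real.pow_div_factorial_le_exp (1 + y * R ^ 2) (by positivity) M
    rw [div_le_iff₀ (by positivity)] at this
    exact this.trans_eq (mul_comm _ _)
  have h4 : Real.exp (1 + y * R ^ 2) * Real.exp (-(Real.pi * y * R ^ 2)) ≤ Real.exp 1 := by
    rw [← Real.exp_add]
    refine Real.exp_le_exp.mpr ?_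
    have := Real.pi_gt_three
    have : 0 ≤ y * R ^ 2 := by positivity
    nlinarith
  calc (1 + R) ^ M * Real.exp (-(Real.pi * y * R ^ 2))
      ≤ (2 * growth y * (1 + y * R ^ 2)) ^ M * Real.exp (-(Real.pi * y * R ^ 2)) := by
        gcongr; exact h1.trans h2
    _ = 2 ^ M * growth y ^ M * ((1 + y * R ^ 2) ^ M * Real.exp (-(Real.pi * y * R ^ 2))) := by
        rw [mul_pow, mul_pow]; ring
    _ ≤ 2 ^ M * growth y ^ M * (M.factorial * Real.exp 1) := by
        refine mul_le_mul_of_nonneg_left ?_ (by positivity)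
        calc _ ≤ (M.factorial * Real.exp (1 + y * R ^ 2)) * Real.exp (-(Real.pi * y * R ^ 2)) := by
              exact mul_le_mul_of_nonneg_right h3 (Real.exp_pos _).le
          _ ≤ _ := by
              rw [mul_assoc]
              exact mul_le_mul_of_nonneg_left h4 (Nat.cast_nonneg _)
    _ = _ := by ring

/-- The kernel decays faster than any power of `‖X‖`, at a polynomial cost in `y + 1/y`. -/
lemma norm_kern_le (p : MvPolynomial (Fin r) ℂ) (K : ℕ) : ∃ (C : ℝ) (B : ℕ), 0 ≤ C ∧
    ∀ (τ : ℍ) (X : Fin r ⊕ Fin s → ℝ),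
      ‖kern p τ X‖ ≤ C * growth τ.im ^ B * ((1 + ‖X‖) ^ K)⁻¹ := by
  obtain ⟨C, A, hC, h⟩ := norm_heatEval_le p
  refine ⟨C * 2 ^ A * (2 ^ (A + K) * (A + K).factorial * Real.exp 1), s + A + (A + K),
    by positivity, fun τ X => ?_⟩
  have hy := τ.im_pos
  have hg := one_le_growth hy
  have h1 := h (1 / (8 * Real.pi * τ.im) : ℝ) (fun i => (X (Sum.inl i) : ℂ)) ‖X‖
    (fun i => by rw [Complex.norm_real]; exact norm_le_pi_norm X _) (norm_nonneg _)
  have h2 : 1 + ‖((1 / (8 * Real.pi * τ.im) : ℝ) : ℂ)‖ ≤ 2 * growth τ.im := by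
    rw [Complex.norm_real, Real.norm_of_nonneg (by positivity)]
    have : 1 / (8 * Real.pi * τ.im) ≤ τ.im⁻¹ := by
      rw [one_div]
      refine inv_anti₀ hy ?_
      nlinarith [Real.pi_gt_three]
    linarith [inv_le_growth hy]
  have h3 : Real.exp (-(Real.pi * τ.im * (∑ j, X (Sum.inl j) ^ 2 + ∑ j, X (Sum.inr j) ^ 2)))
      ≤ Real.exp (-(Real.pi * τ.im * ‖X‖ ^ 2)) := by
    refine Real.exp_le_exp.mpr (neg_le_neg ?_)
    exact mul_le_mul_of_nonneg_left (norm_sq_le_sum X) (by positivity)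
  have h4 := one_add_pow_mul_exp_le (A + K) hy (norm_nonneg X)
  have h5 : τ.im ^ ((s : ℝ) / 2) ≤ growth τ.im ^ s := by
    refine rpow_le_growth hy ?_
    rw [abs_of_nonneg (by positivity)]
    linarith [(Nat.cast_nonneg s : (0 : ℝ) ≤ s)]
  rw [kern, norm_mul, norm_mul, norm_expi_kern, Complex.norm_real,
    Real.norm_of_nonneg (by positivity), ← div_eq_mul_inv, le_div_iff₀ (by positivity)]
  calc τ.im ^ ((s : ℝ) / 2) * ‖heatEval (1 / (8 * Real.pi * τ.im) : ℝ) _ p‖ * Real.exp _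
        * (1 + ‖X‖) ^ K
      ≤ growth τ.im ^ s * (C * ((2 * growth τ.im) ^ A * (1 + ‖X‖) ^ A))
        * Real.exp (-(Real.pi * τ.im * ‖X‖ ^ 2)) * (1 + ‖X‖) ^ K := by
        gcongr
        exact h1.trans (by gcongr)
    _ = growth τ.im ^ s * C * 2 ^ A * growth τ.im ^ A
        * ((1 + ‖X‖) ^ (A + K) * Real.exp (-(Real.pi * τ.im * ‖X‖ ^ 2))) := by
        rw [mul_pow, pow_add]; ring
    _ ≤ growth τ.im ^ s * C * 2 ^ A * growth τ.im ^ A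
        * ((2 ^ (A + K) * (A + K).factorial * Real.exp 1) * growth τ.im ^ (A + K)) := by
        gcongr
    _ = _ := by rw [pow_add, pow_add]; ring

lemma continuous_kern (p : MvPolynomial (Fin r) ℂ) :
    Continuous fun u : ℍ × (Fin r ⊕ Fin s → ℝ) => kern p u.1 u.2 := by
  have him : Continuous fun u : ℍ × (Fin r ⊕ Fin s → ℝ) => u.1.im :=
    UpperHalfPlane.continuous_im.comp continuous_fst
  have hco : Continuous fun u : ℍ × (Fin r ⊕ Fin s → ℝ) => (u.1 : ℂ) :=
    UpperHalfPlane.continuous_coe.comp continuous_fst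
  unfold kern qPlus qMinus
  refine (Continuous.mul ?_ ?_).mul ?_
  · exact Complex.continuous_ofReal.comp
      (him.rpow_const fun u => Or.inl u.1.im_pos.ne')
  · refine (continuous_heatEval p).comp (f := fun u : ℍ × (Fin r ⊕ Fin s → ℝ) =>
      (((1 / (8 * Real.pi * u.1.im) : ℝ) : ℂ), fun i => (u.2 (Sum.inl i) : ℂ))) ?_
    refine Continuous.prodMk ?_ (by fun_prop)
    refine Complex.continuous_ofReal.comp (continuous_const.div (by fun_prop) fun u => ?_)
    have := u.1.im_pos
    positivity
  · refine continuous_expi.comp ((hco.mul ?_).add ((Complex.continuous_conj.comp hco).mul ?_))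
    · fun_prop
    · fun_prop

lemma kern_neg {k : ℕ} {p : MvPolynomial (Fin r) ℂ} (hp : p.IsHomogeneous k) (τ : ℍ)
    (X : Fin r ⊕ Fin s → ℝ) : kern p τ (-X) = (-1) ^ k * kern p τ X := by
  have h := heatEval_smul (-1) ((1 / (8 * Real.pi * τ.im) : ℝ) : ℂ)
    (fun i => (X (Sum.inl i) : ℂ)) hp
  simp only [kern, qPlus, qMinus, Pi.neg_apply, neg_sq, Complex.ofReal_neg]
  rw [neg_one_sq, one_mul] at h
  simp only [neg_one_mul] at h
  rw [h]
  ring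

lemma kern_T (p : MvPolynomial (Fin r) ℂ) (τ : ℍ) (X : Fin r ⊕ Fin s → ℝ) :
    kern p (ModularGroup.T • τ) X = kern p τ X * expi (stdForm r s X : ℝ) := by
  have him : (ModularGroup.T • τ).im = τ.im := by
    rw [ModularGroup.im_T_smul]
  have hco : ((ModularGroup.T • τ : ℍ) : ℂ) = τ + 1 := by
    rw [modular_T_smul, coe_vadd]; push_cast; ring
  rw [kern, kern, him, hco, mul_assoc _ _ (expi ((stdForm r s X : ℝ) : ℂ)), ← expi_add]
  congr 2
  rw [stdForm_eq_qPlus_add_qMinus, map_add, map_one]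
  push_cast
  ring

/-- The Fourier transform of a product of Hermite polynomials and two Gaussians. -/
lemma integral_heatEval_gaussian (p : MvPolynomial (Fin r) ℂ) (t : ℂ) {b₁ b₂ : ℂ} (h₁ : 0 < b₁.re)
    (h₂ : 0 < b₂.re) (ξ : Fin r ⊕ Fin s → ℝ) :
    ∫ X : Fin r ⊕ Fin s → ℝ, heatEval t (fun i => (X (Sum.inl i) : ℂ)) p
      * Complex.exp (∑ i, (-b₁ * (X (Sum.inl i) : ℂ) ^ 2
            - 2 * Real.pi * Complex.I * ξ (Sum.inl i) * X (Sum.inl i))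
          + ∑ i, (-b₂ * (X (Sum.inr i) : ℂ) ^ 2
            - 2 * Real.pi * Complex.I * ξ (Sum.inr i) * X (Sum.inr i)))
    = heatEval (t - 1 / (4 * b₁)) (fun i => -(Complex.I * Real.pi * ξ (Sum.inl i)) / b₁) p
      * (((Real.pi / b₁) ^ (1 / 2 : ℂ)) ^ r
        * Complex.exp (∑ i, -(Real.pi ^ 2 * (ξ (Sum.inl i) : ℂ) ^ 2) / b₁))
      * (((Real.pi / b₂) ^ (1 / 2 : ℂ)) ^ s
        * Complex.exp (∑ i, -(Real.pi ^ 2 * (ξ (Sum.inr i) : ℂ) ^ 2) / b₂)) := by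
  set F : (Fin r →₀ ℕ) → (i : Fin r ⊕ Fin s) → ℝ → ℂ := fun e i x =>
    Sum.elim (fun i => heatMonomial t x (e i)
        * Complex.exp (-b₁ * (x : ℂ) ^ 2 - 2 * Real.pi * Complex.I * ξ (Sum.inl i) * x))
      (fun i => heatMonomial t x 0
        * Complex.exp (-b₂ * (x : ℂ) ^ 2 - 2 * Real.pi * Complex.I * ξ (Sum.inr i) * x)) i with hF
  have hFi : ∀ e i, Integrable (F e i) := by
    rintro e (i | i)
    · exact integrable_heatMonomial_gaussian t h₁ _ _
    · exact integrable_heatMonomial_gaussian t h₂ _ _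
  have h1 : ∀ X : Fin r ⊕ Fin s → ℝ, heatEval t (fun i => (X (Sum.inl i) : ℂ)) p
      * Complex.exp (∑ i, (-b₁ * (X (Sum.inl i) : ℂ) ^ 2
            - 2 * Real.pi * Complex.I * ξ (Sum.inl i) * X (Sum.inl i))
          + ∑ i, (-b₂ * (X (Sum.inr i) : ℂ) ^ 2
            - 2 * Real.pi * Complex.I * ξ (Sum.inr i) * X (Sum.inr i)))
      = ∑ e ∈ p.support, p.coeff e * ∏ i, F e i (X i) := by
    intro X
    rw [heatEval_eq_sum, Finset.sum_mul, Complex.exp_add, Complex.exp_sum, Complex.exp_sum]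
    refine Finset.sum_congr rfl fun e _ => ?_
    rw [Fintype.prod_sum_type]
    simp only [hF, Sum.elim_inl, Sum.elim_inr, heatMonomial_zero, one_mul,
      Finset.prod_mul_distrib]
    ring
  simp only [h1]
  have hFp : ∀ e, Integrable (fun X : Fin r ⊕ Fin s → ℝ => p.coeff e * ∏ i, F e i (X i)) volume :=
    fun e => (Integrable.fintype_prod (hFi e)).const_mul _
  rw [integral_finsetSum _ fun e _ => hFp e, heatEval_eq_sum, Finset.sum_mul, Finset.sum_mul]
  refine Finset.sum_congr rfl fun e _ => ?_
  rw [integral_const_mul, integral_fintype_prod_volume_eq_prod, Fintype.prod_sum_type]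
  simp only [hF, Sum.elim_inl, Sum.elim_inr]
  simp only [integral_heatMonomial_gaussian t h₁, integral_heatMonomial_gaussian t h₂]
  simp only [heatMonomial_zero, one_mul, Finset.prod_mul_distrib, Finset.prod_const, Finset.card_univ,
    Fintype.card_fin, Complex.exp_sum]
  ring

/-- The square root of `-iτ`, in the right half plane. -/
def sqrtI (τ : ℍ) : ℂ := (-Complex.I * τ) ^ (1 / 2 : ℂ)

lemma sqrtI_sq (τ : ℍ) : sqrtI τ ^ 2 = -Complex.I * τ := by
  rw [sqrtI, ← Complex.cpow_nat_mul]; simp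

lemma norm_sqrtI_sq (τ : ℍ) : ‖sqrtI τ‖ ^ 2 = ‖(τ : ℂ)‖ := by
  rw [← norm_pow, sqrtI_sq]; simp

/-- The Fourier transform of the kernel at `Sτ = -1/τ`. -/
lemma integral_kern_S {k : ℕ} {p : MvPolynomial (Fin r) ℂ} (hp : p.IsHomogeneous k) (τ : ℍ)
    (ξ : Fin r ⊕ Fin s → ℝ) :
    ∫ X, kern p (ModularGroup.S • τ) X * expi (-(stdBil ξ X : ℝ))
      = (-(τ : ℂ)) ^ k * sqrtI τ ^ r * conj (sqrtI τ) ^ s / (‖(τ : ℂ)‖ ^ s : ℝ) * kern p τ ξ := by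
  have hτ : (τ : ℂ) ≠ 0 := τ.ne_zero
  have hy := τ.im_pos
  have hS : ((ModularGroup.S • τ : ℍ) : ℂ) = (-(τ : ℂ))⁻¹ := by
    rw [modular_S_smul]
  have hSy : (ModularGroup.S • τ).im = τ.im / ‖(τ : ℂ)‖ ^ 2 := by
    rw [← coe_im, hS, Complex.inv_im, Complex.normSq_neg, Complex.normSq_eq_norm_sq]; simp
  set y := τ.im with hy_def
  set y' := (ModularGroup.S • τ).im with hy'_def
  have hy' : 0 < y' := (ModularGroup.S • τ).im_pos
  have hn : 0 < ‖(τ : ℂ)‖ := norm_pos_iff.mpr hτ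
  -- the kernel at `-1/τ` is a product of Gaussians `exp(-b₁x²)` on `V⁺` and `exp(-b₂x²)` on `V⁻`
  set b₁ : ℂ := Real.pi * Complex.I / τ with hb₁
  set b₂ : ℂ := conj b₁ with hb₂
  have hb₁re : 0 < b₁.re := by
    have : b₁.re = Real.pi * y' := by
      rw [hb₁, hSy, Complex.div_re, Complex.normSq_eq_norm_sq]
      simp [hy_def]
      ring
    rw [this]; positivity
  have hb₂re : 0 < b₂.re := by rw [hb₂, Complex.conj_re]; exact hb₁re
  have hb₁0 : b₁ ≠ 0 := by rintro h; rw [h] at hb₁re; simp at hb₁re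
  have hI := Complex.I_ne_zero
  have hpi : (Real.pi : ℂ) ≠ 0 := by exact_mod_cast Real.pi_ne_zero
  have hnsq : ((‖(τ : ℂ)‖ : ℂ)) ^ 2 = τ * conj (τ : ℂ) := by
    rw [Complex.mul_conj, Complex.normSq_eq_norm_sq]; push_cast; rfl
  have hyI : 2 * Complex.I * (y : ℂ) = τ - conj (τ : ℂ) := by
    rw [Complex.sub_conj, coe_im]; push_cast; ring
  have hbinv : Real.pi / b₁ = -Complex.I * τ := by
    rw [hb₁]; field_simp; rw [Complex.I_sq]; ring
  have hbinv₂ : Real.pi / b₂ = conj (-Complex.I * (τ : ℂ)) := by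
    rw [← hbinv, map_div₀, Complex.conj_ofReal, hb₂]
  have harg : Complex.arg (-Complex.I * (τ : ℂ)) ≠ Real.pi := by
    intro h
    rw [Complex.arg_eq_pi_iff] at h
    have : (-Complex.I * (τ : ℂ)).re = y := by simp [hy_def]
    rw [this] at h
    linarith [h.1]
  have hsq₂ : (Real.pi / b₂) ^ (1 / 2 : ℂ) = conj (sqrtI τ) := by
    rw [hbinv₂, Complex.conj_cpow _ _ harg, sqrtI]
    simp [Complex.conj_ofNat]
  set ξ' : Fin r ⊕ Fin s → ℝ :=
    Sum.elim (fun i => ξ (Sum.inl i)) (fun i => -ξ (Sum.inr i)) with hξ'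
  have hint : ∀ X : Fin r ⊕ Fin s → ℝ,
      kern p (ModularGroup.S • τ) X * expi (-(stdBil ξ X : ℝ))
      = ((y' ^ ((s : ℝ) / 2) : ℝ) : ℂ) *
        (heatEval ((1 / (8 * Real.pi * y') : ℝ) : ℂ) (fun i => (X (Sum.inl i) : ℂ)) p
        * Complex.exp (∑ i, (-b₁ * (X (Sum.inl i) : ℂ) ^ 2
            - 2 * Real.pi * Complex.I * ξ' (Sum.inl i) * X (Sum.inl i))
          + ∑ i, (-b₂ * (X (Sum.inr i) : ℂ) ^ 2
            - 2 * Real.pi * Complex.I * ξ' (Sum.inr i) * X (Sum.inr i)))) := by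
    intro X
    rw [kern, mul_assoc, mul_assoc, mul_assoc, ← expi_add]
    congr 2
    rw [expi]
    congr 1
    rw [hS]
    simp only [qPlus, qMinus, stdBil, Finset.sum_sub_distrib, hξ', Sum.elim_inl, Sum.elim_inr,
      hb₁, hb₂, map_div₀, map_mul, Complex.conj_ofReal, Complex.conj_I, map_inv₀, map_neg]
    push_cast
    simp only [mul_assoc, ← Finset.mul_sum, neg_mul, Finset.sum_neg_distrib, mul_neg]
    have hτ' : conj (τ : ℂ) ≠ 0 := (map_ne_zero _).mpr hτ
    field_simp
    ring
  simp only [hint]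
  rw [integral_const_mul, integral_heatEval_gaussian p _ hb₁re hb₂re, hbinv, hsq₂]
  -- the parameter of the transformed heat operator is the one at `τ`, up to the factor `τ²`, which
  -- the homogeneity of `p` absorbs
  have ht : ((1 / (8 * Real.pi * y') : ℝ) : ℂ) - 1 / (4 * b₁)
      = (-(τ : ℂ)) ^ 2 * ((1 / (8 * Real.pi * y) : ℝ) : ℂ) := by
    have hyc : (y : ℂ) ≠ 0 := by exact_mod_cast hy.ne'
    have hnc : (‖(τ : ℂ)‖ : ℂ) ≠ 0 := by exact_mod_cast hn.ne'
    rw [hSy, hb₁]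
    push_cast
    have h1 : (1 : ℂ) / (8 * Real.pi * (y / (‖(τ : ℂ)‖ : ℂ) ^ 2))
        = τ * conj (τ : ℂ) / (8 * Real.pi * y) := by
      rw [← hnsq]; field_simp
    rw [h1]
    have h2 : conj (τ : ℂ) = τ - 2 * Complex.I * y := by rw [hyI]; ring
    rw [h2]
    have h3 : (1 : ℂ) / (4 * (Real.pi * Complex.I / τ)) = -(Complex.I * τ) / (4 * Real.pi) := by
      field_simp
      rw [Complex.I_sq]; ring
    rw [h3]
    field_simp
    ring
  have hx : (fun i : Fin r => -(Complex.I * Real.pi * ξ' (Sum.inl i)) / b₁)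
      = fun i => -(τ : ℂ) * (ξ (Sum.inl i) : ℂ) := by
    funext i
    rw [hb₁, hξ', Sum.elim_inl]
    field_simp
  rw [ht, hx, heatEval_smul _ _ _ hp]
  have hexp : Complex.exp (∑ i, -(Real.pi ^ 2 * (ξ' (Sum.inl i) : ℂ) ^ 2) / b₁)
      * Complex.exp (∑ i, -(Real.pi ^ 2 * (ξ' (Sum.inr i) : ℂ) ^ 2) / b₂)
      = expi ((τ : ℂ) * (qPlus ξ : ℝ) + conj (τ : ℂ) * (qMinus ξ : ℝ)) := by
    rw [← Complex.exp_add, expi]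
    congr 1
    have e1 : ∀ x : ℂ, -(Real.pi ^ 2 * x) / b₁ = Complex.I * Real.pi * τ * x := by
      intro x
      have : -(Real.pi ^ 2 * x) / b₁ = -(Real.pi * x) * (Real.pi / b₁) := by ring
      rw [this, hbinv]; ring
    have e2 : ∀ x : ℂ, -(Real.pi ^ 2 * x) / b₂ = -(Complex.I * Real.pi * conj (τ : ℂ) * x) := by
      intro x
      have : -(Real.pi ^ 2 * x) / b₂ = -(Real.pi * x) * (Real.pi / b₂) := by ring
      rw [this, hbinv₂, map_mul, map_neg, Complex.conj_I]; ring
    simp only [e1, e2, hξ', Sum.elim_inl, Sum.elim_inr, ← Finset.mul_sum, Finset.sum_neg_distrib,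
      qPlus, qMinus]
    push_cast
    simp only [neg_sq]
    ring
  have hpow : ((y' ^ ((s : ℝ) / 2) : ℝ) : ℂ)
      = ((y ^ ((s : ℝ) / 2) : ℝ) : ℂ) / (‖(τ : ℂ)‖ ^ s : ℝ) := by
    rw [← Complex.ofReal_div]
    congr 1
    rw [hSy, Real.div_rpow hy.le (by positivity), ← Real.rpow_natCast ‖(τ : ℂ)‖ 2,
      ← Real.rpow_mul hn.le]
    congr 1
    rw [← Real.rpow_natCast]
    congr 1
    push_cast
    ring
  rw [hpow, kern, ← hexp, ← sqrtI]
  ring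

end Kernel

/-! ### Vector-valued cusp forms: transformation under the generators, growth, coefficients -/

section CuspForms

variable {r s : ℕ} {E : Type*} [AddCommGroup E] [Module ℝ E] {q : QuadraticForm ℝ E}
  {L : Submodule ℤ E} {sig w : ℤ} {f : ℍ → Disc q L → ℂ}

/-- The character value `𝐞((x, y))` for `x, y ∈ L'` depends only on the class of `x`. -/
lemma expi_bil_congr {x x' y : dual q L} (h : cls q L x = cls q L x') :
    expi (bil q (x : E) (y : E) : ℝ) = expi (bil q (x' : E) (y : E) : ℝ) := by
  have h1 : (x : E) - (x' : E) ∈ L := by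
    have := (Submodule.Quotient.eq _).mp h
    exact this
  obtain ⟨n, hn⟩ := exists_int_bil y.2 h1
  have h2 : bil q (x : E) (y : E) = bil q (x' : E) (y : E) + n := by
    rw [← hn, IsotropicData.bil_comm q (y : E), ← IsotropicData.bil_add_left]
    congr 2
    module
  rw [h2]
  push_cast
  rw [expi_add_int]

lemma out_cls (γ : Disc q L) : cls q L γ.out = γ := Quotient.out_eq γ

lemma exists_cls (γ : Disc q L) : ∃ x : dual q L, cls q L x = γ := ⟨γ.out, out_cls γ⟩

lemma _root_.Module.End.apply_eq_sum {ι : Type*} [Fintype ι] [DecidableEq ι]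
    (A : Module.End ℂ (ι → ℂ)) (v : ι → ℂ) (x : ι) :
    A v x = ∑ γ, v γ * A (Pi.single γ 1) x := by
  conv_lhs => rw [pi_eq_sum_univ' v, map_sum]
  simp

lemma IsCuspForm.map_T [Fintype (Disc q L)] (hf : IsCuspForm q L sig w f) (τ : ℍ)
    (x : dual q L) :
    f (ModularGroup.T • τ) (cls q L x) = expi (q (x : E) : ℝ) * f τ (cls q L x) := by
  classical
  obtain ⟨ρ, ⟨hT, -⟩, h⟩ := hf.modular
  have h1 := congrFun (h Mp2Z.T τ) (cls q L x)
  have h3 : Mp2Z.T.mat • τ = ModularGroup.T • τ := rfl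
  have h4 : Mp2Z.T.phi τ = 1 := rfl
  rw [h3, h4, one_zpow, one_smul, Module.End.apply_eq_sum,
    Finset.sum_eq_single (cls q L x)] at h1
  · rw [h1, hT]
    simp [mul_comm]
  · intro γ _ hγ
    obtain ⟨y, rfl⟩ := exists_cls γ
    rw [hT, Pi.smul_apply, Pi.single_eq_of_ne (Ne.symm hγ), smul_zero, mul_zero]
  · simp

lemma IsCuspForm.map_S [Fintype (Disc q L)] (hf : IsCuspForm q L sig w f) (τ : ℍ)
    (x : dual q L) :
    f (ModularGroup.S • τ) (cls q L x)
      = ((τ : ℂ) ^ (1 / 2 : ℂ)) ^ w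
        * (expi (-(sig : ℂ) / 8) / (Real.sqrt (Nat.card (Disc q L)) : ℂ))
        * ∑ γ : Disc q L, expi (-(bil q (γ.out : E) (x : E) : ℝ)) * f τ γ := by
  classical
  obtain ⟨ρ, ⟨-, hS⟩, h⟩ := hf.modular
  have h1 := congrFun (h Mp2Z.S τ) (cls q L x)
  have h3 : Mp2Z.S.mat • τ = ModularGroup.S • τ := rfl
  have h4 : Mp2Z.S.phi τ = (τ : ℂ) ^ (1 / 2 : ℂ) := rfl
  rw [h3, h4, Pi.smul_apply, Module.End.apply_eq_sum, smul_eq_mul] at h1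
  rw [h1, mul_assoc]
  congr 1
  rw [Finset.mul_sum]
  refine Finset.sum_congr rfl fun γ _ => ?_
  have h5 := hS γ.out x
  rw [out_cls] at h5
  have h6 : ρ Mp2Z.S (Pi.single γ 1) (cls q L x)
      = expi (-(sig : ℂ) / 8) / (Real.sqrt (Nat.card (Disc q L)) : ℂ)
        * expi (-(bil q (γ.out : E) (x : E) : ℝ)) := by
    convert h5 using 2
  rw [h6]
  ring

open Classical in
/-- Orthogonality of the characters of the discriminant group. -/
lemma sum_expi_bil_out [Fintype (Disc q L)] (hL : IsEvenLattice q L)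
    (V : q.IsometryEquiv (stdForm r s)) (γ γ' : Disc q L) :
    ∑ δ : Disc q L, expi (-(bil q (γ.out : E) (δ.out : E) : ℝ))
        * conj (expi (-(bil q (γ'.out : E) (δ.out : E) : ℝ)))
      = if γ = γ' then (Nat.card (Disc q L) : ℂ) else 0 := by
  have hterm : ∀ δ : Disc q L, expi (-(bil q (γ.out : E) (δ.out : E) : ℝ))
        * conj (expi (-(bil q (γ'.out : E) (δ.out : E) : ℝ)))
      = expi (bil q (δ.out : E) ((γ'.out - γ.out : dual q L) : E) : ℝ) := by
    intro δ
    rw [conj_expi, ← expi_add]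
    congr 1
    simp only [map_neg, Complex.conj_ofReal, neg_neg]
    rw [← Complex.ofReal_neg, ← Complex.ofReal_add]
    congr 1
    rw [IsotropicData.bil_comm q (δ.out : E), sub_eq_add_neg, Submodule.coe_add,
      IsotropicData.bil_add_left, Submodule.coe_neg, ← neg_one_smul ℝ ((γ.out : dual q L) : E),
      IsotropicData.bil_smul_left]
    ring
  simp only [hterm]
  split_ifs with h
  · rw [h, sub_self]
    simp [bil, Nat.card_eq_fintype_card]
  · set x : dual q L := γ'.out - γ.out with hx
    -- the character is nontrivial because the bidual of `L` is `L`
    obtain ⟨δ₀, hδ₀⟩ : ∃ δ₀ : dual q L, expi (bil q (δ₀ : E) (x : E) : ℝ) ≠ 1 := by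
      by_contra hcon
      push Not at hcon
      obtain ⟨m, b, hb⟩ := hL.exists_basis
      have hxL : (x : E) ∈ L := by
        have hbi := LinearMap.BilinForm.dualSubmodule_dualSubmodule_of_basis (R := ℤ) _
          (polarBilin_nondegenerate V) ⟨(polarBilin_isSymm q).eq⟩ b
        rw [← hb] at hbi
        refine hbi.le fun y hy => ?_
        have h1 := hcon ⟨y, hy⟩
        rw [expi, Complex.exp_eq_one_iff] at h1
        obtain ⟨n, hn⟩ := h1
        rw [Submodule.mem_one]
        refine ⟨n, ?_⟩
        have h2 : ((bil q y (x : E) : ℝ) : ℂ) = n := by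
          have h3 : (2 * Real.pi * Complex.I : ℂ) ≠ 0 := Complex.two_pi_I_ne_zero
          apply mul_left_cancel₀ h3
          rw [hn]; ring
        have h3 : bil q y (x : E) = n := by exact_mod_cast h2
        rw [IsotropicData.bil_comm] at h3
        rw [bil] at h3
        rw [h3]; simp
      refine h ?_
      rw [← out_cls γ, ← out_cls γ']
      refine ((Submodule.Quotient.eq _).mpr ?_).symm
      exact hxL
    set S : ℂ := ∑ δ : Disc q L, expi (bil q (δ.out : E) (x : E) : ℝ) with hS
    have h1 : expi (bil q (δ₀ : E) (x : E) : ℝ) * S = S := by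
      rw [hS, Finset.mul_sum]
      refine Eq.trans (Finset.sum_congr rfl fun δ _ => ?_)
        (Equiv.sum_comp (Equiv.addLeft (cls q L δ₀)) fun δ : Disc q L =>
          expi (bil q (δ.out : E) (x : E) : ℝ))
      rw [← expi_add, ← Complex.ofReal_add, ← IsotropicData.bil_add_left, ← Submodule.coe_add]
      refine expi_bil_congr ?_
      have h2 : cls q L (δ₀ + δ.out) = cls q L δ₀ + cls q L δ.out := map_add _ _ _
      rw [h2, out_cls, out_cls]
      rfl
    have h2 : (expi (bil q (δ₀ : E) (x : E) : ℝ) - 1) * S = 0 := by rw [sub_mul, h1]; ring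
    exact (mul_eq_zero.mp h2).resolve_left (sub_ne_zero.mpr hδ₀)

/-- `∑_γ |f_γ(τ)|² y^ν`. -/
def normSqForm [Fintype (Disc q L)] (w : ℤ) (f : ℍ → Disc q L → ℂ) (τ : ℍ) : ℝ :=
  (∑ γ, ‖f τ γ‖ ^ 2) * τ.im ^ ((w : ℝ) / 2)

lemma normSqForm_T [Fintype (Disc q L)] (hf : IsCuspForm q L sig w f) (τ : ℍ) :
    normSqForm w f (ModularGroup.T • τ) = normSqForm w f τ := by
  rw [normSqForm, normSqForm, ModularGroup.im_T_smul]
  congr 1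
  refine Finset.sum_congr rfl fun γ _ => ?_
  obtain ⟨x, rfl⟩ := exists_cls γ
  rw [hf.map_T, norm_mul, norm_expi_real, one_mul]

lemma im_S_smul (τ : ℍ) : (ModularGroup.S • τ).im = τ.im / ‖(τ : ℂ)‖ ^ 2 := by
  have hS : ((ModularGroup.S • τ : ℍ) : ℂ) = (-(τ : ℂ))⁻¹ := by
    rw [modular_S_smul]
  rw [← coe_im, hS, Complex.inv_im, Complex.normSq_neg, Complex.normSq_eq_norm_sq]; simp

/-- The invariance under `S`: the matrix of `ρ_L(S)` is unitary, by the orthogonality of the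
characters of the discriminant group. -/
lemma normSqForm_S [Fintype (Disc q L)] (hL : IsEvenLattice q L)
    (V : q.IsometryEquiv (stdForm r s)) (hf : IsCuspForm q L sig w f) (τ : ℍ) :
    normSqForm w f (ModularGroup.S • τ) = normSqForm w f τ := by
  classical
  have hcard : 0 < (Nat.card (Disc q L) : ℝ) := by
    have : Nat.card (Disc q L) ≠ 0 := Nat.card_ne_zero.mpr ⟨⟨0⟩, inferInstance⟩
    positivity
  have hn : 0 < ‖(τ : ℂ)‖ := norm_pos_iff.mpr τ.ne_zero
  have hphi : ‖((τ : ℂ) ^ (1 / 2 : ℂ)) ^ w‖ ^ 2 = ‖(τ : ℂ)‖ ^ w := by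
    rw [norm_zpow, ← zpow_natCast, ← zpow_mul, mul_comm, zpow_mul, zpow_natCast, ← norm_pow,
      ← Complex.cpow_nat_mul]
    simp
  have h1 : ∀ γ : Disc q L, f (ModularGroup.S • τ) γ
      = ((τ : ℂ) ^ (1 / 2 : ℂ)) ^ w
        * (expi (-(sig : ℂ) / 8) / (Real.sqrt (Nat.card (Disc q L)) : ℂ))
        * ∑ δ : Disc q L, expi (-(bil q (δ.out : E) (γ.out : E) : ℝ)) * f τ δ := by
    intro γ
    rw [← hf.map_S, out_cls]
  have hsq : ∀ z : ℂ, ((‖z‖ ^ 2 : ℝ) : ℂ) = z * conj z := fun z => by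
    rw [Complex.mul_conj, Complex.normSq_eq_norm_sq]
  have h2 : ∑ γ : Disc q L, ‖∑ δ : Disc q L, expi (-(bil q (δ.out : E) (γ.out : E) : ℝ)) * f τ δ‖ ^ 2
      = Nat.card (Disc q L) * ∑ γ, ‖f τ γ‖ ^ 2 := by
    apply Complex.ofReal_injective
    push_cast
    simp only [← Complex.ofReal_pow, hsq, map_sum, Finset.sum_mul_sum, map_mul]
    rw [Finset.sum_comm]
    have h3 : ∀ δ : Disc q L, ∑ γ : Disc q L, ∑ δ' : Disc q L,
        expi (-(bil q (δ.out : E) (γ.out : E) : ℝ)) * f τ δ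
          * (conj (expi (-(bil q (δ'.out : E) (γ.out : E) : ℝ))) * conj (f τ δ'))
        = Nat.card (Disc q L) * (f τ δ * conj (f τ δ)) := by
      intro δ
      rw [Finset.sum_comm, Finset.sum_eq_single δ]
      · have := sum_expi_bil_out hL V δ δ
        rw [if_pos rfl] at this
        rw [← this, Finset.sum_mul]
        exact Finset.sum_congr rfl fun γ _ => by ring
      · intro δ' _ hδ'
        have := sum_expi_bil_out hL V δ δ'
        rw [if_neg (Ne.symm hδ')] at this
        have h4 : ∑ γ : Disc q L, expi (-(bil q (δ.out : E) (γ.out : E) : ℝ)) * f τ δ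
          * (conj (expi (-(bil q (δ'.out : E) (γ.out : E) : ℝ))) * conj (f τ δ'))
          = (∑ γ : Disc q L, expi (-(bil q (δ.out : E) (γ.out : E) : ℝ))
            * conj (expi (-(bil q (δ'.out : E) (γ.out : E) : ℝ)))) * (f τ δ * conj (f τ δ')) := by
          rw [Finset.sum_mul]
          exact Finset.sum_congr rfl fun γ _ => by ring
        rw [h4, this, zero_mul]
      · simp
    rw [Finset.sum_congr rfl fun δ _ => h3 δ, Finset.mul_sum]
  have hn8 : ‖expi (-(sig : ℂ) / 8)‖ = 1 := by
    have : (-(sig : ℂ) / 8) = ((-(sig : ℝ) / 8 : ℝ) : ℂ) := by push_cast; ring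
    rw [this, norm_expi_real]
  have h5 : ∑ γ, ‖f (ModularGroup.S • τ) γ‖ ^ 2 = ‖(τ : ℂ)‖ ^ w * ∑ γ, ‖f τ γ‖ ^ 2 := by
    simp only [h1, norm_mul, mul_pow, hphi, norm_div, hn8, div_pow, one_pow]
    rw [← Finset.mul_sum, h2, Complex.norm_real, Real.norm_of_nonneg (Real.sqrt_nonneg _),
      Real.sq_sqrt hcard.le]
    field_simp
  rw [normSqForm, normSqForm, h5, im_S_smul, Real.div_rpow τ.im_pos.le (by positivity)]
  have h6 : (‖(τ : ℂ)‖ ^ 2) ^ ((w : ℝ) / 2) = ‖(τ : ℂ)‖ ^ w := by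
    rw [← Real.rpow_natCast, ← Real.rpow_mul hn.le, ← Real.rpow_intCast]
    congr 1
    push_cast
    ring
  rw [h6]
  have : ‖(τ : ℂ)‖ ^ w ≠ 0 := zpow_ne_zero _ hn.ne'
  field_simp

lemma normSqForm_smul [Fintype (Disc q L)] (hL : IsEvenLattice q L)
    (V : q.IsometryEquiv (stdForm r s)) (hf : IsCuspForm q L sig w f) (γ : SL(2, ℤ)) (τ : ℍ) :
    normSqForm w f (γ • τ) = normSqForm w f τ := by
  have h : IsRowFamily fun (_ : Fin 2 → ℤ) τ => normSqForm w f τ :=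
    isRowFamily_of_generators (fun _ _ τ => normSqForm_S hL V hf τ)
      fun _ _ τ => normSqForm_T hf τ
  exact h γ 0 τ

/-- Exponential decay at the cusp. -/
lemma IsCuspForm.exists_decay [Fintype (Disc q L)] (hf : IsCuspForm q L sig w f) :
    ∃ C ε : ℝ, 0 ≤ C ∧ 0 < ε ∧ ∀ (τ : ℍ) γ, 1 / 4 ≤ τ.im → ‖f τ γ‖ ≤ C * Real.exp (-ε * τ.im) := by
  obtain ⟨c, hc, hc0⟩ := hf.cusp
  have key : ∀ γ : Disc q L, ∃ C ε : ℝ, 0 ≤ C ∧ 0 < ε ∧ ∀ τ : ℍ, 1 / 4 ≤ τ.im →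
      ‖f τ γ‖ ≤ C * Real.exp (-ε * τ.im) := by
    intro γ
    obtain ⟨x, rfl⟩ := exists_cls γ
    set a : ℝ := q (x : E) with ha
    -- the smallest positive element of `a + ℤ`
    set δ : ℝ := a - ⌈a⌉ + 1 with hδ
    have hδ0 : 0 < δ := by have := Int.ceil_lt_add_one a; linarith
    have hδle : ∀ j : ℤ, 0 < a + j → δ ≤ a + j := by
      intro j hj
      have h1 : (-j : ℤ) < ⌈a⌉ := Int.lt_ceil.mpr (by push_cast; linarith)
      have h2 : (-j : ℝ) ≤ ⌈a⌉ - 1 := by exact_mod_cast Int.le_sub_one_of_lt h1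
      linarith
    set τ₀ : ℍ := ⟨Complex.I / 4, by simp⟩ with hτ₀
    have hτ₀im : τ₀.im = 1 / 4 := by
      rw [← coe_im, hτ₀]; simp
    set g : ℤ → ℝ := fun j => ‖c (a + j) (cls q L x) * expi (((a + j : ℝ) : ℂ) * (τ₀ : ℂ))‖ with hg
    have hgs : Summable g := (hc x τ₀).summable.norm
    have hnorm : ∀ (τ : ℍ) (n : ℝ), ‖expi ((n : ℂ) * (τ : ℂ))‖ = Real.exp (-2 * Real.pi * n * τ.im) := by
      intro τ n
      rw [norm_expi]
      congr 1
      simp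
      ring
    refine ⟨(∑' j, g j) * Real.exp (2 * Real.pi * δ / 4), 2 * Real.pi * δ,
      mul_nonneg (tsum_nonneg fun j => norm_nonneg _) (Real.exp_pos _).le, by positivity,
      fun τ hτ => ?_⟩
    have hle : ∀ j : ℤ, ‖c (a + j) (cls q L x) * expi (((a + j : ℝ) : ℂ) * (τ : ℂ))‖
        ≤ g j * (Real.exp (2 * Real.pi * δ / 4) * Real.exp (-(2 * Real.pi * δ) * τ.im)) := by
      intro j
      rcases le_or_gt (a + j) 0 with h | h
      · rw [hg]; simp [hc0 _ _ h]
      · rw [hg]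
        simp only [norm_mul, hnorm, hτ₀im]
        rw [mul_assoc (‖c (a + j) (cls q L x)‖), ← Real.exp_add, ← Real.exp_add]
        refine mul_le_mul_of_nonneg_left (Real.exp_le_exp.mpr ?_) (norm_nonneg _)
        have h1 := hδle j h
        have h2 : 0 ≤ Real.pi * ((a + j - δ) * (τ.im - 1 / 4)) :=
          mul_nonneg Real.pi_pos.le (mul_nonneg (by linarith) (by linarith))
        nlinarith
    have h1 := hc x τ
    rw [← h1.tsum_eq]
    refine (tsum_of_norm_bounded (hgs.mul_right _).hasSum hle).trans ?_
    rw [tsum_mul_right]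
    exact le_of_eq (by ring)
  choose C ε hC hε h using key
  have hne : (Finset.univ : Finset (Disc q L)).Nonempty := ⟨0, Finset.mem_univ _⟩
  refine ⟨∑ γ, C γ, Finset.univ.inf' hne ε, Finset.sum_nonneg fun γ _ => hC γ,
    (Finset.lt_inf'_iff hne).mpr fun γ _ => hε γ, fun τ γ hτ => (h γ τ hτ).trans ?_⟩
  refine mul_le_mul (Finset.single_le_sum (f := C) (fun γ _ => hC γ) (Finset.mem_univ γ))
    (Real.exp_le_exp.mpr ?_) (Real.exp_pos _).le (Finset.sum_nonneg fun γ _ => hC γ)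
  exact mul_le_mul_of_nonneg_right (neg_le_neg (Finset.inf'_le _ (Finset.mem_univ γ)))
    τ.im_pos.le

/-- **Hecke's bound**, with exponential decay at the cusp. -/
theorem IsCuspForm.exists_bound [Fintype (Disc q L)] (hL : IsEvenLattice q L)
    (V : q.IsometryEquiv (stdForm r s)) (hw : 0 ≤ w) (hf : IsCuspForm q L sig w f) :
    ∃ (C ε : ℝ) (B : ℕ), 0 ≤ C ∧ 0 < ε ∧
      ∀ (τ : ℍ) γ, ‖f τ γ‖ ≤ C * growth τ.im ^ B * Real.exp (-ε * τ.im) := by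
  obtain ⟨C, ε, hC, hε, h⟩ := hf.exists_decay
  -- the invariant function `∑ |f_γ|² y^ν` is bounded on the fundamental domain
  obtain ⟨A, hA0, hA⟩ : ∃ A : ℝ, 0 ≤ A ∧ ∀ τ : ℍ, normSqForm w f τ ≤ A := by
    obtain ⟨n, hn⟩ : ∃ n : ℕ, (w : ℝ) / 2 ≤ n := exists_nat_ge _
    refine ⟨Fintype.card (Disc q L) * C ^ 2 * (4 ^ n * (n.factorial / (2 * ε) ^ n)), by positivity,
      fun τ => ?_⟩
    obtain ⟨γ, hγ⟩ := ModularGroup.exists_smul_mem_fd τ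
    rw [← normSqForm_smul hL V hf γ τ]
    set τ' := γ • τ with hτ'
    have hy : 1 / 4 ≤ τ'.im := by
      have := ModularGroup.three_le_four_mul_im_sq_of_mem_fd hγ
      have h0 := τ'.im_pos
      by_contra hcon
      push Not at hcon
      nlinarith
    have h0 : 0 < τ'.im := τ'.im_pos
    have h1 : ∑ γ, ‖f τ' γ‖ ^ 2 ≤ Fintype.card (Disc q L) * C ^ 2 * Real.exp (-(2 * ε) * τ'.im) := by
      have : ∀ γ ∈ Finset.univ, ‖f τ' γ‖ ^ 2 ≤ C ^ 2 * Real.exp (-(2 * ε) * τ'.im) := by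
        intro γ _
        have h2 := h τ' γ hy
        calc ‖f τ' γ‖ ^ 2 ≤ (C * Real.exp (-ε * τ'.im)) ^ 2 := by gcongr
          _ = _ := by
            rw [mul_pow, ← Real.exp_nat_mul]; congr 2; push_cast; ring
      refine (Finset.sum_le_card_nsmul _ _ _ this).trans ?_
      rw [nsmul_eq_mul, mul_assoc]
      rfl
    have h2 : τ'.im ^ ((w : ℝ) / 2) ≤ 4 ^ n * τ'.im ^ n := by
      rw [← mul_pow]
      have h4 : (1 : ℝ) ≤ 4 * τ'.im := by linarith
      have hw2 : 0 ≤ (w : ℝ) / 2 := by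
        have : (0 : ℝ) ≤ w := by exact_mod_cast hw
        positivity
      calc τ'.im ^ ((w : ℝ) / 2) ≤ (4 * τ'.im) ^ ((w : ℝ) / 2) :=
            Real.rpow_le_rpow h0.le (by linarith) hw2
        _ ≤ (4 * τ'.im) ^ (n : ℝ) := Real.rpow_le_rpow_of_exponent_le h4 hn
        _ = _ := Real.rpow_natCast _ _
    have h3 : τ'.im ^ n * Real.exp (-(2 * ε) * τ'.im) ≤ n.factorial / (2 * ε) ^ n := by
      have := Real.pow_div_factorial_le_exp (2 * ε * τ'.im) (by positivity) n
      rw [neg_mul, Real.exp_neg, ← div_eq_mul_inv, div_le_div_iff₀ (by positivity) (by positivity)]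
      rw [div_le_iff₀ (by positivity), mul_pow] at this
      linarith
    calc normSqForm w f τ'
        ≤ (Fintype.card (Disc q L) * C ^ 2 * Real.exp (-(2 * ε) * τ'.im))
          * (4 ^ n * τ'.im ^ n) := by
          rw [normSqForm]
          exact mul_le_mul h1 h2 (by positivity) (by positivity)
      _ = Fintype.card (Disc q L) * C ^ 2 * (4 ^ n * (τ'.im ^ n * Real.exp (-(2 * ε) * τ'.im))) := by
          ring
      _ ≤ _ := by gcongr
  obtain ⟨B, hB⟩ : ∃ B : ℕ, |-((w : ℝ) / 4)| ≤ B := exists_nat_ge _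
  refine ⟨C + Real.sqrt A * Real.exp ε, ε, B, by positivity, hε, fun τ γ => ?_⟩
  have hy := τ.im_pos
  have hg1 : 1 ≤ growth τ.im ^ B := one_le_pow₀ (one_le_growth hy)
  rcases le_or_gt (1 / 4) τ.im with h4 | h4
  · refine (h τ γ h4).trans ?_
    gcongr
    have : 0 ≤ Real.sqrt A * Real.exp ε := by positivity
    nlinarith
  · have h1 : ‖f τ γ‖ ^ 2 * τ.im ^ ((w : ℝ) / 2) ≤ A := by
      refine le_trans ?_ (hA τ)
      rw [normSqForm]
      gcongr
      exact Finset.single_le_sum (f := fun γ => ‖f τ γ‖ ^ 2) (fun _ _ => sq_nonneg _)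
        (Finset.mem_univ γ)
    have h2 : ‖f τ γ‖ ≤ Real.sqrt A * τ.im ^ (-((w : ℝ) / 4)) := by
      refine abs_le_of_sq_le_sq' ?_ (by positivity) |>.2
      rw [mul_pow, Real.sq_sqrt hA0, ← Real.rpow_natCast (τ.im ^ _), ← Real.rpow_mul hy.le]
      have : -((w : ℝ) / 4) * (2 : ℕ) = -((w : ℝ) / 2) := by push_cast; ring
      rw [this, Real.rpow_neg hy.le, ← div_eq_mul_inv, le_div_iff₀ (by positivity)]
      exact h1
    have h3 : 1 ≤ Real.exp ε * Real.exp (-ε * τ.im) := by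
      rw [← Real.exp_add]
      refine Real.one_le_exp ?_
      nlinarith
    calc ‖f τ γ‖ ≤ Real.sqrt A * growth τ.im ^ B :=
          h2.trans (mul_le_mul_of_nonneg_left (rpow_le_growth hy hB) (Real.sqrt_nonneg _))
      _ ≤ Real.sqrt A * growth τ.im ^ B * (Real.exp ε * Real.exp (-ε * τ.im)) :=
          le_mul_of_one_le_right (by positivity) h3
      _ = (Real.sqrt A * Real.exp ε) * growth τ.im ^ B * Real.exp (-ε * τ.im) := by ring
      _ ≤ _ := by gcongr; linarith

/-- The Fourier coefficients as integrals over horizontal segments. -/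
lemma HasFourierExpansion.integral_eq {c : ℝ → Disc q L → ℂ} (hc : HasFourierExpansion q L f c)
    (x : dual q L) (y : ℝ) (hy : 0 < y) :
    ∫ t in (0 : ℝ)..1, f ⟨t + y * Complex.I, by simpa using hy⟩ (cls q L x)
        * expi (-((q (x : E) : ℝ) * (t + y * Complex.I))) = c (q (x : E)) (cls q L x) := by
  set a : ℝ := q (x : E) with ha
  set τ : ℝ → ℍ := fun t => ⟨t + y * Complex.I, by simpa using hy⟩ with hτ
  have hco : ∀ t, (τ t : ℂ) = t + y * Complex.I := fun t => rfl
  set F : ℤ → ℝ → ℂ := fun j t => c (a + j) (cls q L x) * expi ((j : ℂ) * (t + y * Complex.I))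
  have h1 : ∀ t : ℝ, HasSum (fun j => F j t) (f (τ t) (cls q L x)
      * expi (-((a : ℝ) * (t + y * Complex.I)))) := by
    intro t
    refine ((hc x (τ t)).mul_right _).congr_fun fun j => ?_
    rw [mul_assoc, ← expi_add, hco]
    simp only [F]
    congr 2
    push_cast
    ring
  have hnorm : ∀ j t, ‖F j t‖ = ‖F j 0‖ := by
    intro j t
    simp only [F, norm_mul, norm_expi]
    simp
  have h2 : HasSum (fun j => ∫ t in (0 : ℝ)..1, F j t) (∫ t in (0 : ℝ)..1, f (τ t) (cls q L x)
      * expi (-((a : ℝ) * (t + y * Complex.I)))) := by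
    refine intervalIntegral.hasSum_integral_of_dominated_convergence (fun j _ => ‖F j 0‖)
      (fun j => (by fun_prop : Continuous (F j)).aestronglyMeasurable)
      (fun j => Filter.Eventually.of_forall fun t _ => (hnorm j t).le)
      (Filter.Eventually.of_forall fun t _ => (h1 0).summable.norm)
      (by simp) (Filter.Eventually.of_forall fun t _ => h1 t)
  have h3 : ∀ j : ℤ, j ≠ 0 → ∫ t in (0 : ℝ)..1, F j t = 0 := by
    intro j hj
    have hj' : (2 * Real.pi * Complex.I * j : ℂ) ≠ 0 := by
      simp [hj, Real.pi_ne_zero]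
    have : ∀ t : ℝ, F j t = (c (a + j) (cls q L x) * expi ((j : ℂ) * (y * Complex.I)))
        * Complex.exp ((2 * Real.pi * Complex.I * j) * t) := by
      intro t
      simp only [F]
      rw [expi, expi, mul_assoc _ (Complex.exp _), ← Complex.exp_add]
      congr 2
      ring
    simp only [this]
    rw [intervalIntegral.integral_const_mul, integral_exp_mul_complex hj']
    have h4 : Complex.exp (2 * Real.pi * Complex.I * j * (1 : ℝ)) = 1 := by
      rw [Complex.exp_eq_one_iff]; exact ⟨j, by push_cast; ring⟩
    rw [h4]
    simp
  have h4 := hasSum_single (f := fun j => ∫ t in (0 : ℝ)..1, F j t) 0 h3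
  rw [h2.unique h4]
  simp [F]

lemma IsCuspForm.coeff_eq_zero (hf : IsCuspForm q L sig w f) {c : ℝ → Disc q L → ℂ}
    (hc : HasFourierExpansion q L f c) (x : dual q L) (hx : q (x : E) ≤ 0) :
    c (q (x : E)) (cls q L x) = 0 := by
  obtain ⟨c', hc', h0⟩ := hf.cusp
  rw [← hc.integral_eq x 1 one_pos, hc'.integral_eq x 1 one_pos, h0 _ _ hx]

end CuspForms

/-! ### The pairing of a cusp form with a shifted and twisted theta function -/

section Pairing

variable {r s : ℕ} {E : Type*} [AddCommGroup E] [Module ℝ E] {q : QuadraticForm ℝ E}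
  {L : Submodule ℤ E} {sig w : ℤ} {f : ℍ → Disc q L → ℂ}

/-- The term of index `x ∈ L'` of the pairing of `f` with the theta function with characteristics
`(σ, t)` along `z`: the argument is shifted by `σz` and twisted by `𝐞(t(x, z))`. -/
def thetaTerm (V : q.IsometryEquiv (stdForm r s)) (f : ℍ → Disc q L → ℂ)
    (p : MvPolynomial (Fin r) ℂ) (z : E) (τ : ℍ) (σ t : ℝ) (x : dual q L) : ℂ :=
  f τ (cls q L x) * conj (kern p τ (V (x : E) + σ • V z)) * expi (t * bil q (x : E) z : ℝ)

/-- The pairing of `f` with the theta function with characteristics `(σ, t)` along `z`. -/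
def thetaPair (V : q.IsometryEquiv (stdForm r s)) (f : ℍ → Disc q L → ℂ)
    (p : MvPolynomial (Fin r) ℂ) (z : E) (τ : ℍ) (σ t : ℝ) : ℂ :=
  ∑' x : dual q L, thetaTerm V f p z τ σ t x

lemma IsCuspForm.continuous (hf : IsCuspForm q L sig w f) (γ : Disc q L) :
    Continuous fun τ => f τ γ := (hf.holo γ).continuous

/-- The terms decay rapidly in `x`, and exponentially at the cusp. -/
lemma norm_thetaTerm_le [Fintype (Disc q L)] (hL : IsEvenLattice q L)
    (V : q.IsometryEquiv (stdForm r s)) (hw : 0 ≤ w) (hf : IsCuspForm q L sig w f)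
    (p : MvPolynomial (Fin r) ℂ) (z : E) (K : ℕ) :
    ∃ (C ε : ℝ) (B : ℕ), 0 ≤ C ∧ 0 < ε ∧ ∀ (τ : ℍ) (σ t : ℝ) (x : dual q L),
      ‖thetaTerm V f p z τ σ t x‖ ≤ C * growth τ.im ^ B * Real.exp (-ε * τ.im)
        * ((1 + |σ| * ‖V z‖) ^ K * ((1 + ‖V (x : E)‖) ^ K)⁻¹) := by
  obtain ⟨C, ε, B, hC, hε, h⟩ := hf.exists_bound hL V hw
  obtain ⟨C', B', hC', h'⟩ := norm_kern_le (s := s) p K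
  refine ⟨C * C', ε, B + B', by positivity, hε, fun τ σ t x => ?_⟩
  have hg := one_le_growth τ.im_pos
  rw [thetaTerm, norm_mul, norm_expi_real, mul_one, norm_mul, RCLike.norm_conj]
  have h1 := inv_one_add_norm_add_pow_le (V (x : E)) (σ • V z) K
  rw [norm_smul, Real.norm_eq_abs] at h1
  calc ‖f τ (cls q L x)‖ * ‖kern p τ (V (x : E) + σ • V z)‖
      ≤ (C * growth τ.im ^ B * Real.exp (-ε * τ.im)) * (C' * growth τ.im ^ B'
          * ((1 + |σ| * ‖V z‖) ^ K * ((1 + ‖V (x : E)‖) ^ K)⁻¹)) := by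
        refine mul_le_mul (h τ _) ((h' τ _).trans ?_) (norm_nonneg _) (by positivity)
        exact mul_le_mul_of_nonneg_left h1 (by positivity)
    _ = _ := by rw [pow_add]; ring

lemma summable_thetaTerm [Fintype (Disc q L)] (hL : IsEvenLattice q L)
    (V : q.IsometryEquiv (stdForm r s)) (hw : 0 ≤ w) (hf : IsCuspForm q L sig w f)
    (p : MvPolynomial (Fin r) ℂ) (z : E) (τ : ℍ) (σ t : ℝ) :
    Summable fun x => thetaTerm V f p z τ σ t x := by
  obtain ⟨C, ε, B, hC, hε, h⟩ := norm_thetaTerm_le hL V hw hf p z (r + s + 1)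
  refine Summable.of_norm_bounded ?_ (h τ σ t)
  exact ((summable_dual hL V (Nat.lt_succ_self _)).mul_left _).mul_left _

lemma norm_thetaPair_le [Fintype (Disc q L)] (hL : IsEvenLattice q L)
    (V : q.IsometryEquiv (stdForm r s)) (hw : 0 ≤ w) (hf : IsCuspForm q L sig w f)
    (p : MvPolynomial (Fin r) ℂ) (z : E) :
    ∃ (C ε : ℝ) (B : ℕ), 0 ≤ C ∧ 0 < ε ∧ ∀ (τ : ℍ) (σ t : ℝ), |σ| ≤ 1 →
      ‖thetaPair V f p z τ σ t‖ ≤ C * growth τ.im ^ B * Real.exp (-ε * τ.im) := by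
  obtain ⟨C, ε, B, hC, hε, h⟩ := norm_thetaTerm_le hL V hw hf p z (r + s + 1)
  have hs := summable_dual hL V (Nat.lt_succ_self (r + s))
  refine ⟨C * ((1 + ‖V z‖) ^ (r + s + 1) * ∑' x : dual q L, ((1 + ‖V (x : E)‖) ^ (r + s + 1))⁻¹),
    ε, B, mul_nonneg hC (mul_nonneg (by positivity) (tsum_nonneg fun x => by positivity)), hε,
    fun τ σ t hσ => ?_⟩
  have h1 : ∀ x, ‖thetaTerm V f p z τ σ t x‖ ≤ C * growth τ.im ^ B * Real.exp (-ε * τ.im)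
      * ((1 + ‖V z‖) ^ (r + s + 1) * ((1 + ‖V (x : E)‖) ^ (r + s + 1))⁻¹) := fun x => by
    have hg := one_le_growth τ.im_pos
    refine (h τ σ t x).trans (mul_le_mul_of_nonneg_left ?_ (by positivity))
    refine mul_le_mul_of_nonneg_right (pow_le_pow_left₀ (by positivity) ?_ _) (by positivity)
    have := mul_le_mul_of_nonneg_right hσ (norm_nonneg (V z))
    linarith
  refine (tsum_of_norm_bounded ((hs.hasSum.mul_left _).mul_left _) h1).trans (le_of_eq ?_)
  ring

lemma continuous_thetaTerm (hf : IsCuspForm q L sig w f)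
    (V : q.IsometryEquiv (stdForm r s)) (p : MvPolynomial (Fin r) ℂ) (z : E) (x : dual q L) :
    Continuous fun u : ℍ × ℝ × ℝ => thetaTerm V f p z u.1 u.2.1 u.2.2 x := by
  have h1 : Continuous fun u : ℍ × ℝ × ℝ => V (x : E) + u.2.1 • V z :=
    continuous_const.add ((continuous_fst.comp continuous_snd).smul continuous_const)
  have h2 : Continuous fun u : ℍ × ℝ × ℝ => kern p u.1 (V (x : E) + u.2.1 • V z) :=
    Continuous.comp (g := fun v : ℍ × (Fin r ⊕ Fin s → ℝ) => kern p v.1 v.2)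
      (f := fun u : ℍ × ℝ × ℝ => (u.1, V (x : E) + u.2.1 • V z))
      (continuous_kern p) (continuous_fst.prodMk h1)
  have h3 : Continuous fun u : ℍ × ℝ × ℝ => ((u.2.2 * bil q (x : E) z : ℝ) : ℂ) :=
    Complex.continuous_ofReal.comp ((continuous_snd.comp continuous_snd).mul continuous_const)
  exact (((hf.continuous _).comp continuous_fst).mul (Complex.continuous_conj.comp h2)).mul
    (continuous_expi.comp h3)

lemma continuous_growth : Continuous fun τ : ℍ => growth τ.im := by
  unfold growth
  exact UpperHalfPlane.continuous_im.add
    (UpperHalfPlane.continuous_im.inv₀ fun τ => τ.im_pos.ne')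

lemma continuous_thetaPair [Fintype (Disc q L)] (hL : IsEvenLattice q L)
    (V : q.IsometryEquiv (stdForm r s)) (hw : 0 ≤ w) (hf : IsCuspForm q L sig w f)
    (p : MvPolynomial (Fin r) ℂ) (z : E) :
    Continuous fun u : ℍ × ℝ × ℝ => thetaPair V f p z u.1 u.2.1 u.2.2 := by
  obtain ⟨C, ε, B, hC, hε, h⟩ := norm_thetaTerm_le hL V hw hf p z (r + s + 1)
  have hs := summable_dual hL V (Nat.lt_succ_self _)
  rw [continuous_iff_continuousAt]
  intro u₀
  set G : ℝ := growth u₀.1.im + 1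
  set A : ℝ := |u₀.2.1| + 1
  set U : Set (ℍ × ℝ × ℝ) := {u | growth u.1.im < G} ∩ {u | |u.2.1| < A}
  have hU : IsOpen U :=
    (isOpen_lt (continuous_growth.comp continuous_fst) continuous_const).inter
      (isOpen_lt (by fun_prop) continuous_const)
  have hmem : u₀ ∈ U := ⟨by simp [G], by simp [A]⟩
  refine ContinuousOn.continuousAt (s := U) ?_ (hU.mem_nhds hmem)
  refine continuousOn_tsum (u := fun x : dual q L => C * G ^ B
      * ((1 + A * ‖V z‖) ^ (r + s + 1) * ((1 + ‖V (x : E)‖) ^ (r + s + 1))⁻¹))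
    (fun x => (continuous_thetaTerm hf V p z x).continuousOn)
    ((hs.mul_left _).mul_left _) fun x u hu => (h u.1 u.2.1 u.2.2 x).trans ?_
  have hg := one_le_growth u.1.im_pos
  have hu1 : growth u.1.im < G := hu.1
  have hu2 : |u.2.1| < A := hu.2
  have h1 : growth u.1.im ^ B ≤ G ^ B := pow_le_pow_left₀ (by linarith) hu1.le _
  have h2 : (1 + |u.2.1| * ‖V z‖) ^ (r + s + 1) ≤ (1 + A * ‖V z‖) ^ (r + s + 1) :=
    pow_le_pow_left₀ (by positivity) (by
      have := mul_le_mul_of_nonneg_right hu2.le (norm_nonneg (V z))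
      linarith) _
  have h3 : Real.exp (-ε * u.1.im) ≤ 1 := by
    rw [Real.exp_le_one_iff]; nlinarith [u.1.im_pos]
  have h4 : C * growth u.1.im ^ B * Real.exp (-ε * u.1.im) ≤ C * G ^ B :=
    (mul_le_of_le_one_right (by positivity) h3).trans (mul_le_mul_of_nonneg_left h1 hC)
  refine mul_le_mul h4 (mul_le_mul_of_nonneg_right h2 (by positivity)) (by positivity) ?_
  have : 0 ≤ G := by linarith
  positivity

lemma thetaPair_T [Fintype (Disc q L)] (V : q.IsometryEquiv (stdForm r s))
    (hf : IsCuspForm q L sig w f) (p : MvPolynomial (Fin r) ℂ) {z : E} (hz : q z = 0) (τ : ℍ)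
    (σ t : ℝ) : thetaPair V f p z (ModularGroup.T • τ) σ t = thetaPair V f p z τ σ (t - σ) := by
  refine tsum_congr fun x => ?_
  rw [thetaTerm, thetaTerm, hf.map_T, kern_T, map_mul, conj_expi, Complex.conj_ofReal]
  have h1 : V (x : E) + σ • V z = V ((x : E) + σ • z) := by rw [map_add, map_smul]
  have h2 : stdForm r s (V ((x : E) + σ • z)) = q (x : E) + σ * bil q (x : E) z := by
    rw [V.map_app, IsotropicData.q_add, IsotropicData.q_smul, hz,
      IsotropicData.bil_smul_right]
    ring
  rw [h1, h2]
  rw [show expi ((q (x : E) : ℝ) : ℂ) * f τ (cls q L x)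
      * (conj (kern p τ (V ((x : E) + σ • z)))
        * expi (-((q (x : E) + σ * bil q (x : E) z : ℝ) : ℂ)))
      * expi ((t * bil q (x : E) z : ℝ) : ℂ)
    = f τ (cls q L x) * conj (kern p τ (V ((x : E) + σ • z)))
      * (expi ((q (x : E) : ℝ) : ℂ) * expi (-((q (x : E) + σ * bil q (x : E) z : ℝ) : ℂ))
        * expi ((t * bil q (x : E) z : ℝ) : ℂ)) by ring]
  rw [← expi_add, ← expi_add]
  congr 2
  push_cast
  ring

lemma thetaPair_add_int_right (V : q.IsometryEquiv (stdForm r s)) (p : MvPolynomial (Fin r) ℂ)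
    {z : E} (hz : z ∈ L) (τ : ℍ) (σ t : ℝ) (n : ℤ) :
    thetaPair V f p z τ σ (t + n) = thetaPair V f p z τ σ t := by
  refine tsum_congr fun x => ?_
  obtain ⟨m, hm⟩ := exists_int_bil x.2 hz
  rw [thetaTerm, thetaTerm, hm]
  congr 1
  have h : ((t + n) * (m : ℝ) : ℝ) = ((t * m : ℝ) : ℂ) + ((n * m : ℤ) : ℂ) := by
    push_cast; ring
  rw [h, expi_add_int]

lemma thetaPair_add_int_left (hL : IsEvenLattice q L) (V : q.IsometryEquiv (stdForm r s))
    (p : MvPolynomial (Fin r) ℂ)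
    {z : E} (hz : z ∈ L) (hq : q z = 0) (τ : ℍ) (σ t : ℝ) (n : ℤ) :
    thetaPair V f p z τ (σ + n) t = thetaPair V f p z τ σ t := by
  have hzd : z ∈ dual q L := le_dual hL hz
  set Z : dual q L := ⟨z, hzd⟩
  rw [thetaPair, thetaPair, ← (Equiv.addRight (n • Z)).tsum_eq (thetaTerm V f p z τ σ t)]
  refine tsum_congr fun x => ?_
  have h1 : cls q L (x + n • Z) = cls q L x := by
    refine (Submodule.Quotient.eq _).mpr ?_
    rw [add_sub_cancel_left]
    exact (L.submoduleOf (dual q L)).smul_mem n hz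
  have h2 : ((x + n • Z : dual q L) : E) = (x : E) + (n : ℝ) • z := by
    rw [Submodule.coe_add, Submodule.coe_smul, Int.cast_smul_eq_zsmul]
  have h3 : bil q z z = 0 := by rw [IsotropicData.bil_self, hq, mul_zero]
  simp only [thetaTerm, Equiv.coe_addRight]
  rw [h1, h2, map_add, map_smul, IsotropicData.bil_add_left, IsotropicData.bil_smul_left, h3]
  have h4 : V (x : E) + (n : ℝ) • V z + σ • V z = V (x : E) + (σ + n) • V z := by module
  rw [h4]
  simp

/-- The lattice `L'` is the disjoint union of the cosets `γ + L`. -/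
def cosetEquiv (hL : IsEvenLattice q L) : Disc q L × L ≃ dual q L where
  toFun u := u.1.out + ⟨u.2, le_dual hL u.2.2⟩
  invFun x := (cls q L x, ⟨(x : E) - (cls q L x).out, by
    have := (Submodule.Quotient.eq _).mp (out_cls (cls q L x)).symm
    exact this⟩)
  left_inv u := by
    have h : cls q L (u.1.out + ⟨u.2, le_dual hL u.2.2⟩) = u.1 := by
      conv_rhs => rw [← out_cls u.1]
      refine (Submodule.Quotient.eq _).mpr ?_
      rw [add_sub_cancel_left]
      exact u.2.2
    refine Prod.ext h (Subtype.ext ?_)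
    simp only [h]
    simp
  right_inv x := by
    apply Subtype.ext
    simp

lemma cls_cosetEquiv (hL : IsEvenLattice q L) (u : Disc q L × L) :
    cls q L (cosetEquiv hL u) = u.1 := by
  have := congrArg Prod.fst ((cosetEquiv hL).symm_apply_apply u)
  exact this

/-- Poisson summation over `L'`, paired with the transformation of `f` under `S`: a theta series
with kernel `Φ` is turned into the theta series with the Fourier transform of `Φ`. -/
lemma tsum_S [Fintype (Disc q L)] (hL : IsEvenLattice q L)
    (V : q.IsometryEquiv (stdForm r s)) (hf : IsCuspForm q L sig w f)
    {Φ : (Fin r ⊕ Fin s → ℝ) → ℂ} (hc : Continuous Φ) {C C' : ℝ} {K : ℕ} (hK : r + s < K)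
    (hb : ∀ X, ‖Φ X‖ ≤ C * ((1 + ‖X‖) ^ K)⁻¹)
    (hb' : ∀ ξ, ‖∫ X, Φ X * expi (-(stdBil ξ X : ℝ))‖ ≤ C' * ((1 + ‖ξ‖) ^ K)⁻¹) (τ : ℍ) :
    ∑' x : dual q L, f (ModularGroup.S • τ) (cls q L x) * Φ (V (x : E))
      = ((τ : ℂ) ^ (1 / 2 : ℂ)) ^ w * expi (-(sig : ℂ) / 8)
        * ∑' x : dual q L, f τ (cls q L x) * ∫ X, Φ X * expi (-(stdBil (V (x : E)) X : ℝ)) := by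
  have hcard : (Real.sqrt (Nat.card (Disc q L)) : ℂ) ≠ 0 := by
    have : Nat.card (Disc q L) ≠ 0 := Nat.card_ne_zero.mpr ⟨⟨0⟩, inferInstance⟩
    have : 0 < (Nat.card (Disc q L) : ℝ) := by positivity
    exact_mod_cast (Real.sqrt_pos.mpr this).ne'
  have hsd := summable_dual hL V hK
  set Ψ : (Fin r ⊕ Fin s → ℝ) → ℂ := fun ξ => ∫ X, Φ X * expi (-(stdBil ξ X : ℝ)) with hΨ
  have hΨs : Summable fun x : dual q L => Ψ (V (x : E)) :=
    Summable.of_norm_bounded (hsd.mul_left C') fun x => hb' _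
  have hadd : ∀ ξ η X : Fin r ⊕ Fin s → ℝ, expi (-(stdBil ξ X : ℝ)) * expi (-(stdBil η X : ℝ))
      = expi (-(stdBil (ξ + η) X : ℝ)) := by
    intro ξ η X
    rw [← expi_add]
    congr 1
    rw [stdBil_eq_sum, stdBil_eq_sum, stdBil_eq_sum]
    push_cast
    rw [← neg_add, ← Finset.sum_add_distrib]
    congr 1
    refine Finset.sum_congr rfl fun i _ => ?_
    simp only [Pi.add_apply]
    push_cast
    ring
  -- Poisson summation for the translate of the kernel by a character
  have key : ∀ γ : Disc q L, ∑' x : dual q L, expi (-(bil q (γ.out : E) (x : E) : ℝ))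
        * Φ (V (x : E))
      = (Real.sqrt (Nat.card (Disc q L)) : ℂ) * ∑' μ : L, Ψ (V (cosetEquiv hL (γ, μ) : E)) := by
    intro γ
    have hint : ∀ μ : L, ∫ X, (expi (-(stdBil (V (γ.out : E)) X : ℝ)) * Φ X)
          * expi (-(stdBil (V (μ : E)) X : ℝ)) = Ψ (V (cosetEquiv hL (γ, μ) : E)) := by
      intro μ
      rw [hΨ]
      refine integral_congr_ae (Filter.Eventually.of_forall fun X => ?_)
      have h1 : (cosetEquiv hL (γ, μ) : E) = (γ.out : E) + (μ : E) := rfl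
      simp only
      rw [h1, map_add, ← hadd]
      ring
    have hP := poisson_dual hL V (Φ := fun X => expi (-(stdBil (V (γ.out : E)) X : ℝ)) * Φ X)
      (by
        refine (continuous_expi.comp ?_).mul hc
        simp only [stdBil_eq_sum]
        fun_prop) hK (C := C)
      (fun X => by
        rw [norm_mul, ← Complex.ofReal_neg, norm_expi_real, one_mul]
        exact hb X)
      (by
        simp only [hint]
        refine ((cosetEquiv hL).summable_iff.mpr hΨs).comp_injective
          (i := fun μ : L => (γ, μ)) fun μ ν h => (Prod.mk.inj h).2)
    simp only [hint] at hP
    rw [← hP]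
    refine tsum_congr fun x => ?_
    rw [bil_eq_stdBil V]
  have hsum1 : ∀ γ : Disc q L, Summable fun x : dual q L =>
      expi (-(bil q (γ.out : E) (x : E) : ℝ)) * Φ (V (x : E)) := fun γ =>
    Summable.of_norm_bounded (hsd.mul_left C) fun x => by
      rw [norm_mul, ← Complex.ofReal_neg, norm_expi_real, one_mul]
      exact hb _
  have hΨf : Summable fun u : Disc q L × L =>
      f τ (cls q L (cosetEquiv hL u)) * Ψ (V (cosetEquiv hL u : E)) := by
    suffices h : Summable fun x : dual q L => f τ (cls q L x) * Ψ (V (x : E)) from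
      (cosetEquiv hL).summable_iff.mpr h
    refine Summable.of_norm_bounded (hsd.mul_left ((∑ γ, ‖f τ γ‖) * C')) fun x => ?_
    rw [norm_mul, mul_assoc]
    exact mul_le_mul (Finset.single_le_sum (f := fun γ => ‖f τ γ‖)
      (fun _ _ => norm_nonneg _) (Finset.mem_univ _))
      (hb' _) (norm_nonneg _) (Finset.sum_nonneg fun _ _ => norm_nonneg _)
  have hR : ∑' x : dual q L, f τ (cls q L x) * Ψ (V (x : E))
      = ∑ γ : Disc q L, f τ γ * ∑' μ : L, Ψ (V (cosetEquiv hL (γ, μ) : E)) := by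
    rw [← (cosetEquiv hL).tsum_eq, hΨf.tsum_prod, tsum_fintype]
    refine Finset.sum_congr rfl fun γ _ => ?_
    rw [← tsum_mul_left]
    refine tsum_congr fun μ => ?_
    rw [cls_cosetEquiv]
  rw [hR]
  have hL1 : ∀ x : dual q L, f (ModularGroup.S • τ) (cls q L x) * Φ (V (x : E))
      = ∑ γ : Disc q L, ((τ : ℂ) ^ (1 / 2 : ℂ)) ^ w
          * (expi (-(sig : ℂ) / 8) / (Real.sqrt (Nat.card (Disc q L)) : ℂ)) * f τ γ
          * (expi (-(bil q (γ.out : E) (x : E) : ℝ)) * Φ (V (x : E))) := by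
    intro x
    rw [hf.map_S, Finset.mul_sum, Finset.sum_mul]
    refine Finset.sum_congr rfl fun γ _ => ?_
    ring
  simp only [hL1]
  rw [Summable.tsum_finsetSum fun γ _ => (hsum1 γ).mul_left _, Finset.mul_sum]
  refine Finset.sum_congr rfl fun γ _ => ?_
  rw [tsum_mul_left, key]
  field_simp

lemma cpow_half_eq (τ : ℍ) : (τ : ℂ) ^ (1 / 2 : ℂ) = expi (1 / 8) * sqrtI τ := by
  have hτ : (τ : ℂ) ≠ 0 := τ.ne_zero
  have him := τ.im_pos
  have h0 : -Complex.I * (τ : ℂ) ≠ 0 := mul_ne_zero (neg_ne_zero.mpr Complex.I_ne_zero) hτ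
  have hre : 0 < (-Complex.I * (τ : ℂ)).re := by simpa using him
  have harg := abs_lt.mp (Complex.abs_arg_lt_pi_div_two_iff.mpr (Or.inl hre))
  have hlog : Complex.log τ = Real.pi / 2 * Complex.I + Complex.log (-Complex.I * τ) := by
    rw [← Complex.log_I, ← (Complex.log_mul_eq_add_log_iff Complex.I_ne_zero h0).mpr]
    · congr 1
      rw [← mul_assoc, mul_neg, Complex.I_mul_I]; ring
    · rw [Complex.arg_I]
      exact ⟨by linarith [harg.1, Real.pi_pos], by linarith [harg.2]⟩
  rw [sqrtI, Complex.cpow_def_of_ne_zero hτ, Complex.cpow_def_of_ne_zero h0, expi,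
    ← Complex.exp_add, hlog]
  congr 1
  ring

lemma stdBil_add_left (X Y Z : Fin r ⊕ Fin s → ℝ) :
    stdBil (X + Y) Z = stdBil X Z + stdBil Y Z := by
  rw [stdBil_eq_sum, stdBil_eq_sum, stdBil_eq_sum, ← Finset.sum_add_distrib]
  exact Finset.sum_congr rfl fun i _ => by simp only [Pi.add_apply]; ring

lemma stdBil_smul_left (c : ℝ) (X Z : Fin r ⊕ Fin s → ℝ) :
    stdBil (c • X) Z = c * stdBil X Z := by
  rw [stdBil_eq_sum, stdBil_eq_sum, Finset.mul_sum]
  exact Finset.sum_congr rfl fun i _ => by simp only [Pi.smul_apply, smul_eq_mul]; ring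

lemma stdBil_comm (X Z : Fin r ⊕ Fin s → ℝ) : stdBil X Z = stdBil Z X := by
  rw [stdBil_eq_sum, stdBil_eq_sum]
  exact Finset.sum_congr rfl fun i _ => by ring

lemma stdBil_add_right (X Y Z : Fin r ⊕ Fin s → ℝ) :
    stdBil X (Y + Z) = stdBil X Y + stdBil X Z := by
  rw [stdBil_comm, stdBil_add_left, stdBil_comm Y, stdBil_comm Z]

lemma stdBil_smul_right (c : ℝ) (X Z : Fin r ⊕ Fin s → ℝ) :
    stdBil X (c • Z) = c * stdBil X Z := by
  rw [stdBil_comm, stdBil_smul_left, stdBil_comm]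

/-- The Fourier transform of the shifted and twisted kernel at `Sτ`. -/
lemma integral_shift_kern_S {k : ℕ} {p : MvPolynomial (Fin r) ℂ} (hp : p.IsHomogeneous k) (τ : ℍ)
    {Z : Fin r ⊕ Fin s → ℝ} (hZ : stdBil Z Z = 0) (σ t : ℝ) (ξ : Fin r ⊕ Fin s → ℝ) :
    ∫ X, conj (kern p (ModularGroup.S • τ) (X + σ • Z)) * expi (t * stdBil X Z : ℝ)
        * expi (-(stdBil ξ X : ℝ))
      = conj (τ : ℂ) ^ k * conj (sqrtI τ) ^ r * sqrtI τ ^ s / (‖(τ : ℂ)‖ ^ s : ℝ)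
        * (conj (kern p τ (ξ + (-t) • Z)) * expi (σ * stdBil ξ Z : ℝ)) := by
  set G : (Fin r ⊕ Fin s → ℝ) → ℂ := fun Y =>
    conj (kern p (ModularGroup.S • τ) Y * expi (-(stdBil (t • Z + (-1 : ℝ) • ξ) Y : ℝ)))
      * expi (σ * stdBil ξ Z : ℝ) with hG
  have h1 : ∀ X, conj (kern p (ModularGroup.S • τ) (X + σ • Z)) * expi (t * stdBil X Z : ℝ)
        * expi (-(stdBil ξ X : ℝ)) = G (X + σ • Z) := by
    intro X
    rw [hG]
    simp only
    rw [map_mul, conj_expi, mul_assoc, mul_assoc, ← expi_add, ← expi_add]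
    congr 2
    simp only [stdBil_add_left, stdBil_add_right, stdBil_smul_left, stdBil_smul_right, hZ,
      map_neg, Complex.conj_ofReal, neg_neg, stdBil_comm Z X]
    push_cast
    ring
  simp only [h1]
  rw [integral_add_right_eq_self G (σ • Z), hG]
  simp only
  rw [integral_mul_const, integral_conj, integral_kern_S hp]
  have h2 : t • Z + (-1 : ℝ) • ξ = -(ξ + (-t) • Z) := by module
  rw [h2, kern_neg hp]
  simp only [map_mul, map_div₀, map_pow, map_neg, map_one, Complex.conj_ofReal, Complex.conj_conj]
  rw [show (-(conj (τ : ℂ))) ^ k = (-1) ^ k * conj (τ : ℂ) ^ k by rw [← neg_one_mul, mul_pow]]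
  have h3 : ((-1 : ℂ)) ^ k * (-1) ^ k = 1 := by rw [← mul_pow]; simp
  linear_combination (conj (τ : ℂ) ^ k * conj (sqrtI τ) ^ r * sqrtI τ ^ s / (‖(τ : ℂ)‖ ^ s : ℝ)
        * (conj (kern p τ (ξ + (-t) • Z)) * expi (σ * stdBil ξ Z : ℝ))) * h3

/-- The transformation of the pairing under `S`, for a form `f` of weight `k + (r - s)/2` and a
polynomial of degree `k'`. -/
theorem thetaPair_S [Fintype (Disc q L)] (hL : IsEvenLattice q L)
    (V : q.IsometryEquiv (stdForm r s)) {k k' : ℕ} (hf : IsCuspForm q L (r - s) (2 * k + r - s) f)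
    {p : MvPolynomial (Fin r) ℂ} (hp : p.IsHomogeneous k') {z : E} (hz : q z = 0) (τ : ℍ)
    (σ t : ℝ) :
    thetaPair V f p z (ModularGroup.S • τ) σ t
      = (τ : ℂ) ^ k * conj (τ : ℂ) ^ k' * (‖(τ : ℂ)‖ ^ r / ‖(τ : ℂ)‖ ^ s : ℝ)
        * thetaPair V f p z τ (-t) σ := by
  have hτ : (τ : ℂ) ≠ 0 := τ.ne_zero
  set Z := V z
  have hZ : stdBil Z Z = 0 := by
    rw [← bil_eq_stdBil V, IsotropicData.bil_self, hz, mul_zero]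
  set Φ : (Fin r ⊕ Fin s → ℝ) → ℂ := fun X =>
    conj (kern p (ModularGroup.S • τ) (X + σ • Z)) * expi (t * stdBil X Z : ℝ) with hΦ
  obtain ⟨C, B, hC, hk⟩ := norm_kern_le (s := s) p (r + s + 1)
  have hS := tsum_S hL V hf (Φ := Φ) (K := r + s + 1)
    (C := C * growth (ModularGroup.S • τ).im ^ B * (1 + ‖σ • Z‖) ^ (r + s + 1))
    (C' := ‖conj (τ : ℂ) ^ k' * conj (sqrtI τ) ^ r * sqrtI τ ^ s / (‖(τ : ℂ)‖ ^ s : ℝ)‖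
      * (C * growth τ.im ^ B * (1 + ‖(-t) • Z‖) ^ (r + s + 1)))
    (by
      refine (Complex.continuous_conj.comp ((continuous_kern p).comp
        (continuous_const.prodMk (by fun_prop)))).mul (continuous_expi.comp ?_)
      simp only [stdBil_eq_sum]
      fun_prop) (Nat.lt_succ_self _)
    (fun X => by
      rw [hΦ]
      simp only
      rw [norm_mul, norm_expi_real, mul_one, RCLike.norm_conj, mul_assoc]
      have hg := one_le_growth (ModularGroup.S • τ).im_pos
      exact (hk _ _).trans (mul_le_mul_of_nonneg_left (inv_one_add_norm_add_pow_le _ _ _)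
        (by positivity)))
    (fun ξ => by
      rw [hΦ]
      simp only
      rw [integral_shift_kern_S hp τ hZ, norm_mul]
      refine (mul_le_mul_of_nonneg_left ?_ (norm_nonneg _)).trans_eq (mul_assoc _ _ _).symm
      rw [norm_mul, norm_expi_real, mul_one, RCLike.norm_conj, mul_assoc]
      have hg := one_le_growth τ.im_pos
      exact (hk _ _).trans (mul_le_mul_of_nonneg_left (inv_one_add_norm_add_pow_le _ _ _)
        (by positivity))) τ
  have hL1 : thetaPair V f p z (ModularGroup.S • τ) σ t
      = ∑' x : dual q L, f (ModularGroup.S • τ) (cls q L x) * Φ (V (x : E)) := by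
    refine tsum_congr fun x => ?_
    rw [hΦ, thetaTerm, bil_eq_stdBil V]
    ring
  have hR1 : ∀ x : dual q L, f τ (cls q L x) * ∫ X, Φ X * expi (-(stdBil (V (x : E)) X : ℝ))
      = conj (τ : ℂ) ^ k' * conj (sqrtI τ) ^ r * sqrtI τ ^ s / (‖(τ : ℂ)‖ ^ s : ℝ)
        * thetaTerm V f p z τ (-t) σ x := by
    intro x
    rw [hΦ]
    simp only
    rw [integral_shift_kern_S hp τ hZ, thetaTerm, bil_eq_stdBil V]
    ring
  rw [hL1, hS]
  simp only [hR1]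
  rw [tsum_mul_left, ← thetaPair, ← mul_assoc]
  congr 1
  -- the eighth roots of unity cancel
  have hsq : sqrtI τ ≠ 0 := by
    intro h
    have := sqrtI_sq τ
    rw [h] at this
    simp [hτ] at this
  have hn : ((‖(τ : ℂ)‖ : ℝ) : ℂ) ≠ 0 := Complex.ofReal_ne_zero.mpr (by simpa using hτ)
  have e1 : ((τ : ℂ) ^ (1 / 2 : ℂ)) ^ (2 * k : ℤ) = (τ : ℂ) ^ k := by
    rw [zpow_mul, zpow_natCast]
    congr 1
    rw [show (2 : ℤ) = ((2 : ℕ) : ℤ) from rfl, zpow_natCast, ← Complex.cpow_nat_mul]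
    simp
  have e2 : expi (1 / 8) ^ ((r : ℤ) - s) * expi (-(((r : ℤ) - s : ℤ) : ℂ) / 8) = 1 := by
    rw [expi, expi, ← Complex.exp_int_mul, ← Complex.exp_add]
    rw [show (((r : ℤ) - s : ℤ) : ℂ) * (2 * Real.pi * Complex.I * (1 / 8))
      + 2 * Real.pi * Complex.I * (-(((r : ℤ) - s : ℤ) : ℂ) / 8) = 0 by ring, Complex.exp_zero]
  have e3 : sqrtI τ ^ ((r : ℤ) - s) * sqrtI τ ^ s = sqrtI τ ^ r := by
    rw [zpow_sub₀ hsq, zpow_natCast, zpow_natCast]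
    field_simp
  have e4 : sqrtI τ ^ r * conj (sqrtI τ) ^ r = (‖(τ : ℂ)‖ : ℂ) ^ r := by
    rw [← mul_pow, Complex.mul_conj, Complex.normSq_eq_norm_sq, norm_sqrtI_sq]
  have e5 : ((τ : ℂ) ^ (1 / 2 : ℂ)) ^ (2 * (k : ℤ) + r - s)
      = (τ : ℂ) ^ k * (expi (1 / 8) ^ ((r : ℤ) - s) * sqrtI τ ^ ((r : ℤ) - s)) := by
    have h0 : (τ : ℂ) ^ (1 / 2 : ℂ) ≠ 0 := by
      rw [cpow_half_eq]; exact mul_ne_zero (expi_ne_zero _) hsq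
    rw [add_sub_assoc, zpow_add₀ h0, e1, cpow_half_eq, mul_zpow]
  rw [e5]
  push_cast
  rw [← e4, ← e3]
  push_cast at e2
  linear_combination ((τ : ℂ) ^ k * sqrtI τ ^ ((r : ℤ) - s) * (conj (τ : ℂ) ^ k'
    * conj (sqrtI τ) ^ r * sqrtI τ ^ s / (‖(τ : ℂ)‖ : ℂ) ^ s)) * e2

end Pairing

/-! ### Integration on the upper half plane in the coordinates `(x, y)` -/

section Coordinates

/-- The coordinates `(x, y)` of `τ = x + iy`. -/
def coords (τ : ℍ) : ℝ × ℝ := (τ.re, τ.im)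

/-- The point `x + iy` of `ℍ`, for `y > 0`. -/
def ofCoords (p : ℝ × ℝ) : ℍ := ofComplex (p.1 + p.2 * Complex.I)

lemma coe_ofCoords {p : ℝ × ℝ} (hp : 0 < p.2) :
    (ofCoords p : ℂ) = p.1 + p.2 * Complex.I := by
  rw [ofCoords, ofComplex_apply_of_im_pos (by simpa using hp)]

lemma ofCoords_eq {x y : ℝ} (hy : 0 < y) :
    ofCoords (x, y) = ⟨x + y * Complex.I, by simpa using hy⟩ :=
  UpperHalfPlane.ext (coe_ofCoords (p := (x, y)) hy)

lemma re_ofCoords {p : ℝ × ℝ} (hp : 0 < p.2) : (ofCoords p).re = p.1 := by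
  rw [← coe_re, coe_ofCoords hp]; simp

lemma im_ofCoords {p : ℝ × ℝ} (hp : 0 < p.2) : (ofCoords p).im = p.2 := by
  rw [← coe_im, coe_ofCoords hp]; simp

@[simp] lemma ofCoords_coords (τ : ℍ) : ofCoords (coords τ) = τ := by
  apply UpperHalfPlane.ext
  rw [coe_ofCoords (p := coords τ) τ.im_pos]
  exact Complex.re_add_im (τ : ℂ)

lemma continuousOn_ofCoords : ContinuousOn ofCoords {p | 0 < p.2} := by
  rw [UpperHalfPlane.isOpenEmbedding_coe.isInducing.continuousOn_iff]
  have h : Continuous fun p : ℝ × ℝ => (p.1 : ℂ) + p.2 * Complex.I := by fun_prop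
  exact h.continuousOn.congr fun p hp => coe_ofCoords hp

lemma measurableEmbedding_coords : MeasurableEmbedding coords :=
  Complex.measurableEquivRealProd.measurableEmbedding.comp measurableEmbedding_coe

lemma coords_preimage (A : Set ℍ) :
    coords '' A = {p | 0 < p.2 ∧ ofCoords p ∈ A} := by
  ext p
  constructor
  · rintro ⟨τ, hτ, rfl⟩
    exact ⟨τ.im_pos, by simpa using hτ⟩
  · rintro ⟨hp, hA⟩
    exact ⟨_, hA, Prod.ext (re_ofCoords hp) (im_ofCoords hp)⟩

/-- In coordinates the invariant measure is `dx dy / y²`. -/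
lemma map_coords_volume : Measure.map coords (volume : Measure ℍ)
    = ((volume : Measure (ℝ × ℝ)).restrict {p | 0 < p.2}).withDensity
      fun p => ENNReal.ofReal ((p.2 ^ 2)⁻¹) := by
  have hpos : MeasurableSet {p : ℝ × ℝ | 0 < p.2} := measurableSet_lt measurable_const measurable_snd
  ext s hs
  rw [Measure.map_apply measurableEmbedding_coords.measurable hs, withDensity_apply _ hs,
    Measure.restrict_restrict hs, volume_eq_lintegral]
  have h1 : UpperHalfPlane.coe '' (coords ⁻¹' s)
      = Complex.measurableEquivRealProd ⁻¹' (s ∩ {p | 0 < p.2}) := by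
    ext z
    constructor
    · rintro ⟨τ, hτ, rfl⟩
      exact ⟨hτ, τ.im_pos⟩
    · rintro ⟨h, hz⟩
      exact ⟨⟨z, hz⟩, h, rfl⟩
  rw [h1, ← (Complex.volume_preserving_equiv_real_prod).setLIntegral_comp_preimage_emb
    Complex.measurableEquivRealProd.measurableEmbedding]
  refine setLIntegral_congr_fun (Complex.measurableEquivRealProd.measurable
    (hs.inter hpos)) fun z hz => ?_
  have hz' : 0 < z.im := hz.2
  simp only [Complex.measurableEquivRealProd_apply]
  rw [ENNReal.ofReal, ENNReal.coe_inj]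
  ext
  simp [hz'.le]

lemma setLIntegral_eq_coords {A : Set ℍ} (hA : MeasurableSet A) {G : ℍ → ENNReal}
    (hG : Measurable G) :
    ∫⁻ τ in A, G τ = ∫⁻ p in {p : ℝ × ℝ | 0 < p.2 ∧ ofCoords p ∈ A},
      ENNReal.ofReal ((p.2 ^ 2)⁻¹) * G (ofCoords p) := by
  have hpos : MeasurableSet {p : ℝ × ℝ | 0 < p.2} := measurableSet_lt measurable_const measurable_snd
  have hA' : MeasurableSet {p : ℝ × ℝ | 0 < p.2 ∧ ofCoords p ∈ A} := by
    rw [← coords_preimage]; exact measurableEmbedding_coords.measurableSet_image.mpr hA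
  have h1 : ∫⁻ τ in A, G τ = ∫⁻ p in {p : ℝ × ℝ | 0 < p.2 ∧ ofCoords p ∈ A},
      G (ofCoords p) ∂(Measure.map coords volume) := by
    have h2 : A = coords ⁻¹' {p : ℝ × ℝ | 0 < p.2 ∧ ofCoords p ∈ A} := by
      ext τ
      simp [coords, τ.im_pos, show ofCoords (τ.re, τ.im) = τ from ofCoords_coords τ]
    rw [measurableEmbedding_coords.restrict_map, measurableEmbedding_coords.lintegral_map, ← h2]
    simp
  have hm : AEMeasurable (fun p : ℝ × ℝ => G (ofCoords p))
      (volume.restrict ({p : ℝ × ℝ | 0 < p.2 ∧ ofCoords p ∈ A} ∩ {p | 0 < p.2})) := by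
    refine hG.comp_aemeasurable ?_
    exact (continuousOn_ofCoords.aemeasurable hpos).mono_measure
      (Measure.restrict_mono Set.inter_subset_right le_rfl)
  have hsub : {p : ℝ × ℝ | 0 < p.2 ∧ ofCoords p ∈ A} ∩ {p | 0 < p.2}
      = {p : ℝ × ℝ | 0 < p.2 ∧ ofCoords p ∈ A} :=
    Set.inter_eq_left.mpr fun p hp => hp.1
  rw [h1, map_coords_volume, restrict_withDensity hA', Measure.restrict_restrict hA',
    lintegral_withDensity_eq_lintegral_mul₀ (by fun_prop) hm, hsub]
  rfl

lemma integrableOn_iff_coords {A : Set ℍ} (hA : MeasurableSet A) {G : ℍ → ℂ} :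
    IntegrableOn G A ↔ IntegrableOn (fun p : ℝ × ℝ => ((p.2 ^ 2)⁻¹ : ℝ) • G (ofCoords p))
      {p : ℝ × ℝ | 0 < p.2 ∧ ofCoords p ∈ A} := by
  have hA' : MeasurableSet {p : ℝ × ℝ | 0 < p.2 ∧ ofCoords p ∈ A} := by
    rw [← coords_preimage]; exact measurableEmbedding_coords.measurableSet_image.mpr hA
  have h2 : A = coords ⁻¹' {p : ℝ × ℝ | 0 < p.2 ∧ ofCoords p ∈ A} := by
    ext τ
    simp [coords, τ.im_pos, show ofCoords (τ.re, τ.im) = τ from ofCoords_coords τ]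
  have hsub : {p : ℝ × ℝ | 0 < p.2 ∧ ofCoords p ∈ A} ∩ {p | 0 < p.2}
      = {p : ℝ × ℝ | 0 < p.2 ∧ ofCoords p ∈ A} :=
    Set.inter_eq_left.mpr fun p hp => hp.1
  have h3 : G = (fun p => G (ofCoords p)) ∘ coords := by ext τ; simp
  conv_lhs => rw [h3, h2]
  rw [← measurableEmbedding_coords.integrableOn_map_iff, IntegrableOn, map_coords_volume,
    restrict_withDensity hA', Measure.restrict_restrict hA', hsub,
    integrable_withDensity_iff_integrable_smul' (by fun_prop)
      (Filter.Eventually.of_forall fun _ => ENNReal.ofReal_lt_top), IntegrableOn]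
  refine integrable_congr (Filter.Eventually.of_forall fun p => ?_)
  simp only
  rw [ENNReal.toReal_ofReal (by positivity)]

lemma setIntegral_eq_coords {A : Set ℍ} (hA : MeasurableSet A) (G : ℍ → ℂ) :
    ∫ τ in A, G τ = ∫ p in {p : ℝ × ℝ | 0 < p.2 ∧ ofCoords p ∈ A},
      ((p.2 ^ 2)⁻¹ : ℝ) • G (ofCoords p) := by
  have hA' : MeasurableSet {p : ℝ × ℝ | 0 < p.2 ∧ ofCoords p ∈ A} := by
    rw [← coords_preimage]; exact measurableEmbedding_coords.measurableSet_image.mpr hA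
  have h2 : A = coords ⁻¹' {p : ℝ × ℝ | 0 < p.2 ∧ ofCoords p ∈ A} := by
    ext τ
    simp [coords, τ.im_pos, show ofCoords (τ.re, τ.im) = τ from ofCoords_coords τ]
  have hsub : {p : ℝ × ℝ | 0 < p.2 ∧ ofCoords p ∈ A} ∩ {p | 0 < p.2}
      = {p : ℝ × ℝ | 0 < p.2 ∧ ofCoords p ∈ A} :=
    Set.inter_eq_left.mpr fun p hp => hp.1
  have h3 : ∀ τ, G τ = (fun p => G (ofCoords p)) (coords τ) := by intro τ; simp
  have h4 : ∫ τ in A, G τ = ∫ τ in coords ⁻¹' {p : ℝ × ℝ | 0 < p.2 ∧ ofCoords p ∈ A},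
      (fun p => G (ofCoords p)) (coords τ) := by
    rw [← h2]
    exact integral_congr_ae (Filter.Eventually.of_forall h3)
  rw [h4, ← measurableEmbedding_coords.setIntegral_map (fun p => G (ofCoords p)), map_coords_volume,
    restrict_withDensity hA', Measure.restrict_restrict hA', hsub,
    integral_withDensity_eq_integral_toReal_smul (by fun_prop)
      (Filter.Eventually.of_forall fun _ => ENNReal.ofReal_lt_top)]
  refine integral_congr_ae (Filter.Eventually.of_forall fun p => ?_)
  simp only
  rw [ENNReal.toReal_ofReal (by positivity)]

lemma strip_coords : {p : ℝ × ℝ | 0 < p.2 ∧ ofCoords p ∈ strip}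
    = Set.Ico 0 1 ×ˢ Set.Ioi 0 := by
  ext p
  constructor
  · rintro ⟨hp, h1, h2⟩
    rw [re_ofCoords hp] at h1 h2
    exact ⟨⟨h1, h2⟩, hp⟩
  · rintro ⟨⟨h1, h2⟩, hp⟩
    refine ⟨hp, ?_, ?_⟩ <;> rw [re_ofCoords hp] <;> assumption

lemma half_lt_im_of_mem_fd {τ : ℍ} (h : τ ∈ ModularGroup.fd) : 1 / 2 < τ.im := by
  have := ModularGroup.three_le_four_mul_im_sq_of_mem_fd h
  nlinarith [τ.im_pos]

/-- The modular curve has finite volume. -/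
lemma volume_fd_lt_top : volume (ModularGroup.fd : Set ℍ) < ⊤ := by
  have h := setLIntegral_eq_coords measurableSet_fd (G := fun _ => 1) measurable_const
  rw [setLIntegral_one] at h
  rw [h]
  have hsub : {p : ℝ × ℝ | 0 < p.2 ∧ ofCoords p ∈ (ModularGroup.fd : Set ℍ)}
      ⊆ Set.Icc (-1) 1 ×ˢ Set.Ioi (1 / 2) := by
    rintro p ⟨hp, hfd⟩
    have h1 := half_lt_im_of_mem_fd hfd
    have h2 := hfd.2
    rw [im_ofCoords hp] at h1
    rw [re_ofCoords hp, abs_le] at h2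
    exact ⟨⟨by linarith [h2.1], by linarith [h2.2]⟩, h1⟩
  refine (lintegral_mono_set hsub).trans_lt ?_
  rw [Measure.volume_eq_prod, ← Measure.prod_restrict,
    lintegral_prod _ (by fun_prop)]
  simp only [mul_one]
  rw [lintegral_const]
  have hi := integrableOn_Ioi_rpow_of_lt (a := -2) (c := 1 / 2) (by norm_num) (by norm_num)
  have h3 : ∫⁻ y in Set.Ioi (1 / 2 : ℝ), ENNReal.ofReal ((y ^ 2)⁻¹) < ⊤ := by
    have h4 : ∫⁻ y in Set.Ioi (1 / 2 : ℝ), ENNReal.ofReal ((y ^ 2)⁻¹)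
        = ∫⁻ y in Set.Ioi (1 / 2 : ℝ), ‖y ^ (-2 : ℝ)‖ₑ := by
      refine setLIntegral_congr_fun measurableSet_Ioi fun y hy => ?_
      have hy' : (0 : ℝ) < y := lt_trans (by norm_num) hy
      rw [← ofReal_norm, Real.norm_of_nonneg (by positivity), Real.rpow_neg hy'.le]
      norm_cast
    rw [h4]
    exact hi.2
  refine ENNReal.mul_lt_top h3 ?_
  simp

/-- A polynomial in `y + 1/y` times an exponentially decaying function is bounded for `y > 1/2`. -/
lemma exists_growth_mul_exp_le {ε : ℝ} (hε : 0 < ε) (B : ℕ) :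
    ∃ M : ℝ, ∀ y : ℝ, 1 / 2 < y → growth y ^ B * Real.exp (-ε * y) ≤ M := by
  refine ⟨B.factorial / ε ^ B * Real.exp (2 * ε), fun y hy => ?_⟩
  have hy0 : 0 < y := lt_trans (by norm_num) hy
  have h1 : growth y ≤ y + 2 := by
    have : y⁻¹ ≤ 2 := by
      rw [inv_le_comm₀ hy0 two_pos]; linarith
    unfold growth; linarith
  have hg : 0 ≤ growth y := by linarith [one_le_growth hy0]
  have h2 : growth y ^ B ≤ (y + 2) ^ B := pow_le_pow_left₀ hg h1 _
  have h3 : (ε * (y + 2)) ^ B / B.factorial ≤ Real.exp (ε * (y + 2)) :=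
    Real.pow_div_factorial_le_exp _ (by positivity) _
  have h4 : (y + 2) ^ B ≤ B.factorial / ε ^ B * Real.exp (ε * (y + 2)) := by
    rw [div_le_iff₀ (by positivity), mul_pow] at h3
    rw [div_mul_eq_mul_div, le_div_iff₀ (by positivity)]
    linarith
  calc growth y ^ B * Real.exp (-ε * y)
      ≤ (B.factorial / ε ^ B * Real.exp (ε * (y + 2))) * Real.exp (-ε * y) :=
        mul_le_mul_of_nonneg_right (h2.trans h4) (Real.exp_pos _).le
    _ = _ := by
        rw [mul_assoc, ← Real.exp_add]
        congr 2
        ring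

lemma integrableOn_fd_of_decay {G : ℍ → ℂ} (hG : Measurable G) {C ε : ℝ} {B : ℕ} (hC : 0 ≤ C)
    (hε : 0 < ε) (h : ∀ τ, ‖G τ‖ ≤ C * growth τ.im ^ B * Real.exp (-ε * τ.im)) :
    IntegrableOn G ModularGroup.fd := by
  obtain ⟨M, hM⟩ := exists_growth_mul_exp_le hε B
  refine Measure.integrableOn_of_bounded (M := C * M) volume_fd_lt_top.ne hG.aestronglyMeasurable ?_
  refine (ae_restrict_iff' measurableSet_fd).mpr (Filter.Eventually.of_forall fun τ hτ => ?_)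
  refine (h τ).trans ?_
  rw [mul_assoc]
  exact mul_le_mul_of_nonneg_left (hM _ (half_lt_im_of_mem_fd hτ)) hC

end Coordinates

/-! ### Fourier coefficients in the characteristics -/

section Characteristics

lemma integral_unitBox_fin_two {G : (Fin 2 → ℝ) → ℂ} (hG : Continuous G) :
    ∫ a in unitBox (Fin 2), G a = ∫ x in (0 : ℝ)..1, ∫ y in (0 : ℝ)..1, G ![x, y] := by
  have h1 : unitBox (Fin 2) = MeasurableEquiv.finTwoArrow ⁻¹' (Set.Ioc (0 : ℝ) 1 ×ˢ Set.Ioc (0 : ℝ) 1) := by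
    ext a
    simp [unitBox, Fin.forall_fin_two]
  have h2 : ∀ a : Fin 2 → ℝ, G a = (fun p : ℝ × ℝ => G ![p.1, p.2]) (MeasurableEquiv.finTwoArrow a) := by
    intro a
    congr 1
    ext i
    fin_cases i <;> rfl
  rw [h1, integral_congr_ae (Filter.Eventually.of_forall h2), (volume_preserving_finTwoArrow ℝ).setIntegral_preimage_emb
    (MeasurableEquiv.measurableEmbedding _) (fun p : ℝ × ℝ => G ![p.1, p.2]),
    Measure.volume_eq_prod, setIntegral_prod, intervalIntegral.integral_of_le zero_le_one]
  · refine integral_congr_ae (Filter.Eventually.of_forall fun x => ?_)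
    simp only
    rw [intervalIntegral.integral_of_le zero_le_one]
  · have hc : Continuous fun p : ℝ × ℝ => G ![p.1, p.2] := hG.comp (by fun_prop)
    exact (hc.continuousOn.integrableOn_compact (isCompact_Icc.prod isCompact_Icc)).mono_set
      (Set.prod_mono Set.Ioc_subset_Icc_self Set.Ioc_subset_Icc_self)

lemma integral_unitBox_fin_two_swap {G : (Fin 2 → ℝ) → ℂ} (hG : Continuous G) :
    ∫ a in unitBox (Fin 2), G a = ∫ y in (0 : ℝ)..1, ∫ x in (0 : ℝ)..1, G ![x, y] := by
  rw [integral_unitBox_fin_two hG, intervalIntegral_intervalIntegral_swap]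
  have hc : Continuous fun p : ℝ × ℝ => G ![p.1, p.2] := hG.comp (by fun_prop)
  exact (hc.continuousOn.integrableOn_compact (isCompact_uIcc.prod isCompact_uIcc)).mono_set
      (Set.prod_mono Set.uIoc_subset_uIcc Set.uIoc_subset_uIcc)

variable {r s : ℕ} {E : Type*} [AddCommGroup E] [Module ℝ E] {q : QuadraticForm ℝ E}
  {L : Submodule ℤ E} {sig w : ℤ} {f : ℍ → Disc q L → ℂ}

/-- The Fourier coefficient of index `m = (c, d)` of `y^{w/2}` times the pairing, as a function of
the characteristics `(t, σ)`. -/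
def charCoeff (w : ℤ) (V : q.IsometryEquiv (stdForm r s)) (f : ℍ → Disc q L → ℂ)
    (p : MvPolynomial (Fin r) ℂ) (z : E) (m : Fin 2 → ℤ) (τ : ℍ) : ℂ :=
  ((τ.im ^ ((w : ℝ) / 2) : ℝ) : ℂ) * ∫ a in unitBox (Fin 2),
    thetaPair V f p z τ (a 1) (a 0) * expi (-(∑ i, m i * a i : ℝ))

lemma continuous_charCoeff_integrand [Fintype (Disc q L)] (hL : IsEvenLattice q L)
    (V : q.IsometryEquiv (stdForm r s)) (hw : 0 ≤ w) (hf : IsCuspForm q L sig w f)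
    (p : MvPolynomial (Fin r) ℂ) (z : E) (m : Fin 2 → ℤ) :
    Continuous fun u : ℍ × (Fin 2 → ℝ) =>
      thetaPair V f p z u.1 (u.2 1) (u.2 0) * expi (-(∑ i, m i * u.2 i : ℝ)) := by
  have h1 : Continuous fun u : ℍ × (Fin 2 → ℝ) => (u.1, u.2 1, u.2 0) := by fun_prop
  have h2 : Continuous fun u : ℍ × (Fin 2 → ℝ) => (-(∑ i, m i * u.2 i : ℝ) : ℂ) := by fun_prop
  exact ((continuous_thetaPair hL V hw hf p z).comp h1).mul (continuous_expi.comp h2)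

lemma continuous_thetaPair_two [Fintype (Disc q L)] (hL : IsEvenLattice q L)
    (V : q.IsometryEquiv (stdForm r s)) (hw : 0 ≤ w) (hf : IsCuspForm q L sig w f)
    (p : MvPolynomial (Fin r) ℂ) (z : E) (τ : ℍ) :
    Continuous fun a : Fin 2 → ℝ => thetaPair V f p z τ (a 1) (a 0) := by
  have h1 : Continuous fun a : Fin 2 → ℝ => (τ, a 1, a 0) := by fun_prop
  exact (continuous_thetaPair hL V hw hf p z).comp h1

lemma measurable_charCoeff [Fintype (Disc q L)] (hL : IsEvenLattice q L)
    (V : q.IsometryEquiv (stdForm r s)) (hw : 0 ≤ w) (hf : IsCuspForm q L sig w f)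
    (p : MvPolynomial (Fin r) ℂ) (z : E) (m : Fin 2 → ℤ) :
    Measurable (charCoeff w V f p z m) := by
  refine Measurable.mul ?_ ?_
  · exact Complex.measurable_ofReal.comp
      ((UpperHalfPlane.continuous_im.measurable).pow_const _)
  · exact ((continuous_charCoeff_integrand hL V hw hf p z m).stronglyMeasurable
      |>.integral_prod_right).measurable

/-- The transformation of `y^ν` times the pairing under `S`, for `f` of weight `ν`. -/
lemma im_rpow_mul_thetaPair_S [Fintype (Disc q L)] (hL : IsEvenLattice q L)
    (V : q.IsometryEquiv (stdForm r s)) {k : ℕ} (hf : IsCuspForm q L (r - s) (2 * k + r - s) f)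
    {p : MvPolynomial (Fin r) ℂ} (hp : p.IsHomogeneous k) {z : E} (hz : q z = 0) (τ : ℍ)
    (σ t : ℝ) :
    (((ModularGroup.S • τ).im ^ (((2 * k + r - s : ℤ) : ℝ) / 2) : ℝ) : ℂ)
        * thetaPair V f p z (ModularGroup.S • τ) σ t
      = ((τ.im ^ (((2 * k + r - s : ℤ) : ℝ) / 2) : ℝ) : ℂ) * thetaPair V f p z τ (-t) σ := by
  have hn : 0 < ‖(τ : ℂ)‖ := norm_pos_iff.mpr τ.ne_zero
  rw [thetaPair_S hL V hf hp hz, ← mul_assoc]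
  congr 1
  rw [← mul_pow, Complex.mul_conj, Complex.normSq_eq_norm_sq, ← Complex.ofReal_pow,
    ← Complex.ofReal_mul, ← Complex.ofReal_mul, im_S_smul]
  congr 1
  rw [Real.div_rpow τ.im_pos.le (by positivity), ← Real.rpow_natCast (‖(τ : ℂ)‖) 2,
    ← Real.rpow_mul hn.le]
  have h1 : ‖(τ : ℂ)‖ ^ (((2 : ℕ) : ℝ) * (((2 * k + r - s : ℤ) : ℝ) / 2))
      = (‖(τ : ℂ)‖ ^ 2) ^ k * (‖(τ : ℂ)‖ ^ r / ‖(τ : ℂ)‖ ^ s) := by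
    have h2 : (((2 : ℕ) : ℝ) * (((2 * k + r - s : ℤ) : ℝ) / 2))
        = ((2 * k : ℕ) : ℝ) + (r : ℝ) - (s : ℝ) := by push_cast; ring
    rw [h2, Real.rpow_sub hn, Real.rpow_add hn, Real.rpow_natCast, Real.rpow_natCast,
      Real.rpow_natCast, pow_mul]
    ring
  rw [h1]
  field_simp
  rw [Real.rpow_natCast]

lemma integral_comp_neg_of_periodic {h : ℝ → ℂ} (hp : Function.Periodic h 1) :
    ∫ x in (0 : ℝ)..1, h (-x) = ∫ x in (0 : ℝ)..1, h x := by
  rw [intervalIntegral.integral_comp_neg, neg_zero]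
  have := hp.intervalIntegral_add_eq (-1) 0
  simpa using this

lemma integral_comp_sub_of_periodic {h : ℝ → ℂ} (hp : Function.Periodic h 1) (y : ℝ) :
    ∫ x in (0 : ℝ)..1, h (x - y) = ∫ x in (0 : ℝ)..1, h x := by
  rw [intervalIntegral.integral_comp_sub_right]
  have := hp.intervalIntegral_add_eq (-y) 0
  rw [show (1 : ℝ) - y = -y + 1 by ring, zero_sub, this, zero_add]

/-- The coefficients transform under `SL₂(ℤ)` through their index. -/
theorem isRowFamily_charCoeff [Fintype (Disc q L)] (hL : IsEvenLattice q L)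
    (V : q.IsometryEquiv (stdForm r s)) {k : ℕ} (hw : 0 ≤ (2 * k + r - s : ℤ))
    (hf : IsCuspForm q L (r - s) (2 * k + r - s) f)
    {p : MvPolynomial (Fin r) ℂ} (hp : p.IsHomogeneous k) {z : E} (hzL : z ∈ L) (hz : q z = 0) :
    IsRowFamily (charCoeff (2 * k + r - s) V f p z) := by
  have hcont := fun τ m => (continuous_charCoeff_integrand hL V hw hf p z m).comp
    (continuous_const (y := τ) |>.prodMk continuous_id)
  have hcont' := fun τ (c d : ℤ) => hcont τ ![c, d]
  simp only [Function.comp_def, id_eq, Fin.sum_univ_two, Matrix.cons_val_zero,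
    Matrix.cons_val_one] at hcont'
  have hint : ∀ (x : ℂ) (c d : ℤ), expi (x + c * d) = expi x := fun x c d => by
    have := expi_add_int x (c * d)
    push_cast at this
    exact this
  refine isRowFamily_of_generators (fun c d τ => ?_) fun c d τ => ?_
  -- `S` maps the characteristics `(σ, t)` to `(-t, σ)`
  · simp only [charCoeff, Fin.sum_univ_two, Matrix.cons_val_zero, Matrix.cons_val_one]
    rw [← integral_const_mul]
    simp_rw [← mul_assoc, im_rpow_mul_thetaPair_S hL V hf hp hz τ, mul_assoc]
    rw [integral_const_mul]
    congr 1
    rw [integral_unitBox_fin_two_swap, integral_unitBox_fin_two (hcont' τ d (-c))]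
    · refine intervalIntegral.integral_congr fun y _ => ?_
      simp only [Matrix.cons_val_zero, Matrix.cons_val_one]
      have hper : Function.Periodic (fun u : ℝ => thetaPair V f p z τ u y
          * expi (-((d * y + (-c : ℤ) * u : ℝ) : ℂ))) 1 := by
        intro u
        have h1 := thetaPair_add_int_left (f := f) hL V p hzL hz τ u y 1
        rw [Int.cast_one] at h1
        beta_reduce
        rw [h1]
        congr 1
        rw [← hint (-((d * y + (-c : ℤ) * u : ℝ) : ℂ)) c 1]
        congr 1
        push_cast
        ring
      rw [← integral_comp_neg_of_periodic hper]
      refine intervalIntegral.integral_congr fun x _ => ?_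
      congr 2
      push_cast
      ring
    · have h2 : Continuous fun a : Fin 2 → ℝ => (τ, -a 0, a 1) := by fun_prop
      exact ((continuous_thetaPair hL V hw hf p z).comp h2).mul
        (continuous_expi.comp (by fun_prop))
  -- `T` maps the characteristics `(σ, t)` to `(σ, t - σ)`
  · simp only [charCoeff, Fin.sum_univ_two, Matrix.cons_val_zero, Matrix.cons_val_one]
    rw [ModularGroup.im_T_smul]
    congr 1
    simp_rw [thetaPair_T V hf p hz]
    rw [integral_unitBox_fin_two_swap, integral_unitBox_fin_two_swap (hcont' τ c (c + d))]
    · refine intervalIntegral.integral_congr fun y _ => ?_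
      simp only [Matrix.cons_val_zero, Matrix.cons_val_one]
      have hper : Function.Periodic (fun u : ℝ => thetaPair V f p z τ y u
          * expi (-((c * u + (c + d : ℤ) * y : ℝ) : ℂ))) 1 := by
        intro u
        have h1 := thetaPair_add_int_right (f := f) V p hzL τ y u 1
        rw [Int.cast_one] at h1
        beta_reduce
        rw [h1]
        congr 1
        rw [← hint (-((c * (u + 1) + (c + d : ℤ) * y : ℝ) : ℂ)) c 1]
        congr 1
        push_cast
        ring
      rw [← integral_comp_sub_of_periodic hper y]
      refine intervalIntegral.integral_congr fun x _ => ?_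
      congr 2
      push_cast
      ring
    · have h2 : Continuous fun a : Fin 2 → ℝ => (τ, a 1, a 0 - a 1) := by fun_prop
      exact ((continuous_thetaPair hL V hw hf p z).comp h2).mul
        (continuous_expi.comp (by fun_prop))

lemma norm_im_rpow_mul_le {ν : ℝ} {a : ℂ} {τ : ℍ} {C ε : ℝ} {B : ℕ}
    (h : ‖a‖ ≤ C * growth τ.im ^ B * Real.exp (-ε * τ.im)) :
    ‖((τ.im ^ ν : ℝ) : ℂ) * a‖ ≤ C * growth τ.im ^ (B + ⌈|ν|⌉₊) * Real.exp (-ε * τ.im) := by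
  have hg := one_le_growth τ.im_pos
  rw [norm_mul, Complex.norm_real, Real.norm_of_nonneg (Real.rpow_nonneg τ.im_pos.le _)]
  calc τ.im ^ ν * ‖a‖ ≤ growth τ.im ^ ⌈|ν|⌉₊ * (C * growth τ.im ^ B * Real.exp (-ε * τ.im)) :=
        mul_le_mul (rpow_le_growth τ.im_pos (Nat.le_ceil _)) h (norm_nonneg _) (by positivity)
    _ = _ := by rw [pow_add]; ring

lemma integrableOn_fd_thetaPair [Fintype (Disc q L)] (hL : IsEvenLattice q L)
    (V : q.IsometryEquiv (stdForm r s)) (hw : 0 ≤ w) (hf : IsCuspForm q L sig w f)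
    (p : MvPolynomial (Fin r) ℂ) (z : E) {ν : ℝ} :
    IntegrableOn (fun τ : ℍ => ((τ.im ^ ν : ℝ) : ℂ) * thetaPair V f p z τ 0 0)
      ModularGroup.fd := by
  obtain ⟨C, ε, B, hC, hε, h⟩ := norm_thetaPair_le hL V hw hf p z
  refine integrableOn_fd_of_decay ?_ hC hε fun τ => norm_im_rpow_mul_le (h τ 0 0 (by simp))
  refine Measurable.mul ?_ ?_
  · exact Complex.measurable_ofReal.comp
      ((UpperHalfPlane.continuous_im.measurable).pow_const _)
  · have h2 : Continuous fun τ : ℍ => (τ, (0 : ℝ), (0 : ℝ)) := by fun_prop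
    exact ((continuous_thetaPair hL V hw hf p z).comp h2).measurable

lemma integrableOn_fd_charCoeff [Fintype (Disc q L)] (hL : IsEvenLattice q L)
    (V : q.IsometryEquiv (stdForm r s)) (hw : 0 ≤ w) (hf : IsCuspForm q L sig w f)
    (p : MvPolynomial (Fin r) ℂ) (z : E) (m : Fin 2 → ℤ) :
    IntegrableOn (charCoeff w V f p z m) ModularGroup.fd := by
  obtain ⟨C, ε, B, hC, hε, h⟩ := norm_thetaPair_le hL V hw hf p z
  refine integrableOn_fd_of_decay (measurable_charCoeff hL V hw hf p z m) hC hε fun τ =>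
    norm_im_rpow_mul_le (B := B) ?_
  have hvol : volume (unitBox (Fin 2)) = 1 := by
    rw [unitBox_eq, Real.volume_pi_Ioc]; simp
  refine (norm_setIntegral_le_of_norm_le_const (C := C * growth τ.im ^ B * Real.exp (-ε * τ.im))
    (by rw [hvol]; simp) fun a ha => ?_).trans (by simp [Measure.real, hvol])
  rw [norm_mul, ← Complex.ofReal_neg, norm_expi_real, mul_one]
  exact h τ _ _ (abs_le.mpr ⟨by linarith [(ha 1).1], (ha 1).2⟩)

/-- The Petersson product with the theta function, unfolded: the coefficient of index `0` remains
on the fundamental domain, the others contribute integrals over the strip. -/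
theorem integral_fd_thetaPair [Fintype (Disc q L)] (hL : IsEvenLattice q L)
    (V : q.IsometryEquiv (stdForm r s)) {k : ℕ} (hw : 0 ≤ (2 * k + r - s : ℤ))
    (hf : IsCuspForm q L (r - s) (2 * k + r - s) f)
    {p : MvPolynomial (Fin r) ℂ} (hp : p.IsHomogeneous k) {z : E} (hzL : z ∈ L) (hz : q z = 0)
    (hfin : ∑' n : ℕ, ∫⁻ τ in strip,
      ‖charCoeff (2 * k + r - s) V f p z ![0, (n + 1 : ℤ)] τ‖ₑ ≠ ⊤) :
    ∫ τ in ModularGroup.fd, ((τ.im ^ (((2 * k + r - s : ℤ) : ℝ) / 2) : ℝ) : ℂ)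
        * thetaPair V f p z τ 0 0
      = (∫ τ in ModularGroup.fd, charCoeff (2 * k + r - s) V f p z 0 τ)
        + 2 * ∑' n : ℕ, ∫ τ in strip, charCoeff (2 * k + r - s) V f p z ![0, (n + 1 : ℤ)] τ := by
  set F := charCoeff (2 * k + r - s) V f p z with hF
  have hm : ∀ m, Measurable (F m) := measurable_charCoeff hL V hw hf p z
  have h0 : IntegrableOn (F 0) ModularGroup.fd := integrableOn_fd_charCoeff hL V hw hf p z 0
  have hrow : IsRowFamily F := isRowFamily_charCoeff hL V hw hf hp hzL hz
  obtain ⟨hi, hs, hsum⟩ := hasSum_integral_fd hm hrow hfin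
  have hnorm := tsum_lintegral_fd_eq (φ := fun w τ => ‖F w τ‖ₑ) (fun w => (hm w).enorm)
    (fun γ w τ => congrArg (fun z => ‖z‖ₑ) (hrow γ w τ))
  have hfin2 : ∫⁻ τ in ModularGroup.fd, ∑' w : {w : Fin 2 → ℤ // w ≠ 0}, ‖F w τ‖ₑ ≠ ⊤ := by
    rw [lintegral_tsum fun w : {w : Fin 2 → ℤ // w ≠ 0} => (hm w).enorm.aemeasurable, hnorm]
    exact ENNReal.mul_ne_top (by norm_num) hfin
  -- almost everywhere on the fundamental domain the Fourier series in the characteristics converges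
  -- absolutely, and it is evaluated at the characteristics `0`
  have hae := ae_lt_top'
    (AEMeasurable.tsum fun w : {w : Fin 2 → ℤ // w ≠ 0} => (hm w).enorm.aemeasurable) hfin2
  rw [← hsum.tsum_eq, integral_tsum_of_summable_integral_norm
      (F := fun (w : {w : Fin 2 → ℤ // w ≠ 0}) τ => F w τ) (fun w => hi w w.2) hs,
    ← sub_eq_iff_eq_add', ← integral_sub (integrableOn_fd_thetaPair hL V hw hf p z) h0]
  · refine integral_congr_ae ?_
    filter_upwards [hae] with τ hτ
    have hsm : Summable fun w : {w : Fin 2 → ℤ // w ≠ 0} => F w τ := Summable.of_enorm hτ.ne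
    have hsm' : Summable fun w : Fin 2 → ℤ => F w τ :=
      (summable_subtype_and_compl (s := {w : Fin 2 → ℤ | w ≠ 0})).mp
        ⟨hsm, by
          have : Finite ({w : Fin 2 → ℤ | w ≠ 0}ᶜ : Set _) := by
            have h : ({w : Fin 2 → ℤ | w ≠ 0}ᶜ : Set _) = {0} := by ext w; simp
            rw [h]; infer_instance
          exact Summable.of_finite⟩
    have hy : ((τ.im ^ (((2 * k + r - s : ℤ) : ℝ) / 2) : ℝ) : ℂ) ≠ 0 :=
      Complex.ofReal_ne_zero.mpr (Real.rpow_pos_of_pos τ.im_pos _).ne'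
    have hfour := hasSum_fourier_of_periodic (continuous_thetaPair_two hL V hw hf p z τ)
      (fun a m => by
        rw [thetaPair_add_int_left hL V p hzL hz, thetaPair_add_int_right V p hzL])
      ((summable_mul_left_iff hy).mp hsm') 0
    have hfour2 := hfour.mul_left ((τ.im ^ (((2 * k + r - s : ℤ) : ℝ) / 2) : ℝ) : ℂ)
    simp only [Pi.zero_apply, mul_zero, Finset.sum_const_zero, Complex.ofReal_zero, expi_zero,
      mul_one] at hfour2
    rw [← hfour2.tsum_eq, sub_eq_iff_eq_add']
    have h3 := hsm'.tsum_eq_add_tsum_ite 0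
    rw [show (fun m : Fin 2 → ℤ => ((τ.im ^ (((2 * k + r - s : ℤ) : ℝ) / 2) : ℝ) : ℂ)
      * ∫ a in unitBox (Fin 2), thetaPair V f p z τ (a 1) (a 0)
        * expi (-(∑ i, m i * a i : ℝ))) = fun m => F m τ from rfl, h3]
    congr 1
    rw [← tsum_subtype_eq_of_support_subset (s := {w : Fin 2 → ℤ | w ≠ 0})]
    · refine tsum_congr fun w => ?_
      rw [if_neg w.2]
    · intro w hw
      simp only [Function.mem_support] at hw
      intro h
      exact hw (if_pos h)

end Characteristics

/-! ### Integration by parts over the fundamental domain -/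

section Green

/-- The height of the unit circle above `x`. -/
def arc (x : ℝ) : ℝ := Real.sqrt (1 - x ^ 2)

lemma arc_pos {x : ℝ} (hx : x ^ 2 < 1) : 0 < arc x := Real.sqrt_pos.mpr (by linarith)

lemma arc_neg (x : ℝ) : arc (-x) = arc x := by simp [arc]

lemma arc_sq {x : ℝ} (hx : x ^ 2 < 1) : arc x ^ 2 = 1 - x ^ 2 := Real.sq_sqrt (by linarith)

lemma hasDerivAt_arc {x : ℝ} (hx : x ^ 2 < 1) : HasDerivAt arc (-x / arc x) x := by
  have h1 : HasDerivAt (fun x : ℝ => 1 - x ^ 2) (-(2 * x)) x := by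
    simpa using (hasDerivAt_pow 2 x).const_sub 1
  have h2 := h1.sqrt (by nlinarith)
  refine h2.congr_deriv ?_
  have := arc_pos hx
  unfold arc at *
  field_simp

lemma sq_lt_one_of_mem {x : ℝ} (hx : x ∈ Set.Icc (-(1 / 2) : ℝ) (1 / 2)) : x ^ 2 < 1 := by
  nlinarith [hx.1, hx.2]

/-- Green's formula over `{|x| ≤ 1/2, arc x ≤ y ≤ arc x + T}` for a function `H(τ)W(y)` with a
holomorphic `1`-periodic function `H`, whose `∂/∂x + i∂/∂y` is `iHW'`. -/
lemma green_rectangle {H : ℂ → ℂ} (hH : DifferentiableOn ℂ H {z | 0 < z.im})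
    (hper : ∀ z, 0 < z.im → H (z + 1) = H z) {W W' : ℝ → ℂ}
    (hW : ∀ y, 0 < y → HasDerivAt W (W' y) y) (hW' : ContinuousOn W' (Set.Ioi 0)) {T : ℝ}
    (hT : 0 ≤ T) :
    ∫ x in (-(1 / 2) : ℝ)..(1 / 2), ∫ t in (0 : ℝ)..T,
        H (x + (arc x + t : ℝ) * Complex.I) * W' (arc x + t)
      = (∫ x in (-(1 / 2) : ℝ)..(1 / 2), (1 + Complex.I * (-x / arc x : ℝ))
          * (H (x + (arc x + T : ℝ) * Complex.I) * W (arc x + T)))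
        - ∫ x in (-(1 / 2) : ℝ)..(1 / 2), (1 + Complex.I * (-x / arc x : ℝ))
          * (H (x + (arc x : ℝ) * Complex.I) * W (arc x)) := by
  set Ω : Set (ℝ × ℝ) := {p | p.1 ^ 2 < 1 ∧ 0 < arc p.1 + p.2}
  set G : ℝ × ℝ → ℂ := fun p =>
    H (p.1 + (arc p.1 + p.2 : ℝ) * Complex.I) * W (arc p.1 + p.2) with hG
  set A : ℝ × ℝ → (ℝ × ℝ →L[ℝ] ℝ) := fun p =>
    (-p.1 / arc p.1) • ContinuousLinearMap.fst ℝ ℝ ℝ + ContinuousLinearMap.snd ℝ ℝ ℝ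
  have hA : ∀ p ∈ Ω, HasFDerivAt (fun p : ℝ × ℝ => arc p.1 + p.2) (A p) p := fun p hp =>
    ((hasDerivAt_arc hp.1).comp_hasFDerivAt p hasFDerivAt_fst).add hasFDerivAt_snd
  -- in the coordinates `(x, t)`, `y = arc x + t`, the operator `∂/∂x + i∂/∂y` becomes a divergence
  have key : ∀ p ∈ Ω, ∃ F' G' : ℝ × ℝ →L[ℝ] ℂ,
      HasFDerivAt (fun p => -Complex.I * G p) F' p ∧
      HasFDerivAt (fun p => (1 + Complex.I * (-p.1 / arc p.1 : ℝ)) * G p) G' p ∧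
      F' (1, 0) + G' (0, 1)
        = H (p.1 + (arc p.1 + p.2 : ℝ) * Complex.I) * W' (arc p.1 + p.2) := by
    intro p hp
    have hZ := (Complex.ofRealCLM.hasFDerivAt.comp p
      (hasFDerivAt_fst (𝕜 := ℝ) (E := ℝ) (F := ℝ))).add
      ((Complex.ofRealCLM.hasFDerivAt.comp p (hA p hp)).mul_const Complex.I)
    have him : 0 < ((p.1 : ℂ) + (arc p.1 + p.2 : ℝ) * Complex.I).im := by
      have := hp.2
      simpa using this
    have hHd : HasDerivAt H (deriv H ((p.1 : ℂ) + (arc p.1 + p.2 : ℝ) * Complex.I))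
        ((p.1 : ℂ) + (arc p.1 + p.2 : ℝ) * Complex.I) :=
      (hH.differentiableAt ((isOpen_lt continuous_const Complex.continuous_im).mem_nhds
        him)).hasDerivAt
    have hHZ := HasDerivAt.comp_hasFDerivAt p hHd hZ
    have hWY := (hW _ hp.2).hasFDerivAt.comp p (hA p hp)
    have hGd := hHZ.mul hWY
    have hc : DifferentiableAt ℝ (fun x : ℝ => (1 + Complex.I * ((-x / arc x : ℝ) : ℂ))) p.1 := by
      have h1 := (hasDerivAt_id p.1).neg.div (hasDerivAt_arc hp.1) (arc_pos hp.1).ne'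
      exact ((h1.ofReal_comp.const_mul Complex.I).const_add 1).differentiableAt
    have hcp := hc.hasDerivAt.hasFDerivAt.comp p
      (hasFDerivAt_fst (𝕜 := ℝ) (E := ℝ) (F := ℝ))
    refine ⟨_, _, hGd.const_mul (-Complex.I), hcp.mul hGd, ?_⟩
    simp [A]
    ring_nf
  choose! F' G' hF' hG' hFG using key
  have hrect : Set.uIcc (-(1 / 2) : ℝ) (1 / 2) ×ˢ Set.uIcc 0 T ⊆ Ω := by
    rintro p ⟨h1, h2⟩
    rw [Set.uIcc_of_le (by norm_num)] at h1
    rw [Set.uIcc_of_le hT] at h2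
    have h3 := sq_lt_one_of_mem h1
    exact ⟨h3, add_pos_of_pos_of_nonneg (arc_pos h3) h2.1⟩
  have hopen : Set.Ioo (min (-(1 / 2) : ℝ) (1 / 2)) (max (-(1 / 2) : ℝ) (1 / 2))
      ×ˢ Set.Ioo (min 0 T) (max 0 T) \ ∅ ⊆ Ω := by
    refine Set.Subset.trans ?_ hrect
    rw [Set.sdiff_empty]
    exact Set.prod_mono Set.Ioo_subset_Icc_self Set.Ioo_subset_Icc_self
  have harc : Continuous arc := by unfold arc; fun_prop
  have hcontZ : Continuous fun p : ℝ × ℝ => (p.1 : ℂ) + (arc p.1 + p.2 : ℝ) * Complex.I := by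
    fun_prop
  have hcont : ContinuousOn (fun p : ℝ × ℝ =>
      H (p.1 + (arc p.1 + p.2 : ℝ) * Complex.I) * W' (arc p.1 + p.2)) Ω := by
    refine ContinuousOn.mul ?_ ?_
    · refine hH.continuousOn.comp hcontZ.continuousOn fun p hp => ?_
      have := hp.2
      simpa using this
    · exact hW'.comp (by fun_prop) fun p hp => hp.2
  have hdiv := integral2_divergence_prod_of_hasFDerivAt_off_countable
    (fun p => -Complex.I * G p) (fun p => (1 + Complex.I * (-p.1 / arc p.1 : ℝ)) * G p)
    F' G' (-(1 / 2)) 0 (1 / 2) T ∅ Set.countable_empty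
    (fun p hp => (hF' p (hrect hp)).continuousAt.continuousWithinAt)
    (fun p hp => (hG' p (hrect hp)).continuousAt.continuousWithinAt)
    (fun p hp => hF' p (hopen hp)) (fun p hp => hG' p (hopen hp))
    (by
      refine ((hcont.mono hrect).integrableOn_compact
        (isCompact_uIcc.prod isCompact_uIcc)).congr_fun (fun p hp => (hFG p (hrect hp)).symm)
        (measurableSet_uIcc.prod measurableSet_uIcc))
  -- the vertical sides cancel by periodicity
  have hside : ∫ y in (0 : ℝ)..T, -Complex.I * G (1 / 2, y)
      = ∫ y in (0 : ℝ)..T, -Complex.I * G (-(1 / 2), y) := by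
    refine intervalIntegral.integral_congr fun y hy => ?_
    rw [Set.uIcc_of_le hT] at hy
    simp only [hG, arc_neg]
    have h0 : 0 < arc (1 / 2) := arc_pos (by norm_num)
    rw [← hper (((-(1 / 2) : ℝ) : ℂ) + (arc (1 / 2) + y : ℝ) * Complex.I)
      (by simpa using add_pos_of_pos_of_nonneg h0 hy.1)]
    congr 3
    push_cast
    ring
  rw [hside] at hdiv
  simp only [add_sub_cancel_right, hG, add_zero] at hdiv
  rw [← hdiv]
  refine intervalIntegral.integral_congr fun x hx => ?_
  refine intervalIntegral.integral_congr fun t ht => ?_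
  exact (hFG (x, t) (hrect ⟨hx, ht⟩)).symm

/-- The shear `(x, t) ↦ (x, arc x + t)`. -/
def arcShear : ℝ × ℝ ≃ᵐ ℝ × ℝ where
  toFun p := (p.1, arc p.1 + p.2)
  invFun p := (p.1, p.2 - arc p.1)
  left_inv p := by simp
  right_inv p := by simp
  measurable_toFun := by
    have harc : Continuous arc := by unfold arc; fun_prop
    exact (by fun_prop : Continuous fun p : ℝ × ℝ => (p.1, arc p.1 + p.2)).measurable
  measurable_invFun := by
    have harc : Continuous arc := by unfold arc; fun_prop
    exact (by fun_prop : Continuous fun p : ℝ × ℝ => (p.1, p.2 - arc p.1)).measurable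

lemma measurePreserving_arcShear : MeasurePreserving arcShear volume volume := by
  have harc : Continuous arc := by unfold arc; fun_prop
  rw [Measure.volume_eq_prod]
  exact (MeasurePreserving.id (volume : Measure ℝ)).skew_product
    (g := fun x t => arc x + t)
    (by
      change Measurable fun p : ℝ × ℝ => arc p.1 + p.2
      exact (by fun_prop : Continuous fun p : ℝ × ℝ => arc p.1 + p.2).measurable)
    (Filter.Eventually.of_forall fun x => map_add_left_eq_self volume (arc x))

lemma arcShear_preimage_fd :
    arcShear ⁻¹' {p : ℝ × ℝ | 0 < p.2 ∧ ofCoords p ∈ (ModularGroup.fd : Set ℍ)}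
      = Set.Icc (-(1 / 2)) (1 / 2) ×ˢ Set.Ici 0 := by
  have hns : ∀ p : ℝ × ℝ, 0 < p.2 → Complex.normSq (ofCoords p) = p.1 ^ 2 + p.2 ^ 2 := by
    intro p hp
    rw [coe_ofCoords hp, Complex.normSq_apply]
    simp
    ring
  ext ⟨x, t⟩
  constructor
  · rintro ⟨hp, h1, h2⟩
    rw [hns _ hp] at h1
    rw [re_ofCoords hp] at h2
    change 0 < arc x + t at hp
    change 1 ≤ x ^ 2 + (arc x + t) ^ 2 at h1
    change |x| ≤ 1 / 2 at h2
    have hx : x ∈ Set.Icc (-(1 / 2) : ℝ) (1 / 2) := abs_le.mp h2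
    have h3 := arc_sq (sq_lt_one_of_mem hx)
    refine ⟨hx, ?_⟩
    have h4 : arc x ≤ arc x + t := by
      refine le_of_sq_le_sq ?_ hp.le
      linarith
    simpa using h4
  · rintro ⟨hx, ht⟩
    have ht' : 0 ≤ t := ht
    have h3 := arc_sq (sq_lt_one_of_mem hx)
    have h4 := arc_pos (sq_lt_one_of_mem hx)
    have hp : 0 < (arcShear (x, t)).2 := add_pos_of_pos_of_nonneg h4 ht'
    refine ⟨hp, ?_, ?_⟩
    · rw [hns _ hp]
      change 1 ≤ x ^ 2 + (arc x + t) ^ 2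
      nlinarith
    · rw [re_ofCoords hp]
      exact abs_le.mpr hx

/-- The integral over the fundamental domain as a limit of integrals over rectangles in the
coordinates `(x, t)`, `τ = x + i(arc x + t)`. -/
lemma tendsto_integral_fd {F : ℍ → ℂ} (hi : IntegrableOn F ModularGroup.fd) :
    Filter.Tendsto (fun n : ℕ => ∫ x in (-(1 / 2) : ℝ)..(1 / 2), ∫ t in (0 : ℝ)..n,
        (((arc x + t) ^ 2)⁻¹ : ℝ) • F (ofCoords (x, arc x + t))) Filter.atTop
      (nhds (∫ τ in ModularGroup.fd, F τ)) := by
  have hi2 := (integrableOn_iff_coords measurableSet_fd).mp hi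
  rw [← measurePreserving_arcShear.integrableOn_comp_preimage
    arcShear.measurableEmbedding, arcShear_preimage_fd] at hi2
  rw [setIntegral_eq_coords measurableSet_fd,
    ← measurePreserving_arcShear.setIntegral_preimage_emb arcShear.measurableEmbedding,
    arcShear_preimage_fd]
  have hU : (⋃ n : ℕ, Set.Icc (-(1 / 2) : ℝ) (1 / 2) ×ˢ Set.Icc (0 : ℝ) n)
      = Set.Icc (-(1 / 2)) (1 / 2) ×ˢ Set.Ici 0 := by
    rw [← Set.prod_iUnion]
    congr 1
    ext t
    simp only [Set.mem_iUnion, Set.mem_Icc, Set.mem_Ici]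
    exact ⟨fun ⟨n, h, _⟩ => h, fun h => ⟨⌈t⌉₊, h, Nat.le_ceil t⟩⟩
  rw [← hU] at hi2 ⊢
  refine (tendsto_setIntegral_of_monotone (fun n => measurableSet_Icc.prod measurableSet_Icc)
    (fun m n hmn => Set.prod_mono le_rfl (Set.Icc_subset_Icc_right (by exact_mod_cast hmn)))
    hi2).congr fun n => ?_
  have hi3 := hi2.mono_set (Set.subset_iUnion
    (fun n : ℕ => Set.Icc (-(1 / 2) : ℝ) (1 / 2) ×ˢ Set.Icc (0 : ℝ) n) n)
  rw [Measure.volume_eq_prod] at hi3 ⊢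
  rw [setIntegral_prod _ hi3, intervalIntegral.integral_of_le (by norm_num),
    integral_Icc_eq_integral_Ioc]
  refine integral_congr_ae (Filter.Eventually.of_forall fun x => ?_)
  simp only
  rw [intervalIntegral.integral_of_le (Nat.cast_nonneg n), integral_Icc_eq_integral_Ioc]
  rfl

variable {r s : ℕ} {E : Type*} [AddCommGroup E] [Module ℝ E] {q : QuadraticForm ℝ E}
  {L : Submodule ℤ E} {sig w : ℤ} {f : ℍ → Disc q L → ℂ}

/-- The non-holomorphic factor `y^b [e^{-Δ/8πy} p](x⁺)‾ e^{-2πy(x⁺)²}` of a term of the pairing. -/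
def radialFactor (p : MvPolynomial (Fin r) ℂ) (X : Fin r ⊕ Fin s → ℝ) (b y : ℝ) : ℂ :=
  ((y ^ b : ℝ) : ℂ) * conj (heatEval (1 / (8 * Real.pi * y) : ℝ)
    (fun i => (X (Sum.inl i) : ℂ)) p) * (Real.exp (-(2 * Real.pi * y * ∑ j, X (Sum.inl j) ^ 2)) : ℝ)

/-- The holomorphic factor `f_x(τ) 𝐞(-q(x)τ)` of a term of the pairing. -/
def holoFactor (f : ℍ → Disc q L → ℂ) (x : dual q L) (z : ℂ) : ℂ :=
  f (ofComplex z) (cls q L x) * expi (-((q (x : E) : ℝ) : ℂ) * z)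

lemma countable_dual (hL : IsEvenLattice q L) (V : q.IsometryEquiv (stdForm r s)) :
    Countable (dual q L) := by
  obtain ⟨b, b', -, hb', -, -⟩ := exists_dual_bases hL V
  exact (intSpanEquiv b' _ hb').symm.injective.countable

/-- The complex conjugate of the kernel is antiholomorphic up to a function of `y`. -/
lemma conj_kern (p : MvPolynomial (Fin r) ℂ) (τ : ℍ) (X : Fin r ⊕ Fin s → ℝ) :
    conj (kern p τ X) = expi (-((stdForm r s X : ℝ) : ℂ) * τ)
      * radialFactor p X ((s : ℝ) / 2) τ.im := by
  have hexp : expi (-(conj ((τ : ℂ) * (qPlus X : ℝ) + conj (τ : ℂ) * (qMinus X : ℝ))))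
      = expi (-((stdForm r s X : ℝ) : ℂ) * τ)
        * (Real.exp (-(2 * Real.pi * τ.im * ∑ j, X (Sum.inl j) ^ 2)) : ℝ) := by
    have h1 : conj (τ : ℂ) = τ - 2 * τ.im * Complex.I := by
      apply Complex.ext <;> simp
      ring
    have h2 : (∑ j, X (Sum.inl j) ^ 2 : ℝ) = 2 * qPlus X := by
      unfold qPlus; ring
    rw [h2, Complex.ofReal_exp, expi, expi, ← Complex.exp_add, stdForm_eq_qPlus_add_qMinus]
    congr 1
    simp only [map_add, map_mul, Complex.conj_conj, Complex.conj_ofReal]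
    rw [h1]
    push_cast
    ring_nf
    simp only [Complex.I_sq]
    ring
  rw [kern, map_mul, map_mul, conj_expi, hexp, Complex.conj_ofReal, radialFactor]
  push_cast
  ring

lemma rpow_mul_thetaTerm (V : q.IsometryEquiv (stdForm r s)) (p : MvPolynomial (Fin r) ℂ) (z : E)
    (b : ℝ) (τ : ℍ) (x : dual q L) :
    ((τ.im ^ b : ℝ) : ℂ) * thetaTerm V f p z τ 0 0 x
      = holoFactor f x τ * radialFactor p (V (x : E)) (b + (s : ℝ) / 2) τ.im := by
  rw [thetaTerm, zero_smul, add_zero, conj_kern, V.map_app, holoFactor, radialFactor, radialFactor,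
    Real.rpow_add τ.im_pos, ofComplex_apply, zero_mul, Complex.ofReal_zero, expi_zero]
  push_cast
  ring

/-- `d/dy` maps the radial factor of `p` to that of `∑ x_j² p`. -/
lemma hasDerivAt_radialFactor {k : ℕ} {p : MvPolynomial (Fin r) ℂ} (hp : p.IsHomogeneous k)
    (X : Fin r ⊕ Fin s → ℝ) {y : ℝ} (hy : 0 < y) :
    HasDerivAt (radialFactor p X (k + (r : ℝ) / 2))
      (-(2 * Real.pi : ℝ) * radialFactor ((∑ i, MvPolynomial.X i ^ 2) * p) X (k + (r : ℝ) / 2) y)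
      y := by
  set R : ℝ := ∑ j, X (Sum.inl j) ^ 2 with hR
  set x : Fin r → ℂ := fun i => (X (Sum.inl i) : ℂ) with hx
  have hπ : (Real.pi : ℂ) ≠ 0 := Complex.ofReal_ne_zero.mpr Real.pi_ne_zero
  have hyc : (y : ℂ) ≠ 0 := Complex.ofReal_ne_zero.mpr hy.ne'
  have h1 : HasDerivAt (fun y : ℝ => ((y ^ (k + (r : ℝ) / 2) : ℝ) : ℂ))
      (((k + (r : ℝ) / 2) * y ^ (k + (r : ℝ) / 2 - 1) : ℝ) : ℂ) y :=
    (Real.hasDerivAt_rpow_const (Or.inl hy.ne')).ofReal_comp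
  have h2 : HasDerivAt (fun y : ℝ => ((1 / (8 * Real.pi * y) : ℝ) : ℂ))
      ((-(1 / (8 * Real.pi * y ^ 2)) : ℝ) : ℂ) y := by
    have : HasDerivAt (fun y : ℝ => 1 / (8 * Real.pi * y)) (-(1 / (8 * Real.pi * y ^ 2))) y := by
      have h := ((hasDerivAt_id y).const_mul (8 * Real.pi)).inv
        (mul_ne_zero (by positivity) hy.ne')
      simp only [one_div]
      refine h.congr_deriv ?_
      have := Real.pi_ne_zero
      simp only [id]
      field_simp
    exact this.ofReal_comp
  have h3 := (hasDerivAt_heatEval ((1 / (8 * Real.pi * y) : ℝ) : ℂ) x p).comp y h2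
  have h4 := (Complex.conjCLE.toContinuousLinearMap.hasFDerivAt).comp_hasDerivAt y h3
  have h5 : HasDerivAt (fun y : ℝ => ((Real.exp (-(2 * Real.pi * y * R)) : ℝ) : ℂ))
      ((Real.exp (-(2 * Real.pi * y * R)) * (-(2 * Real.pi * R)) : ℝ) : ℂ) y := by
    have h := (((hasDerivAt_id y).const_mul (2 * Real.pi)).mul_const R).neg.exp
    refine h.ofReal_comp.congr_deriv ?_
    simp
  refine ((h1.mul h4).mul h5).congr_deriv ?_
  have hpow : y ^ (k + (r : ℝ) / 2 - 1) = y ^ (k + (r : ℝ) / 2) / y := by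
    rw [Real.rpow_sub hy, Real.rpow_one]
  simp only [radialFactor]
  rw [heatEval_sum_sq_mul _ _ hp, hpow, ← hx, ← hR]
  have hRc : (∑ i, x i ^ 2 : ℂ) = (R : ℂ) := by rw [hR, hx]; push_cast; rfl
  rw [hRc]
  simp only [Function.comp_apply, Pi.mul_apply, map_sub, map_mul, map_pow, map_add, map_natCast, map_ofNat,
    Complex.conj_ofReal, Fintype.card_fin, ContinuousLinearEquiv.coe_coe,
    Complex.conjCLE_apply, map_neg]
  push_cast
  field_simp
  ring

lemma continuousOn_radialFactor (p : MvPolynomial (Fin r) ℂ) (X : Fin r ⊕ Fin s → ℝ) (b : ℝ) :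
    ContinuousOn (radialFactor p X b) (Set.Ioi 0) := by
  have h1 : ContinuousOn (fun y : ℝ => ((y ^ b : ℝ) : ℂ)) (Set.Ioi 0) :=
    Complex.continuous_ofReal.comp_continuousOn
      (continuousOn_id.rpow_const fun y hy => Or.inl (ne_of_gt hy))
  have h2 : ContinuousOn (fun y : ℝ => (((1 / (8 * Real.pi * y) : ℝ) : ℂ),
      fun i : Fin r => (X (Sum.inl i) : ℂ))) (Set.Ioi 0) := by
    refine ContinuousOn.prodMk (Complex.continuous_ofReal.comp_continuousOn ?_) continuousOn_const
    refine continuousOn_const.div (by fun_prop) fun y hy => ?_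
    have : 0 < y := hy
    positivity
  have h3 := Complex.continuous_conj.comp_continuousOn ((continuous_heatEval p).comp_continuousOn h2)
  exact (h1.mul h3).mul (by fun_prop)

lemma holoFactor_differentiableOn (hf : IsCuspForm q L sig w f) (x : dual q L) :
    DifferentiableOn ℂ (holoFactor f x) {z | 0 < z.im} := by
  have h1 := UpperHalfPlane.mdifferentiable_iff.mp (hf.holo (cls q L x))
  refine h1.mul ?_
  unfold expi
  fun_prop

lemma holoFactor_add_one [Fintype (Disc q L)] (hf : IsCuspForm q L sig w f) (x : dual q L)
    {z : ℂ} (hz : 0 < z.im) : holoFactor f x (z + 1) = holoFactor f x z := by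
  have hz1 : 0 < (z + 1).im := by simpa using hz
  have h1 : ofComplex (z + 1) = ModularGroup.T • ofComplex z := by
    apply UpperHalfPlane.ext
    rw [modular_T_smul, coe_vadd, ofComplex_apply_of_im_pos hz1, ofComplex_apply_of_im_pos hz]
    push_cast
    ring
  rw [holoFactor, holoFactor, h1, hf.map_T, mul_right_comm, mul_comm, ← expi_add]
  congr 2
  ring

lemma half_lt_arc {x : ℝ} (hx : x ∈ Set.Icc (-(1 / 2) : ℝ) (1 / 2)) : 1 / 2 < arc x := by
  have h1 := arc_sq (sq_lt_one_of_mem hx)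
  have h2 := arc_pos (sq_lt_one_of_mem hx)
  nlinarith [hx.1, hx.2]

lemma norm_arc_form_le {x : ℝ} (hx : x ∈ Set.Icc (-(1 / 2) : ℝ) (1 / 2)) :
    ‖(1 + Complex.I * (-x / arc x : ℝ) : ℂ)‖ ≤ 2 := by
  have h1 := half_lt_arc hx
  have h2 : |x| ≤ arc x := (abs_le.mpr hx).trans h1.le
  refine (norm_add_le _ _).trans ?_
  rw [norm_one, norm_mul, Complex.norm_I, one_mul, Complex.norm_real, Real.norm_eq_abs, abs_div,
    abs_neg, abs_of_pos (by linarith : 0 < arc x)]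
  have : |x| / arc x ≤ 1 := (div_le_one (by linarith)).mpr h2
  linarith

/-- One term of the Petersson product of `f` with the theta function of `∑ x_j² p`, as a line
integral over the lower boundary of the fundamental domain. -/
lemma integral_fd_thetaTerm_sum_sq [Fintype (Disc q L)] (hL : IsEvenLattice q L)
    (V : q.IsometryEquiv (stdForm r s)) (hw : 0 ≤ w) (hf : IsCuspForm q L sig w f) {k : ℕ}
    {p : MvPolynomial (Fin r) ℂ} (hp : p.IsHomogeneous k) (x : dual q L) :
    ∫ τ in ModularGroup.fd, ((τ.im ^ (k + 2 + ((r : ℝ) - s) / 2) : ℝ) : ℂ)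
        * thetaTerm V f ((∑ i, MvPolynomial.X i ^ 2) * p) 0 τ 0 0 x
      = (1 / (2 * Real.pi) : ℝ) * ∫ t in (-(1 / 2) : ℝ)..(1 / 2),
          (1 + Complex.I * (-t / arc t : ℝ)) * (((ofCoords (t, arc t)).im ^ (k + ((r : ℝ) - s) / 2) : ℝ)
            * thetaTerm V f p 0 (ofCoords (t, arc t)) 0 0 x) := by
  set P := (∑ i, MvPolynomial.X i ^ 2) * p with hP
  obtain ⟨C, ε, B, hC, hε, hbd⟩ := norm_thetaTerm_le hL V hw hf P 0 0
  obtain ⟨C', ε', B', hC', hε', hbd'⟩ := norm_thetaTerm_le hL V hw hf p 0 0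
  simp only [pow_zero, inv_one, mul_one] at hbd hbd'
  have hmeas : ∀ (p : MvPolynomial (Fin r) ℂ) (b : ℝ), Measurable fun τ : ℍ =>
      ((τ.im ^ b : ℝ) : ℂ) * thetaTerm V f p 0 τ 0 0 x := by
    intro p b
    refine Measurable.mul (Complex.measurable_ofReal.comp
      ((UpperHalfPlane.continuous_im.measurable).pow_const _)) ?_
    have h2 : Continuous fun τ : ℍ => (τ, (0 : ℝ), (0 : ℝ)) := by fun_prop
    exact ((continuous_thetaTerm hf V p 0 x).comp h2).measurable
  have hlim := tendsto_integral_fd (integrableOn_fd_of_decay (hmeas P _) hC hε fun τ =>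
    norm_im_rpow_mul_le (ν := k + 2 + ((r : ℝ) - s) / 2) (hbd τ 0 0 x))
  set W := radialFactor p (V (x : E)) (k + (r : ℝ) / 2) with hW
  set W' := fun y => -(2 * Real.pi : ℝ) * radialFactor P (V (x : E)) (k + (r : ℝ) / 2) y with hW'
  have hW'c : ContinuousOn W' (Set.Ioi 0) :=
    continuousOn_const.mul (continuousOn_radialFactor P (V (x : E)) _)
  have hG : ∀ (t y : ℝ), 0 < y → holoFactor f x (t + (y : ℝ) * Complex.I) * W y
      = (((ofCoords (t, y)).im ^ (k + ((r : ℝ) - s) / 2) : ℝ) : ℂ)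
        * thetaTerm V f p 0 (ofCoords (t, y)) 0 0 x := by
    intro t y hy
    rw [rpow_mul_thetaTerm, coe_ofCoords (p := (t, y)) hy, im_ofCoords (p := (t, y)) hy, hW,
      show (k : ℝ) + ((r : ℝ) - s) / 2 + (s : ℝ) / 2 = k + (r : ℝ) / 2 by ring]
  -- Green's formula up to height `n`; the upper boundary contributes nothing as `n → ∞`
  have hgreen : ∀ n : ℕ, ∫ t in (-(1 / 2) : ℝ)..(1 / 2), ∫ u in (0 : ℝ)..n,
        (((arc t + u) ^ 2)⁻¹ : ℝ) • ((((ofCoords (t, arc t + u)).im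
          ^ (k + 2 + ((r : ℝ) - s) / 2) : ℝ) : ℂ) * thetaTerm V f P 0 (ofCoords (t, arc t + u)) 0 0 x)
      = (1 / (2 * Real.pi) : ℝ) * (∫ t in (-(1 / 2) : ℝ)..(1 / 2), (1 + Complex.I * (-t / arc t : ℝ))
            * (((ofCoords (t, arc t)).im ^ (k + ((r : ℝ) - s) / 2) : ℝ)
              * thetaTerm V f p 0 (ofCoords (t, arc t)) 0 0 x))
        - (1 / (2 * Real.pi) : ℝ) * ∫ t in (-(1 / 2) : ℝ)..(1 / 2), (1 + Complex.I * (-t / arc t : ℝ))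
            * (((ofCoords (t, arc t + n)).im ^ (k + ((r : ℝ) - s) / 2) : ℝ)
              * thetaTerm V f p 0 (ofCoords (t, arc t + n)) 0 0 x) := by
    intro n
    have h1 := green_rectangle (holoFactor_differentiableOn hf x)
      (fun z hz => holoFactor_add_one hf x hz) (W := W) (W' := W')
      (fun y hy => hasDerivAt_radialFactor hp (V (x : E)) hy) hW'c (Nat.cast_nonneg n)
    have hmem : ∀ t ∈ Set.uIcc (-(1 / 2) : ℝ) (1 / 2), 0 < arc t := fun t ht => by
      rw [Set.uIcc_of_le (by norm_num)] at ht
      linarith [half_lt_arc ht]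
    have e1 : ∀ t ∈ Set.uIcc (-(1 / 2) : ℝ) (1 / 2), ∀ u ∈ Set.uIcc (0 : ℝ) n,
        (((arc t + u) ^ 2)⁻¹ : ℝ) • ((((ofCoords (t, arc t + u)).im
          ^ (k + 2 + ((r : ℝ) - s) / 2) : ℝ) : ℂ) * thetaTerm V f P 0 (ofCoords (t, arc t + u)) 0 0 x)
        = (-(1 / (2 * Real.pi)) : ℝ) * (holoFactor f x (t + (arc t + u : ℝ) * Complex.I)
          * W' (arc t + u)) := by
      intro t ht u hu
      rw [Set.uIcc_of_le (Nat.cast_nonneg n)] at hu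
      have hy : 0 < arc t + u := add_pos_of_pos_of_nonneg (hmem t ht) hu.1
      have hπ : (Real.pi : ℂ) ≠ 0 := Complex.ofReal_ne_zero.mpr Real.pi_ne_zero
      rw [rpow_mul_thetaTerm, coe_ofCoords (p := (t, arc t + u)) hy,
        im_ofCoords (p := (t, arc t + u)) hy, hW']
      have hyc : ((arc t + u : ℝ) : ℂ) ≠ 0 := Complex.ofReal_ne_zero.mpr hy.ne'
      have e2 : radialFactor P (V (x : E)) (k + 2 + ((r : ℝ) - s) / 2 + (s : ℝ) / 2) (arc t + u)
          = ((arc t + u : ℝ) : ℂ) ^ 2 * radialFactor P (V (x : E)) (k + (r : ℝ) / 2) (arc t + u) := by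
        rw [radialFactor, radialFactor,
          show (k : ℝ) + 2 + ((r : ℝ) - s) / 2 + (s : ℝ) / 2 = 2 + (k + (r : ℝ) / 2) by ring,
          Real.rpow_add hy]
        push_cast
        rw [Real.rpow_two]
        push_cast
        ring
      rw [e2, Complex.real_smul]
      push_cast at hyc ⊢
      field_simp
    have e3 : ∫ t in (-(1 / 2) : ℝ)..(1 / 2), ∫ u in (0 : ℝ)..n,
        (((arc t + u) ^ 2)⁻¹ : ℝ) • ((((ofCoords (t, arc t + u)).im
          ^ (k + 2 + ((r : ℝ) - s) / 2) : ℝ) : ℂ) * thetaTerm V f P 0 (ofCoords (t, arc t + u)) 0 0 x)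
        = ∫ t in (-(1 / 2) : ℝ)..(1 / 2), ∫ u in (0 : ℝ)..n, (-(1 / (2 * Real.pi)) : ℝ)
          * (holoFactor f x (t + (arc t + u : ℝ) * Complex.I) * W' (arc t + u)) :=
      intervalIntegral.integral_congr fun t ht => intervalIntegral.integral_congr fun u hu =>
        e1 t ht u hu
    rw [e3]
    simp only [intervalIntegral.integral_const_mul]
    rw [h1]
    have e4 : ∀ v : ℝ, 0 ≤ v → ∫ t in (-(1 / 2) : ℝ)..(1 / 2), (1 + Complex.I * (-t / arc t : ℝ))
          * (holoFactor f x (t + (arc t + v : ℝ) * Complex.I) * W (arc t + v))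
        = ∫ t in (-(1 / 2) : ℝ)..(1 / 2), (1 + Complex.I * (-t / arc t : ℝ))
            * (((ofCoords (t, arc t + v)).im ^ (k + ((r : ℝ) - s) / 2) : ℝ)
              * thetaTerm V f p 0 (ofCoords (t, arc t + v)) 0 0 x) := fun v hv =>
      intervalIntegral.integral_congr fun t ht => by
        rw [hG t (arc t + v) (add_pos_of_pos_of_nonneg (hmem t ht) hv)]
    have e5 := e4 0 le_rfl
    simp only [add_zero] at e5
    rw [e4 n (Nat.cast_nonneg n), e5]
    push_cast
    ring
  -- the contribution of the upper edge tends to zero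
  have htop : Filter.Tendsto (fun n : ℕ => ∫ t in (-(1 / 2) : ℝ)..(1 / 2),
      (1 + Complex.I * (-t / arc t : ℝ))
        * ((((ofCoords (t, arc t + n)).im ^ (k + ((r : ℝ) - s) / 2) : ℝ) : ℂ)
              * thetaTerm V f p 0 (ofCoords (t, arc t + n)) 0 0 x)) Filter.atTop (nhds 0) := by
    set ν := (k + ((r : ℝ) - s) / 2)
    obtain ⟨M, hM⟩ := exists_growth_mul_exp_le (half_pos hε') (B' + ⌈|ν|⌉₊)
    have hbound : ∀ n : ℕ, ‖∫ t in (-(1 / 2) : ℝ)..(1 / 2),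
        (1 + Complex.I * (-t / arc t : ℝ))
          * ((((ofCoords (t, arc t + n)).im ^ ν : ℝ) : ℂ)
              * thetaTerm V f p 0 (ofCoords (t, arc t + n)) 0 0 x)‖
        ≤ 2 * (C' * M) * Real.exp (-(ε' / 2) * n) := by
      intro n
      refine (intervalIntegral.norm_integral_le_of_norm_le_const
        (C := 2 * (C' * M) * Real.exp (-(ε' / 2) * n)) fun t ht => ?_).trans_eq (by norm_num)
      rw [Set.uIoc_of_le (by norm_num)] at ht
      have ht' : t ∈ Set.Icc (-(1 / 2) : ℝ) (1 / 2) := Set.Ioc_subset_Icc_self ht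
      have harc := half_lt_arc ht'
      have hn : (0 : ℝ) ≤ n := Nat.cast_nonneg n
      have hy : 0 < arc t + n := by linarith
      rw [norm_mul, mul_assoc]
      refine mul_le_mul (norm_arc_form_le ht') ?_ (norm_nonneg _) zero_le_two
      refine (norm_im_rpow_mul_le (hbd' _ 0 0 x)).trans ?_
      rw [im_ofCoords (p := (t, arc t + n)) hy]
      have h1 := hM (arc t + n) (by linarith)
      have h2 : Real.exp (-ε' * (arc t + n)) ≤ Real.exp (-(ε' / 2) * (arc t + n))
          * Real.exp (-(ε' / 2) * n) := by
        rw [← Real.exp_add, Real.exp_le_exp]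
        nlinarith
      have hg : 0 ≤ growth (arc t + n) := by linarith [one_le_growth hy]
      calc C' * growth (arc t + n) ^ (B' + ⌈|ν|⌉₊) * Real.exp (-ε' * (arc t + n))
          ≤ C' * growth (arc t + n) ^ (B' + ⌈|ν|⌉₊) * (Real.exp (-(ε' / 2) * (arc t + n))
              * Real.exp (-(ε' / 2) * n)) := mul_le_mul_of_nonneg_left h2 (by positivity)
        _ = C' * (growth (arc t + n) ^ (B' + ⌈|ν|⌉₊) * Real.exp (-(ε' / 2) * (arc t + n)))
              * Real.exp (-(ε' / 2) * n) := by ring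
        _ ≤ _ := mul_le_mul_of_nonneg_right (mul_le_mul_of_nonneg_left h1 hC') (Real.exp_pos _).le
    refine squeeze_zero_norm hbound ?_
    rw [show (0 : ℝ) = 2 * (C' * M) * 0 by ring]
    refine Filter.Tendsto.const_mul _ ?_
    refine Real.tendsto_exp_atBot.comp ?_
    exact (tendsto_natCast_atTop_atTop).const_mul_atTop_of_neg (by linarith)
  have hlim2 := (tendsto_const_nhds (x := ((1 / (2 * Real.pi) : ℝ) : ℂ)
    * (∫ t in (-(1 / 2) : ℝ)..(1 / 2), (1 + Complex.I * (-t / arc t : ℝ))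
            * ((((ofCoords (t, arc t)).im ^ (k + ((r : ℝ) - s) / 2) : ℝ) : ℂ)
              * thetaTerm V f p 0 (ofCoords (t, arc t)) 0 0 x)))).sub
    (htop.const_mul ((1 / (2 * Real.pi) : ℝ) : ℂ))
  rw [mul_zero, sub_zero] at hlim2
  refine tendsto_nhds_unique hlim (hlim2.congr fun n => (hgreen n).symm)

lemma S_smul_arc {t : ℝ} (ht : t ∈ Set.Icc (-(1 / 2) : ℝ) (1 / 2)) :
    ModularGroup.S • ofCoords (t, arc t) = ofCoords (-t, arc (-t)) := by
  have h1 := arc_sq (sq_lt_one_of_mem ht)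
  have h2 := arc_pos (sq_lt_one_of_mem ht)
  apply UpperHalfPlane.ext
  have hS : ((ModularGroup.S • ofCoords (t, arc t) : ℍ) : ℂ)
      = (-(ofCoords (t, arc t) : ℂ))⁻¹ := by
    rw [modular_S_smul]
  rw [hS, coe_ofCoords (p := (t, arc t)) h2, arc_neg, coe_ofCoords (p := (-t, arc t)) h2]
  refine inv_eq_of_mul_eq_one_right ?_
  have h3 : ((arc t : ℝ) : ℂ) ^ 2 = 1 - (t : ℂ) ^ 2 := by exact_mod_cast congrArg ((↑) : ℝ → ℂ) h1
  push_cast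
  ring_nf
  rw [Complex.I_sq, h3]
  ring

lemma norm_ofCoords_arc {t : ℝ} (ht : t ∈ Set.Icc (-(1 / 2) : ℝ) (1 / 2)) :
    ‖(ofCoords (t, arc t) : ℂ)‖ = 1 := by
  have h1 := arc_sq (sq_lt_one_of_mem ht)
  have h2 := arc_pos (sq_lt_one_of_mem ht)
  have h3 : ‖(ofCoords (t, arc t) : ℂ)‖ ^ 2 = 1 := by
    rw [← Complex.normSq_eq_norm_sq, coe_ofCoords (p := (t, arc t)) h2, Complex.normSq_apply]
    simp
    nlinarith
  exact (pow_eq_one_iff_of_nonneg (norm_nonneg _) two_ne_zero).mp h3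

/-- The Petersson product of a cusp form of weight `k + 2 + (r - s)/2` with the theta function of
`∑ x_j² p`, `p` homogeneous of degree `k`, vanishes: it is a line integral over the arc of the unit
circle, whose integrand is odd under `S`. -/
theorem integral_fd_thetaPair_sum_sq [Fintype (Disc q L)] (hL : IsEvenLattice q L)
    (V : q.IsometryEquiv (stdForm r s)) {k : ℕ} (hw : 0 ≤ (2 * ((k + 2 : ℕ) : ℤ) + r - s : ℤ))
    (hf : IsCuspForm q L (r - s) (2 * ((k + 2 : ℕ) : ℤ) + r - s) f)
    {p : MvPolynomial (Fin r) ℂ} (hp : p.IsHomogeneous k) :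
    ∫ τ in ModularGroup.fd, ((τ.im ^ (k + 2 + ((r : ℝ) - s) / 2) : ℝ) : ℂ)
        * thetaPair V f ((∑ i, MvPolynomial.X i ^ 2) * p) 0 τ 0 0 = 0 := by
  set P := (∑ i, MvPolynomial.X i ^ 2) * p with hP
  set ν₁ := (k : ℝ) + 2 + ((r : ℝ) - s) / 2
  set ν := (k : ℝ) + ((r : ℝ) - s) / 2
  obtain ⟨C, ε, B, hC, hε, hbd⟩ := norm_thetaTerm_le hL V hw hf P 0 (r + s + 1)
  obtain ⟨C', ε', B', hC', hε', hbd'⟩ := norm_thetaTerm_le hL V hw hf p 0 (r + s + 1)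
  have hsd := summable_dual hL V (Nat.lt_succ_self (r + s))
  simp only [map_zero, norm_zero, mul_zero, add_zero, one_pow, one_mul] at hbd hbd'
  have hmeas : ∀ (p : MvPolynomial (Fin r) ℂ) (b : ℝ) (x : dual q L), Measurable fun τ : ℍ =>
      ((τ.im ^ b : ℝ) : ℂ) * thetaTerm V f p 0 τ 0 0 x := by
    intro p b x
    refine Measurable.mul (Complex.measurable_ofReal.comp
      ((UpperHalfPlane.continuous_im.measurable).pow_const _)) ?_
    have h2 : Continuous fun τ : ℍ => (τ, (0 : ℝ), (0 : ℝ)) := by fun_prop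
    exact ((continuous_thetaTerm hf V p 0 x).comp h2).measurable
  obtain ⟨M, hM⟩ := exists_growth_mul_exp_le hε (B + ⌈|ν₁|⌉₊)
  have hterm : ∀ (x : dual q L) (τ : ℍ), ‖((τ.im ^ ν₁ : ℝ) : ℂ) * thetaTerm V f P 0 τ 0 0 x‖
      ≤ (C * ((1 + ‖V (x : E)‖) ^ (r + s + 1))⁻¹) * growth τ.im ^ (B + ⌈|ν₁|⌉₊)
        * Real.exp (-ε * τ.im) := fun x τ =>
    norm_im_rpow_mul_le ((hbd τ 0 0 x).trans (le_of_eq (by ring)))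
  have hint : ∀ x : dual q L, IntegrableOn (fun τ : ℍ =>
      ((τ.im ^ ν₁ : ℝ) : ℂ) * thetaTerm V f P 0 τ 0 0 x) ModularGroup.fd := fun x =>
    integrableOn_fd_of_decay (hmeas P _ x) (by positivity) hε (hterm x)
  have hterm' : ∀ (x : dual q L), ∀ τ ∈ (ModularGroup.fd : Set ℍ),
      ‖((τ.im ^ ν₁ : ℝ) : ℂ) * thetaTerm V f P 0 τ 0 0 x‖
        ≤ (C * M) * ((1 + ‖V (x : E)‖) ^ (r + s + 1))⁻¹ := fun x τ hτ => by
    refine (hterm x τ).trans ?_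
    rw [mul_assoc]
    refine (mul_le_mul_of_nonneg_left (hM _ (half_lt_im_of_mem_fd hτ)) (by positivity)).trans_eq ?_
    ring
  have hcount := countable_dual hL V
  have hfin : IsFiniteMeasure (volume.restrict (ModularGroup.fd : Set ℍ)) :=
    ⟨by rw [Measure.restrict_apply_univ]; exact volume_fd_lt_top⟩
  have hsum : HasSum (fun x : dual q L => ∫ τ in ModularGroup.fd,
      ((τ.im ^ ν₁ : ℝ) : ℂ) * thetaTerm V f P 0 τ 0 0 x)
      (∫ τ in ModularGroup.fd, ((τ.im ^ ν₁ : ℝ) : ℂ) * thetaPair V f P 0 τ 0 0) := by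
    refine hasSum_integral_of_dominated_convergence
      (fun x _ => (C * M) * ((1 + ‖V (x : E)‖) ^ (r + s + 1))⁻¹)
      (fun x => (hmeas P _ x).aestronglyMeasurable)
      (fun x => (ae_restrict_iff' measurableSet_fd).mpr
        (Filter.Eventually.of_forall (hterm' x)))
      (Filter.Eventually.of_forall fun _ => hsd.mul_left _) (integrable_const _)
      (Filter.Eventually.of_forall fun τ => ?_)
    exact (summable_thetaTerm hL V hw hf P 0 τ 0 0).hasSum.mul_left _
  -- the same sum, through the line integrals
  set g : ℝ → ℂ := fun t => (1 + Complex.I * (-t / arc t : ℝ))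
    * ((((ofCoords (t, arc t)).im ^ ν : ℝ) : ℂ) * thetaPair V f p 0 (ofCoords (t, arc t)) 0 0) with hg
  have harc : Continuous arc := by unfold arc; fun_prop
  have huIoc : ∀ t ∈ Set.uIoc (-(1 / 2) : ℝ) (1 / 2), t ∈ Set.Icc (-(1 / 2) : ℝ) (1 / 2) := by
    intro t ht
    rw [Set.uIoc_of_le (by norm_num)] at ht
    exact Set.Ioc_subset_Icc_self ht
  have hmaps : Set.MapsTo (fun t => (t, arc t)) (Set.Icc (-(1 / 2) : ℝ) (1 / 2))
      {p : ℝ × ℝ | 0 < p.2} := fun t ht => arc_pos (sq_lt_one_of_mem ht)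
  have hcoords : ContinuousOn (fun t => ofCoords (t, arc t)) (Set.Icc (-(1 / 2) : ℝ) (1 / 2)) :=
    continuousOn_ofCoords.comp (by fun_prop) hmaps
  have hline : HasSum (fun x : dual q L => ∫ t in (-(1 / 2) : ℝ)..(1 / 2),
      (1 + Complex.I * (-t / arc t : ℝ)) * (((ofCoords (t, arc t)).im ^ ν : ℝ)
            * thetaTerm V f p 0 (ofCoords (t, arc t)) 0 0 x))
      (∫ t in (-(1 / 2) : ℝ)..(1 / 2), g t) := by
    obtain ⟨M', hM'⟩ := exists_growth_mul_exp_le hε' (B' + ⌈|ν|⌉₊)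
    refine intervalIntegral.hasSum_integral_of_dominated_convergence
      (fun x _ => 2 * ((C' * M') * ((1 + ‖V (x : E)‖) ^ (r + s + 1))⁻¹))
      (fun x => ?_)
      (fun x => Filter.Eventually.of_forall fun t ht => ?_)
      (Filter.Eventually.of_forall fun t ht => (hsd.mul_left _).mul_left _)
      (by simp)
      (Filter.Eventually.of_forall fun t ht =>
        ((summable_thetaTerm hL V hw hf p 0 _ 0 0).hasSum.mul_left _).mul_left _)
    · have hc : ContinuousOn (fun t : ℝ => (1 + Complex.I * (-t / arc t : ℝ))
          * ((((ofCoords (t, arc t)).im ^ ν : ℝ) : ℂ)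
            * thetaTerm V f p 0 (ofCoords (t, arc t)) 0 0 x)) (Set.Icc (-(1 / 2)) (1 / 2)) := by
        refine ContinuousOn.mul ?_ (ContinuousOn.mul ?_ ?_)
        · refine continuousOn_const.add (continuousOn_const.mul
            (Complex.continuous_ofReal.comp_continuousOn ?_))
          exact continuousOn_neg.div harc.continuousOn fun t ht => (arc_pos (sq_lt_one_of_mem ht)).ne'
        · refine Complex.continuous_ofReal.comp_continuousOn ?_
          exact (UpperHalfPlane.continuous_im.comp_continuousOn hcoords).rpow_const
            fun t ht => Or.inl (UpperHalfPlane.im_pos _).ne'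
        · have h2 : Continuous fun τ : ℍ => (τ, (0 : ℝ), (0 : ℝ)) := by fun_prop
          exact ((continuous_thetaTerm hf V p 0 x).comp h2).comp_continuousOn hcoords
      rw [Set.uIoc_of_le (by norm_num)]
      exact (hc.mono Set.Ioc_subset_Icc_self).aestronglyMeasurable measurableSet_Ioc
    · have ht' := huIoc t ht
      rw [norm_mul]
      refine mul_le_mul (norm_arc_form_le ht') ?_ (norm_nonneg _) zero_le_two
      have h1 : ‖thetaTerm V f p 0 (ofCoords (t, arc t)) 0 0 x‖
          ≤ (C' * ((1 + ‖V (x : E)‖) ^ (r + s + 1))⁻¹) * growth (ofCoords (t, arc t)).im ^ B'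
            * Real.exp (-ε' * (ofCoords (t, arc t)).im) :=
        (hbd' _ 0 0 x).trans (le_of_eq (by ring))
      refine (norm_im_rpow_mul_le h1).trans ?_
      rw [mul_assoc]
      refine (mul_le_mul_of_nonneg_left (hM' _ ?_) (by positivity)).trans_eq (by ring)
      rw [im_ofCoords (p := (t, arc t)) (arc_pos (sq_lt_one_of_mem ht'))]
      exact half_lt_arc ht'
  have h1 := hsum
  simp only [hP, ν₁] at h1
  have h2 := (hline.mul_left ((1 / (2 * Real.pi) : ℝ) : ℂ))
  have h3 : ∀ x : dual q L, _ := integral_fd_thetaTerm_sum_sq hL V hw hf hp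
  rw [funext h3] at h1
  rw [h1.unique h2]
  -- the integrand is odd
  have hodd : ∀ t ∈ Set.Icc (-(1 / 2) : ℝ) (1 / 2), g (-t) = -g t := by
    intro t ht
    have ha := arc_pos (sq_lt_one_of_mem ht)
    have hac : ((arc t : ℝ) : ℂ) ≠ 0 := Complex.ofReal_ne_zero.mpr ha.ne'
    have hτ := coe_ofCoords (p := (t, arc t)) ha
    have hn := norm_ofCoords_arc ht
    have h4 := thetaPair_S hL V hf hp (z := 0) (map_zero _) (ofCoords (t, arc t)) 0 0
    rw [S_smul_arc ht, hn, pow_add, mul_right_comm ((ofCoords (t, arc t) : ℂ) ^ k), ← mul_pow,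
      Complex.mul_conj, Complex.normSq_eq_norm_sq, hn] at h4
    have him : (ofCoords (-t, arc (-t))).im = (ofCoords (t, arc t)).im := by
      rw [im_ofCoords (p := (t, arc t)) ha, im_ofCoords (p := (-t, arc (-t))) (by rwa [arc_neg]),
        arc_neg]
    have harcsq : ((arc t : ℝ) : ℂ) ^ 2 = 1 - (t : ℂ) ^ 2 := by
      exact_mod_cast congrArg ((↑) : ℝ → ℂ) (arc_sq (sq_lt_one_of_mem ht))
    simp only [hg]
    rw [him, h4, hτ, arc_neg, neg_zero]
    push_cast
    simp only [one_pow, div_one, mul_one, one_mul]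
    have h5 : (1 + Complex.I * (- -(t : ℂ) / (arc t : ℂ))) * ((t : ℂ) + arc t * Complex.I) ^ 2
        = -(1 + Complex.I * (-(t : ℂ) / (arc t : ℂ))) := by
      field_simp
      ring_nf
      simp only [Complex.I_sq, Complex.I_pow_three]
      linear_combination (t * Complex.I - arc t : ℂ) * harcsq
    linear_combination ((((ofCoords (t, arc t)).im ^ ν : ℝ) : ℂ)
      * thetaPair V f p 0 (ofCoords (t, arc t)) 0 0) * h5
  have h6 : ∫ t in (-(1 / 2) : ℝ)..(1 / 2), g t = -∫ t in (-(1 / 2) : ℝ)..(1 / 2), g t := by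
    have := intervalIntegral.integral_comp_neg (a := -(1 / 2)) (b := 1 / 2) g
    rw [neg_neg] at this
    rw [← intervalIntegral.integral_neg]
    refine this.symm.trans ?_
    refine intervalIntegral.integral_congr fun t ht => hodd t ?_
    rwa [Set.uIcc_of_le (by norm_num)] at ht
  rw [self_eq_neg.mp h6, mul_zero]

end Green

/-! ### The Fourier transform of the kernel along an isotropic line -/

section Line

variable {n s : ℕ}

lemma conj_heatMonomial (t x : ℝ) (e : ℕ) : conj (heatMonomial t x e) = heatMonomial t x e := by
  induction e using Nat.strong_induction_on with
  | _ e ih =>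
    rcases e with _ | e
    · simp [heatMonomial_zero]
    · rw [heatMonomial_succ, map_sub, map_mul, map_mul, map_mul, map_mul, ih e (by omega),
        ih (e - 1) (by omega), Complex.conj_ofReal, Complex.conj_ofReal, Complex.conj_ofNat,
        Complex.conj_natCast]

/-- The kernel of the polynomial `X₀ᵐ h(X₁, …, X_n)`, `h` harmonic, on a line in the direction of
an isotropic vector `Z` whose positive part is a multiple of the first basis vector. Since the
parameter `1/(8πy)` of the heat operator is `1/(4b)` for the Gaussian `e^{-bu²}`, `b = 2πy`, that
occurs, the transform of the Hermite polynomial is a pure power. What remains is the kernel of `h`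
at the point `X - (X₀/r₀)Z` of the line. -/
theorem integral_conj_kern_line {h : MvPolynomial (Fin n) ℂ} (hh : lap h = 0) (m : ℕ) (τ : ℍ)
    {X Z : Fin (n + 1) ⊕ Fin s → ℝ} {r₀ : ℝ} (hr : r₀ ≠ 0) (hZ0 : Z (Sum.inl 0) = r₀)
    (hZ : ∀ i : Fin n, Z (Sum.inl i.succ) = 0)
    (hQ : ∀ σ : ℝ, stdForm (n + 1) s (X + σ • Z) = stdForm (n + 1) s X) (d : ℝ) :
    ∫ σ : ℝ, conj (kern (MvPolynomial.X 0 ^ m * MvPolynomial.rename Fin.succ h) τ (X + σ • Z))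
        * expi (-(d * σ : ℝ))
      = conj (kern (MvPolynomial.rename Fin.succ h) τ (X - (X (Sum.inl 0) / r₀) • Z))
        * expi ((d * (X (Sum.inl 0) / r₀) : ℝ))
        * (((|r₀|⁻¹ * (1 / (2 * τ.im)) ^ (1 / 2 : ℝ)
            * Real.exp (-(Real.pi * d ^ 2 / (2 * τ.im * r₀ ^ 2))) : ℝ) : ℂ)
          * (-(Complex.I * (d / (2 * r₀ * τ.im) : ℝ))) ^ m) := by
  have hy := τ.im_pos
  have hy' : (τ.im : ℂ) ≠ 0 := Complex.ofReal_ne_zero.mpr hy.ne'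
  have hπ : (Real.pi : ℂ) ≠ 0 := Complex.ofReal_ne_zero.mpr Real.pi_ne_zero
  have hr' : (r₀ : ℂ) ≠ 0 := Complex.ofReal_ne_zero.mpr hr
  set t : ℝ := 1 / (8 * Real.pi * τ.im) with ht
  set A : ℂ := expi (-((stdForm (n + 1) s X : ℝ) : ℂ) * τ) * (τ.im ^ ((s : ℝ) / 2) : ℝ)
    * conj (MvPolynomial.eval (fun i => ((X (Sum.inl (Fin.succ i)) : ℝ) : ℂ)) h)
    * (Real.exp (-(2 * Real.pi * τ.im * ∑ i : Fin n, X (Sum.inl i.succ) ^ 2)) : ℝ)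
    * expi ((d * (X (Sum.inl 0) / r₀) : ℝ)) with hA
  set b : ℂ := ((2 * Real.pi * τ.im : ℝ) : ℂ) with hb
  have hb0 : 0 < b.re := by rw [hb, Complex.ofReal_re]; positivity
  set G : ℝ → ℂ := fun u => heatMonomial t u m
      * Complex.exp (-b * (u : ℂ) ^ 2 - 2 * Real.pi * Complex.I * ((d / r₀ : ℝ) : ℂ) * u) with hG
  have h1 : ∀ σ : ℝ,
      conj (kern (MvPolynomial.X 0 ^ m * MvPolynomial.rename Fin.succ h) τ (X + σ • Z))
        * expi (-(d * σ : ℝ)) = A * G (X (Sum.inl 0) + r₀ * σ) := by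
    intro σ
    have e0 : (X + σ • Z) (Sum.inl 0) = X (Sum.inl 0) + r₀ * σ := by simp [hZ0, mul_comm]
    have e1 : ∀ i : Fin n, (X + σ • Z) (Sum.inl i.succ) = X (Sum.inl i.succ) := fun i => by
      simp [hZ i]
    rw [conj_kern, hQ, radialFactor, heatEval_X_pow_mul_rename, map_mul, Fin.sum_univ_succ]
    simp only [e0, e1]
    rw [heatEval_of_lap_eq_zero _ _ hh, conj_heatMonomial, hA, hG]
    simp only
    have e2 : (Real.exp (-(2 * Real.pi * τ.im * ((X (Sum.inl 0) + r₀ * σ) ^ 2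
          + ∑ i : Fin n, X (Sum.inl i.succ) ^ 2))) : ℂ) * expi (-((d * σ : ℝ) : ℂ))
        = (Real.exp (-(2 * Real.pi * τ.im * ∑ i : Fin n, X (Sum.inl i.succ) ^ 2)) : ℝ)
          * expi ((d * (X (Sum.inl 0) / r₀) : ℝ))
          * Complex.exp (-b * ((X (Sum.inl 0) + r₀ * σ : ℝ) : ℂ) ^ 2
            - 2 * Real.pi * Complex.I * ((d / r₀ : ℝ) : ℂ) * ((X (Sum.inl 0) + r₀ * σ : ℝ) : ℂ)) := by
      rw [Complex.ofReal_exp, Complex.ofReal_exp, expi, expi, ← Complex.exp_add, ← Complex.exp_add,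
        ← Complex.exp_add, hb]
      congr 1
      push_cast
      field_simp
      ring
    rw [← ht]
    linear_combination (expi (-((stdForm (n + 1) s X : ℝ) : ℂ) * τ) * (τ.im ^ ((s : ℝ) / 2) : ℝ)
      * conj (MvPolynomial.eval (fun i => ((X (Sum.inl (Fin.succ i)) : ℝ) : ℂ)) h)
      * heatMonomial t (X (Sum.inl 0) + r₀ * σ : ℝ) m) * e2
  have h2 := integral_heatMonomial_gaussian (t : ℂ) hb0 (d / r₀) m
  -- the parameter of the transformed Hermite polynomial vanishes
  have e3 : (t : ℂ) - 1 / (4 * b) = 0 := by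
    rw [ht, hb]; push_cast; field_simp; ring
  have e4 : -(Complex.I * Real.pi * ((d / r₀ : ℝ) : ℂ)) / b
      = -(Complex.I * (d / (2 * r₀ * τ.im) : ℝ)) := by
    rw [hb]; push_cast; field_simp
  have e5 : (Real.pi / b : ℂ) ^ (1 / 2 : ℂ) = ((1 / (2 * τ.im)) ^ (1 / 2 : ℝ) : ℝ) := by
    rw [Complex.ofReal_cpow (by positivity), hb]
    congr 1
    · push_cast; field_simp
    · push_cast; rfl
  have e6 : Complex.exp (-(Real.pi ^ 2 * ((d / r₀ : ℝ) : ℂ) ^ 2) / b)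
      = (Real.exp (-(Real.pi * d ^ 2 / (2 * τ.im * r₀ ^ 2))) : ℝ) := by
    rw [Complex.ofReal_exp, hb]
    congr 1
    push_cast
    field_simp
  rw [e3, e4, e5, e6, heatMonomial_zero_left] at h2
  have h3 : ∫ σ : ℝ, G (X (Sum.inl 0) + r₀ * σ) = |r₀⁻¹| • ∫ u, G u := by
    rw [Measure.integral_comp_mul_left (fun v => G (X (Sum.inl 0) + v)),
      integral_add_left_eq_self G]
  have h4 : conj (kern (MvPolynomial.rename Fin.succ h) τ (X - (X (Sum.inl 0) / r₀) • Z))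
        * expi ((d * (X (Sum.inl 0) / r₀) : ℝ)) = A := by
    have hX : X - (X (Sum.inl 0) / r₀) • Z = X + (-(X (Sum.inl 0) / r₀)) • Z := by module
    have f0 : (X - (X (Sum.inl 0) / r₀) • Z) (Sum.inl 0) = 0 := by
      simp [hZ0, div_mul_cancel₀ _ hr]
    have f1 : ∀ i : Fin n, (X - (X (Sum.inl 0) / r₀) • Z) (Sum.inl i.succ) = X (Sum.inl i.succ) :=
      fun i => by simp [hZ i]
    have f2 := heatEval_X_pow_mul_rename (t : ℂ)
      (fun i => (((X - (X (Sum.inl 0) / r₀) • Z) (Sum.inl i) : ℝ) : ℂ)) 0 h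
    rw [pow_zero, one_mul, heatMonomial_zero, one_mul, heatEval_of_lap_eq_zero _ _ hh] at f2
    rw [conj_kern, radialFactor, ← ht, f2, Fin.sum_univ_succ, f0, hX, hQ, ← hX, hA]
    simp only [f1]
    rw [zero_pow two_ne_zero, zero_add]
    ring
  rw [integral_congr_ae (Filter.Eventually.of_forall h1), integral_const_mul, h3, h2, h4,
    Complex.real_smul, abs_inv]
  push_cast
  ring

/-- The kernel is integrable along every line. -/
lemma integrable_conj_kern_line {r : ℕ} (p : MvPolynomial (Fin r) ℂ) (τ : ℍ)
    (X : Fin r ⊕ Fin s → ℝ) {Z : Fin r ⊕ Fin s → ℝ} (hZ : Z ≠ 0) (d : ℝ) :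
    Integrable fun σ : ℝ => conj (kern p τ (X + σ • Z)) * expi (-(d * σ : ℝ)) := by
  obtain ⟨C, B, hC, h⟩ := norm_kern_le (s := s) p 2
  have hg := one_le_growth τ.im_pos
  have hZ' : ‖Z‖ ≠ 0 := norm_ne_zero_iff.mpr hZ
  have h1 : Integrable fun σ : ℝ => (1 + ‖‖Z‖ * σ‖) ^ (-(2 : ℝ)) :=
    (integrable_one_add_norm (E := ℝ) (μ := volume) (r := 2) (by simp)).comp_mul_left' hZ'
  have hc : Continuous fun σ : ℝ => kern p τ (X + σ • Z) :=
    Continuous.comp (g := fun v : ℍ × (Fin r ⊕ Fin s → ℝ) => kern p v.1 v.2)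
      (f := fun σ : ℝ => (τ, X + σ • Z)) (continuous_kern p) (by fun_prop)
  refine ((h1.const_mul (C * growth τ.im ^ B * (1 + ‖X‖) ^ 2))).mono' ?_
    (Filter.Eventually.of_forall fun σ => ?_)
  · exact ((Complex.continuous_conj.comp hc).mul (continuous_expi.comp
      (by fun_prop : Continuous fun σ : ℝ => (-(d * σ : ℝ) : ℂ)))).aestronglyMeasurable
  · have e : expi (-((d * σ : ℝ) : ℂ)) = expi ((-(d * σ) : ℝ) : ℂ) := by push_cast; rfl
    rw [norm_mul, RCLike.norm_conj, e, norm_expi_real, mul_one]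
    refine (h τ _).trans ?_
    have h2 := inv_one_add_norm_add_pow_le (σ • Z) X 2
    rw [add_comm (σ • Z) X, norm_smul] at h2
    rw [Real.rpow_neg (by positivity), Real.rpow_two, norm_mul, norm_norm, mul_comm ‖Z‖, mul_assoc _ ((1 + ‖X‖) ^ 2)]
    exact mul_le_mul_of_nonneg_left h2 (by positivity)

end Line

/-! ### Vectors of the dual lattice orthogonal to the isotropic vector -/

namespace IsotropicData

variable {E : Type*} [AddCommGroup E] [Module ℝ E] {q : QuadraticForm ℝ E} {L : Submodule ℤ E}
  (D : IsotropicData q L)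

/-- The pairs `(x, δ)` of a vector `x ∈ L₁'` and a class `δ ∈ M'/L` with `π(δ) = x + L₁`. -/
abbrev Pairs : Type _ := {p : dual D.q1 D.L1 × Disc q L // D.ProjectsTo p.2 (p.1 : D.E1)}

lemma sub_mem_of_cls_eq {x y : dual q L} (h : cls q L x = cls q L y) : (x : E) - (y : E) ∈ L := by
  have := (Submodule.Quotient.eq _).mp h
  exact this

lemma z_ne_zero : D.z ≠ 0 := by
  intro h
  have := D.pairing
  rw [h] at this
  simp [bil] at this

lemma z_mem_dual (hL : IsEvenLattice q L) : D.z ∈ dual q L := le_dual hL D.z_mem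

lemma bil_proj (x : E) (y : D.E1) : bil q (D.proj x : E) (y : E) = bil q x (y : E) := by
  rw [D.proj_apply, bil_add_left, bil_add_left, bil_smul_left, bil_smul_left, D.bil_zd_E1,
    D.bil_z_E1]
  ring

lemma proj_mem_dual {x : E} (hx : x ∈ dual q L) : D.proj x ∈ dual D.q1 D.L1 := by
  intro y hy
  obtain ⟨n, hn⟩ := exists_int_bil hx (show (y : E) ∈ L from hy)
  refine Submodule.mem_one.mpr ⟨n, ?_⟩
  have h : bil q (D.proj x : E) (y : E) = n := by rw [bil_proj, hn]
  exact h.symm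

/-- The vector `x + (δ, z')z` of the class `δ`, for `π(δ) = x + L₁`. -/
def lift (p : D.Pairs) : E := (p.1.1 : D.E1) + bil q ((p.1.2.out : dual q L) : E) D.zd • D.z

lemma bil_lift_z (p : D.Pairs) : bil q (D.lift p) D.z = 0 := by
  rw [lift, bil_add_left, bil_smul_left, D.bil_E1_z, D.bil_z_z]; ring

lemma q_lift (p : D.Pairs) : q (D.lift p) = D.q1 (p.1.1 : D.E1) := by
  have := D.q_coe (p.1.1 : D.E1) 0 (bil q ((p.1.2.out : dual q L) : E) D.zd)
  rw [zero_smul, add_zero] at this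
  rw [lift, this]
  simp

/-- For a representative `l` of `δ` with `(l, z) = Nj`, the class `δ` contains `v = l - jζ - y` for the
vector `y ∈ L₁` that witnesses `π(δ) = x + L₁`. This `v` is orthogonal to `z` and projects to `x`, so
it differs from the lift by an integral multiple of `z`. -/
lemma exists_lift_eq (hL : IsEvenLattice q L) (p : D.Pairs) :
    ∃ x : dual q L, (x : E) = D.lift p ∧ cls q L x = p.1.2 := by
  obtain ⟨⟨x1, δ⟩, l, j, hl, hj, hy⟩ := p
  have hy' : ((D.proj (l : E) - j • D.proj D.zeta - (x1 : D.E1) : D.E1) : E) ∈ L := hy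
  set y : D.E1 := D.proj (l : E) - j • D.proj D.zeta - (x1 : D.E1) with hydef
  set v : E := (l : E) - j • D.zeta - (y : E) with hv
  have hvL : (l : E) - v ∈ L := by
    rw [hv]
    have : (l : E) - ((l : E) - j • D.zeta - (y : E)) = j • D.zeta + (y : E) := by abel
    rw [this]
    exact L.add_mem (L.smul_mem _ D.zeta_mem) hy'
  have hvz : bil q v D.z = 0 := by
    have : v = (l : E) + (-(j : ℝ)) • D.zeta + (-1 : ℝ) • (y : E) := by
      rw [hv, ← Int.cast_smul_eq_zsmul ℝ]; module
    rw [this, bil_add_left, bil_add_left, bil_smul_left, bil_smul_left, hj, D.zeta_spec,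
      D.bil_E1_z]
    ring
  have hproj : D.proj v = x1 := by
    have h1 : D.proj (y : E) = y := by simpa using D.proj_coe y 0 0
    have h2 : D.proj (j • D.zeta) = j • D.proj D.zeta := map_zsmul _ _ _
    rw [hv, map_sub, map_sub, h1, h2, hydef]
    abel
  have hvd : v ∈ dual q L := by
    have : v = (l : E) - ((l : E) - v) := by abel
    rw [this]
    exact (dual q L).sub_mem l.2 (le_dual hL hvL)
  have hout : ((δ.out : dual q L) : E) - v ∈ L := by
    have h1 : ((δ.out : dual q L) : E) - (l : E) ∈ L :=
      sub_mem_of_cls_eq (by rw [hl, out_cls])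
    have : ((δ.out : dual q L) : E) - v = (((δ.out : dual q L) : E) - (l : E)) + ((l : E) - v) := by
      abel
    rw [this]
    exact L.add_mem h1 hvL
  obtain ⟨m, hm⟩ := exists_int_bil D.zd_mem hout
  have hc : bil q ((δ.out : dual q L) : E) D.zd = D.coordZ v + m := by
    rw [D.coordZ_apply, hvz, mul_zero, sub_zero, ← hm, bil_comm q D.zd, ← bil_add_left]
    congr 1; abel
  have hlift : (x1 : D.E1) + bil q ((δ.out : dual q L) : E) D.zd • D.z = v + m • D.z := by
    rw [hc]
    conv_rhs => rw [D.decomp v, hproj, hvz]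
    rw [← Int.cast_smul_eq_zsmul ℝ]
    module
  refine ⟨⟨v + m • D.z, (dual q L).add_mem hvd ((dual q L).smul_mem _ (D.z_mem_dual hL))⟩,
    hlift.symm, ?_⟩
  rw [← hl]
  refine (Submodule.Quotient.eq _).mpr ?_
  change v + m • D.z - (l : E) ∈ L
  have : v + m • D.z - (l : E) = m • D.z - ((l : E) - v) := by abel
  rw [this]
  exact L.sub_mem (L.smul_mem _ D.z_mem) hvL

/-- The element of `L'` of the class `δ` with orthogonal projection `x`. -/
def liftDual (hL : IsEvenLattice q L) (p : D.Pairs) : dual q L := (D.exists_lift_eq hL p).choose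

lemma coe_liftDual (hL : IsEvenLattice q L) (p : D.Pairs) : (D.liftDual hL p : E) = D.lift p :=
  (D.exists_lift_eq hL p).choose_spec.1

lemma cls_liftDual (hL : IsEvenLattice q L) (p : D.Pairs) : cls q L (D.liftDual hL p) = p.1.2 :=
  (D.exists_lift_eq hL p).choose_spec.2

lemma proj_lift (p : D.Pairs) : D.proj (D.lift p) = p.1.1 := by
  have := D.proj_coe (p.1.1 : D.E1) 0 (bil q ((p.1.2.out : dual q L) : E) D.zd)
  rw [zero_smul, add_zero] at this
  exact this

lemma cls_add_zsmul_z (hL : IsEvenLattice q L) (x : dual q L) (m : ℤ) :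
    cls q L (x + m • ⟨D.z, D.z_mem_dual hL⟩) = cls q L x := by
  refine (Submodule.Quotient.eq _).mpr ?_
  rw [add_sub_cancel_left]
  exact (L.submoduleOf (dual q L)).smul_mem m D.z_mem

/-- The map `((x, δ), m) ↦ x + (δ, z')z + mz`. -/
def liftAdd (hL : IsEvenLattice q L) (v : D.Pairs × ℤ) : {x : dual q L // bil q (x : E) D.z = 0} :=
  ⟨D.liftDual hL v.1 + v.2 • ⟨D.z, D.z_mem_dual hL⟩, by
    rw [Submodule.coe_add, bil_add_left, D.coe_liftDual hL, bil_lift_z, Submodule.coe_smul,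
      ← Int.cast_smul_eq_zsmul ℝ, bil_smul_left]
    change 0 + (v.2 : ℝ) * bil q D.z D.z = 0
    rw [D.bil_z_z]; ring⟩

lemma coe_liftAdd (hL : IsEvenLattice q L) (v : D.Pairs × ℤ) :
    (((D.liftAdd hL v).1 : dual q L) : E) = D.lift v.1 + (v.2 : ℝ) • D.z := by
  rw [liftAdd, Submodule.coe_add, D.coe_liftDual hL, Submodule.coe_smul, ← Int.cast_smul_eq_zsmul ℝ]

lemma cls_liftAdd (hL : IsEvenLattice q L) (v : D.Pairs × ℤ) :
    cls q L (D.liftAdd hL v).1 = v.1.1.2 := by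
  rw [liftAdd, D.cls_add_zsmul_z hL, D.cls_liftDual hL]

/-- Every `x ∈ L'` with `(x, z) = 0` is uniquely of the form `x₁ + (δ, z')z + mz`. -/
lemma bijective_liftAdd (hL : IsEvenLattice q L) : Function.Bijective (D.liftAdd hL) := by
  constructor
  · intro v v' h
    have h1 : D.lift v.1 + (v.2 : ℝ) • D.z = D.lift v'.1 + (v'.2 : ℝ) • D.z := by
      rw [← D.coe_liftAdd hL v, ← D.coe_liftAdd hL v', h]
    have h2 : v.1.1.2 = v'.1.1.2 := by
      rw [← D.cls_liftAdd hL v, ← D.cls_liftAdd hL v', h]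
    have hz : D.proj D.z = 0 := by simpa using D.proj_coe 0 0 1
    have h3 : v.1.1.1 = v'.1.1.1 := by
      apply Subtype.ext
      have := congrArg D.proj h1
      simpa [proj_lift, hz] using this
    have h4 : v.1 = v'.1 := Subtype.ext (Prod.ext h3 h2)
    refine Prod.ext h4 ?_
    rw [h4] at h1
    have h5 := smul_left_injective ℝ D.z_ne_zero (add_left_cancel h1)
    exact_mod_cast h5
  · rintro ⟨x, hx⟩
    set p : D.Pairs := ⟨(⟨D.proj (x : E), D.proj_mem_dual x.2⟩, cls q L x),
      x, 0, rfl, by simpa using hx, by simp⟩ with hp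
    have hout : (((cls q L x).out : dual q L) : E) - (x : E) ∈ L :=
      sub_mem_of_cls_eq (out_cls _)
    obtain ⟨m, hm⟩ := exists_int_bil D.zd_mem hout
    refine ⟨(p, -m), Subtype.ext (Subtype.ext ?_)⟩
    rw [coe_liftAdd]
    have hc : bil q (((cls q L x).out : dual q L) : E) D.zd = D.coordZ (x : E) + m := by
      rw [D.coordZ_apply, hx, mul_zero, sub_zero, ← hm, bil_comm q D.zd, ← bil_add_left]
      congr 1; abel
    change (D.proj (x : E) : E) + bil q (((cls q L x).out : dual q L) : E) D.zd • D.z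
      + ((-m : ℤ) : ℝ) • D.z = x
    rw [hc]
    conv_rhs => rw [D.decomp (x : E), hx]
    push_cast
    module

end IsotropicData

/-! ### Unfolding a character coefficient to integrals over lines -/

section Unfolding

variable {r s : ℕ} {E : Type*} [AddCommGroup E] [Module ℝ E] {q : QuadraticForm ℝ E}
  {L : Submodule ℤ E} {sig w : ℤ} {f : ℍ → Disc q L → ℂ}

lemma hasSum_of_eq {ι : Type*} {F G : ι → ℂ} {a : ℂ} (h : HasSum F a) (e : ∀ i, G i = F i) :
    HasSum G a := by
  rwa [funext e]

lemma integral_expi_int (m : ℤ) :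
    ∫ t in (0 : ℝ)..1, expi ((t * m : ℝ) : ℂ) = if m = 0 then 1 else 0 := by
  split_ifs with h
  · simp [h, expi_zero]
  · have hc : (2 * Real.pi * Complex.I * m : ℂ) ≠ 0 := by
      simp [Real.pi_ne_zero, h]
    have h1 := integral_exp_mul_complex (a := 0) (b := 1) hc
    have h2 : ∀ t : ℝ, expi ((t * m : ℝ) : ℂ) = Complex.exp (2 * Real.pi * Complex.I * m * t) := by
      intro t
      rw [expi]
      congr 1
      push_cast
      ring
    have h3 : Complex.exp (2 * Real.pi * Complex.I * m) = 1 := by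
      have := expi_int m
      rw [expi] at this
      exact this
    simp only [h2]
    rw [h1]
    simp [h3]

/-- The integral over the twist kills the terms with `(x, z) ≠ 0`; the sum over `x + ℤz` and the
integral over the shift combine to an integral over a line. -/
theorem hasSum_charIntegral [Fintype (Disc q L)] (hL : IsEvenLattice q L)
    (V : q.IsometryEquiv (stdForm r s)) (hw : 0 ≤ w) (hf : IsCuspForm q L sig w f)
    (p : MvPolynomial (Fin r) ℂ) (D : IsotropicData q L) (τ : ℍ) (d : ℤ) :
    HasSum (fun P : D.Pairs => f τ P.1.2
        * ∫ σ : ℝ, conj (kern p τ (V (D.lift P) + σ • V D.z)) * expi (-(d * σ : ℝ)))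
      (∫ a in unitBox (Fin 2), thetaPair V f p D.z τ (a 1) (a 0)
        * expi (-(∑ i, (![0, d] : Fin 2 → ℤ) i * a i : ℝ))) := by
  have hcount := countable_dual hL V
  obtain ⟨C, ε, B, hC, hε, hbd⟩ := norm_thetaTerm_le hL V hw hf p D.z (r + s + 1)
  have hsd := summable_dual hL V (Nat.lt_succ_self (r + s))
  have hg := one_le_growth τ.im_pos
  have hterm : ∀ x : dual q L, Continuous fun a : Fin 2 → ℝ => thetaTerm V f p D.z τ (a 1) (a 0) x
      * expi (-(∑ i, (![0, d] : Fin 2 → ℤ) i * a i : ℝ)) := fun x => by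
    have h1 : Continuous fun a : Fin 2 → ℝ => (τ, a 1, a 0) := by fun_prop
    exact ((continuous_thetaTerm hf V p D.z x).comp h1).mul (continuous_expi.comp (by fun_prop))
  have hE : ∀ a : Fin 2 → ℝ, ‖expi (-(∑ i, (![0, d] : Fin 2 → ℤ) i * a i : ℝ))‖ = 1 := fun a => by
    rw [show (-((∑ i, (![0, d] : Fin 2 → ℤ) i * a i : ℝ) : ℂ))
      = ((-∑ i, (![0, d] : Fin 2 → ℤ) i * a i : ℝ) : ℂ) by push_cast; rfl, norm_expi_real]
  have hfinm : IsFiniteMeasure (volume.restrict (unitBox (Fin 2))) := by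
    refine ⟨?_⟩
    rw [Measure.restrict_apply_univ, unitBox_eq, Real.volume_pi_Ioc]
    exact ENNReal.prod_lt_top fun i _ => ENNReal.ofReal_lt_top
  have h1 : HasSum (fun x : dual q L => ∫ a in unitBox (Fin 2), thetaTerm V f p D.z τ (a 1) (a 0) x
      * expi (-(∑ i, (![0, d] : Fin 2 → ℤ) i * a i : ℝ)))
      (∫ a in unitBox (Fin 2), thetaPair V f p D.z τ (a 1) (a 0)
        * expi (-(∑ i, (![0, d] : Fin 2 → ℤ) i * a i : ℝ))) := by
    refine hasSum_integral_of_dominated_convergence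
      (fun x _ => C * growth τ.im ^ B * Real.exp (-ε * τ.im)
        * ((1 + ‖V D.z‖) ^ (r + s + 1) * ((1 + ‖V (x : E)‖) ^ (r + s + 1))⁻¹))
      (fun x => (hterm x).aestronglyMeasurable)
      (fun x => (ae_restrict_iff' measurableSet_unitBox).mpr
        (Filter.Eventually.of_forall fun a ha => ?_))
      (Filter.Eventually.of_forall fun _ => (hsd.mul_left _).mul_left _) (integrable_const _)
      (Filter.Eventually.of_forall fun a =>
        (summable_thetaTerm hL V hw hf p D.z τ (a 1) (a 0)).hasSum.mul_right _)
    rw [norm_mul, hE, mul_one]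
    refine (hbd τ _ _ x).trans (mul_le_mul_of_nonneg_left ?_ (by positivity))
    refine mul_le_mul_of_nonneg_right (pow_le_pow_left₀ (by positivity) ?_ _) (by positivity)
    have ha1 : |a 1| ≤ 1 := by
      have : a 1 ∈ Set.Ioc (0 : ℝ) 1 := by
        rw [unitBox_eq] at ha
        exact ha 1 (Set.mem_univ _)
      rw [abs_of_pos this.1]; exact this.2
    have := mul_le_mul_of_nonneg_right ha1 (norm_nonneg (V D.z))
    linarith
  -- the integral of a single term
  have h2 : ∀ x : dual q L, ∫ a in unitBox (Fin 2), thetaTerm V f p D.z τ (a 1) (a 0) x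
      * expi (-(∑ i, (![0, d] : Fin 2 → ℤ) i * a i : ℝ))
      = if bil q (x : E) D.z = 0 then f τ (cls q L x) * ∫ σ in (0 : ℝ)..1,
          conj (kern p τ (V (x : E) + σ • V D.z)) * expi (-(d * σ : ℝ)) else 0 := by
    intro x
    obtain ⟨m, hm⟩ := exists_int_bil x.2 D.z_mem
    rw [integral_unitBox_fin_two_swap (hterm x)]
    have h3 : ∀ σ t : ℝ, thetaTerm V f p D.z τ ((![t, σ] : Fin 2 → ℝ) 1) ((![t, σ] : Fin 2 → ℝ) 0) x
        * expi (-(∑ i, (![0, d] : Fin 2 → ℤ) i * (![t, σ] : Fin 2 → ℝ) i : ℝ))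
        = (f τ (cls q L x) * (conj (kern p τ (V (x : E) + σ • V D.z)) * expi (-(d * σ : ℝ))))
          * expi ((t * m : ℝ) : ℂ) := by
      intro σ t
      simp only [thetaTerm, hm, Fin.sum_univ_two, Matrix.cons_val_zero, Matrix.cons_val_one,
        Int.cast_zero, zero_mul, zero_add]
      ring
    simp only [h3, intervalIntegral.integral_const_mul, intervalIntegral.integral_mul_const,
      integral_expi_int]
    rw [hm]
    split_ifs with h4 h5 h5
    · simp
    · exact absurd (by exact_mod_cast h4) h5
    · exact absurd (by exact_mod_cast h5) h4
    · simp
  rw [funext h2] at h1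
  have h3 : HasSum (fun x : {x : dual q L // bil q (x : E) D.z = 0} => f τ (cls q L x.1)
      * ∫ σ in (0 : ℝ)..1, conj (kern p τ (V (x.1 : E) + σ • V D.z)) * expi (-(d * σ : ℝ)))
      (∫ a in unitBox (Fin 2), thetaPair V f p D.z τ (a 1) (a 0)
        * expi (-(∑ i, (![0, d] : Fin 2 → ℤ) i * a i : ℝ))) := by
    have h4 := (hasSum_subtype_iff_of_support_subset
      (s := {x : dual q L | bil q (x : E) D.z = 0}) (fun x hx => by
        by_contra h5
        exact hx (if_neg h5))).mpr h1
    exact hasSum_of_eq h4 fun x => (if_pos x.2).symm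
  rw [← (Equiv.ofBijective _ (D.bijective_liftAdd hL)).hasSum_iff] at h3
  refine h3.prod_fiberwise fun P => ?_
  have hVz : V D.z ≠ 0 := fun h => D.z_ne_zero ((map_eq_zero_iff V V.injective).mp h)
  have h4 := ((integrable_conj_kern_line p τ (V (D.lift P)) hVz d).hasSum_intervalIntegral
    0).mul_left (f τ P.1.2)
  refine hasSum_of_eq h4 fun m => ?_
  simp only [Function.comp_apply, Equiv.ofBijective_apply, D.cls_liftAdd, D.coe_liftAdd, map_add,
    map_smul]
  congr 1
  rw [show (0 : ℝ) + m + 1 = 1 + m by ring,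
    ← intervalIntegral.integral_comp_add_right (fun σ : ℝ =>
      conj (kern p τ (V (D.lift P) + σ • V D.z)) * expi (-(d * σ : ℝ))) (m : ℝ)]
  refine intervalIntegral.integral_congr fun σ _ => ?_
  have e1 : expi (-((d * (σ + m) : ℝ) : ℂ)) = expi (-((d * σ : ℝ) : ℂ)) := by
    rw [show (-((d * (σ + m) : ℝ) : ℂ)) = -((d * σ : ℝ) : ℂ) + ((-(d * m) : ℤ) : ℂ) by
      push_cast; ring, expi_add_int]
  have e2 : V (D.lift P) + (σ + m) • V D.z = V (D.lift P) + (m : ℝ) • V D.z + σ • V D.z := by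
    module
  rw [e1, e2]

end Unfolding

/-! ### Coordinates adapted to the isotropic vector -/

section Frame

variable {r s : ℕ}

lemma sum_sq_frame (b : OrthonormalBasis (Fin r) ℝ (EuclideanSpace ℝ (Fin r))) (x : Fin r → ℝ) :
    ∑ i, (∑ j, b i j * x j) ^ 2 = ∑ j, x j ^ 2 := by
  have h := b.sum_sq_norm_inner_right (WithLp.toLp 2 x)
  rw [EuclideanSpace.norm_sq_eq] at h
  simp only [PiLp.inner_apply, Real.norm_eq_abs, sq_abs, RCLike.inner_apply,
    conj_trivial] at h
  rw [← h]
  refine Finset.sum_congr rfl fun i _ => ?_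
  congr 1
  exact Finset.sum_congr rfl fun j _ => mul_comm _ _

/-- The rows of the matrix of an orthonormal basis are orthonormal. -/
lemma sum_frame_mul_frame (b : OrthonormalBasis (Fin r) ℝ (EuclideanSpace ℝ (Fin r))) (i k : Fin r) :
    ∑ j, b i j * b k j = if i = k then 1 else 0 := by
  have h := orthonormal_iff_ite.mp b.orthonormal k i
  rw [PiLp.inner_apply] at h
  simp only [RCLike.inner_apply, conj_trivial] at h
  rw [h]
  simp [eq_comm]

/-- The isometry of `ℝ^{r,s}` that expresses the positive part in the coordinates of an orthonormal
basis. -/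
def frameIso (b : OrthonormalBasis (Fin r) ℝ (EuclideanSpace ℝ (Fin r))) :
    (stdForm r s).IsometryEquiv (stdForm r s) :=
  let A : (Fin r ⊕ Fin s → ℝ) →ₗ[ℝ] (Fin r ⊕ Fin s → ℝ) :=
    { toFun := fun X => Sum.elim (fun i => ∑ j, b i j * X (Sum.inl j)) (fun j => X (Sum.inr j))
      map_add' := fun X Y => by
        ext (i | j) <;> simp [mul_add, Finset.sum_add_distrib]
      map_smul' := fun c X => by
        ext (i | j)
        · simp only [Pi.smul_apply, smul_eq_mul, Sum.elim_inl, RingHom.id_apply, Finset.mul_sum]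
          exact Finset.sum_congr rfl fun j _ => by ring
        · simp }
  have hA : Function.Injective A := by
    rw [injective_iff_map_eq_zero]
    intro X hX
    have h1 : ∀ j, X (Sum.inr j) = 0 := fun j => congrFun hX (Sum.inr j)
    have h2 : ∑ j, X (Sum.inl j) ^ 2 = 0 := by
      rw [← sum_sq_frame b fun j => X (Sum.inl j)]
      refine Finset.sum_eq_zero fun i _ => ?_
      have : ∑ j, b i j * X (Sum.inl j) = 0 := congrFun hX (Sum.inl i)
      rw [this]; ring
    ext (i | j)
    · have := (Finset.sum_eq_zero_iff_of_nonneg fun j _ => sq_nonneg _).mp h2 i (Finset.mem_univ i)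
      exact pow_eq_zero_iff two_ne_zero |>.mp this
    · exact h1 j
  { LinearEquiv.ofInjectiveEndo A hA with
    map_app' := fun X => by
      change stdForm r s (A X) = stdForm r s X
      rw [stdForm_eq_qPlus_add_qMinus, stdForm_eq_qPlus_add_qMinus]
      have := sum_sq_frame b fun j => X (Sum.inl j)
      simp only [qPlus, qMinus, A, LinearMap.coe_mk, AddHom.coe_mk, Sum.elim_inl, Sum.elim_inr,
        this] }

lemma frameIso_inl (b : OrthonormalBasis (Fin r) ℝ (EuclideanSpace ℝ (Fin r)))
    (X : Fin r ⊕ Fin s → ℝ) (i : Fin r) :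
    frameIso b X (Sum.inl i) = ∑ j, b i j * X (Sum.inl j) := rfl

lemma qPlus_frameIso (b : OrthonormalBasis (Fin r) ℝ (EuclideanSpace ℝ (Fin r)))
    (X : Fin r ⊕ Fin s → ℝ) : qPlus (frameIso b X) = qPlus X := by
  simp only [qPlus, frameIso_inl, sum_sq_frame b fun j => X (Sum.inl j)]

lemma qMinus_frameIso (b : OrthonormalBasis (Fin r) ℝ (EuclideanSpace ℝ (Fin r)))
    (X : Fin r ⊕ Fin s → ℝ) : qMinus (frameIso b X) = qMinus X := rfl

end Frame

namespace IsotropicData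

variable {N bm : ℕ} {E : Type*} [AddCommGroup E] [Module ℝ E] {q : QuadraticForm ℝ E}
  {L : Submodule ℤ E} (D : IsotropicData q L) (v₀ : q.IsometryEquiv (stdForm (N + 3) bm))
  (b : OrthonormalBasis (Fin (N + 3)) ℝ (EuclideanSpace ℝ (Fin (N + 3))))
  (u : D.E1) (a : ℝˣ) (g₁ : Orth D.q1)

lemma sum_sq_plus_z : ∑ j, v₀ D.z (Sum.inl j) ^ 2 = D.rho v₀ ^ 2 := by
  rw [rho, normPlus, Real.sq_sqrt (Finset.sum_nonneg fun j _ => sq_nonneg _)]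

lemma sum_sq_minus_z : ∑ j, v₀ D.z (Sum.inr j) ^ 2 = D.rho v₀ ^ 2 := by
  have h := D.isotropic
  rw [← v₀.map_app, stdForm_eq_qPlus_add_qMinus, qPlus, qMinus, D.sum_sq_plus_z] at h
  linarith

lemma rho_pos : 0 < D.rho v₀ := by
  refine lt_of_le_of_ne (Real.sqrt_nonneg _) fun h => D.z_ne_zero ?_
  have h1 := D.sum_sq_plus_z v₀
  have h2 := D.sum_sq_minus_z v₀
  rw [← h, zero_pow two_ne_zero] at h1 h2
  refine (map_eq_zero_iff v₀ v₀.injective).mp ?_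
  ext (i | j)
  · have := (Finset.sum_eq_zero_iff_of_nonneg fun j _ => sq_nonneg _).mp h1 i (Finset.mem_univ i)
    exact pow_eq_zero_iff two_ne_zero |>.mp this
  · have := (Finset.sum_eq_zero_iff_of_nonneg fun j _ => sq_nonneg _).mp h2 j (Finset.mem_univ j)
    exact pow_eq_zero_iff two_ne_zero |>.mp this

lemma v₀_zStar_inl (j : Fin (N + 3)) :
    v₀ (D.zStar v₀) (Sum.inl j) = v₀ D.z (Sum.inl j) / (2 * D.rho v₀ ^ 2) := by
  rw [zStar, map_smul, QuadraticMap.IsometryEquiv.apply_symm_apply]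
  simp only [Pi.smul_apply, Sum.elim_inl, smul_eq_mul]
  ring

lemma v₀_zStar_inr (j : Fin bm) :
    v₀ (D.zStar v₀) (Sum.inr j) = -v₀ D.z (Sum.inr j) / (2 * D.rho v₀ ^ 2) := by
  rw [zStar, map_smul, QuadraticMap.IsometryEquiv.apply_symm_apply]
  simp only [Pi.smul_apply, Sum.elim_inr, smul_eq_mul]
  ring

/-- The pairing with `z⁺`, up to a scalar. -/
lemma sum_mul_plus_z (x : E) : ∑ j, v₀ x (Sum.inl j) * v₀ D.z (Sum.inl j)
    = bil q x D.z / 2 + D.rho v₀ ^ 2 * bil q x (D.zStar v₀) := by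
  have hρ := (D.rho_pos v₀).ne'
  rw [bil_eq_stdBil v₀, bil_eq_stdBil v₀, stdBil, stdBil]
  simp only [D.v₀_zStar_inl, D.v₀_zStar_inr, neg_div, mul_neg, mul_div_assoc', Finset.sum_neg_distrib,
    ← Finset.sum_div]
  field_simp
  ring

lemma bil_z_zStar : bil q D.z (D.zStar v₀) = 1 := by
  have h := D.sum_mul_plus_z v₀ D.z
  have hρ := (D.rho_pos v₀).ne'
  rw [D.bil_z_z, zero_div, zero_add] at h
  have h2 := D.sum_sq_plus_z v₀
  simp only [sq] at h2 h
  rw [h2] at h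
  have : D.rho v₀ * D.rho v₀ ≠ 0 := mul_ne_zero hρ hρ
  field_simp at h
  linarith

lemma v1_coe (y : D.E1) :
    D.v1 v₀ (y : E) = v₀ ((y : E) - bil q (y : E) (D.zStar v₀) • D.z) := by
  have h : D.v1 v₀ (y : E) = v₀ ((y : E) - bil q (D.zStar v₀) (y : E) • D.z
    - bil q D.z (y : E) • D.zStar v₀) := rfl
  rw [h, D.bil_z_E1, zero_smul, sub_zero, bil_comm]

/-- The image of `g₁⁻¹x`, `x ∈ (L₁)_ℝ`, under the isometry `v₁`, in the coordinates of the
orthonormal basis of `V⁺`. -/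
def levelVec (x : D.E1) : Fin (N + 3) ⊕ Fin bm → ℝ :=
  frameIso b (D.v1 v₀ (g₁.symm x : E))

/-- The isometry `x ↦ v₀(g_z⁻¹x)`, in the coordinates of the orthonormal basis of `V⁺`. -/
def adapted : q.IsometryEquiv (stdForm (N + 3) bm) :=
  ((D.parab u a g₁).symm.trans v₀).trans (frameIso b)

lemma adapted_apply (x : E) :
    D.adapted v₀ b u a g₁ x = frameIso b (v₀ ((D.parab u a g₁).symm x)) := rfl

/-- The phase `(δ, z') + (x, u + a g₁(z^*)_{L₁})` of a pair `(x, δ)`. -/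
def phase (P : D.Pairs) : ℝ :=
  bil q ((P.1.2.out : dual q L) : E) D.zd
    + bil q ((P.1.1 : D.E1) : E) ((u : E) + (a : ℝ) • (g₁ (D.proj (D.zStar v₀)) : E))

lemma parab_coe (y : D.E1) (β : ℝ) : D.parab u a g₁ ((y : E) + β • D.z)
    = (g₁ y : E) + (β * a - bil q (u : E) (g₁ y : E)) • D.z := by
  have h : D.parab u a g₁ ((y : E) + β • D.z) = D.unip u (D.levi a g₁ ((y : E) + β • D.z)) := rfl
  rw [h, map_add, map_smul, D.levi_E1, D.levi_z, map_add, map_smul, map_smul, D.unip_z, D.unip_E1]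
  module

lemma parab_symm_coe (x : D.E1) (c : ℝ) : (D.parab u a g₁).symm ((x : E) + c • D.z)
    = (g₁.symm x : E) + ((a : ℝ)⁻¹ * (c + bil q (u : E) (x : E))) • D.z := by
  have h := D.parab_coe u a g₁ (g₁.symm x) ((a : ℝ)⁻¹ * (c + bil q (u : E) (x : E)))
  rw [QuadraticMap.IsometryEquiv.apply_symm_apply] at h
  have ha : (a : ℝ) ≠ 0 := a.ne_zero
  have h2 : (a : ℝ)⁻¹ * (c + bil q (u : E) (x : E)) * a - bil q (u : E) (x : E) = c := by
    field_simp; ring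
  rw [h2] at h
  rw [← h, QuadraticMap.IsometryEquiv.symm_apply_apply]

lemma adapted_z : D.adapted v₀ b u a g₁ D.z = (a : ℝ)⁻¹ • frameIso b (v₀ D.z) := by
  have h := D.parab_symm_coe u a g₁ 0 1
  simp only [Submodule.coe_zero, zero_add, one_smul, map_zero, bil] at h
  rw [adapted_apply, h, add_zero, mul_one, map_smul, map_smul]

lemma bil_symm_zStar (x : D.E1) : bil q (g₁.symm x : E) (D.zStar v₀)
    = bil q (x : E) (g₁ (D.proj (D.zStar v₀)) : E) := by
  have h1 : bil q (g₁.symm x : E) (D.zStar v₀)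
      = bil D.q1 (g₁.symm x) (D.proj (D.zStar v₀)) := by
    rw [bil_comm, ← D.bil_proj, bil_comm]
    rfl
  have h2 : bil D.q1 (g₁.symm x) (D.proj (D.zStar v₀))
      = bil D.q1 (g₁ (g₁.symm x)) (g₁ (D.proj (D.zStar v₀))) := by
    simp only [bil, QuadraticMap.polarBilin_apply_apply, QuadraticMap.polar, ← map_add, g₁.map_app]
  rw [h1, h2, QuadraticMap.IsometryEquiv.apply_symm_apply]
  rfl

lemma adapted_lift (P : D.Pairs) : D.adapted v₀ b u a g₁ (D.lift P)
    = D.levelVec v₀ b g₁ P.1.1 + D.phase v₀ u a g₁ P • D.adapted v₀ b u a g₁ D.z := by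
  have ha : (a : ℝ) ≠ 0 := a.ne_zero
  have hz : ∀ c : ℝ, c • (a : ℝ)⁻¹ • frameIso b (v₀ D.z) = frameIso b (v₀ ((c * (a : ℝ)⁻¹) • D.z)) :=
    fun c => by simp only [map_smul, smul_smul]
  rw [adapted_z, adapted_apply, lift, D.parab_symm_coe, levelVec, v1_coe, bil_symm_zStar, hz,
    ← map_add, ← map_add, phase, bil_add_right, bil_smul_right, bil_comm q (u : E)]
  congr 2
  have : (a : ℝ)⁻¹ * (bil q ((P.1.2.out : dual q L) : E) D.zd + bil q ((P.1.1 : D.E1) : E) (u : E))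
      = -bil q ((P.1.1 : D.E1) : E) (g₁ (D.proj (D.zStar v₀)) : E)
        + (bil q ((P.1.2.out : dual q L) : E) D.zd + (bil q ((P.1.1 : D.E1) : E) (u : E)
          + a * bil q ((P.1.1 : D.E1) : E) (g₁ (D.proj (D.zStar v₀)) : E))) * (a : ℝ)⁻¹ := by
    field_simp; ring
  rw [this]
  module

variable {b} (hb : ∀ j, b 0 j = v₀ D.z (Sum.inl j) / D.rho v₀)
include hb

lemma frameIso_z_zero : frameIso b (v₀ D.z) (Sum.inl 0) = D.rho v₀ := by
  have hρ := (D.rho_pos v₀).ne'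
  rw [frameIso_inl]
  simp only [hb, div_mul_eq_mul_div, ← Finset.sum_div, ← sq]
  rw [D.sum_sq_plus_z, sq, mul_div_assoc, div_self hρ, mul_one]

lemma frameIso_z_succ (i : Fin (N + 2)) : frameIso b (v₀ D.z) (Sum.inl i.succ) = 0 := by
  have hρ := (D.rho_pos v₀).ne'
  have h : ∀ j, v₀ D.z (Sum.inl j) = D.rho v₀ * b 0 j := fun j => by rw [hb]; field_simp
  rw [frameIso_inl]
  simp only [h]
  have h2 := sum_frame_mul_frame b i.succ 0
  rw [if_neg (Fin.succ_ne_zero i)] at h2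
  calc ∑ j, b i.succ j * (D.rho v₀ * b 0 j) = D.rho v₀ * ∑ j, b i.succ j * b 0 j := by
        rw [Finset.mul_sum]
        exact Finset.sum_congr rfl fun j _ => by ring
    _ = 0 := by rw [h2, mul_zero]

lemma adapted_z_zero : D.adapted v₀ b u a g₁ D.z (Sum.inl 0) = D.rho v₀ / a := by
  rw [adapted_z, Pi.smul_apply, D.frameIso_z_zero v₀ hb, smul_eq_mul]; ring

lemma adapted_z_succ (i : Fin (N + 2)) : D.adapted v₀ b u a g₁ D.z (Sum.inl i.succ) = 0 := by
  rw [adapted_z, Pi.smul_apply, D.frameIso_z_succ v₀ hb, smul_zero]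

lemma levelVec_zero (x : D.E1) : D.levelVec v₀ b g₁ x (Sum.inl 0) = 0 := by
  have hρ := (D.rho_pos v₀).ne'
  set y := g₁.symm x
  have h := D.sum_mul_plus_z v₀ ((y : E) - bil q (y : E) (D.zStar v₀) • D.z)
  have h1 : (y : E) - bil q (y : E) (D.zStar v₀) • D.z
      = (y : E) + (-bil q (y : E) (D.zStar v₀)) • D.z := by module
  rw [h1, bil_add_left, bil_add_left, bil_smul_left, bil_smul_left, D.bil_z_zStar, D.bil_z_z,
    D.bil_E1_z, ← h1] at h
  rw [levelVec, v1_coe, frameIso_inl]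
  simp only [hb, div_mul_eq_mul_div, ← Finset.sum_div]
  rw [div_eq_zero_iff]
  left
  rw [← Finset.sum_congr rfl fun j _ => mul_comm (v₀ ((y : E) - bil q (y : E) (D.zStar v₀) • D.z)
    (Sum.inl j)) (v₀ D.z (Sum.inl j))]
  linarith

omit hb

lemma stdForm_levelVec (x : D.E1) : stdForm (N + 3) bm (D.levelVec v₀ b g₁ x) = D.q1 x := by
  rw [levelVec, (frameIso b).map_app, v1_coe, v₀.map_app]
  have h := D.q_coe (g₁.symm x) 0 (-bil q (g₁.symm x : E) (D.zStar v₀))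
  have h2 : ((g₁.symm x : D.E1) : E) + (0 : ℝ) • D.zd + (-bil q (g₁.symm x : E) (D.zStar v₀)) • D.z
      = (g₁.symm x : E) - bil q (g₁.symm x : E) (D.zStar v₀) • D.z := by module
  rw [h2] at h
  rw [h]
  have h3 : q (g₁.symm x : E) = q (x : E) := g₁.symm.map_app x
  rw [h3]
  simp

end IsotropicData

/-! ### The lattice `L₁` and the map `π` -/

namespace IsotropicData

variable {E : Type*} [AddCommGroup E] [Module ℝ E] {q : QuadraticForm ℝ E}
  {L : Submodule ℤ E} (D : IsotropicData q L)

lemma ProjectsTo.congr {D : IsotropicData q L} {δ : Disc q L} {x x' : D.E1}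
    (h : D.ProjectsTo δ x) (hx : x - x' ∈ D.L1) : D.ProjectsTo δ x' := by
  obtain ⟨l, j, hl, hj, hy⟩ := h
  refine ⟨l, j, hl, hj, ?_⟩
  have := D.L1.add_mem hy hx
  rwa [sub_add_sub_cancel] at this

lemma ProjectsTo.sub_mem (hL : IsEvenLattice q L) {D : IsotropicData q L} {δ : Disc q L}
    {x x' : dual D.q1 D.L1} (h : D.ProjectsTo δ (x : D.E1)) (h' : D.ProjectsTo δ (x' : D.E1)) :
    (x : D.E1) - (x' : D.E1) ∈ D.L1 := by
  have h1 : (D.liftDual hL ⟨(x, δ), h⟩ : E) - (D.liftDual hL ⟨(x', δ), h'⟩ : E) ∈ L :=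
    sub_mem_of_cls_eq (by rw [D.cls_liftDual hL, D.cls_liftDual hL])
  rw [D.coe_liftDual hL, D.coe_liftDual hL, lift, lift, add_sub_add_right_eq_sub] at h1
  exact h1

/-- The map `π` from `M'/L` to `L₁'/L₁` is surjective. -/
lemma exists_projectsTo (x : dual D.q1 D.L1) : ∃ δ : Disc q L, D.ProjectsTo δ (x : D.E1) := by
  have hN : (D.level : ℝ) ≠ 0 := Nat.cast_ne_zero.mpr D.level_pos.ne'
  set c : ℝ := -bil q ((x : D.E1) : E) D.zeta / D.level with hc
  set v : E := ((x : D.E1) : E) + (0 : ℝ) • D.zd + c • D.z with hv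
  have hvd : v ∈ dual q L := by
    intro y hy
    obtain ⟨j, hj⟩ := (D.level_spec (bil q y D.z)).mp ⟨y, hy, rfl⟩
    set y' : E := y + (-(j : ℝ)) • D.zeta with hy'
    have hy'L : y' ∈ L := by
      have : y' = y - j • D.zeta := by rw [hy', ← Int.cast_smul_eq_zsmul ℝ]; module
      rw [this]
      exact L.sub_mem hy (L.smul_mem _ D.zeta_mem)
    have hy'z : bil q y' D.z = 0 := by
      rw [hy', bil_add_left, bil_smul_left, hj, D.zeta_spec]; ring
    obtain ⟨n, hn⟩ := exists_int_bil D.zd_mem hy'L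
    have hdec := D.decomp y'
    rw [hy'z, zero_smul, add_zero, D.coordZ_apply, hy'z, mul_zero, sub_zero, bil_comm, hn,
      Int.cast_smul_eq_zsmul] at hdec
    have hp : D.proj y' ∈ D.L1 := by
      change (D.proj y' : E) ∈ L
      rw [eq_sub_of_add_eq hdec.symm]
      exact L.sub_mem hy'L (L.smul_mem _ D.z_mem)
    obtain ⟨m, hm⟩ := exists_int_bil x.2 hp
    have hm' : bil q ((x : D.E1) : E) y' = m := by
      rw [bil_comm, ← D.bil_proj, bil_comm]
      exact hm
    have hvζ : bil q v D.zeta = 0 := by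
      rw [hv, zero_smul, add_zero, bil_add_left, bil_smul_left, hc, bil_comm q D.z, D.zeta_spec]
      field_simp
      ring
    have hvy : bil q v y = m := by
      have h1 : y = y' + (j : ℝ) • D.zeta := by rw [hy']; module
      have h2 : bil q v y' = m := by
        rw [hv, zero_smul, add_zero, bil_add_left, bil_smul_left, bil_comm q D.z, hy'z, hm']
        ring
      rw [h1, bil_add_right, bil_smul_right, hvζ, h2]
      ring
    exact Submodule.mem_one.mpr ⟨m, hvy.symm⟩
  refine ⟨cls q L ⟨v, hvd⟩, ⟨v, hvd⟩, 0, rfl, ?_, ?_⟩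
  · exact (D.bil_coe_z (x : D.E1) 0 c).trans (by simp)
  · have h1 : D.proj v = x := D.proj_coe (x : D.E1) 0 c
    change D.proj v - (0 : ℤ) • D.proj D.zeta - (x : D.E1) ∈ D.L1
    rw [h1]
    simp

lemma finite_disc_L1 [Finite (Disc q L)] (hL : IsEvenLattice q L) : Finite (Disc D.q1 D.L1) := by
  refine Finite.of_surjective (α := {δ : Disc q L // ∃ x : dual D.q1 D.L1, D.ProjectsTo δ x})
    (fun δ => cls D.q1 D.L1 δ.2.choose) fun γ => ?_
  obtain ⟨δ, hδ⟩ := D.exists_projectsTo γ.out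
  refine ⟨⟨δ, γ.out, hδ⟩, ?_⟩
  have h : ∃ x : dual D.q1 D.L1, D.ProjectsTo δ x := ⟨γ.out, hδ⟩
  refine Eq.trans ?_ (out_cls γ)
  exact (Submodule.Quotient.eq _).mpr (h.choose_spec.sub_mem hL hδ)

lemma reduce_cls (f : ℍ → Disc q L → ℂ) (τ : ℍ) (x : dual D.q1 D.L1) :
    D.reduce f τ (cls D.q1 D.L1 x) = ∑ᶠ (δ : Disc q L) (_ : D.ProjectsTo δ (x : D.E1)), f τ δ := by
  have h : (((cls D.q1 D.L1 x).out : dual D.q1 D.L1) : D.E1) - (x : D.E1) ∈ D.L1 :=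
    sub_mem_of_cls_eq (out_cls _)
  have h' : (x : D.E1) - (((cls D.q1 D.L1 x).out : dual D.q1 D.L1) : D.E1) ∈ D.L1 := by
    rw [← neg_sub]; exact D.L1.neg_mem h
  refine finsum_congr fun δ => ?_
  exact finsum_congr_Prop (propext ⟨fun h1 => h1.congr h, fun h1 => h1.congr h'⟩) fun _ => rfl

/-- Summation over pairs, and a further index, in two steps. -/
lemma hasSum_prod_of_pairs [Fintype (Disc q L)] {ι : Type*}
    {G : ι → dual D.q1 D.L1 → Disc q L → ℂ} {S : ℂ}
    (h : HasSum (fun v : ι × D.Pairs => G v.1 v.2.1.1 v.2.1.2) S) :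
    HasSum (fun v : ι × dual D.q1 D.L1 =>
      ∑ᶠ (δ : Disc q L) (_ : D.ProjectsTo δ (v.2 : D.E1)), G v.1 v.2 δ) S := by
  classical
  set A : Set ((ι × dual D.q1 D.L1) × Disc q L) := {p | D.ProjectsTo p.2 (p.1.2 : D.E1)} with hA
  set φ : ι × D.Pairs → (ι × dual D.q1 D.L1) × Disc q L := fun v => ((v.1, v.2.1.1), v.2.1.2)
  have hφ : Function.Injective φ := by
    rintro ⟨n, ⟨⟨x, δ⟩, hP⟩⟩ ⟨n', ⟨⟨x', δ'⟩, hP'⟩⟩ h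
    simp only [φ, Prod.mk.injEq] at h
    obtain ⟨⟨rfl, rfl⟩, rfl⟩ := h
    rfl
  have h1 : HasSum (A.indicator fun p => G p.1.1 p.1.2 p.2) S := by
    refine (hφ.hasSum_iff fun p hp => Set.indicator_of_notMem (fun hpA => hp ?_) _).mp ?_
    · exact ⟨(p.1.1, ⟨(p.1.2, p.2), hpA⟩), rfl⟩
    · refine hasSum_of_eq h fun v => ?_
      exact Set.indicator_of_mem (show φ v ∈ A from v.2.2) fun p => G p.1.1 p.1.2 p.2
  refine h1.prod_fiberwise fun v => ?_
  have h2 := hasSum_fintype fun δ : Disc q L => A.indicator (fun p => G p.1.1 p.1.2 p.2) (v, δ)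
  convert h2 using 1
  rw [finsum_eq_sum_of_fintype]
  refine Finset.sum_congr rfl fun δ _ => ?_
  by_cases hδ : D.ProjectsTo δ (v.2 : D.E1)
  · rw [finsum_eq_if, if_pos hδ, Set.indicator_of_mem]
    exact hδ
  · rw [finsum_eq_if, if_neg hδ, Set.indicator_of_notMem]
    exact hδ

lemma hasSum_of_pairs [Fintype (Disc q L)] {G : dual D.q1 D.L1 → Disc q L → ℂ} {S : ℂ}
    (h : HasSum (fun P : D.Pairs => G P.1.1 P.1.2) S) :
    HasSum (fun x : dual D.q1 D.L1 => ∑ᶠ (δ : Disc q L) (_ : D.ProjectsTo δ (x : D.E1)), G x δ)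
      S := by
  have h1 := D.hasSum_prod_of_pairs (ι := Unit) (G := fun _ => G)
    (((Equiv.punitProd D.Pairs).hasSum_iff).mpr h)
  exact ((Equiv.punitProd (dual D.q1 D.L1)).hasSum_iff).mp h1

end IsotropicData

/-! ### Summation over the adapted coordinates -/

namespace IsotropicData

variable {N bm : ℕ} {E : Type*} [AddCommGroup E] [Module ℝ E] {q : QuadraticForm ℝ E}
  {L : Submodule ℤ E} (D : IsotropicData q L) (v₀ : q.IsometryEquiv (stdForm (N + 3) bm))
  (b : OrthonormalBasis (Fin (N + 3)) ℝ (EuclideanSpace ℝ (Fin (N + 3))))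
  (g₁ : Orth D.q1)

/-- Shifting the lifts by integral multiples of `z`, one bounds the phases. -/
lemma summable_levelVec (hL : IsEvenLattice q L) {K : ℕ} (hK : N + 3 + bm < K) :
    Summable fun P : D.Pairs => ((1 + ‖D.levelVec v₀ b g₁ P.1.1‖) ^ K)⁻¹ := by
  obtain ⟨V, hV⟩ : ∃ V, V = D.adapted v₀ b 0 1 g₁ := ⟨_, rfl⟩
  have h1 := summable_dual hL V hK
  obtain ⟨φ, hφdef⟩ : ∃ φ : D.Pairs → dual q L,
    ∀ P, φ P = (D.liftAdd hL (P, -⌊D.phase v₀ 0 1 g₁ P⌋)).1 := ⟨_, fun P => rfl⟩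
  have hφ : Function.Injective φ := fun P P' h => by
    rw [hφdef, hφdef] at h
    exact congrArg Prod.fst ((D.bijective_liftAdd hL).1 (Subtype.ext h))
  refine Summable.of_nonneg_of_le (fun P => by positivity) (fun P => ?_)
    ((h1.comp_injective hφ).mul_left ((1 + ‖V D.z‖) ^ K))
  have h2 : D.levelVec v₀ b g₁ P.1.1
      = V (φ P : E) + (-(Int.fract (D.phase v₀ 0 1 g₁ P))) • V D.z := by
    have h3 : (φ P : E) = D.lift P + ((-⌊D.phase v₀ 0 1 g₁ P⌋ : ℤ) : ℝ) • D.z := by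
      rw [hφdef]
      exact D.coe_liftAdd hL _
    rw [h3, map_add, map_smul, hV, D.adapted_lift, ← Int.self_sub_floor]
    push_cast
    module
  rw [h2]
  refine (inv_one_add_norm_add_pow_le _ _ K).trans ?_
  refine mul_le_mul_of_nonneg_right (pow_le_pow_left₀ (by positivity) ?_ _) (by positivity)
  rw [norm_smul, norm_neg, Real.norm_of_nonneg (Int.fract_nonneg _)]
  have := mul_le_mul_of_nonneg_right (Int.fract_lt_one (D.phase v₀ 0 1 g₁ P)).le (norm_nonneg (V D.z))
  linarith

lemma summable_levelVec_dual (hL : IsEvenLattice q L) {K : ℕ} (hK : N + 3 + bm < K) :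
    Summable fun x : dual D.q1 D.L1 => ((1 + ‖D.levelVec v₀ b g₁ x‖) ^ K)⁻¹ := by
  choose δ hδ using D.exists_projectsTo
  have hφ : Function.Injective fun x : dual D.q1 D.L1 => (⟨(x, δ x), hδ x⟩ : D.Pairs) :=
    fun x x' h => congrArg (fun P : D.Pairs => P.1.1) h
  have h := (D.summable_levelVec v₀ b g₁ hL hK).comp_injective hφ
  simpa only [Function.comp_def] using h

end IsotropicData

/-! ### Pairing with a theta function as a sum over the dual lattice -/

section Pairing

variable {E : Type*} [AddCommGroup E] [Module ℝ E] {q : QuadraticForm ℝ E}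
  {L : Submodule ℤ E} {r s m : ℕ}

/-- The sum over the classes and the sums over their elements combine to a sum over `L'`. -/
lemma peterssonIntegrand_theta [Finite (Disc q L)] (v : E →ₗ[ℝ] (Fin r ⊕ Fin s → ℝ)) (bneg : ℕ)
    {c : Fin m → EuclideanSpace ℝ (Fin r)} (hc : Orthonormal ℝ c) (h : MvPolynomial (Fin m) ℂ)
    (g : Orth q) (w : ℤ) (F : ℍ → Disc q L → ℂ) (τ : ℍ) {T : dual q L → ℂ}
    (hT : ∀ x : dual q L, T x = heatEval (1 / (8 * Real.pi * τ.im) : ℝ)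
        (fun i => ((∑ j, c i j * v (g.symm (x : E)) (Sum.inl j) : ℝ) : ℂ)) h
      * expi ((τ : ℂ) * (qPlus (v (g.symm (x : E))) : ℝ)
          + conj (τ : ℂ) * (qMinus (v (g.symm (x : E))) : ℝ)))
    (hs : Summable T) :
    peterssonIntegrand w F (theta q L v bneg (inFrame c h) g) τ
      = ((τ.im ^ ((w : ℝ) / 2) : ℝ) : ℂ) * (((τ.im ^ ((bneg : ℝ) / 2) : ℝ) : ℂ)
        * ∑' x : dual q L, F τ (cls q L x) * conj (T x)) := by
  have hfin := Fintype.ofFinite (Disc q L)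
  have h1 : ∀ γ, theta q L v bneg (inFrame c h) g τ γ = ((τ.im ^ ((bneg : ℝ) / 2) : ℝ) : ℂ)
      * ∑' x : {x : dual q L // cls q L x = γ}, T x.1 := by
    intro γ
    rw [theta]
    congr 1
    refine tsum_congr fun x => ?_
    rw [eval_heat_inFrame hc, hT]
  have hs2 : Summable fun x : dual q L => F τ (cls q L x) * conj (T x) := by
    refine Summable.of_norm_bounded (hs.norm.mul_left (∑ γ, ‖F τ γ‖)) fun x => ?_
    rw [norm_mul, RCLike.norm_conj]
    exact mul_le_mul_of_nonneg_right (Finset.single_le_sum (f := fun γ => ‖F τ γ‖)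
      (fun γ _ => norm_nonneg _) (Finset.mem_univ _)) (norm_nonneg _)
  have h2 : ∑' x : dual q L, F τ (cls q L x) * conj (T x)
      = ∑ γ, F τ γ * conj (∑' x : {x : dual q L // cls q L x = γ}, T x.1) := by
    rw [← (Equiv.sigmaFiberEquiv fun x => cls q L x).tsum_eq, Summable.tsum_sigma, tsum_fintype]
    · refine Finset.sum_congr rfl fun γ _ => ?_
      rw [Complex.conj_tsum, ← tsum_mul_left]
      refine tsum_congr fun x => ?_
      rw [Equiv.sigmaFiberEquiv_apply, x.2]
    · exact (Equiv.summable_iff (Equiv.sigmaFiberEquiv fun x => cls q L x)).mpr hs2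
  rw [peterssonIntegrand, finsum_eq_sum_of_fintype, h2, Finset.mul_sum, Finset.mul_sum,
    Finset.sum_mul]
  refine Finset.sum_congr rfl fun γ _ => ?_
  rw [h1, map_mul, Complex.conj_ofReal]
  ring

end Pairing

/-! ### Integrals over the strip -/

section Strip

/-- The integral representation of the `K`-Bessel function, with two parameters. -/
lemma integral_rpow_mul_exp_eq_besselK (α : ℝ) {A B : ℝ} (hA : 0 < A) (hB : 0 < B) :
    ∫ y in Set.Ioi (0 : ℝ), y ^ (α - 1) * Real.exp (-(A / y) - B * y)
      = 2 * (A / B) ^ (α / 2) * besselK α (2 * Real.sqrt (A * B)) := by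
  set r := Real.sqrt (A / B) with hr
  have hr0 : 0 < r := Real.sqrt_pos.mpr (by positivity)
  have hBr : B * r = Real.sqrt (A * B) := by
    rw [hr, Real.sqrt_div hA.le, Real.sqrt_mul hA.le]
    have := Real.mul_self_sqrt hB.le
    have h0 : Real.sqrt B ≠ 0 := (Real.sqrt_pos.mpr hB).ne'
    field_simp
    nlinarith
  have hAr : A / r = Real.sqrt (A * B) := by
    rw [hr, Real.sqrt_div hA.le, Real.sqrt_mul hA.le]
    have := Real.mul_self_sqrt hA.le
    have h0 : Real.sqrt A ≠ 0 := (Real.sqrt_pos.mpr hA).ne'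
    have h1 : Real.sqrt B ≠ 0 := (Real.sqrt_pos.mpr hB).ne'
    field_simp
    nlinarith
  have h := integral_comp_mul_left_Ioi
    (fun y : ℝ => y ^ (α - 1) * Real.exp (-(A / y) - B * y)) 0 hr0
  rw [mul_zero] at h
  have h2 : ∫ y in Set.Ioi (0 : ℝ), y ^ (α - 1) * Real.exp (-(A / y) - B * y)
      = r * ∫ t in Set.Ioi (0 : ℝ), (r * t) ^ (α - 1) * Real.exp (-(A / (r * t)) - B * (r * t)) := by
    rw [h, smul_eq_mul, ← mul_assoc, mul_inv_cancel₀ hr0.ne', one_mul]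
  have h3 : ∀ t ∈ Set.Ioi (0 : ℝ),
      (r * t) ^ (α - 1) * Real.exp (-(A / (r * t)) - B * (r * t))
      = r ^ (α - 1) * (t ^ (α - 1)
        * Real.exp (-(2 * Real.sqrt (A * B) / 2) * (t + 1 / t))) := by
    intro t ht
    have ht0 : (0 : ℝ) < t := ht
    rw [Real.mul_rpow hr0.le ht0.le, mul_assoc]
    congr 3
    rw [← div_div, hAr, ← mul_assoc, hBr]
    ring
  have h4 : r * r ^ (α - 1) = (A / B) ^ (α / 2) := by
    nth_rw 1 [← Real.rpow_one r]
    rw [← Real.rpow_add hr0, hr, Real.sqrt_eq_rpow, ← Real.rpow_mul (by positivity)]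
    congr 1; ring
  rw [h2, setIntegral_congr_fun measurableSet_Ioi h3, integral_const_mul, ← mul_assoc, h4, besselK]
  ring

lemma setIntegral_strip {G : ℍ → ℂ} (hG : IntegrableOn G strip) :
    ∫ τ in strip, G τ
      = ∫ y in Set.Ioi (0 : ℝ), ((y ^ 2)⁻¹ : ℝ) • ∫ x in (0 : ℝ)..1, G (ofCoords (x, y)) := by
  have h1 := (integrableOn_iff_coords measurableSet_strip).mp hG
  rw [setIntegral_eq_coords measurableSet_strip]
  rw [strip_coords] at h1 ⊢
  rw [Measure.volume_eq_prod] at h1 ⊢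
  rw [IntegrableOn, ← Measure.prod_restrict] at h1
  rw [← Measure.prod_restrict, integral_prod_symm _ h1]
  refine integral_congr_ae (Filter.Eventually.of_forall fun y => ?_)
  simp only
  rw [integral_smul, intervalIntegral.integral_of_le zero_le_one, integral_Ico_eq_integral_Ioc]

lemma setLIntegral_strip {φ : ℝ → ENNReal} (hφ : Measurable φ) :
    ∫⁻ τ in strip, φ τ.im = ∫⁻ y in Set.Ioi (0 : ℝ), ENNReal.ofReal ((y ^ 2)⁻¹) * φ y := by
  have hm : Measurable fun τ : ℍ => φ τ.im := hφ.comp UpperHalfPlane.continuous_im.measurable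
  rw [setLIntegral_eq_coords measurableSet_strip hm, strip_coords, Measure.volume_eq_prod,
    ← Measure.prod_restrict]
  have h1 : ∫⁻ p, ENNReal.ofReal ((p.2 ^ 2)⁻¹) * φ (ofCoords p).im
        ∂(volume.restrict (Set.Ico (0 : ℝ) 1)).prod (volume.restrict (Set.Ioi (0 : ℝ)))
      = ∫⁻ p, ENNReal.ofReal ((p.2 ^ 2)⁻¹) * φ p.2
        ∂(volume.restrict (Set.Ico (0 : ℝ) 1)).prod (volume.restrict (Set.Ioi (0 : ℝ))) := by
    rw [Measure.prod_restrict]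
    refine setLIntegral_congr_fun (measurableSet_Ico.prod measurableSet_Ioi) fun p hp => ?_
    rw [im_ofCoords hp.2]
  rw [h1, lintegral_prod_symm _ (by fun_prop)]
  simp

/-- A weight of order `y²` at `0` and of exponential decay at `∞`: it is integrable over the strip
for the measure `dxdy/y²`. -/
def strongWeight (B : ℕ) (ε y : ℝ) : ℝ := y ^ (B + 2) * growth y ^ B * Real.exp (-ε * y)

lemma setLIntegral_strip_strongWeight_lt_top (B : ℕ) {ε : ℝ} (hε : 0 < ε) :
    ∫⁻ τ in strip, ENNReal.ofReal (strongWeight B ε τ.im) < ⊤ := by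
  have hm : Measurable (strongWeight B ε) := by unfold strongWeight growth; fun_prop
  rw [setLIntegral_strip (φ := fun y => ENNReal.ofReal (strongWeight B ε y)) hm.ennreal_ofReal]
  have h1 : ∀ y ∈ Set.Ioi (0 : ℝ), ENNReal.ofReal ((y ^ 2)⁻¹) * ENNReal.ofReal (strongWeight B ε y)
      = ENNReal.ofReal ((y ^ 2 + 1) ^ B * Real.exp (-ε * y)) := by
    intro y hy
    have hy0 : y ≠ 0 := (ne_of_gt hy)
    rw [← ENNReal.ofReal_mul (by positivity), strongWeight, growth, pow_add, mul_right_comm (y ^ B),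
      ← mul_pow, mul_add, mul_inv_cancel₀ hy0, ← sq]
    congr 1
    field_simp
  rw [setLIntegral_congr_fun measurableSet_Ioi h1]
  have h2 : IntegrableOn (fun y : ℝ => (y ^ 2 + 1) ^ B * Real.exp (-ε * y)) (Set.Ioi 0) := by
    have h3 : ∀ y : ℝ, (y ^ 2 + 1) ^ B * Real.exp (-ε * y)
        = ∑ i ∈ Finset.range (B + 1), (B.choose i : ℝ) * (y ^ (2 * i) * Real.exp (-ε * y)) := by
      intro y
      rw [add_pow, Finset.sum_mul]
      refine Finset.sum_congr rfl fun i _ => ?_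
      rw [one_pow, pow_mul]; ring
    simp only [h3]
    refine integrable_finsetSum _ fun i _ => Integrable.const_mul ?_ _
    have h5 := integrableOn_rpow_mul_exp_neg_mul_rpow (p := 1) (s := ((2 * i : ℕ) : ℝ)) (b := ε)
      (by have : (0:ℝ) ≤ ((2 * i : ℕ) : ℝ) := Nat.cast_nonneg _; linarith) one_pos hε
    refine h5.congr_fun (fun y hy => ?_) measurableSet_Ioi
    simp only [Real.rpow_natCast, Real.rpow_one]
  exact h2.lintegral_lt_top

/-- A factor `e^{-c/y}` is smaller than any power of `y/c`. -/
lemma exp_neg_div_le (M : ℕ) {c y : ℝ} (hc : 0 < c) (hy : 0 < y) :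
    Real.exp (-(c / y)) ≤ M.factorial * (y / c) ^ M := by
  have h1 := Real.pow_div_factorial_le_exp (c / y) (by positivity) M
  rw [Real.exp_neg, inv_le_comm₀ (Real.exp_pos _) (by positivity)]
  refine le_trans (le_of_eq ?_) h1
  rw [mul_inv, ← inv_pow, inv_div]
  ring

end Strip

/-! ### The character coefficients at the cusp -/

section Factor

/-- The `τ`-dependent factor of the Fourier transform of the kernel along an isotropic line. -/
def lineFactor (r₀ : ℝ) (m : ℕ) (d y : ℝ) : ℂ :=
  ((|r₀|⁻¹ * (1 / (2 * y)) ^ (1 / 2 : ℝ)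
      * Real.exp (-(Real.pi * d ^ 2 / (2 * y * r₀ ^ 2))) : ℝ) : ℂ)
    * (-(Complex.I * (d / (2 * r₀ * y) : ℝ))) ^ m

lemma measurable_lineFactor (r₀ : ℝ) (m : ℕ) (d : ℝ) : Measurable (lineFactor r₀ m d) := by
  unfold lineFactor
  fun_prop

/-- The Gaussian in `d/√y` gives any power of `y` near `0` and makes the sum over `d` converge. -/
lemma norm_lineFactor_le {r₀ : ℝ} (hr : r₀ ≠ 0) (m B : ℕ) (hB : m ≤ B) : ∃ C : ℝ, 0 ≤ C ∧
    ∀ d y : ℝ, 1 ≤ d → 0 < y →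
      ‖lineFactor r₀ m d y‖ ≤ C * (d ^ 2)⁻¹ * (y ^ (B + 2) * growth y ^ (m + 1)) := by
  set c₀ : ℝ := Real.pi / (2 * r₀ ^ 2) with hc
  have hc0 : 0 < c₀ := by positivity
  have hr' : 0 < |r₀| := abs_pos.mpr hr
  refine ⟨|r₀|⁻¹ * ((B + 2).factorial * (1 / c₀) ^ (B + 2)) * (1 / (2 * |r₀|)) ^ m, by positivity,
    fun d y hd hy => ?_⟩
  have hd0 : 0 < d := lt_of_lt_of_le one_pos hd
  have hg := one_le_growth hy
  have h1 : (1 / (2 * y)) ^ (1 / 2 : ℝ) ≤ growth y := by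
    have h2 : (1 / (2 * y)) ^ (1 / 2 : ℝ) ≤ (y⁻¹) ^ (1 / 2 : ℝ) := by
      refine Real.rpow_le_rpow (by positivity) ?_ (by norm_num)
      rw [one_div]
      exact inv_anti₀ hy (by linarith)
    rw [Real.inv_rpow hy.le, ← Real.rpow_neg hy.le] at h2
    have h3 := rpow_le_growth hy (a := -(1 / 2)) (A := 1) (by rw [abs_neg, abs_of_pos] <;> norm_num)
    rw [pow_one] at h3
    exact h2.trans h3
  have h2 : Real.exp (-(Real.pi * d ^ 2 / (2 * y * r₀ ^ 2)))
      ≤ ((B + 2).factorial * (1 / c₀) ^ (B + 2)) * (y ^ (B + 2) * (d ^ (2 * (B + 2)))⁻¹) := by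
    have h3 := exp_neg_div_le (B + 2) (c := c₀ * d ^ 2) (by positivity) hy
    have e1 : Real.pi * d ^ 2 / (2 * y * r₀ ^ 2) = c₀ * d ^ 2 / y := by rw [hc]; field_simp
    rw [e1]
    refine h3.trans (le_of_eq ?_)
    rw [div_pow, mul_pow, ← pow_mul, one_div, inv_pow]
    field_simp
  have h3 : ‖(-(Complex.I * (d / (2 * r₀ * y) : ℝ)) : ℂ) ^ m‖
      ≤ (1 / (2 * |r₀|)) ^ m * d ^ m * growth y ^ m := by
    rw [norm_pow, norm_neg, norm_mul, Complex.norm_I, one_mul, Complex.norm_real, Real.norm_eq_abs,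
      abs_div, abs_mul, abs_mul, abs_of_pos hd0, abs_of_pos hy, abs_two, ← mul_pow, ← mul_pow]
    refine pow_le_pow_left₀ (by positivity) ?_ _
    calc d / (2 * |r₀| * y) = 1 / (2 * |r₀|) * d * y⁻¹ := by field_simp
      _ ≤ _ := mul_le_mul_of_nonneg_left (inv_le_growth hy) (by positivity)
  have h4 : d ^ m * (d ^ (2 * (B + 2)))⁻¹ ≤ (d ^ 2)⁻¹ := by
    rw [← div_eq_mul_inv, div_le_iff₀ (by positivity), ← div_eq_inv_mul, le_div_iff₀ (by positivity),
      ← pow_add]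
    exact pow_le_pow_right₀ hd (by omega)
  rw [lineFactor, norm_mul, Complex.norm_real, Real.norm_of_nonneg (by positivity)]
  calc |r₀|⁻¹ * (1 / (2 * y)) ^ (1 / 2 : ℝ) * Real.exp (-(Real.pi * d ^ 2 / (2 * y * r₀ ^ 2)))
        * ‖(-(Complex.I * (d / (2 * r₀ * y) : ℝ)) : ℂ) ^ m‖
      ≤ |r₀|⁻¹ * growth y
          * (((B + 2).factorial * (1 / c₀) ^ (B + 2)) * (y ^ (B + 2) * (d ^ (2 * (B + 2)))⁻¹))
          * ((1 / (2 * |r₀|)) ^ m * d ^ m * growth y ^ m) := by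
        refine mul_le_mul ?_ h3 (norm_nonneg _) (by positivity)
        refine mul_le_mul (mul_le_mul_of_nonneg_left h1 (by positivity)) h2 (Real.exp_pos _).le
          (by positivity)
    _ = (|r₀|⁻¹ * ((B + 2).factorial * (1 / c₀) ^ (B + 2)) * (1 / (2 * |r₀|)) ^ m)
          * (d ^ m * (d ^ (2 * (B + 2)))⁻¹) * (y ^ (B + 2) * growth y ^ (m + 1)) := by ring
    _ ≤ _ := by
        refine mul_le_mul_of_nonneg_right (mul_le_mul_of_nonneg_left h4 (by positivity))
          (by positivity)

end Factor

namespace IsotropicData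

variable {N bm : ℕ} {E : Type*} [AddCommGroup E] [Module ℝ E] {q : QuadraticForm ℝ E}
  {L : Submodule ℤ E} (D : IsotropicData q L) (v₀ : q.IsometryEquiv (stdForm (N + 3) bm))
  (b : OrthonormalBasis (Fin (N + 3)) ℝ (EuclideanSpace ℝ (Fin (N + 3))))
  (u : D.E1) (a : ℝˣ) (g₁ : Orth D.q1) {sig w : ℤ} {f : ℍ → Disc q L → ℂ}

/-- The contribution of a pair `(x, δ)` to the coefficient of `y^ν` times the pairing of `f` with
the kernel of `X₀ᵐ h` at the character `σ ↦ 𝐞(dσ)`. -/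
def pairTerm (w : ℤ) (f : ℍ → Disc q L → ℂ) (h : MvPolynomial (Fin (N + 2)) ℂ) (m : ℕ) (d : ℝ)
    (P : D.Pairs) (τ : ℍ) : ℂ :=
  ((τ.im ^ ((w : ℝ) / 2) : ℝ) : ℂ) * (lineFactor (D.rho v₀ / a) m d τ.im * (f τ P.1.2
    * (conj (kern (MvPolynomial.rename Fin.succ h) τ (D.levelVec v₀ b g₁ P.1.1))
      * expi (d * D.phase v₀ u a g₁ P : ℝ))))

lemma measurable_pairTerm (hf : IsCuspForm q L sig w f) (h : MvPolynomial (Fin (N + 2)) ℂ) (m : ℕ)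
    (d : ℝ) (P : D.Pairs) : Measurable (D.pairTerm v₀ b u a g₁ w f h m d P) := by
  have him := UpperHalfPlane.continuous_im.measurable
  have h1 : Measurable fun τ : ℍ => kern (MvPolynomial.rename Fin.succ h) τ
      (D.levelVec v₀ b g₁ P.1.1) :=
    (Continuous.comp (g := fun v : ℍ × (Fin (N + 3) ⊕ Fin bm → ℝ) =>
      kern (MvPolynomial.rename Fin.succ h) v.1 v.2)
      (f := fun τ : ℍ => (τ, D.levelVec v₀ b g₁ P.1.1)) (continuous_kern _) (by fun_prop)).measurable
  exact (Complex.measurable_ofReal.comp (him.pow_const _)).mul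
    (((measurable_lineFactor _ _ _).comp him).mul ((hf.continuous _).measurable.mul
      ((Complex.continuous_conj.measurable.comp h1).mul_const _)))

/-- The bound that justifies the interchange of the sums over `d` and over the pairs with the
integral over the strip. -/
lemma norm_pairTerm_le [Fintype (Disc q L)] (hL : IsEvenLattice q L) (hw : 0 ≤ w)
    (hf : IsCuspForm q L sig w f) (h : MvPolynomial (Fin (N + 2)) ℂ) (m K : ℕ) :
    ∃ (C ε : ℝ) (B : ℕ), 0 ≤ C ∧ 0 < ε ∧ ∀ (d : ℝ) (P : D.Pairs) (τ : ℍ), 1 ≤ d →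
      ‖D.pairTerm v₀ b u a g₁ w f h m d P τ‖
        ≤ C * (d ^ 2)⁻¹ * ((1 + ‖D.levelVec v₀ b g₁ P.1.1‖) ^ K)⁻¹ * strongWeight B ε τ.im := by
  obtain ⟨C₁, ε, B₁, hC₁, hε, h₁⟩ := hf.exists_bound hL v₀ hw
  obtain ⟨C₂, B₂, hC₂, h₂⟩ := norm_kern_le (s := bm) (MvPolynomial.rename Fin.succ h) K
  set B₃ := ⌈|(w : ℝ) / 2|⌉₊
  set B := B₁ + B₂ + B₃ + (m + 1) with hB
  have hr : D.rho v₀ / a ≠ 0 := div_ne_zero (D.rho_pos v₀).ne' a.ne_zero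
  obtain ⟨C₃, hC₃, h₃⟩ := norm_lineFactor_le hr m B (by omega)
  refine ⟨C₃ * C₁ * C₂, ε, B, by positivity, hε, fun d P τ hd => ?_⟩
  have hy := τ.im_pos
  have hg := one_le_growth hy
  have h4 : τ.im ^ ((w : ℝ) / 2) ≤ growth τ.im ^ B₃ := rpow_le_growth hy (Nat.le_ceil _)
  rw [pairTerm, norm_mul, norm_mul, norm_mul, norm_mul, RCLike.norm_conj, norm_expi_real, mul_one,
    Complex.norm_real, Real.norm_of_nonneg (by positivity)]
  calc τ.im ^ ((w : ℝ) / 2) * (‖lineFactor (D.rho v₀ / a) m d τ.im‖ * (‖f τ P.1.2‖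
        * ‖kern (MvPolynomial.rename Fin.succ h) τ (D.levelVec v₀ b g₁ P.1.1)‖))
      ≤ growth τ.im ^ B₃ * ((C₃ * (d ^ 2)⁻¹ * (τ.im ^ (B + 2) * growth τ.im ^ (m + 1)))
        * ((C₁ * growth τ.im ^ B₁ * Real.exp (-ε * τ.im))
          * (C₂ * growth τ.im ^ B₂ * ((1 + ‖D.levelVec v₀ b g₁ P.1.1‖) ^ K)⁻¹))) := by
        refine mul_le_mul h4 ?_ (by positivity) (by positivity)
        refine mul_le_mul (h₃ d _ hd hy) ?_ (by positivity) (by positivity)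
        exact mul_le_mul (h₁ τ _) (h₂ τ _) (norm_nonneg _) (by positivity)
    _ = _ := by
        rw [strongWeight, hB]
        simp only [pow_add]
        ring

variable {b} (hb : ∀ j, b 0 j = v₀ D.z (Sum.inl j) / D.rho v₀)
include hb

/-- The character coefficients with first index `0`, as sums over pairs. -/
theorem hasSum_charCoeff [Fintype (Disc q L)] (hL : IsEvenLattice q L) (hw : 0 ≤ w)
    (hf : IsCuspForm q L sig w f) {h : MvPolynomial (Fin (N + 2)) ℂ} (hh : lap h = 0) (m : ℕ)
    (d : ℤ) (τ : ℍ) :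
    HasSum (fun P : D.Pairs => D.pairTerm v₀ b u a g₁ w f h m d P τ)
      (charCoeff w (D.adapted v₀ b u a g₁) f
        (MvPolynomial.X 0 ^ m * MvPolynomial.rename Fin.succ h) D.z ![0, d] τ) := by
  have hr : D.rho v₀ / a ≠ 0 := div_ne_zero (D.rho_pos v₀).ne' a.ne_zero
  have h1 := (hasSum_charIntegral hL (D.adapted v₀ b u a g₁) hw hf
    (MvPolynomial.X 0 ^ m * MvPolynomial.rename Fin.succ h) D τ d).mul_left
      ((τ.im ^ ((w : ℝ) / 2) : ℝ) : ℂ)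
  refine hasSum_of_eq h1 fun P => ?_
  have hZ0 := D.adapted_z_zero v₀ u a g₁ hb
  have hX0 : D.adapted v₀ b u a g₁ (D.lift P) (Sum.inl 0) / (D.rho v₀ / a)
      = D.phase v₀ u a g₁ P := by
    rw [D.adapted_lift, Pi.add_apply, Pi.smul_apply, hZ0, D.levelVec_zero v₀ g₁ hb, zero_add,
      smul_eq_mul, mul_div_assoc, div_self hr, mul_one]
  have h2 := integral_conj_kern_line hh m τ (X := D.adapted v₀ b u a g₁ (D.lift P))
    (Z := D.adapted v₀ b u a g₁ D.z) hr hZ0 (D.adapted_z_succ v₀ u a g₁ hb) (fun σ => by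
      rw [← map_smul, ← map_add, QuadraticMap.IsometryEquiv.map_app,
        QuadraticMap.IsometryEquiv.map_app, q_add, q_smul, D.isotropic, bil_smul_right,
        D.bil_lift_z]
      ring) d
  have h3 : D.adapted v₀ b u a g₁ (D.lift P) - D.phase v₀ u a g₁ P • D.adapted v₀ b u a g₁ D.z
      = D.levelVec v₀ b g₁ P.1.1 := by rw [D.adapted_lift, add_sub_cancel_right]
  rw [hX0, h3] at h2
  have h4 := congrArg (fun c : ℂ => ((τ.im ^ ((w : ℝ) / 2) : ℝ) : ℂ) * (f τ P.1.2 * c)) h2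
  refine Eq.trans ?_ h4.symm
  simp only [pairTerm, lineFactor]
  ring

end IsotropicData

/-! ### Integration of the character coefficients over the strip -/

lemma strongWeight_nonneg (B : ℕ) (ε : ℝ) (τ : ℍ) : 0 ≤ strongWeight B ε τ.im := by
  have hy := τ.im_pos
  have hg := one_le_growth hy
  unfold strongWeight
  positivity

lemma measurable_strongWeight (B : ℕ) (ε : ℝ) : Measurable (strongWeight B ε) := by
  unfold strongWeight growth
  fun_prop

lemma integrableOn_strip_strongWeight (B : ℕ) {ε : ℝ} (hε : 0 < ε) :
    IntegrableOn (fun τ : ℍ => strongWeight B ε τ.im) strip := by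
  refine ⟨((measurable_strongWeight B ε).comp
    UpperHalfPlane.continuous_im.measurable).aestronglyMeasurable, ?_⟩
  rw [hasFiniteIntegral_iff_ofReal (Filter.Eventually.of_forall fun τ => strongWeight_nonneg B ε τ)]
  exact setLIntegral_strip_strongWeight_lt_top B hε

lemma summable_inv_succ_sq : Summable fun n : ℕ => (((n : ℝ) + 1) ^ 2)⁻¹ := by
  have h := (summable_nat_add_iff 1).mpr (Real.summable_nat_pow_inv.mpr one_lt_two)
  simpa using h

namespace IsotropicData

variable {N bm : ℕ} {E : Type*} [AddCommGroup E] [Module ℝ E] {q : QuadraticForm ℝ E}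
  {L : Submodule ℤ E} (D : IsotropicData q L) (v₀ : q.IsometryEquiv (stdForm (N + 3) bm))
  {b : OrthonormalBasis (Fin (N + 3)) ℝ (EuclideanSpace ℝ (Fin (N + 3)))}
  (u : D.E1) (a : ℝˣ) (g₁ : Orth D.q1) {sig w : ℤ} {f : ℍ → Disc q L → ℂ}

lemma countable_pairs (hL : IsEvenLattice q L) (v₀ : q.IsometryEquiv (stdForm (N + 3) bm)) :
    Countable D.Pairs := by
  have := countable_dual hL v₀
  have hφ : Function.Injective fun P : D.Pairs => (D.liftAdd hL (P, 0)).1 := fun P P' h =>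
    congrArg Prod.fst ((D.bijective_liftAdd hL).1 (Subtype.ext h))
  exact hφ.countable

lemma integrableOn_strip_pairTerm [Fintype (Disc q L)] (hL : IsEvenLattice q L) (hw : 0 ≤ w)
    (hf : IsCuspForm q L sig w f) (h : MvPolynomial (Fin (N + 2)) ℂ) (m : ℕ) {d : ℝ} (hd : 1 ≤ d)
    (P : D.Pairs) : IntegrableOn (D.pairTerm v₀ b u a g₁ w f h m d P) strip := by
  obtain ⟨C, ε, B, hC, hε, hbd⟩ := D.norm_pairTerm_le v₀ b u a g₁ hL hw hf h m 0
  refine Integrable.mono' ((integrableOn_strip_strongWeight B hε).const_mul (C * (d ^ 2)⁻¹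
    * ((1 + ‖D.levelVec v₀ b g₁ P.1.1‖) ^ 0)⁻¹))
    (D.measurable_pairTerm v₀ b u a g₁ hf h m d P).aestronglyMeasurable
    (Filter.Eventually.of_forall fun τ => hbd d P τ hd)

/-- The integrals of all terms over the strip are absolutely summable. -/
lemma summable_integral_norm_pairTerm [Fintype (Disc q L)] (hL : IsEvenLattice q L) (hw : 0 ≤ w)
    (hf : IsCuspForm q L sig w f) (h : MvPolynomial (Fin (N + 2)) ℂ) (m : ℕ) :
    Summable fun v : ℕ × D.Pairs =>
      ∫ τ in strip, ‖D.pairTerm v₀ b u a g₁ w f h m ((v.1 : ℝ) + 1) v.2 τ‖ := by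
  set K := N + 3 + bm + 1
  obtain ⟨C, ε, B, hC, hε, hbd⟩ := D.norm_pairTerm_le v₀ b u a g₁ hL hw hf h m K
  have hI := integrableOn_strip_strongWeight B hε
  have hs := (summable_inv_succ_sq.mul_of_nonneg (D.summable_levelVec v₀ b g₁ hL
    (Nat.lt_succ_self (N + 3 + bm))) (fun n => by positivity) (fun P => by positivity)).mul_left
      (C * ∫ τ in strip, strongWeight B ε τ.im)
  refine Summable.of_nonneg_of_le (fun v => integral_nonneg fun τ => norm_nonneg _) (fun v => ?_) hs
  have h1 : (1 : ℝ) ≤ (v.1 : ℝ) + 1 := by linarith [(Nat.cast_nonneg v.1 : (0 : ℝ) ≤ v.1)]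
  refine (integral_mono_of_nonneg (Filter.Eventually.of_forall fun τ => norm_nonneg _)
    (hI.const_mul (C * (((v.1 : ℝ) + 1) ^ 2)⁻¹ * ((1 + ‖D.levelVec v₀ b g₁ v.2.1.1‖) ^ K)⁻¹))
    (Filter.Eventually.of_forall fun τ => hbd _ v.2 τ h1)).trans (le_of_eq ?_)
  rw [integral_const_mul]
  change _ = _ * (_ * ((1 + ‖D.levelVec v₀ b g₁ v.2.1.1‖) ^ K)⁻¹)
  ring

variable (hb : ∀ j, b 0 j = v₀ D.z (Sum.inl j) / D.rho v₀)
include hb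

/-- The absolute convergence that the unfolding requires. -/
lemma tsum_lintegral_strip_charCoeff_ne_top [Fintype (Disc q L)] (hL : IsEvenLattice q L)
    (hw : 0 ≤ w) (hf : IsCuspForm q L sig w f) {h : MvPolynomial (Fin (N + 2)) ℂ} (hh : lap h = 0)
    (m : ℕ) :
    ∑' n : ℕ, ∫⁻ τ in strip, ‖charCoeff w (D.adapted v₀ b u a g₁) f
      (MvPolynomial.X 0 ^ m * MvPolynomial.rename Fin.succ h) D.z ![0, (n + 1 : ℤ)] τ‖ₑ ≠ ⊤ := by
  set K := N + 3 + bm + 1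
  obtain ⟨C, ε, B, hC, hε, hbd⟩ := D.norm_pairTerm_le v₀ b u a g₁ hL hw hf h m K
  have hs := D.summable_levelVec v₀ b g₁ hL (Nat.lt_succ_self (N + 3 + bm))
  set W := ∑' P : D.Pairs, ((1 + ‖D.levelVec v₀ b g₁ P.1.1‖) ^ K)⁻¹
  have hW : 0 ≤ W := tsum_nonneg fun P => by positivity
  have h1 : ∀ (n : ℕ) (τ : ℍ), ‖charCoeff w (D.adapted v₀ b u a g₁) f
      (MvPolynomial.X 0 ^ m * MvPolynomial.rename Fin.succ h) D.z ![0, (n + 1 : ℤ)] τ‖ₑ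
      ≤ ENNReal.ofReal (C * W * (((n : ℝ) + 1) ^ 2)⁻¹) * ENNReal.ofReal (strongWeight B ε τ.im) := by
    intro n τ
    have hd : (1 : ℝ) ≤ (((n + 1 : ℤ)) : ℝ) := by
      push_cast; linarith [(Nat.cast_nonneg n : (0 : ℝ) ≤ n)]
    have h2 := (D.hasSum_charCoeff v₀ u a g₁ hb hL hw hf hh m (n + 1) τ)
    rw [← h2.tsum_eq, ← ofReal_norm, ← ENNReal.ofReal_mul (by positivity)]
    refine ENNReal.ofReal_le_ofReal ?_
    refine (tsum_of_norm_bounded (((hs.hasSum.mul_left (C * ((((n + 1 : ℤ)) : ℝ) ^ 2)⁻¹)).mul_right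
      (strongWeight B ε τ.im))) fun P => hbd _ P τ hd).trans (le_of_eq ?_)
    push_cast
    ring
  have h2 : ∀ n : ℕ, ∫⁻ τ in strip, ‖charCoeff w (D.adapted v₀ b u a g₁) f
      (MvPolynomial.X 0 ^ m * MvPolynomial.rename Fin.succ h) D.z ![0, (n + 1 : ℤ)] τ‖ₑ
      ≤ ENNReal.ofReal (C * W * (((n : ℝ) + 1) ^ 2)⁻¹)
        * ∫⁻ τ in strip, ENNReal.ofReal (strongWeight B ε τ.im) := by
    intro n
    have hm : Measurable fun τ : ℍ => ENNReal.ofReal (strongWeight B ε τ.im) :=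
      ((measurable_strongWeight B ε).comp UpperHalfPlane.continuous_im.measurable).ennreal_ofReal
    rw [← lintegral_const_mul _ hm]
    exact lintegral_mono (h1 n)
  refine ne_top_of_le_ne_top ?_ (ENNReal.tsum_le_tsum h2)
  rw [ENNReal.tsum_mul_right]
  refine ENNReal.mul_ne_top ?_ (setLIntegral_strip_strongWeight_lt_top B hε).ne
  exact (summable_inv_succ_sq.mul_left (C * W)).tsum_ofReal_ne_top

/-- The sum of the strip integrals of the character coefficients is the absolutely convergent double
sum of the strip integrals of their terms. -/
theorem hasSum_integral_strip_pairTerm [Fintype (Disc q L)] (hL : IsEvenLattice q L) (hw : 0 ≤ w)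
    (hf : IsCuspForm q L sig w f) {h : MvPolynomial (Fin (N + 2)) ℂ} (hh : lap h = 0) (m : ℕ) :
    HasSum (fun v : ℕ × D.Pairs =>
        ∫ τ in strip, D.pairTerm v₀ b u a g₁ w f h m ((v.1 : ℝ) + 1) v.2 τ)
      (∑' n : ℕ, ∫ τ in strip, charCoeff w (D.adapted v₀ b u a g₁) f
        (MvPolynomial.X 0 ^ m * MvPolynomial.rename Fin.succ h) D.z ![0, (n + 1 : ℤ)] τ) := by
  have hcount := D.countable_pairs hL v₀
  have hs := D.summable_integral_norm_pairTerm v₀ (b := b) u a g₁ hL hw hf h m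
  have h1 : Summable fun v : ℕ × D.Pairs =>
      ∫ τ in strip, D.pairTerm v₀ b u a g₁ w f h m ((v.1 : ℝ) + 1) v.2 τ :=
    Summable.of_norm_bounded hs fun v => norm_integral_le_integral_norm _
  have h2 : ∀ n : ℕ, HasSum (fun P : D.Pairs =>
        ∫ τ in strip, D.pairTerm v₀ b u a g₁ w f h m ((n : ℝ) + 1) P τ)
      (∫ τ in strip, charCoeff w (D.adapted v₀ b u a g₁) f
        (MvPolynomial.X 0 ^ m * MvPolynomial.rename Fin.succ h) D.z ![0, (n + 1 : ℤ)] τ) := by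
    intro n
    have hd : (1 : ℝ) ≤ (n : ℝ) + 1 := by linarith [(Nat.cast_nonneg n : (0 : ℝ) ≤ n)]
    have h3 := hasSum_integral_of_summable_integral_norm
      (fun P : D.Pairs => D.integrableOn_strip_pairTerm v₀ (b := b) u a g₁ hL hw hf h m hd P)
      (hs.prod_factor n)
    have h4 : ∀ τ : ℍ, ∑' P : D.Pairs, D.pairTerm v₀ b u a g₁ w f h m ((n : ℝ) + 1) P τ
        = charCoeff w (D.adapted v₀ b u a g₁) f
          (MvPolynomial.X 0 ^ m * MvPolynomial.rename Fin.succ h) D.z ![0, (n + 1 : ℤ)] τ := by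
      intro τ
      rw [← (D.hasSum_charCoeff v₀ u a g₁ hb hL hw hf hh m (n + 1) τ).tsum_eq]
      push_cast
      rfl
    simp only [h4] at h3
    exact h3
  rw [(h1.hasSum.prod_fiberwise h2).tsum_eq]
  exact h1.hasSum

omit hb

lemma normPlus_pos {r s : ℕ} {X : Fin r ⊕ Fin s → ℝ} (hX : 0 < stdForm r s X) : 0 < normPlus X := by
  rw [stdForm_eq_qPlus_add_qMinus, qPlus, qMinus] at hX
  have : 0 ≤ ∑ j, X (Sum.inr j) ^ 2 := Finset.sum_nonneg fun j _ => sq_nonneg _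
  exact Real.sqrt_pos.mpr (by linarith)

lemma heatEval_rename_succ {n : ℕ} (t : ℂ) (x : Fin (n + 1) → ℂ) {h : MvPolynomial (Fin n) ℂ}
    (hh : lap h = 0) : heatEval t x (MvPolynomial.rename Fin.succ h)
      = MvPolynomial.eval (fun i => x i.succ) h := by
  have h1 := heatEval_X_pow_mul_rename t x 0 h
  rwa [pow_zero, one_mul, heatMonomial_zero, one_mul, heatEval_of_lap_eq_zero _ _ hh] at h1

/-- The integral over `x` picks out a Fourier coefficient of `f`, the integral over `y` is a
`K`-Bessel function. -/
theorem integral_strip_pairTerm [Fintype (Disc q L)] (hL : IsEvenLattice q L) (hw0 : 0 ≤ w)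
    (hf : IsCuspForm q L sig w f) {c : ℝ → Disc q L → ℂ} (hc : HasFourierExpansion q L f c)
    {h : MvPolynomial (Fin (N + 2)) ℂ} (hh : lap h = 0) (m k₁ : ℕ)
    (hw : w = 2 * (k₁ + m) + (N + 3) - bm) {d : ℝ} (hd : 1 ≤ d) (P : D.Pairs) :
    ∫ τ in strip, D.pairTerm v₀ b u a g₁ w f h m d P τ
      = if 0 < D.q1 (P.1.1 : D.E1) then
          ((|D.rho v₀ / a|⁻¹ * (1 / 2) ^ (1 / 2 : ℝ) * (2
              * (d / (2 * |D.rho v₀ / a| * normPlus (D.levelVec v₀ b g₁ P.1.1)))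
                ^ ((k₁ : ℝ) + (N : ℝ) / 2)
              * besselK ((k₁ : ℝ) + (N : ℝ) / 2)
                (2 * (Real.pi * d * normPlus (D.levelVec v₀ b g₁ P.1.1) / |D.rho v₀ / a|))) : ℝ) : ℂ)
            * (-(Complex.I * (d / (2 * (D.rho v₀ / a)) : ℝ))) ^ m
            * conj (MvPolynomial.eval
                (fun i => ((D.levelVec v₀ b g₁ P.1.1 (Sum.inl (Fin.succ i)) : ℝ) : ℂ)) h)
            * expi (d * D.phase v₀ u a g₁ P : ℝ) * c (D.q1 (P.1.1 : D.E1)) P.1.2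
        else 0 := by
  set X := D.levelVec v₀ b g₁ P.1.1 with hX
  set r₀ := D.rho v₀ / a with hr₀
  have hr : r₀ ≠ 0 := div_ne_zero (D.rho_pos v₀).ne' a.ne_zero
  set q₁ := D.q1 (P.1.1 : D.E1) with hq₁
  have hqX : stdForm (N + 3) bm X = q₁ := D.stdForm_levelVec v₀ g₁ _
  set H := MvPolynomial.eval (fun i => ((X (Sum.inl (Fin.succ i)) : ℝ) : ℂ)) h with hH
  have hql : q (D.liftDual hL P : E) = q₁ := by rw [D.coe_liftDual hL, D.q_lift]
  rw [setIntegral_strip (D.integrableOn_strip_pairTerm v₀ u a g₁ hL hw0 hf h m hd P)]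
  -- the integral over `x`
  have hinner : ∀ y ∈ Set.Ioi (0 : ℝ), ((y ^ 2)⁻¹ : ℝ)
      • ∫ x in (0 : ℝ)..1, D.pairTerm v₀ b u a g₁ w f h m d P (ofCoords (x, y))
      = ((y ^ 2)⁻¹ : ℝ) • (((y ^ ((w : ℝ) / 2) : ℝ) : ℂ) * lineFactor r₀ m d y
        * radialFactor (MvPolynomial.rename Fin.succ h) X ((bm : ℝ) / 2) y
        * expi (d * D.phase v₀ u a g₁ P : ℝ)) * c q₁ P.1.2 := by
    intro y hy
    have hy0 : (0 : ℝ) < y := hy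
    have h1 := hc.integral_eq (D.liftDual hL P) y hy0
    rw [D.cls_liftDual hL, hql] at h1
    rw [← h1, smul_mul_assoc, ← intervalIntegral.integral_const_mul]
    congr 1
    refine intervalIntegral.integral_congr fun x _ => ?_
    simp only [pairTerm]
    rw [conj_kern, ← hX, hqX, im_ofCoords (p := (x, y)) hy0, ← hr₀, coe_ofCoords (p := (x, y)) hy0,
      ofCoords_eq hy0, neg_mul]
    ring
  rw [setIntegral_congr_fun measurableSet_Ioi hinner]
  split_ifs with hpos
  · have hR : 0 < normPlus X := normPlus_pos (hqX ▸ hpos)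
    set R := normPlus X with hRdef
    have hd0 : 0 < d := lt_of_lt_of_le one_pos hd
    have hr' : 0 < |r₀| := abs_pos.mpr hr
    set A := Real.pi * d ^ 2 / (2 * r₀ ^ 2) with hA
    set B := 2 * Real.pi * R ^ 2 with hB
    have hA0 : 0 < A := by positivity
    have hB0 : 0 < B := by positivity
    set s := (k₁ : ℝ) + (N : ℝ) / 2 with hs
    -- the powers of `y` combine to `y ^ (s - 1)`
    have hy : ∀ y ∈ Set.Ioi (0 : ℝ), ((y ^ 2)⁻¹ : ℝ) • (((y ^ ((w : ℝ) / 2) : ℝ) : ℂ)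
        * lineFactor r₀ m d y
        * radialFactor (MvPolynomial.rename Fin.succ h) X ((bm : ℝ) / 2) y
        * expi (d * D.phase v₀ u a g₁ P : ℝ)) * c q₁ P.1.2
        = (((|r₀|⁻¹ * (1 / 2) ^ (1 / 2 : ℝ) : ℝ) : ℂ) * (-(Complex.I * (d / (2 * r₀) : ℝ))) ^ m
            * conj H * expi (d * D.phase v₀ u a g₁ P : ℝ) * c q₁ P.1.2)
          * ((y ^ (s - 1) * Real.exp (-(A / y) - B * y) : ℝ) : ℂ) := by
      intro y hy
      have hy0 : (0 : ℝ) < y := hy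
      have hyc : (y : ℂ) ≠ 0 := Complex.ofReal_ne_zero.mpr hy0.ne'
      have e1 : (1 / (2 * y)) ^ (1 / 2 : ℝ) = (1 / 2) ^ (1 / 2 : ℝ) * y ^ (-(1 / 2) : ℝ) := by
        rw [Real.rpow_neg hy0.le, ← Real.inv_rpow hy0.le, ← Real.mul_rpow (by norm_num) (by positivity)]
        congr 1
        field_simp
      have e2 : (-(Complex.I * (d / (2 * r₀ * y) : ℝ)) : ℂ) ^ m
          = (-(Complex.I * (d / (2 * r₀) : ℝ))) ^ m * ((y ^ (-(m : ℝ)) : ℝ) : ℂ) := by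
        rw [Real.rpow_neg hy0.le, Real.rpow_natCast, ← inv_pow, Complex.ofReal_pow, ← mul_pow]
        congr 1
        rw [← div_div, div_eq_mul_inv _ y]
        push_cast
        ring
      have e3 : Real.exp (-(A / y) - B * y) = Real.exp (-(Real.pi * d ^ 2 / (2 * y * r₀ ^ 2)))
          * Real.exp (-(2 * Real.pi * y * R ^ 2)) := by
        rw [← Real.exp_add, hA, hB]
        congr 1
        field_simp
        ring
      have e4 : y ^ (s - 1) = (y ^ 2)⁻¹ * y ^ ((w : ℝ) / 2) * y ^ (-(1 / 2) : ℝ) * y ^ (-(m : ℝ))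
          * y ^ ((bm : ℝ) / 2) := by
        have : (y ^ 2)⁻¹ = y ^ (-2 : ℝ) := by
          rw [Real.rpow_neg hy0.le, Real.rpow_two]
        rw [this, ← Real.rpow_add hy0, ← Real.rpow_add hy0, ← Real.rpow_add hy0,
          ← Real.rpow_add hy0, hs, hw]
        congr 1
        push_cast
        ring
      have e5 : ∑ j, X (Sum.inl j) ^ 2 = R ^ 2 := by
        rw [hRdef, normPlus, Real.sq_sqrt (Finset.sum_nonneg fun j _ => sq_nonneg _)]
      rw [radialFactor, heatEval_rename_succ _ _ hh, ← hH, lineFactor, e1, e2, e3, e4, e5,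
        Complex.real_smul]
      push_cast
      ring
    rw [setIntegral_congr_fun measurableSet_Ioi hy, integral_const_mul, integral_complex_ofReal,
      integral_rpow_mul_exp_eq_besselK s hA0 hB0]
    have e6 : (A / B) ^ (s / 2) = (d / (2 * |r₀| * R)) ^ s := by
      have : A / B = (d / (2 * |r₀| * R)) ^ (2 : ℝ) := by
        rw [Real.rpow_two, div_pow, mul_pow, mul_pow, sq_abs, hA, hB]
        field_simp
      rw [this, ← Real.rpow_mul (by positivity)]
      congr 1
      ring
    have e7 : Real.sqrt (A * B) = Real.pi * d * R / |r₀| := by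
      have : A * B = (Real.pi * d * R / |r₀|) ^ 2 := by
        rw [div_pow, sq_abs, hA, hB]
        field_simp
      rw [this, Real.sqrt_sq (by positivity)]
    rw [e6, e7]
    push_cast
    ring
  · have h0 : c q₁ P.1.2 = 0 := by
      have := hf.coeff_eq_zero hc (D.liftDual hL P) (by rw [hql]; exact not_lt.mp hpos)
      rwa [D.cls_liftDual hL, hql] at this
    simp [h0]

end IsotropicData

namespace IsotropicData

variable {N bm : ℕ} {E : Type*} [AddCommGroup E] [Module ℝ E] {q : QuadraticForm ℝ E}
  {L : Submodule ℤ E} (D : IsotropicData q L) (v₀ : q.IsometryEquiv (stdForm (N + 3) bm))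
  (b : OrthonormalBasis (Fin (N + 3)) ℝ (EuclideanSpace ℝ (Fin (N + 3))))
  (u : D.E1) (a : ℝˣ) (g₁ : Orth D.q1) {sig w : ℤ} {f : ℍ → Disc q L → ℂ}

/-! ### The zeroth character coefficient and the theta function of `L₁` -/

lemma neg_index_pos (D : IsotropicData q L) (v₀ : q.IsometryEquiv (stdForm (N + 3) bm)) : 0 < bm := by
  refine Nat.pos_of_ne_zero fun h => ?_
  subst h
  have h1 := D.sum_sq_minus_z v₀
  rw [Finset.univ_eq_empty, Finset.sum_empty] at h1
  have := D.rho_pos v₀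
  nlinarith

lemma orthonormal_tail : Orthonormal ℝ (Fin.tail b) :=
  b.orthonormal.comp Fin.succ (Fin.succ_injective _)

lemma levelVec_inl_succ (x : D.E1) (i : Fin (N + 2)) : D.levelVec v₀ b g₁ x (Sum.inl i.succ)
    = ∑ j, Fin.tail b i j * D.v1 v₀ (g₁.symm x : E) (Sum.inl j) := rfl

lemma normPlus_levelVec (x : D.E1) :
    normPlus (D.levelVec v₀ b g₁ x) = normPlus (D.v1 v₀ (g₁.symm x : E)) := by
  have h := sum_sq_frame b fun j => D.v1 v₀ (g₁.symm x : E) (Sum.inl j)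
  simp only [normPlus, levelVec, frameIso_inl, h]

lemma kern_levelVec {h : MvPolynomial (Fin (N + 2)) ℂ} (hh : lap h = 0) (τ : ℍ) (x : D.E1) :
    kern (MvPolynomial.rename Fin.succ h) τ (D.levelVec v₀ b g₁ x)
      = ((τ.im ^ ((bm : ℝ) / 2) : ℝ) : ℂ)
        * (heatEval (1 / (8 * Real.pi * τ.im) : ℝ)
            (fun i => ((∑ j, Fin.tail b i j
              * ((D.v1 v₀ ∘ₗ D.E1.subtype) (g₁.symm x)) (Sum.inl j) : ℝ) : ℂ)) h
          * expi ((τ : ℂ) * (qPlus ((D.v1 v₀ ∘ₗ D.E1.subtype) (g₁.symm x)) : ℝ)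
            + conj (τ : ℂ) * (qMinus ((D.v1 v₀ ∘ₗ D.E1.subtype) (g₁.symm x)) : ℝ))) := by
  have h1 : qPlus (D.levelVec v₀ b g₁ x) = qPlus ((D.v1 v₀ ∘ₗ D.E1.subtype) (g₁.symm x)) :=
    qPlus_frameIso b _
  have h2 : qMinus (D.levelVec v₀ b g₁ x) = qMinus ((D.v1 v₀ ∘ₗ D.E1.subtype) (g₁.symm x)) :=
    qMinus_frameIso b _
  rw [kern, heatEval_rename_succ _ _ hh, heatEval_of_lap_eq_zero _ _ hh, h1, h2, mul_assoc]
  rfl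

variable {b} (hb : ∀ j, b 0 j = v₀ D.z (Sum.inl j) / D.rho v₀)
include hb

/-- The zeroth character coefficient for `m = 0` is the integrand of the pairing of `f_{L₁}` with
the theta function of `L₁`, up to a constant. -/
theorem charCoeff_zero [Fintype (Disc q L)] (hL : IsEvenLattice q L) (hw : 0 ≤ w)
    (hf : IsCuspForm q L sig w f) {h : MvPolynomial (Fin (N + 2)) ℂ} (hh : lap h = 0) (τ : ℍ) :
    charCoeff w (D.adapted v₀ b u a g₁) f
        (MvPolynomial.X 0 ^ 0 * MvPolynomial.rename Fin.succ h) D.z 0 τ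
      = ((|(a : ℝ)| / (Real.sqrt 2 * D.rho v₀) : ℝ) : ℂ)
        * peterssonIntegrand w (D.reduce f)
          (theta D.q1 D.L1 (D.v1 v₀ ∘ₗ D.E1.subtype) (bm - 1) (inFrame (Fin.tail b) h) g₁) τ := by
  have hfin := D.finite_disc_L1 hL
  have hy := τ.im_pos
  have hρ := D.rho_pos v₀
  have hbm := D.neg_index_pos v₀
  obtain ⟨T, hT⟩ : ∃ T : dual D.q1 D.L1 → ℂ, ∀ x, T x = heatEval (1 / (8 * Real.pi * τ.im) : ℝ)
        (fun i => ((∑ j, Fin.tail b i j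
          * ((D.v1 v₀ ∘ₗ D.E1.subtype) (g₁.symm (x : D.E1))) (Sum.inl j) : ℝ) : ℂ)) h
      * expi ((τ : ℂ) * (qPlus ((D.v1 v₀ ∘ₗ D.E1.subtype) (g₁.symm (x : D.E1))) : ℝ)
        + conj (τ : ℂ) * (qMinus ((D.v1 v₀ ∘ₗ D.E1.subtype) (g₁.symm (x : D.E1))) : ℝ)) :=
    ⟨_, fun x => rfl⟩
  have hyp : 0 < τ.im ^ ((bm : ℝ) / 2) := Real.rpow_pos_of_pos hy _
  have hyc : ((τ.im ^ ((bm : ℝ) / 2) : ℝ) : ℂ) ≠ 0 := Complex.ofReal_ne_zero.mpr hyp.ne'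
  have hkern : ∀ x : dual D.q1 D.L1,
      kern (MvPolynomial.rename Fin.succ h) τ (D.levelVec v₀ b g₁ x)
      = ((τ.im ^ ((bm : ℝ) / 2) : ℝ) : ℂ) * T x := fun x => by
    rw [D.kern_levelVec v₀ b g₁ hh, hT]
  have hsum : Summable T := by
    obtain ⟨C, B, hC, hbd⟩ := norm_kern_le (s := bm) (MvPolynomial.rename Fin.succ h)
      (N + 3 + bm + 1)
    have hs := (D.summable_levelVec_dual v₀ b g₁ hL (Nat.lt_succ_self (N + 3 + bm))).mul_left
      ((τ.im ^ ((bm : ℝ) / 2))⁻¹ * (C * growth τ.im ^ B))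
    refine Summable.of_norm_bounded hs fun x => ?_
    have h1 := hbd τ (D.levelVec v₀ b g₁ x)
    rw [hkern, norm_mul, Complex.norm_real, Real.norm_of_nonneg hyp.le] at h1
    rw [mul_assoc, ← div_eq_inv_mul, le_div_iff₀ hyp, mul_comm]
    exact h1
  set κ : ℂ := ((τ.im ^ ((w : ℝ) / 2) * (|(a : ℝ)| / (Real.sqrt 2 * D.rho v₀)
    * τ.im ^ (((bm - 1 : ℕ) : ℝ) / 2)) : ℝ) : ℂ) with hκ
  have hline : lineFactor (D.rho v₀ / a) 0 0 τ.im * ((τ.im ^ ((bm : ℝ) / 2) : ℝ) : ℂ)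
      = ((|(a : ℝ)| / (Real.sqrt 2 * D.rho v₀) * τ.im ^ (((bm - 1 : ℕ) : ℝ) / 2) : ℝ) : ℂ) := by
    rw [lineFactor, pow_zero, mul_one, ← Complex.ofReal_mul]
    congr 1
    have e1 : τ.im ^ ((bm : ℝ) / 2)
        = τ.im ^ (((bm - 1 : ℕ) : ℝ) / 2) * τ.im ^ (1 / 2 : ℝ) := by
      rw [← Real.rpow_add hy, Nat.cast_sub hbm]
      congr 1
      push_cast
      ring
    have e2 : (1 / (2 * τ.im)) ^ (1 / 2 : ℝ) = 1 / (Real.sqrt 2 * τ.im ^ (1 / 2 : ℝ)) := by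
      rw [Real.div_rpow zero_le_one (by positivity), Real.one_rpow,
        Real.mul_rpow (by norm_num) hy.le, Real.sqrt_eq_rpow]
    have hy2 : τ.im ^ (1 / 2 : ℝ) ≠ 0 := (Real.rpow_pos_of_pos hy _).ne'
    have ha : |(a : ℝ)| ≠ 0 := abs_ne_zero.mpr a.ne_zero
    have h2 : Real.sqrt 2 ≠ 0 := by positivity
    rw [e1, e2, abs_div, abs_of_pos hρ]
    simp only [ne_eq, OfNat.ofNat_ne_zero, not_false_eq_true, zero_pow, mul_zero, zero_div, neg_zero,
      Real.exp_zero, mul_one]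
    field_simp
  have h1 := D.hasSum_charCoeff v₀ u a g₁ hb hL hw hf hh 0 0 τ
  have h0 : (![0, 0] : Fin 2 → ℤ) = 0 := by
    ext i
    fin_cases i <;> rfl
  rw [h0] at h1
  have h2 : HasSum (fun P : D.Pairs => f τ P.1.2 * (κ * conj (T P.1.1))) _ :=
    hasSum_of_eq h1 fun P => by
      rw [pairTerm, hkern, map_mul, Complex.conj_ofReal, Int.cast_zero, zero_mul, Complex.ofReal_zero,
        expi_zero, hκ, Complex.ofReal_mul, ← hline]
      ring
  have h3 := D.hasSum_of_pairs (G := fun x δ => f τ δ * (κ * conj (T x))) h2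
  rw [peterssonIntegrand_theta _ _ (orthonormal_tail b) h g₁ w (D.reduce f) τ hT hsum, ← h3.tsum_eq,
    ← tsum_mul_left, ← tsum_mul_left, ← tsum_mul_left]
  refine tsum_congr fun x => ?_
  have h4 := finsum_mem_mul (s := {δ : Disc q L | D.ProjectsTo δ (x : D.E1)}) (f τ) (κ * conj (T x))
  rw [D.reduce_cls]
  refine h4.symm.trans ?_
  rw [hκ]
  push_cast
  simp only [Set.mem_ofPred_eq]
  ring

/-- For `m > 0` the zeroth character coefficient vanishes. -/
theorem charCoeff_zero_of_pos [Fintype (Disc q L)] (hL : IsEvenLattice q L) (hw : 0 ≤ w)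
    (hf : IsCuspForm q L sig w f) {h : MvPolynomial (Fin (N + 2)) ℂ} (hh : lap h = 0) {m : ℕ}
    (hm : m ≠ 0) (τ : ℍ) :
    charCoeff w (D.adapted v₀ b u a g₁) f
        (MvPolynomial.X 0 ^ m * MvPolynomial.rename Fin.succ h) D.z 0 τ = 0 := by
  have h1 := D.hasSum_charCoeff v₀ u a g₁ hb hL hw hf hh m 0 τ
  have h0 : (![0, 0] : Fin 2 → ℤ) = 0 := by
    ext i
    fin_cases i <;> rfl
  rw [h0] at h1
  rw [← h1.tsum_eq]
  refine (tsum_congr fun P => ?_).trans tsum_zero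
  rw [pairTerm, lineFactor, Int.cast_zero, zero_div, Complex.ofReal_zero, mul_zero, neg_zero,
    zero_pow hm]
  ring

omit hb

/-! ### Reindexing by multiples of vectors of `L₁'` -/

lemma levelVec_smul (c : ℝ) (x : D.E1) :
    D.levelVec v₀ b g₁ (c • x) = c • D.levelVec v₀ b g₁ x := by
  rw [levelVec, map_smul, Submodule.coe_smul, map_smul, map_smul, levelVec]

/-- Only finitely many positive integers divide a vector `x ≠ 0` of `L₁'`. -/
lemma finite_divisors (hL : IsEvenLattice q L) (v₀ : q.IsometryEquiv (stdForm (N + 3) bm))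
    {x : D.E1} (hx : x ≠ 0) :
    {n : ℕ | 0 < n ∧ (n : ℝ)⁻¹ • x ∈ dual D.q1 D.L1}.Finite := by
  set b₀ := EuclideanSpace.basisFun (Fin (N + 3)) ℝ
  set g₀ : Orth D.q1 := QuadraticMap.IsometryEquiv.refl D.q1
  set A := {n : ℕ | 0 < n ∧ (n : ℝ)⁻¹ • x ∈ dual D.q1 D.L1} with hA
  refine Set.not_infinite.mp fun hinf => ?_
  have := hinf.to_subtype
  set φ : A → dual D.q1 D.L1 := fun n => ⟨((n : ℕ) : ℝ)⁻¹ • x, n.2.2⟩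
  have hφ : Function.Injective φ := by
    intro n n' h
    have h1 : (((n : ℕ) : ℝ)⁻¹ • x : D.E1) = ((n' : ℕ) : ℝ)⁻¹ • x := congrArg Subtype.val h
    have h2 := inv_injective (smul_left_injective ℝ hx h1)
    exact Subtype.ext (by exact_mod_cast h2)
  have hs := (D.summable_levelVec_dual v₀ b₀ g₀ hL (Nat.lt_succ_self (N + 3 + bm))).comp_injective hφ
  have h1 : Summable fun _ : A => ((1 + ‖D.levelVec v₀ b₀ g₀ x‖) ^ (N + 3 + bm + 1))⁻¹ := by
    refine Summable.of_nonneg_of_le (fun _ => by positivity) (fun n => ?_) hs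
    have hn : (1 : ℝ) ≤ ((n : ℕ) : ℝ) := by exact_mod_cast n.2.1
    simp only [Function.comp_apply, φ]
    refine inv_anti₀ (by positivity) (pow_le_pow_left₀ (by positivity) ?_ _)
    rw [D.levelVec_smul, norm_smul, norm_inv, Real.norm_of_nonneg (by linarith)]
    have h2 : ((n : ℕ) : ℝ)⁻¹ ≤ 1 := inv_le_one_of_one_le₀ hn
    have := mul_le_mul_of_nonneg_right h2 (norm_nonneg (D.levelVec v₀ b₀ g₀ x))
    linarith
  rw [summable_const_iff] at h1
  have : ((1 + ‖D.levelVec v₀ b₀ g₀ x‖) ^ (N + 3 + bm + 1))⁻¹ ≠ 0 := by positivity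
  exact this h1

end IsotropicData

/-! ### The divisor sums -/

namespace IsotropicData

variable {N bm : ℕ} {E : Type*} [AddCommGroup E] [Module ℝ E] {q : QuadraticForm ℝ E}
  {L : Submodule ℤ E} (D : IsotropicData q L) (v₀ : q.IsometryEquiv (stdForm (N + 3) bm))
  (b : OrthonormalBasis (Fin (N + 3)) ℝ (EuclideanSpace ℝ (Fin (N + 3))))
  (u : D.E1) (a : ℝˣ) (g₁ : Orth D.q1) {sig w : ℤ} {f : ℍ → Disc q L → ℂ}

/-- The factor of the Fourier expansion of the lift that depends on `x ∈ L₁'` only. -/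
def besselFactor (h : MvPolynomial (Fin (N + 2)) ℂ) (s : ℝ) (x : D.E1) : ℂ :=
  expi (bil q (x : E) ((u : E) + (a : ℝ) • (g₁ (D.proj (D.zStar v₀)) : E)) : ℝ)
    * (conj (MvPolynomial.eval
        (fun i => ((D.levelVec v₀ b g₁ x (Sum.inl (Fin.succ i)) : ℝ) : ℂ)) h)
      / ((normPlus (D.levelVec v₀ b g₁ x) ^ s : ℝ) : ℂ))
    * (besselK s (2 * Real.pi * |(a : ℝ)| * normPlus (D.levelVec v₀ b g₁ x) / D.rho v₀) : ℝ)

/-- The constant factor of the strip integrals, for `r₀ = ‖v₀⁺(z)‖/a`. -/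
def besselConst (r₀ : ℝ) (m : ℕ) (s : ℝ) : ℂ :=
  ((|r₀|⁻¹ * (1 / 2) ^ (1 / 2 : ℝ) * (2 * (1 / (2 * |r₀|)) ^ s) : ℝ) : ℂ)
    * (-(Complex.I * (1 / (2 * r₀) : ℝ))) ^ m

lemma normPlus_smul {r s : ℕ} {c : ℝ} (hc : 0 ≤ c) (X : Fin r ⊕ Fin s → ℝ) :
    normPlus (c • X) = c * normPlus X := by
  have h : ∑ j, (c • X) (Sum.inl j) ^ 2 = c ^ 2 * ∑ j, X (Sum.inl j) ^ 2 := by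
    rw [Finset.mul_sum]
    exact Finset.sum_congr rfl fun j _ => by rw [Pi.smul_apply, smul_eq_mul, mul_pow]
  rw [normPlus, normPlus, h, Real.sqrt_mul (sq_nonneg c), Real.sqrt_sq hc]

/-- In terms of the multiple `d • x`, the strip integral for the pair `(x, δ)` depends on `d` through
a power and the Fourier coefficient only. -/
theorem integral_strip_pairTerm_eq [Fintype (Disc q L)] (hL : IsEvenLattice q L) (hw0 : 0 ≤ w)
    (hf : IsCuspForm q L sig w f) {c : ℝ → Disc q L → ℂ} (hc : HasFourierExpansion q L f c)
    {h : MvPolynomial (Fin (N + 2)) ℂ} (hh : lap h = 0) (m k₁ : ℕ) (hhom : h.IsHomogeneous k₁)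
    (hw : w = 2 * (k₁ + m) + (N + 3) - bm) {d : ℝ} (hd : 1 ≤ d) (P : D.Pairs) :
    ∫ τ in strip, D.pairTerm v₀ b u a g₁ w f h m d P τ
      = if 0 < D.q1 (P.1.1 : D.E1) then
          besselConst (D.rho v₀ / a) m ((k₁ : ℝ) + (N : ℝ) / 2)
            * D.besselFactor v₀ b u a g₁ h ((k₁ : ℝ) + (N : ℝ) / 2) (d • (P.1.1 : D.E1))
            * ((d : ℂ) ^ (k₁ + m + N)
              * (expi (d * bil q ((P.1.2.out : dual q L) : E) D.zd : ℝ)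
                * c (D.q1 (P.1.1 : D.E1)) P.1.2))
        else 0 := by
  rw [D.integral_strip_pairTerm v₀ u a g₁ hL hw0 hf hc hh m k₁ hw hd P]
  split_ifs with hpos
  · have hd0 : 0 < d := lt_of_lt_of_le one_pos hd
    have hdc : (d : ℂ) ≠ 0 := Complex.ofReal_ne_zero.mpr hd0.ne'
    have hρ := D.rho_pos v₀
    have ha : 0 < |(a : ℝ)| := abs_pos.mpr a.ne_zero
    set X := D.levelVec v₀ b g₁ P.1.1 with hX
    have hR : 0 < normPlus X := normPlus_pos ((D.stdForm_levelVec v₀ g₁ _).symm ▸ hpos)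
    set s := (k₁ : ℝ) + (N : ℝ) / 2 with hs
    set r₀ := D.rho v₀ / a with hr₀
    have hr : 0 < |r₀| := abs_pos.mpr (div_ne_zero hρ.ne' a.ne_zero)
    set H := MvPolynomial.eval (fun i => ((X (Sum.inl (Fin.succ i)) : ℝ) : ℂ)) h with hH
    have e1 : MvPolynomial.eval (fun i => (((d • X) (Sum.inl (Fin.succ i)) : ℝ) : ℂ)) h
        = (d : ℂ) ^ k₁ * H := by
      have := heatEval_smul (d : ℂ) 0 (fun i => ((X (Sum.inl (Fin.succ i)) : ℝ) : ℂ)) hhom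
      rw [mul_zero, heatEval_zero, heatEval_zero] at this
      rw [hH, ← this]
      congr 2
      funext i
      rw [Pi.smul_apply, smul_eq_mul, Complex.ofReal_mul]
    have e2 : 2 * Real.pi * |(a : ℝ)| * (d * normPlus X) / D.rho v₀
        = 2 * (Real.pi * d * normPlus X / |r₀|) := by
      rw [hr₀, abs_div, abs_of_pos hρ]
      field_simp
    have e3 : (d / (2 * |r₀| * normPlus X)) ^ s
        = (1 / (2 * |r₀|)) ^ s * (d ^ (2 * k₁ + N) / (d * normPlus X) ^ s) := by
      have h1 : d ^ (2 * k₁ + N) = d ^ s * d ^ s := by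
        rw [← Real.rpow_add hd0, ← Real.rpow_natCast, hs]
        congr 1
        push_cast
        ring
      rw [h1, Real.mul_rpow hd0.le hR.le, Real.div_rpow hd0.le (by positivity),
        Real.mul_rpow (by positivity) hR.le, Real.div_rpow zero_le_one (by positivity), Real.one_rpow]
      have : d ^ s ≠ 0 := (Real.rpow_pos_of_pos hd0 s).ne'
      have : normPlus X ^ s ≠ 0 := (Real.rpow_pos_of_pos hR s).ne'
      field_simp
    have e4 : (-(Complex.I * (d / (2 * r₀) : ℝ)) : ℂ) ^ m
        = (d : ℂ) ^ m * (-(Complex.I * (1 / (2 * r₀) : ℝ))) ^ m := by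
      rw [← mul_pow]
      congr 1
      push_cast
      ring
    have e5 : expi ((d * D.phase v₀ u a g₁ P : ℝ) : ℂ)
        = expi (d * bil q ((P.1.2.out : dual q L) : E) D.zd : ℝ)
          * expi (bil q ((d • (P.1.1 : D.E1) : D.E1) : E)
            ((u : E) + (a : ℝ) • (g₁ (D.proj (D.zStar v₀)) : E)) : ℝ) := by
      rw [← expi_add, ← Complex.ofReal_add, Submodule.coe_smul, bil_smul_left, phase]
      congr 2
      ring
    rw [besselFactor, besselConst, D.levelVec_smul, ← hX, normPlus_smul hd0.le, e1, e2, e3, e4, e5,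
      map_mul, map_pow, Complex.conj_ofReal]
    rw [show k₁ + m + N = m + (k₁ + N) by ring, pow_add _ m]
    have e6 : (d : ℂ) ^ (2 * k₁ + N) = (d : ℂ) ^ k₁ * (d : ℂ) ^ (k₁ + N) := by
      rw [← pow_add]; congr 1; ring
    generalize (d * normPlus X) ^ s = Y
    generalize besselK s _ = B
    generalize expi ((bil q ((d • (P.1.1 : D.E1) : D.E1) : E) _ : ℝ) : ℂ) = Z₁
    generalize expi ((d * bil q ((P.1.2.out : dual q L) : E) D.zd : ℝ) : ℂ) = Z₂
    generalize c _ _ = C₀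
    generalize (1 / (2 * |r₀|)) ^ s = R₁
    generalize (1 / 2 : ℝ) ^ (1 / 2 : ℝ) = R₂
    generalize (-(Complex.I * (1 / (2 * r₀) : ℝ)) : ℂ) ^ m = R₃
    generalize |r₀|⁻¹ = R₄
    generalize conj H = H'
    simp only [Complex.ofReal_mul, Complex.ofReal_inv, Complex.ofReal_pow, div_eq_mul_inv, e6]
    ring
  · rfl

variable {b} (hb : ∀ j, b 0 j = v₀ D.z (Sum.inl j) / D.rho v₀)
include hb

/-- The sum over `d` and the pairs `(x, δ)`, rearranged according to the vectors `d • x` of `L₁'`. -/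
theorem hasSum_divisorCoeff [Fintype (Disc q L)] (hL : IsEvenLattice q L) (hw0 : 0 ≤ w)
    (hf : IsCuspForm q L sig w f) {c : ℝ → Disc q L → ℂ} (hc : HasFourierExpansion q L f c)
    {h : MvPolynomial (Fin (N + 2)) ℂ} (hh : lap h = 0) (m k₁ : ℕ) (hhom : h.IsHomogeneous k₁)
    (hw : w = 2 * (k₁ + m) + (N + 3) - bm) :
    HasSum (fun x : {x : dual D.q1 D.L1 // 0 < D.q1 (x : D.E1)} =>
        besselConst (D.rho v₀ / a) m ((k₁ : ℝ) + (N : ℝ) / 2)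
          * D.besselFactor v₀ b u a g₁ h ((k₁ : ℝ) + (N : ℝ) / 2) (x.1 : D.E1)
          * D.divisorCoeff c (k₁ + m + N) (x.1 : D.E1))
      (∑' n : ℕ, ∫ τ in strip, charCoeff w (D.adapted v₀ b u a g₁) f
        (MvPolynomial.X 0 ^ m * MvPolynomial.rename Fin.succ h) D.z ![0, (n + 1 : ℤ)] τ) := by
  classical
  set S := ∑' n : ℕ, ∫ τ in strip, charCoeff w (D.adapted v₀ b u a g₁) f
        (MvPolynomial.X 0 ^ m * MvPolynomial.rename Fin.succ h) D.z ![0, (n + 1 : ℤ)] τ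
  set t := k₁ + m + N
  set A : D.E1 → ℂ := fun x => besselConst (D.rho v₀ / a) m ((k₁ : ℝ) + (N : ℝ) / 2)
    * D.besselFactor v₀ b u a g₁ h ((k₁ : ℝ) + (N : ℝ) / 2) x with hA
  -- the inner sum over the classes, for `x = d • y`
  set G : ℕ → D.E1 → ℂ := fun n x => (n : ℂ) ^ t
    * ∑ᶠ (δ : Disc q L) (_ : D.ProjectsTo δ ((n : ℝ)⁻¹ • x)),
      expi ((n * bil q ((δ.out : dual q L) : E) D.zd : ℝ)) * c (q (x : E) / n ^ 2) δ with hG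
  have hdiv : ∀ (n : ℕ) (x : D.E1), (((n + 1 : ℕ) : ℝ))⁻¹ • (((n + 1 : ℕ) : ℝ) • x) = x := by
    intro n x
    rw [smul_smul, inv_mul_cancel₀ (by positivity), one_smul]
  have h1 := D.hasSum_integral_strip_pairTerm v₀ u a g₁ hb hL hw0 hf hh m
  have h2 : HasSum (fun v : ℕ × dual D.q1 D.L1 => if 0 < D.q1 (v.2 : D.E1) then
      A (((v.1 + 1 : ℕ) : ℝ) • (v.2 : D.E1)) * G (v.1 + 1) (((v.1 + 1 : ℕ) : ℝ) • (v.2 : D.E1))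
      else 0) S := by
    have h3 := D.hasSum_prod_of_pairs (ι := ℕ) (S := S)
      (G := fun n x δ => if 0 < D.q1 (x : D.E1) then A (((n + 1 : ℕ) : ℝ) • (x : D.E1))
        * (((n + 1 : ℕ) : ℂ) ^ t * (expi ((((n + 1 : ℕ) : ℝ) * bil q ((δ.out : dual q L) : E) D.zd : ℝ))
          * c (D.q1 (x : D.E1)) δ)) else 0)
      (hasSum_of_eq h1 fun v => by
        have hd : (1 : ℝ) ≤ (v.1 : ℝ) + 1 := by linarith [(Nat.cast_nonneg v.1 : (0 : ℝ) ≤ v.1)]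
        rw [D.integral_strip_pairTerm_eq v₀ b u a g₁ hL hw0 hf hc hh m k₁ hhom hw hd v.2, hA]
        push_cast
        rfl)
    refine hasSum_of_eq h3 fun v => ?_
    split_ifs with hpos
    · simp only [hG, hdiv]
      have hq : q ((((v.1 + 1 : ℕ) : ℝ) • (v.2 : D.E1) : D.E1) : E) / ((v.1 + 1 : ℕ) : ℝ) ^ 2
          = D.q1 (v.2 : D.E1) := by
        rw [Submodule.coe_smul, q_smul]
        have : (((v.1 + 1 : ℕ) : ℝ)) ≠ 0 := by positivity
        field_simp
        rfl
      rw [hq, ← mul_assoc]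
      have h4 := mul_finsum_mem (s := {δ : Disc q L | D.ProjectsTo δ (v.2 : D.E1)})
        (fun δ : Disc q L => expi ((((v.1 + 1 : ℕ) : ℝ) * bil q ((δ.out : dual q L) : E) D.zd : ℝ))
          * c (D.q1 (v.2 : D.E1)) δ)
        (A (((v.1 + 1 : ℕ) : ℝ) • (v.2 : D.E1)) * ((v.1 + 1 : ℕ) : ℂ) ^ t)
      refine h4.trans (finsum_congr fun δ => finsum_congr fun _ => ?_)
      ring
    · simp
  -- the pairs `(x, d)` with `d ∣ x`
  set K : dual D.q1 D.L1 × ℕ → ℂ := fun p =>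
    if 0 < p.2 ∧ (p.2 : ℝ)⁻¹ • (p.1 : D.E1) ∈ dual D.q1 D.L1 then
      if 0 < D.q1 (p.1 : D.E1) then A p.1 * G p.2 p.1 else 0
    else 0 with hK
  set φ : ℕ × dual D.q1 D.L1 → dual D.q1 D.L1 × ℕ := fun v => ((v.1 + 1) • v.2, v.1 + 1) with hφdef
  have hcoe : ∀ v : ℕ × dual D.q1 D.L1, ((φ v).1 : D.E1) = ((v.1 + 1 : ℕ) : ℝ) • (v.2 : D.E1) :=
    fun v => by
      change (((v.1 + 1) • v.2 : dual D.q1 D.L1) : D.E1) = _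
      rw [Nat.cast_smul_eq_nsmul ℝ]
      exact map_nsmul (dual D.q1 D.L1).subtype _ _
  have hφ : Function.Injective φ := by
    intro v v' h
    have h4 : v.1 = v'.1 := by
      have := congrArg Prod.snd h
      simpa [hφdef] using this
    have h5 : ((φ v).1 : D.E1) = (φ v').1 := congrArg (fun p => (p.1 : D.E1)) h
    rw [hcoe, hcoe, h4] at h5
    have h6 := congrArg (fun x => (((v'.1 + 1 : ℕ) : ℝ))⁻¹ • x) h5
    simp only [hdiv] at h6
    exact Prod.ext h4 (Subtype.ext h6)
  have h3 : HasSum K S := by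
    refine (hφ.hasSum_iff fun p hp => ?_).mp (hasSum_of_eq h2 fun v => ?_)
    · refine if_neg fun hcond => hp ⟨(p.2 - 1, ⟨(p.2 : ℝ)⁻¹ • (p.1 : D.E1), hcond.2⟩), ?_⟩
      have hp2 : p.2 - 1 + 1 = p.2 := Nat.sub_add_cancel hcond.1
      refine Prod.ext (Subtype.ext ?_) hp2
      rw [hcoe, hp2]
      have : ((p.2 : ℕ) : ℝ) ≠ 0 := Nat.cast_ne_zero.mpr hcond.1.ne'
      rw [smul_smul, mul_inv_cancel₀ this, one_smul]
    · have h4 : (φ v).2 = v.1 + 1 := rfl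
      have hmem : 0 < v.1 + 1 ∧ (((v.1 + 1 : ℕ) : ℝ))⁻¹ • ((((v.1 + 1 : ℕ) : ℝ)) • (v.2 : D.E1))
          ∈ dual D.q1 D.L1 := ⟨Nat.succ_pos _, by rw [hdiv]; exact v.2.2⟩
      have hpos : 0 < D.q1 (((v.1 + 1 : ℕ) : ℝ) • (v.2 : D.E1)) ↔ 0 < D.q1 (v.2 : D.E1) := by
        rw [QuadraticMap.map_smul, smul_eq_mul]
        have : (0 : ℝ) < ((v.1 + 1 : ℕ) : ℝ) * ((v.1 + 1 : ℕ) : ℝ) := by positivity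
        exact mul_pos_iff_of_pos_left this
      simp only [Function.comp_apply, hK]
      rw [hcoe, h4, if_pos hmem]
      simp only [hpos]
  have h4 : HasSum (fun x : dual D.q1 D.L1 => if 0 < D.q1 (x : D.E1) then
      A x * D.divisorCoeff c t x else 0) S := by
    refine h3.prod_fiberwise fun x => ?_
    split_ifs with hpos
    · have hx : (x : D.E1) ≠ 0 := by
        rintro h0
        rw [h0, QuadraticMap.map_zero] at hpos
        exact lt_irrefl _ hpos
      have hfin := D.finite_divisors hL v₀ hx
      have h5 := hasSum_sum_of_ne_finset_zero (f := fun n : ℕ => K (x, n)) (s := hfin.toFinset)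
        (fun n hn => if_neg fun hcond => hn (hfin.mem_toFinset.mpr hcond))
        (L := SummationFilter.unconditional ℕ)
      have h6 : ∑ n ∈ hfin.toFinset, K (x, n) = A x * D.divisorCoeff c t x := by
        have h7 : D.divisorCoeff c t x = ∑ n ∈ hfin.toFinset, G n x :=
          finsum_mem_eq_finite_toFinset_sum (fun n => G n x) hfin
        rw [h7, Finset.mul_sum]
        refine Finset.sum_congr rfl fun n hn => ?_
        rw [hK]
        simp only
        have hcond : 0 < n ∧ (n : ℝ)⁻¹ • (x : D.E1) ∈ dual D.q1 D.L1 := hfin.mem_toFinset.mp hn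
        rw [if_pos hcond, if_pos hpos]
      rwa [h6] at h5
    · refine hasSum_of_eq hasSum_zero fun n => ?_
      simp only [hK, if_neg hpos, ite_self]
  have h5 := (hasSum_subtype_iff_of_support_subset
    (s := {x : dual D.q1 D.L1 | 0 < D.q1 (x : D.E1)}) (fun x hx => by
      by_contra h6
      exact hx (if_neg h6))).mpr h4
  exact hasSum_of_eq h5 fun x => (if_pos x.2).symm

end IsotropicData

/-! ### The Fourier expansion of the lift -/

section Pairing

variable {E : Type*} [AddCommGroup E] [Module ℝ E] {q : QuadraticForm ℝ E}
  {L : Submodule ℤ E} {r s : ℕ} {sig w : ℤ} {f : ℍ → Disc q L → ℂ}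

/-- With zero characteristics, the pairing does not depend on the isotropic vector. -/
lemma thetaPair_zero_zero (V : q.IsometryEquiv (stdForm r s)) (p : MvPolynomial (Fin r) ℂ)
    (z z' : E) (τ : ℍ) : thetaPair V f p z τ 0 0 = thetaPair V f p z' τ 0 0 := by
  simp only [thetaPair, thetaTerm, zero_smul, zero_mul]

lemma thetaPair_C_mul_add [Fintype (Disc q L)] (hL : IsEvenLattice q L)
    (V : q.IsometryEquiv (stdForm r s)) (hw : 0 ≤ w) (hf : IsCuspForm q L sig w f) (c : ℂ)
    (p₁ p₂ : MvPolynomial (Fin r) ℂ) (z : E) (τ : ℍ) :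
    thetaPair V f (MvPolynomial.C c * p₁ + p₂) z τ 0 0
      = conj c * thetaPair V f p₁ z τ 0 0 + thetaPair V f p₂ z τ 0 0 := by
  have h₁ := (summable_thetaTerm hL V hw hf p₁ z τ 0 0).hasSum.mul_left (conj c)
  have h₂ := (summable_thetaTerm hL V hw hf p₂ z τ 0 0).hasSum
  refine (hasSum_of_eq (h₁.add h₂) fun x => ?_).tsum_eq
  rw [thetaTerm, thetaTerm, thetaTerm, kern, kern, kern, map_add, ← MvPolynomial.smul_eq_C_mul,
    map_smul, smul_eq_mul]
  simp only [map_mul, map_add]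
  ring

end Pairing

/-- The powers of `2`, `a` and `ρ = ‖v₀⁺(z)‖` in front of the sum over `λ`. -/
lemma besselConst_eq {ρ a : ℝ} (hρ : 0 < ρ) (ha : a ≠ 0) (m : ℕ) (s : ℝ) :
    2 * (2 : ℂ) ^ m * IsotropicData.besselConst (ρ / a) m s
      = (-Complex.I) ^ m * (((a / |a|) ^ m * |a| ^ (1 + s + m)
        / ((2 : ℝ) ^ (s - 3 / 2) * ρ ^ (1 + s + m)) : ℝ) : ℂ) := by
  have ha' : 0 < |a| := abs_pos.mpr ha
  have h1 : (2 * (2 : ℝ) ^ m * (|ρ / a|⁻¹ * (1 / 2) ^ (1 / 2 : ℝ) * (2 * (1 / (2 * |ρ / a|)) ^ s)))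
      * (1 / (2 * (ρ / a))) ^ m
      = (a / |a|) ^ m * |a| ^ (1 + s + m) / ((2 : ℝ) ^ (s - 3 / 2) * ρ ^ (1 + s + m)) := by
    have e1 : (1 / (2 * |ρ / a|)) = |a| / (2 * ρ) := by
      rw [abs_div, abs_of_pos hρ]
      field_simp
    have e2 : (1 / (2 * (ρ / a))) = a / |a| * (|a| / (2 * ρ)) := by
      field_simp
    have e3 : (2 : ℝ) ^ (s - 3 / 2) = 2 ^ s * (1 / 2) ^ (1 / 2 : ℝ) / 2 := by
      rw [Real.div_rpow zero_le_one zero_le_two, Real.one_rpow,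
        show s - 3 / 2 = s - 1 / 2 - 1 by ring, Real.rpow_sub two_pos, Real.rpow_sub two_pos,
        Real.rpow_one]
      ring
    have e4 : ((1 / 2 : ℝ) ^ (1 / 2 : ℝ)) * (1 / 2 : ℝ) ^ (1 / 2 : ℝ) = 1 / 2 := by
      rw [← Real.rpow_add (by norm_num)]
      norm_num
    have hA : |a| ^ (1 + s + m) = |a| * |a| ^ s * |a| ^ m := by
      rw [Real.rpow_add ha', Real.rpow_add ha', Real.rpow_one, Real.rpow_natCast]
    have hR : ρ ^ (1 + s + m) = ρ * ρ ^ s * ρ ^ m := by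
      rw [Real.rpow_add hρ, Real.rpow_add hρ, Real.rpow_one, Real.rpow_natCast]
    have hs : ρ ^ s ≠ 0 := (Real.rpow_pos_of_pos hρ s).ne'
    have h2 : (2 : ℝ) ^ s ≠ 0 := (Real.rpow_pos_of_pos two_pos s).ne'
    have hh : (1 / 2 : ℝ) ^ (1 / 2 : ℝ) ≠ 0 := (Real.rpow_pos_of_pos (by norm_num) _).ne'
    rw [e1, e2, e3, hA, hR, mul_pow, div_pow |a|, mul_pow 2 ρ,
      Real.div_rpow ha'.le (by positivity), Real.mul_rpow zero_le_two hρ.le, abs_div, abs_of_pos hρ]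
    generalize (1 / 2 : ℝ) ^ (1 / 2 : ℝ) = t at *
    generalize (a / |a|) ^ m = σ
    generalize |a| ^ s = A at *
    generalize ρ ^ s = R at *
    generalize (2 : ℝ) ^ s = B at *
    field_simp
    linear_combination 2 * σ * A * e4
  rw [← h1, IsotropicData.besselConst, ← neg_mul, mul_pow]
  push_cast
  ring

namespace IsotropicData

variable {N bm : ℕ} {E : Type*} [AddCommGroup E] [Module ℝ E] {q : QuadraticForm ℝ E}
  {L : Submodule ℤ E} (D : IsotropicData q L) (v₀ : q.IsometryEquiv (stdForm (N + 3) bm))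
  (b : OrthonormalBasis (Fin (N + 3)) ℝ (EuclideanSpace ℝ (Fin (N + 3))))
  (u : D.E1) (a : ℝˣ) (g₁ : Orth D.q1) {sig w : ℤ} {f : ℍ → Disc q L → ℂ}

/-- The integrand of the lift in the coordinates adapted to `z`. -/
lemma peterssonIntegrand_theta_eq [Fintype (Disc q L)] (hL : IsEvenLattice q L)
    (p : MvPolynomial (Fin (N + 3)) ℂ) (z : E) (τ : ℍ) :
    peterssonIntegrand w f
        (theta q L v₀.toLinearEquiv.toLinearMap bm (inFrame b p) (D.parab u a g₁)) τ
      = ((τ.im ^ ((w : ℝ) / 2) : ℝ) : ℂ) * thetaPair (D.adapted v₀ b u a g₁) f p z τ 0 0 := by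
  have hy := τ.im_pos
  set v := v₀.toLinearEquiv.toLinearMap
  set g := D.parab u a g₁
  obtain ⟨T, hT⟩ : ∃ T : dual q L → ℂ, ∀ x, T x = heatEval (1 / (8 * Real.pi * τ.im) : ℝ)
        (fun i => ((∑ j, b i j * v (g.symm (x : E)) (Sum.inl j) : ℝ) : ℂ)) p
      * expi ((τ : ℂ) * (qPlus (v (g.symm (x : E))) : ℝ)
        + conj (τ : ℂ) * (qMinus (v (g.symm (x : E))) : ℝ)) := ⟨_, fun x => rfl⟩
  have hyp : 0 < τ.im ^ ((bm : ℝ) / 2) := Real.rpow_pos_of_pos hy _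
  have hkern : ∀ x : dual q L, kern p τ (D.adapted v₀ b u a g₁ x)
      = ((τ.im ^ ((bm : ℝ) / 2) : ℝ) : ℂ) * T x := fun x => by
    rw [hT, kern, D.adapted_apply, qPlus_frameIso, qMinus_frameIso, mul_assoc]
    rfl
  have hsum : Summable T := by
    obtain ⟨C, B, hC, hbd⟩ := norm_kern_le (s := bm) p (N + 3 + bm + 1)
    have hs := (summable_dual hL (D.adapted v₀ b u a g₁) (Nat.lt_succ_self (N + 3 + bm))).mul_left
      ((τ.im ^ ((bm : ℝ) / 2))⁻¹ * (C * growth τ.im ^ B))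
    refine Summable.of_norm_bounded hs fun x => ?_
    have h1 := hbd τ (D.adapted v₀ b u a g₁ x)
    rw [hkern, norm_mul, Complex.norm_real, Real.norm_of_nonneg hyp.le] at h1
    rw [mul_assoc, ← div_eq_inv_mul, le_div_iff₀ hyp, mul_comm]
    exact h1
  rw [peterssonIntegrand_theta v bm b.orthonormal p g w f τ hT hsum, thetaPair, ← tsum_mul_left]
  congr 1
  refine tsum_congr fun x => ?_
  rw [thetaTerm, zero_smul, add_zero, hkern, map_mul, Complex.conj_ofReal, zero_mul,
    Complex.ofReal_zero, expi_zero]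
  ring

variable {b} (hb : ∀ j, b 0 j = v₀ D.z (Sum.inl j) / D.rho v₀)
include hb

/-- Only the part `x_1^m h(x_2, …)` of `h_κ` contributes to the lift: the multiples of `∑ x_j²` are
orthogonal to cusp forms. -/
theorem petersson_theta_harmonicPoly [Fintype (Disc q L)] (hL : IsEvenLattice q L) {k : ℕ}
    (hw : w = 2 * k + (N + 3 : ℕ) - bm) (hw0 : 0 ≤ w)
    (hf : IsCuspForm q L ((N + 3 : ℕ) - bm) w f)
    (κ : Fin (N + 2) → ℕ) (hκ : Antitone κ) (ε : ℤˣ) (hk : k = κ 0) :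
    petersson w f (theta q L v₀.toLinearEquiv.toLinearMap bm
        (inFrame b (harmonicPoly (N + 1) κ ε)) (D.parab u a g₁))
      = gegenbauerCoeff ((κ 1 : ℝ) + ((N : ℝ) + 1) / 2) (k - κ 1) 0 * 2 ^ (k - κ 1)
        * ((∫ τ in ModularGroup.fd, charCoeff w (D.adapted v₀ b u a g₁) f
            (MvPolynomial.X 0 ^ (k - κ 1)
              * MvPolynomial.rename Fin.succ (harmonicPoly N (Fin.tail κ) ε)) D.z 0 τ)
          + 2 * ∑' n : ℕ, ∫ τ in strip, charCoeff w (D.adapted v₀ b u a g₁) f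
            (MvPolynomial.X 0 ^ (k - κ 1)
              * MvPolynomial.rename Fin.succ (harmonicPoly N (Fin.tail κ) ε)) D.z
              ![0, (n + 1 : ℤ)] τ) := by
  obtain ⟨p, hp, hp0, hdec⟩ := harmonicPoly_succ_eq N κ hκ ε
  have ht : Antitone (Fin.tail κ) := fun i j hij => hκ (Fin.succ_le_succ_iff.mpr hij)
  rw [← hk] at hp hp0 hdec
  set m := k - κ 1 with hm
  set h := harmonicPoly N (Fin.tail κ) ε with hh
  set A := gegenbauerCoeff ((κ 1 : ℝ) + ((N : ℝ) + 1) / 2) m 0 * 2 ^ m with hA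
  set V := D.adapted v₀ b u a g₁
  have hlap : lap h = 0 := lap_harmonicPoly N _ ht ε
  have hmk : m + κ 1 = k := Nat.sub_add_cancel (hk ▸ hκ (Fin.zero_le 1))
  have hP : (MvPolynomial.X 0 ^ m * MvPolynomial.rename Fin.succ h
      : MvPolynomial (Fin (N + 3)) ℂ).IsHomogeneous k := by
    have h1 : (MvPolynomial.rename Fin.succ h : MvPolynomial (Fin (N + 3)) ℂ).IsHomogeneous (κ 1) :=
      (isHomogeneous_harmonicPoly N _ ht ε).rename_isHomogeneous
    have h2 := ((MvPolynomial.isHomogeneous_X ℂ (0 : Fin (N + 3))).pow m).mul h1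
    rwa [one_mul, hmk] at h2
  have hconj : conj A = A := by
    rw [hA, map_mul, map_pow, gegenbauerCoeff, Complex.conj_ofReal, Complex.conj_ofNat]
  -- the part divisible by `∑ x_j²`
  have hzero : ∫ τ in ModularGroup.fd, ((τ.im ^ ((w : ℝ) / 2) : ℝ) : ℂ)
      * thetaPair V f ((∑ i, MvPolynomial.X i ^ 2) * p) D.z τ 0 0 = 0 := by
    rcases lt_or_ge k 2 with h2 | h2
    · rw [hp0 h2, mul_zero]
      simp [thetaPair, thetaTerm, kern]
    · obtain ⟨k', rfl⟩ := Nat.exists_eq_add_of_le' h2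
      subst hw
      have h3 := integral_fd_thetaPair_sum_sq hL V hw0 hf (p := p) hp
      rw [← h3]
      refine setIntegral_congr_fun measurableSet_fd fun τ _ => ?_
      rw [thetaPair_zero_zero V _ D.z 0]
      congr 4
      push_cast
      ring
  have hfin := D.tsum_lintegral_strip_charCoeff_ne_top v₀ u a g₁ hb hL hw0 hf hlap m
  have hmain : ∫ τ in ModularGroup.fd, ((τ.im ^ ((w : ℝ) / 2) : ℝ) : ℂ)
      * thetaPair V f (MvPolynomial.X 0 ^ m * MvPolynomial.rename Fin.succ h) D.z τ 0 0
      = (∫ τ in ModularGroup.fd, charCoeff w V f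
            (MvPolynomial.X 0 ^ m * MvPolynomial.rename Fin.succ h) D.z 0 τ)
          + 2 * ∑' n : ℕ, ∫ τ in strip, charCoeff w V f
            (MvPolynomial.X 0 ^ m * MvPolynomial.rename Fin.succ h) D.z ![0, (n + 1 : ℤ)] τ := by
    subst hw
    exact integral_fd_thetaPair hL V hw0 hf hP D.z_mem D.isotropic hfin
  rw [← hmain, petersson, ← add_zero (A * _), ← hzero, ← integral_const_mul, ← integral_add
    ((integrableOn_fd_thetaPair hL V hw0 hf _ D.z).const_mul A)
    (integrableOn_fd_thetaPair hL V hw0 hf _ D.z)]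
  refine integral_congr_ae (Filter.Eventually.of_forall fun τ => ?_)
  simp only
  rw [D.peterssonIntegrand_theta_eq v₀ b u a g₁ hL _ D.z, hdec,
    thetaPair_C_mul_add hL V hw0 hf A _ _ D.z τ, hconj]
  ring

end IsotropicData

end ThetaLift

open ThetaLift in
theorem theorem5 {E : Type*} [AddCommGroup E] [Module ℝ E]
    (q : QuadraticForm ℝ E) (L : Submodule ℤ E) (hL : IsEvenLattice q L)
    -- signature `(b⁺, b⁻) = (bp, bm)` with `b⁺ = N + 3 > 2`
    (N bp bm : ℕ) (hbp : bp = N + 3)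
    (v₀ : q.IsometryEquiv (stdForm (N + 3) bm))
    (D : IsotropicData q L)
    -- an orthonormal basis of `V⁺` with first vector `v₀⁺(z)/‖v₀⁺(z)‖`
    (b : OrthonormalBasis (Fin (N + 3)) ℝ (EuclideanSpace ℝ (Fin (N + 3))))
    (hb : ∀ j, b 0 j = v₀ D.z (Sum.inl j) / D.rho v₀)
    -- `κ = (k₀, k₁, …, ε k_{b⁺-2})` with `k = k₀ ≥ k₁ ≥ ⋯ ≥ 0`
    (κ : Fin (N + 2) → ℕ) (hκ : Antitone κ) (ε : ℤˣ)
    (k k₁ : ℕ) (hk : k = κ 0) (hk₁ : k₁ = κ 1)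
    -- `w = 2ν = 2k + b⁺ - b⁻` with `ν > 3/2`
    (w : ℤ) (hw : w = 2 * k + bp - bm) (hν : 3 < w)
    (f : UpperHalfPlane → Disc q L → ℂ) (hf : IsCuspForm q L (bp - bm) w f)
    (c : ℝ → Disc q L → ℂ) (hc : HasFourierExpansion q L f c)
    (u : D.E1) (a : ℝˣ) (g₁ : Orth D.q1) :
    -- the theta function `Θ_L(τ, g_z; h_κ)` at `g_z = n_z(u) m_z(a, g₁)`
    let Θ : UpperHalfPlane → Disc q L → ℂ :=
      theta q L v₀.toLinearEquiv.toLinearMap bm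
        (inFrame b (harmonicPoly (N + 1) κ ε)) (D.parab u a g₁)
    -- `h_{κ⁽¹⁾}` as a function on `V⁺`, and the theta function `Θ_{L₁}(τ, g₁; h_{κ⁽¹⁾})`
    let h₁ : MvPolynomial (Fin (N + 3) ⊕ Fin bm) ℂ :=
      inFrame (Fin.tail b) (harmonicPoly N (Fin.tail κ) ε)
    let Θ₁ : UpperHalfPlane → Disc D.q1 D.L1 → ℂ :=
      theta D.q1 D.L1 (D.v1 v₀ ∘ₗ D.E1.subtype) (bm - 1) h₁ g₁
    let ρ : ℝ := D.rho v₀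
    let s : ℝ := k₁ + ((bp : ℝ) - 3) / 2
    -- the term of index `x`, where `V = v₁(g₁⁻¹x)`
    let term : {x : dual D.q1 D.L1 // 0 < D.q1 (x : D.E1)} → ℂ := fun x =>
      let V : Fin (N + 3) ⊕ Fin bm → ℝ := D.v1 v₀ (g₁.symm (x.1 : D.E1) : E)
      D.divisorCoeff c (k + bp - 3) (x.1 : D.E1)
        * expi (bil q ((x.1 : D.E1) : E)
            ((u : E) + (a : ℝ) • (g₁ (D.proj (D.zStar v₀)) : E)) : ℝ)
        * ((starRingEnd ℂ) (MvPolynomial.eval (fun i => ((V i : ℝ) : ℂ)) h₁)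
            / ((normPlus V ^ s : ℝ) : ℂ))
        * (besselK s (2 * Real.pi * |(a : ℝ)| * normPlus V / ρ) : ℝ)
    MeasureTheory.IntegrableOn (peterssonIntegrand w f Θ) ModularGroup.fd ∧
    (k = k₁ →
      MeasureTheory.IntegrableOn (peterssonIntegrand w (D.reduce f) Θ₁) ModularGroup.fd) ∧
    Summable term ∧
    petersson w f Θ =
      (if k = k₁ then ((|(a : ℝ)| / (Real.sqrt 2 * ρ) : ℝ) : ℂ) * petersson w (D.reduce f) Θ₁
        else 0)
      + (-Complex.I) ^ (k - k₁)
        * (((((a : ℝ) / |(a : ℝ)|) ^ (k - k₁) * |(a : ℝ)| ^ ((k : ℝ) + ((bp : ℝ) - 1) / 2)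
              * Real.Gamma (k + (bp : ℝ) / 2 - 1))
            / ((2 : ℝ) ^ ((k₁ : ℝ) + (bp : ℝ) / 2 - 3) * ((k - k₁).factorial : ℝ)
              * Real.Gamma (k₁ + (bp : ℝ) / 2 - 1) * ρ ^ ((k : ℝ) + ((bp : ℝ) - 1) / 2)) : ℝ) : ℂ)
        * ∑' x, term x := by
  intro Θ h₁ Θ₁ ρ s term
  subst hbp hk₁
  have hfinite : Finite (Disc q L) := finite_disc hL v₀
  have := Fintype.ofFinite (Disc q L)
  have hw0 : 0 ≤ w := by omega
  have ht : Antitone (Fin.tail κ) := fun i j hij => hκ (Fin.succ_le_succ_iff.mpr hij)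
  have hlap := lap_harmonicPoly N _ ht ε
  have hhom : (harmonicPoly N (Fin.tail κ) ε).IsHomogeneous (κ 1) :=
    isHomogeneous_harmonicPoly N _ ht ε
  have hk10 : κ 1 ≤ k := hk ▸ hκ (Fin.zero_le 1)
  have hρ : 0 < ρ := D.rho_pos v₀
  have ha0 : (a : ℝ) ≠ 0 := a.ne_zero
  have hzero : ((|(a : ℝ)| / (Real.sqrt 2 * ρ) : ℝ) : ℂ) ≠ 0 := by
    have := abs_pos.mpr ha0
    exact Complex.ofReal_ne_zero.mpr (by positivity)
  set m := k - κ 1 with hm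
  have hmk : κ 1 + m = k := Nat.add_sub_cancel' hk10
  have hs : s = (κ 1 : ℝ) + (N : ℝ) / 2 := by
    simp only [s]
    push_cast
    ring
  -- the sum over `x`
  have hw' : w = 2 * ((κ 1 : ℕ) + (m : ℤ)) + (N + 3) - bm := by
    rw [hw, ← hmk]
    push_cast
    ring
  obtain ⟨h, hh⟩ : ∃ h, h = harmonicPoly N (Fin.tail κ) ε := ⟨_, rfl⟩
  rw [← hh] at hlap hhom
  obtain ⟨B, hB⟩ : ∃ B, B = IsotropicData.besselConst (ρ / a) m ((κ 1 : ℝ) + (N : ℝ) / 2) :=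
    ⟨_, rfl⟩
  have hBeq := besselConst_eq hρ ha0 m ((κ 1 : ℝ) + (N : ℝ) / 2)
  rw [← hB] at hBeq
  -- summability transfers back to the terms because the constant does not vanish
  have hB0 : B ≠ 0 := by
    rintro rfl
    have h1 := abs_pos.mpr ha0
    rw [mul_zero] at hBeq
    refine mul_ne_zero (pow_ne_zero _ (neg_ne_zero.mpr Complex.I_ne_zero))
      (Complex.ofReal_ne_zero.mpr (div_ne_zero (mul_ne_zero (pow_ne_zero _ (div_ne_zero ha0 h1.ne'))
        (Real.rpow_pos_of_pos h1 _).ne') (by positivity))) hBeq.symm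
  have hterm : ∀ x, B * D.besselFactor v₀ b u a g₁ h ((κ 1 : ℝ) + (N : ℝ) / 2) (x.1 : D.E1)
      * D.divisorCoeff c (κ 1 + m + N) (x.1 : D.E1) = B * term x := fun x => by
    have he := eval_inFrame (r := N + 3) (s := bm) (c := Fin.tail b) h
      (D.v1 v₀ (g₁.symm (x.1 : D.E1) : E))
    simp only [term, h₁]
    rw [hs, ← hh, he, IsotropicData.besselFactor, D.normPlus_levelVec,
      show k + (N + 3) - 3 = κ 1 + m + N by omega]
    simp only [D.levelVec_inl_succ]
    ring
  have hsum := D.hasSum_divisorCoeff v₀ u a g₁ hb hL hw0 hf hc hlap m (κ 1) hhom hw'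
  rw [← hB] at hsum
  have hsum' := hasSum_of_eq hsum fun x => (hterm x).symm
  have hsummable : Summable term := (summable_mul_left_iff hB0).mp hsum'.summable
  have hmain := D.petersson_theta_harmonicPoly v₀ u a g₁ hb hL hw hw0 hf κ hκ ε hk
  rw [← hh, ← hm, ← hsum'.tsum_eq, tsum_mul_left] at hmain
  -- the leading coefficient of the Gegenbauer polynomial gives the quotient of Gamma values
  have hgeg : gegenbauerCoeff ((κ 1 : ℝ) + ((N : ℝ) + 1) / 2) m 0
      = ((Real.Gamma (k + ((N + 3 : ℕ) : ℝ) / 2 - 1) / ((m.factorial : ℝ)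
        * Real.Gamma (κ 1 + ((N + 3 : ℕ) : ℝ) / 2 - 1)) : ℝ) : ℂ) := by
    rw [gegenbauerCoeff, ← hmk]
    congr 1
    push_cast
    rw [pow_zero, Nat.factorial_zero, Nat.sub_zero, Nat.cast_one, one_mul, one_mul, sub_zero,
      show (κ 1 : ℝ) + ((N : ℝ) + 1) / 2 + m = κ 1 + m + ((N : ℝ) + 3) / 2 - 1 by ring,
      show (κ 1 : ℝ) + ((N : ℝ) + 1) / 2 = κ 1 + ((N : ℝ) + 3) / 2 - 1 by ring]
  have hk1 : k = κ 1 ↔ m = 0 := by omega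
  -- for `k = k₁` the zeroth coefficient is the integrand for the lattice `L₁`
  have hcoef : k = κ 1 → ∀ τ, charCoeff w (D.adapted v₀ b u a g₁) f
      (MvPolynomial.X 0 ^ m * MvPolynomial.rename Fin.succ h) D.z 0 τ
      = ((|(a : ℝ)| / (Real.sqrt 2 * ρ) : ℝ) : ℂ) * peterssonIntegrand w (D.reduce f) Θ₁ τ :=
    fun hkk τ => by
      rw [hk1.mp hkk, D.charCoeff_zero v₀ u a g₁ hb hL hw0 hf hlap, hh]
  refine ⟨?_, fun hkk => ?_, hsummable, ?_⟩
  · refine (integrableOn_fd_thetaPair hL (D.adapted v₀ b u a g₁) hw0 hf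
      (harmonicPoly (N + 1) κ ε) D.z (ν := (w : ℝ) / 2)).congr
      (Filter.Eventually.of_forall fun τ => ?_)
    exact (D.peterssonIntegrand_theta_eq v₀ b u a g₁ hL _ D.z τ).symm
  · refine ((integrableOn_fd_charCoeff hL (D.adapted v₀ b u a g₁) hw0 hf
      (MvPolynomial.X 0 ^ m * MvPolynomial.rename Fin.succ h) D.z 0).const_mul
      ((|(a : ℝ)| / (Real.sqrt 2 * ρ) : ℝ) : ℂ)⁻¹).congr (Filter.Eventually.of_forall fun τ => ?_)
    simp only
    rw [hcoef hkk, inv_mul_cancel_left₀ hzero]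
  · -- the constant of the expansion
    have hconst : gegenbauerCoeff ((κ 1 : ℝ) + ((N : ℝ) + 1) / 2) m 0 * (2 * 2 ^ m * B)
        = (-Complex.I) ^ m
        * (((((a : ℝ) / |(a : ℝ)|) ^ m * |(a : ℝ)| ^ ((k : ℝ) + (((N + 3 : ℕ) : ℝ) - 1) / 2)
              * Real.Gamma (k + ((N + 3 : ℕ) : ℝ) / 2 - 1))
            / ((2 : ℝ) ^ ((κ 1 : ℝ) + ((N + 3 : ℕ) : ℝ) / 2 - 3) * (m.factorial : ℝ)
              * Real.Gamma (κ 1 + ((N + 3 : ℕ) : ℝ) / 2 - 1)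
              * ρ ^ ((k : ℝ) + (((N + 3 : ℕ) : ℝ) - 1) / 2)) : ℝ) : ℂ) := by
      have e1 : 1 + ((κ 1 : ℝ) + (N : ℝ) / 2) + m = (k : ℝ) + (((N + 3 : ℕ) : ℝ) - 1) / 2 := by
        rw [← hmk]; push_cast; ring
      have e2 : (κ 1 : ℝ) + (N : ℝ) / 2 - 3 / 2 = (κ 1 : ℝ) + ((N + 3 : ℕ) : ℝ) / 2 - 3 := by
        push_cast; ring
      rw [hBeq, hgeg, e1, e2, mul_left_comm, ← Complex.ofReal_mul]
      congr 2
      rw [div_mul_div_comm]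
      congr 1 <;> ring
    rw [hmain, ← hconst]
    split_ifs with hkk
    · have hm0 := hk1.mp hkk
      have hg1 : gegenbauerCoeff ((κ 1 : ℝ) + ((N : ℝ) + 1) / 2) m 0 * 2 ^ m = 1 := by
        rw [hm0, gegenbauerCoeff, pow_zero, pow_zero, mul_one, ← Complex.ofReal_one]
        congr 1
        have : Real.Gamma ((κ 1 : ℝ) + ((N : ℝ) + 1) / 2) ≠ 0 :=
          (Real.Gamma_pos_of_pos (by positivity)).ne'
        simp [this]
      rw [petersson, ← MeasureTheory.integral_const_mul, mul_add, hg1, one_mul]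
      congr 1
      · exact MeasureTheory.integral_congr_ae (Filter.Eventually.of_forall (hcoef hkk))
      · linear_combination (-(2 * B * ∑' x, term x)) * hg1
    · have hm0 : m ≠ 0 := fun h0 => hkk (hk1.mpr h0)
      simp only [D.charCoeff_zero_of_pos v₀ u a g₁ hb hL hw0 hf hlap hm0,
        MeasureTheory.integral_zero]
      ring
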